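/- Fix a real number $\alpha_0$ that is an irrational multiple of $\pi$. **Measurement patterns.** A measurement pattern $(V,I,O,A)$ consists of a finite register $V$ of qubits, input and output registers $I,O\subseteq V$, and a finite sequence $A$ of commands of the following kinds: $E_{i,j}$ ($i\neq j$), the controlled-$Z$ gate $\Lambda Z$ on $i,j$; $M_i^\alpha$ with $\alpha\in\{0,\pi,\alpha_0\}$, the measurement of qubit $i$ in the basis $|\pm_\alpha\rangle=\frac1{\sqrt2}(|0\rangle\pm e^{i\alpha}|1\rangle)$, with outcome $s_i\in\{0,1\}$; and the corrections $X_i^\sigma$, $Z_i^\sigma$, where $\sigma$ is a finite sum modulo 2 of distinct outcomes. No command acts on an already measured qubit, only outcomes of earlier measurements are used, and output qubits are not measured by commands. Non-input qubits start in $|+\rangle=|+_0\rangle$. The size is the total number of qubits affected by the commands, with multiplicity (2 for each $E_{i,j}$, 1 for every other command). Say that a command $q$ depends on an earlier command $p$ if $p$ acts on a qubit on which $q$ acts or whose outcome appears in $q$; the depth is the length of the longest subsequence of $A$ in which each element depends on the preceding one. **Circuits with unbounded fan-out.** Such a circuit $(V,I,O,G)$ has a finite sequence $G$ of gates, each one being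 $H$, $R_z(\alpha_0)=\mathrm{diag}(1,e^{i\alpha_0})$, $\Lambda Z$, or a fan-out gate $|y_1,\dots,y_{n-1},x\rangle\mapsto|y_1\oplus x,\dots,y_{n-1}\oplus x,x\rangle$ for some $n\ge 1$, applied to distinct qubits. Non-input qubits start in $|0\rangle$. The size is the total number of qubits affected by the gates, with multiplicity (so $n$ for a fan-out gate on $n$ qubits), and the depth is the length of the longest subsequence of $G$ in which consecutive gates share a qubit. **Classes.** Consider families indexed by $n\in\mathbb N$ whose $n$-th member has $n$ input qubits and one output qubit, and which are *uniform*: a Turing machine with $O(\log n)$ work space generates, on input $1^n$, a description of the $n$-th member. A word $w\in\{0,1\}^n$ is accepted with the probability that, with the input register prepared in $|w\rangle$, the output qubit of the $n$-th member finally yields $1$ when measured in the standard basis. For $k\in\mathbb N$, $\mathrm{QMNC}^k$ (respectively $\mathrm{QNC}_{\mathrm f}^k$) is the class of languages $L\subseteq\{0,1\}^*$ for which there is a uniform family of measurement patterns (respectively of circuits with unbounded fan-out) of polynomial size and depth $O(\log^k n)$ which accepts every $w\in L$ with probability $1$ and every $w\notin L$ with probability $0$. The classes $\mathrm{BQMNC}^k$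 and $\mathrm{BQNC}_{\mathrm f}^k$ are defined in the same way, except that words of length $n$ are decided with a two-sided error at most $\varepsilon(n)$, for some $\varepsilon$ with $\varepsilon(n)<\frac12$ for all $n$ and $\varepsilon(n)=O(n^{-c})$ for some constant $c>0$. **Theorem.** For every $k\in\mathbb N$, $$\mathrm{QMNC}^k=\mathrm{QNC}_{\mathrm f}^k\qquad\text{and}\qquad \mathrm{BQMNC}^k=\mathrm{BQNC}_{\mathrm f}^k .$$ -/

import Mathlib

open Matrix Filter Asymptotics

noncomputable section

namespace MBQC

/-! ### Registers of qubits -/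

/-- (Not necessarily normalised) pure states of a register whose qubits are labelled by `V`,
given by their amplitudes in the computational basis. -/
abbrev QState (V : Type) : Type := (V → Fin 2) → ℂ

section Register

variable {V : Type} [Fintype V] [DecidableEq V]

/-- The operator which acts as the `2 × 2` matrix `U` on qubit `i` and trivially elsewhere. -/
def applyOne (U : Matrix (Fin 2) (Fin 2) ℂ) (i : V) (ψ : QState V) : QState V :=
  fun y => ∑ b : Fin 2, U (y i) b * ψ (Function.update y i b)

/-- The controlled-`Z` gate `ΛZ` on the qubits `i` and `j`. -/
def applyCZ (i j : V) (ψ : QState V) : QState V :=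
  fun y => if y i = 1 ∧ y j = 1 then -ψ y else ψ y

/-- The map on basis states of the fan-out gate with control `c` and targets `ts`:
the value of the control is added modulo 2 to every target. -/
def fanBasis (ts : List V) (c : V) (y : V → Fin 2) : V → Fin 2 :=
  fun v => if v ∈ ts then y v + y c else y v

/-- The fan-out gate. The permutation `fanBasis ts c` of the basis states is its own inverse
whenever `c ∉ ts`, so that the amplitude of the image at `y` is the one of `ψ` at
`fanBasis ts c y`. -/
def applyFan (ts : List V) (c : V) (ψ : QState V) : QState V :=
  fun y => ψ (fanBasis ts c y)

def ketZero : Fin 2 → ℂ := ![1, 0]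

def ketPlus : Fin 2 → ℂ := ![1 / (Real.sqrt 2 : ℂ), 1 / (Real.sqrt 2 : ℂ)]

/-- `|+_α⟩` for `b = 0` and `|-_α⟩` for `b = 1`. -/
def ketAngle (α : ℝ) (b : Fin 2) : Fin 2 → ℂ :=
  ![1 / (Real.sqrt 2 : ℂ),
    (-1) ^ (b : ℕ) * Complex.exp (Complex.I * (α : ℂ)) / (Real.sqrt 2 : ℂ)]

/-- The orthogonal projector on `|+_α⟩` (for `b = 0`) or `|-_α⟩` (for `b = 1`). -/
def projAngle (α : ℝ) (b : Fin 2) : Matrix (Fin 2) (Fin 2) ℂ :=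
  vecMulVec (ketAngle α b) (star (ketAngle α b))

def pauliX : Matrix (Fin 2) (Fin 2) ℂ := !![0, 1; 1, 0]

def pauliZ : Matrix (Fin 2) (Fin 2) ℂ := !![1, 0; 0, -1]

def hadamard : Matrix (Fin 2) (Fin 2) ℂ := (1 / (Real.sqrt 2 : ℂ)) • !![1, 1; 1, -1]

def rotZ (α : ℝ) : Matrix (Fin 2) (Fin 2) ℂ :=
  !![1, 0; 0, Complex.exp (Complex.I * (α : ℂ))]

/-- The product state in which the `k`-th qubit of the list `inputs` is in the basis state given
by the `k`-th letter of `w`, and every other qubit is in the state `anc`. -/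
def initState (anc : Fin 2 → ℂ) (inputs : List V) (w : List (Fin 2)) : QState V :=
  fun y => ∏ v : V,
    if v ∈ inputs then (if w.getD (inputs.idxOf v) 0 = y v then 1 else 0) else anc (y v)

/-- The squared norm of the component of `ψ` in which all the qubits of `outputs` have value 1:
for `ψ` of norm one and a single output qubit, the probability that this qubit yields `1` when
measured in the standard basis (whether or not the other qubits are measured or discarded). -/
def probOnes (outputs : List V) (ψ : QState V) : ℝ :=
  ∑ y : V → Fin 2, if ∀ o ∈ outputs, y o = 1 then ‖ψ y‖ ^ 2 else 0

end Register

/-- The maximal length of a subsequence of `l` whose consecutive elements are related by `R`. -/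
def chainDepth {β : Type} (R : β → β → Prop) (l : List β) : ℕ :=
  sSup {d | ∃ l' : List β, l'.Sublist l ∧ l'.IsChain R ∧ l'.length = d}

/-! ### Measurement patterns -/

/-- The basis of measurement angles: `0`, `π` and a fixed angle. -/
inductive Angle
  | zero
  | pi
  | irr

/-- The value of an angle, `α₀` being the value of the fixed one. -/
def Angle.val (α₀ : ℝ) : Angle → ℝ
  | .zero => 0
  | .pi => Real.pi
  | .irr => α₀

/-- The commands of the measurement calculus: entangling `E i j`, measurement `M i a` with
outcome `s_i`, and the dependent Pauli corrections `X_i^σ`, `Z_i^σ`, where the list `σ` of qubits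
stands for the sum modulo 2 of their outcomes. -/
inductive Command (V : Type)
  | E (i j : V)
  | M (i : V) (a : Angle)
  | X (i : V) (σ : List V)
  | Z (i : V) (σ : List V)

namespace Command

variable {V : Type}

/-- The qubits affected by a command. -/
def acts : Command V → List V
  | E i j => [i, j]
  | M i _ => [i]
  | X i _ => [i]
  | Z i _ => [i]

/-- The qubits whose outcomes are read by a command. -/
def signals : Command V → List V
  | E _ _ => []
  | M _ _ => []
  | X _ σ => σ
  | Z _ σ => σ

/-- The domain of a command: `{i, j}` for `E i j`, `{i}` for `M i a`, and
`{i} ∪ {j | s_j appears in σ}` for `X_i^σ` and `Z_i^σ`. -/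
def dom (c : Command V) : List V := c.acts ++ c.signals

/-- The qubits measured by a command. -/
def measured : Command V → List V
  | M i _ => [i]
  | _ => []

/-- The size of a command: the number of qubits affected by it. -/
def size (c : Command V) : ℕ := c.acts.length

/-- `q`, performed later than `p`, depends on `p`: some qubit on which `p` acts is acted upon by
`q`, or its measurement outcome is used by `q`. Two corrections on distinct qubits that
merely read the same outcome do not depend on each other: classical outcomes can be copied,
and the classical side-processing is free. -/
def Dep (p q : Command V) : Prop := ∃ v, v ∈ p.acts ∧ v ∈ q.dom

/-- Well-formedness of a sequence of commands, listed in the order of execution, when the qubits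
in `S` have been measured before: no command is applied to a measured qubit, only
outcomes of previous measurements are used, `E` acts on two distinct qubits, and the terms of
a sum of outcomes are distinct. -/
def WellFormedFrom : List V → List (Command V) → Prop
  | _, [] => True
  | S, c :: A =>
    (c.acts.Nodup ∧ c.signals.Nodup ∧ (∀ v ∈ c.acts, v ∉ S) ∧ ∀ v ∈ c.signals, v ∈ S) ∧
      WellFormedFrom (c.measured ++ S) A

end Command

/-- Measurement patterns `(V, I, O, A)` with `V = {0, …, numQubits - 1}`. The commands are listed
in the order of execution. -/
structure Pattern where
  numQubits : ℕ
  inputs : List (Fin numQubits)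
  outputs : List (Fin numQubits)
  commands : List (Command (Fin numQubits))

namespace Pattern

structure WellFormed (t : Pattern) : Prop where
  inputs_nodup : t.inputs.Nodup
  outputs_nodup : t.outputs.Nodup
  commands_wf : Command.WellFormedFrom [] t.commands
  outputs_unmeasured : ∀ c ∈ t.commands, ∀ v ∈ c.measured, v ∉ t.outputs

/-- The size of a pattern: the total size of its commands. -/
def size (t : Pattern) : ℕ := (t.commands.map Command.size).sum

/-- The quantum depth of a pattern: the length of the longest path of dependent commands. -/
def depth (t : Pattern) : ℕ := chainDepth Command.Dep t.commands

/-- The probability that executing the commands and then measuring the output qubit in the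
standard basis yields `1`, starting from the state `ψ` and the outcomes `s` of the previous
measurements. By the Born rule this is a sum over the two outcomes of each measurement,
where `ψ` is projected without being renormalised. -/
def prob {V : Type} [Fintype V] [DecidableEq V] (α₀ : ℝ) (outputs : List V) :
    List (Command V) → QState V → (V → Fin 2) → ℝ
  | [], ψ, _ => probOnes outputs ψ
  | .E i j :: A, ψ, s => prob α₀ outputs A (applyCZ i j ψ) s
  | .M i a :: A, ψ, s =>
      ∑ b : Fin 2, prob α₀ outputs A (applyOne (projAngle (a.val α₀) b) i ψ)
        (Function.update s i b)
  | .X i σ :: A, ψ, s =>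
      prob α₀ outputs A (applyOne (pauliX ^ ((σ.map s).sum : Fin 2).val) i ψ) s
  | .Z i σ :: A, ψ, s =>
      prob α₀ outputs A (applyOne (pauliZ ^ ((σ.map s).sum : Fin 2).val) i ψ) s

/-- The probability that the pattern (with a single output qubit) accepts the word `w`: the input
qubits are initialised in the basis state `|w⟩` and all the other ones in the state `|+⟩`. -/
def acceptProb (α₀ : ℝ) (t : Pattern) (w : List (Fin 2)) : ℝ :=
  prob α₀ t.outputs t.commands (initState ketPlus t.inputs w) (fun _ => 0)

end Pattern

/-! ### Quantum circuits with unbounded fan-out -/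

/-- The gates: `H`, `R_z(α₀)` for a fixed angle `α₀`, `ΛZ`, and fan-out gates with
control `c` and targets `ts`. -/
inductive Gate (V : Type)
  | H (i : V)
  | Rz (i : V)
  | CZ (i j : V)
  | fan (ts : List V) (c : V)

namespace Gate

variable {V : Type}

/-- The qubits affected by a gate. -/
def acts : Gate V → List V
  | H i => [i]
  | Rz i => [i]
  | CZ i j => [i, j]
  | fan ts c => ts ++ [c]

/-- The size of a gate: the number of qubits affected by it. -/
def size (g : Gate V) : ℕ := g.acts.length

/-- Two gates depend on each other if they affect a common qubit. -/
def Dep (p q : Gate V) : Prop := ∃ v, v ∈ p.acts ∧ v ∈ q.acts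

def apply [DecidableEq V] (α₀ : ℝ) : Gate V → QState V → QState V
  | H i, ψ => applyOne hadamard i ψ
  | Rz i, ψ => applyOne (rotZ α₀) i ψ
  | CZ i j, ψ => applyCZ i j ψ
  | fan ts c, ψ => applyFan ts c ψ

end Gate

/-- Quantum circuits with unbounded fan-out `(V, I, O, G)`, with `V = {0, …, numQubits - 1}`. The
gates are listed in the order of execution. -/
structure Circuit where
  numQubits : ℕ
  inputs : List (Fin numQubits)
  outputs : List (Fin numQubits)
  gates : List (Gate (Fin numQubits))

namespace Circuit

/-- Every gate is applied to distinct qubits. -/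
structure WellFormed (C : Circuit) : Prop where
  inputs_nodup : C.inputs.Nodup
  outputs_nodup : C.outputs.Nodup
  gates_wf : ∀ g ∈ C.gates, g.acts.Nodup

/-- The size of a circuit: the total size of its gates. -/
def size (C : Circuit) : ℕ := (C.gates.map Gate.size).sum

/-- The depth of a circuit: the length of the longest path of dependent gates. -/
def depth (C : Circuit) : ℕ := chainDepth Gate.Dep C.gates

/-- The probability that the circuit (with a single output qubit) accepts the word `w`: the input
qubits are initialised in the basis state `|w⟩` and all the other ones in the state `|0⟩`. -/
def acceptProb (α₀ : ℝ) (C : Circuit) (w : List (Fin 2)) : ℝ :=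
  probOnes C.outputs
    (C.gates.foldl (fun ψ g => g.apply α₀ ψ) (initState ketZero C.inputs w))

end Circuit

/-! ### Log-space Turing machines -/

/-- What is read on a read-only input tape whose word is delimited by end markers. -/
inductive InSymbol (ι : Type)
  | leftEnd
  | letter (a : ι)
  | rightEnd

inductive Move
  | left
  | stay
  | right

/-- One instruction: the next state, the move of the input head, the symbol written on
each work tape and the move of its head, and the symbol (if any) appended to the output. -/
structure Action (Q Γ Ω : Type) (k : ℕ) where
  next : Q
  inMove : Move
  write : Fin k → Γ
  workMove : Fin k → Move
  emit : Option Ω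

/-- Deterministic Turing machines with a read-only two-way input tape over `ι`, `k` two-way
infinite work tapes and a write-only output tape over `Ω`. The machine halts when the
transition function yields `none`. -/
structure Transducer (ι Ω : Type) where
  Q : Type
  Γ : Type
  k : ℕ
  finite_Q : Finite Q
  finite_Γ : Finite Γ
  start : Q
  blank : Γ
  δ : Q → InSymbol ι → (Fin k → Γ) → Option (Action Q Γ Ω k)

namespace Transducer

variable {ι Ω : Type}

structure Config (M : Transducer ι Ω) where
  state : M.Q
  inPos : ℕ
  tape : Fin M.k → ℤ → M.Γ
  head : Fin M.k → ℤ
  out : List Ω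

/-- The cell `0` of the input tape holds the left end marker, the cells `1, …, |w|` hold the word
`w`, and the cell `|w| + 1` holds the right end marker. -/
def readInput (w : List ι) : ℕ → InSymbol ι
  | 0 => .leftEnd
  | p + 1 => match w[p]? with
    | some a => .letter a
    | none => .rightEnd

/-- Moves of the input head; it never leaves the cells `0, …, n + 1`. -/
def moveInput (n : ℕ) : Move → ℕ → ℕ
  | .left, p => p - 1
  | .stay, p => p
  | .right, p => min (p + 1) (n + 1)

def moveWork : Move → ℤ → ℤ
  | .left, p => p - 1
  | .stay, p => p
  | .right, p => p + 1

def init (M : Transducer ι Ω) : M.Config where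
  state := M.start
  inPos := 0
  tape := fun _ _ => M.blank
  head := fun _ => 0
  out := []

/-- One step of the machine on the input word `w`. -/
def step (M : Transducer ι Ω) (w : List ι) (c : M.Config) : Option M.Config :=
  (M.δ c.state (readInput w c.inPos) (fun i => c.tape i (c.head i))).map fun a =>
    { state := a.next
      inPos := moveInput w.length a.inMove c.inPos
      tape := fun i => Function.update (c.tape i) (c.head i) (a.write i)
      head := fun i => moveWork (a.workMove i) (c.head i)
      out := c.out ++ a.emit.toList }

/-- On the input `w` the machine halts with output `u`. -/
def Outputs (M : Transducer ι Ω) (w : List ι) (u : List Ω) : Prop :=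
  ∃ c, StateTransition.Reaches (M.step w) M.init c ∧ M.step w c = none ∧ c.out = u

/-- On the input `w` the work heads only visit the cells `-s, …, s`. -/
def UsesSpace (M : Transducer ι Ω) (w : List ι) (s : ℕ) : Prop :=
  ∀ c, StateTransition.Reaches (M.step w) M.init c → ∀ i, |c.head i| ≤ (s : ℤ)

end Transducer

/-- The word `f n` is generated from `1ⁿ` by a Turing machine with `O(log n)` cells of work
space. -/
def LogSpaceGenerated {Ω : Type} (f : ℕ → List Ω) : Prop :=
  ∃ (M : Transducer Unit Ω) (a : ℕ), ∀ n : ℕ,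
    M.Outputs (List.replicate n ()) (f n) ∧
      M.UsesSpace (List.replicate n ()) (a * (Nat.log 2 n + 1))

/-! ### Descriptions of patterns and circuits -/

/-- The alphabet of the descriptions: letters for unary numbers, list delimiters, and
names of the commands and gates. -/
inductive Token
  | tick
  | endNum
  | endList
  | cE
  | cM (a : Angle)
  | cX
  | cZ
  | gH
  | gRz
  | gCZ
  | gFan

/-- Numbers are described in unary. (The numbers involved are labels of qubits of polynomially
large registers, which log-space machines can convert between unary and binary.) -/
def encodeNum (v : ℕ) : List Token := List.replicate v .tick ++ [.endNum]

def encodeList {m : ℕ} (l : List (Fin m)) : List Token :=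
  l.flatMap (fun v => encodeNum v) ++ [.endList]

def encodeCommand {m : ℕ} : Command (Fin m) → List Token
  | .E i j => .cE :: encodeNum i ++ encodeNum j
  | .M i a => .cM a :: encodeNum i
  | .X i σ => .cX :: encodeNum i ++ encodeList σ
  | .Z i σ => .cZ :: encodeNum i ++ encodeList σ

def encodeGate {m : ℕ} : Gate (Fin m) → List Token
  | .H i => .gH :: encodeNum i
  | .Rz i => .gRz :: encodeNum i
  | .CZ i j => .gCZ :: encodeNum i ++ encodeNum j
  | .fan ts c => .gFan :: encodeList ts ++ encodeNum c

/-- The description of a pattern. -/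
def Pattern.encode (t : Pattern) : List Token :=
  encodeNum t.numQubits ++ encodeList t.inputs ++ encodeList t.outputs ++
    t.commands.flatMap encodeCommand

/-- The description of a circuit. -/
def Circuit.encode (C : Circuit) : List Token :=
  encodeNum C.numQubits ++ encodeList C.inputs ++ encodeList C.outputs ++
    C.gates.flatMap encodeGate

/-! ### Complexity classes -/

def PolyBounded (f : ℕ → ℕ) : Prop := ∃ p : Polynomial ℕ, ∀ n, f n ≤ p.eval n

/-- `d(n) = O(log^k n)`. -/
def IsBigOLogPow (k : ℕ) (d : ℕ → ℕ) : Prop :=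
  (fun n => (d n : ℝ)) =O[atTop] fun n : ℕ => Real.log (n : ℝ) ^ k

/-- Uniform families of measurement patterns of input size `n`, depth `O(log^k n)` and polynomial
size, with one output qubit. -/
structure PatternFamily (k : ℕ) (P : ℕ → Pattern) : Prop where
  wellFormed : ∀ n, (P n).WellFormed
  inputs : ∀ n, (P n).inputs.length = n
  outputs : ∀ n, (P n).outputs.length = 1
  uniform : LogSpaceGenerated fun n => (P n).encode
  size : PolyBounded fun n => (P n).size
  depth : IsBigOLogPow k fun n => (P n).depth

/-- Uniform families of quantum circuits with unbounded fan-out of input size `n`, depth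
`O(log^k n)` and polynomial size, with one output qubit. -/
structure CircuitFamily (k : ℕ) (C : ℕ → Circuit) : Prop where
  wellFormed : ∀ n, (C n).WellFormed
  inputs : ∀ n, (C n).inputs.length = n
  outputs : ∀ n, (C n).outputs.length = 1
  uniform : LogSpaceGenerated fun n => (C n).encode
  size : PolyBounded fun n => (C n).size
  depth : IsBigOLogPow k fun n => (C n).depth

/-- The words are accepted with probability `1` or `0` according to their membership in `L`. -/
def DecidesExactly (p : List (Fin 2) → ℝ) (L : Language (Fin 2)) : Prop :=
  ∀ w, (w ∈ L → p w = 1) ∧ (w ∉ L → p w = 0)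

/-- The words are accepted with a two-sided error at most `ε n` at length `n`. -/
def DecidesWithError (ε : ℕ → ℝ) (p : List (Fin 2) → ℝ) (L : Language (Fin 2)) : Prop :=
  ∀ w, (w ∈ L → 1 - ε w.length ≤ p w) ∧ (w ∉ L → p w ≤ ε w.length)

/-- A polynomially small error: below `1/2` for all input sizes, and `O(n^{-c})` for some
constant `c > 0`. -/
def PolySmall (ε : ℕ → ℝ) : Prop :=
  (∀ n, ε n < 1 / 2) ∧ ∃ c : ℝ, 0 < c ∧ ε =O[atTop] fun n : ℕ => (n : ℝ) ^ (-c)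

/-- The class `QMNC^k` over the measurement angles `0`, `π`, `α₀`. -/
def QMNC (α₀ : ℝ) (k : ℕ) : Set (Language (Fin 2)) :=
  {L | ∃ P : ℕ → Pattern, PatternFamily k P ∧
    DecidesExactly (fun w => (P w.length).acceptProb α₀ w) L}

/-- The class `BQMNC^k` over the measurement angles `0`, `π`, `α₀`. -/
def BQMNC (α₀ : ℝ) (k : ℕ) : Set (Language (Fin 2)) :=
  {L | ∃ P : ℕ → Pattern, PatternFamily k P ∧ ∃ ε, PolySmall ε ∧
    DecidesWithError ε (fun w => (P w.length).acceptProb α₀ w) L}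

/-- The class `QNC_f^k` over the gates `H`, `R_z(α₀)`, `ΛZ` and fan-out. -/
def QNCf (α₀ : ℝ) (k : ℕ) : Set (Language (Fin 2)) :=
  {L | ∃ C : ℕ → Circuit, CircuitFamily k C ∧
    DecidesExactly (fun w => (C w.length).acceptProb α₀ w) L}

/-- The class `BQNC_f^k` over the gates `H`, `R_z(α₀)`, `ΛZ` and fan-out. -/
def BQNCf (α₀ : ℝ) (k : ℕ) : Set (Language (Fin 2)) :=
  {L | ∃ C : ℕ → Circuit, CircuitFamily k C ∧ ∃ ε, PolySmall ε ∧
    DecidesWithError ε (fun w => (C w.length).acceptProb α₀ w) L}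

end MBQC

end

/-!
Patterns and circuits simulate each other exactly, with the same acceptance probability for every
input word, with a depth multiplied by a constant, and in such a way that the description of the
simulating object is computed from the given description in logarithmic space. Since the acceptance
probabilities agree, both equalities of classes follow from these two simulations
(`PatternFamily.toCircuit` and `CircuitFamily.toPattern`).

*From patterns to circuits* (`Pattern.toCircuit`). A measurement is deferred: a change of basis
takes the basis of the measurement to the standard one, and a fan-out gate followed by Hadamard
gates stores the outcome `s_i` as the state `H |s_i⟩` of auxiliary qubits, one for each command of
the pattern. As `X` has the eigenvalue `(-1) ^ s` on `H |s⟩`, a fan-out gate with control `i` onto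
copies of the outcomes in `σ` acts on `i` as `Z ^ σ`. Every command has its own copies, so commands
which do not depend on each other yield gates on disjoint qubits. No gate affects
a measured qubit after its outcome has been copied, so the branches for its two values do not
interfere and their contributions to the final probability add up
(`Pattern.toCircuit_acceptProb`).

*From circuits to patterns* (`Circuit.toPattern`). Entangling `x` with a fresh qubit `y`, measuring
`x` with angle `α` and correcting `y` by `X ^ s_x` moves the state from `x` to `y` and applies
`H R_z(-α)`; the gates `H` and `R_z(α₀)` are products of such operators. For a fan-out gate, the
value of the control is passed on along a line of fresh qubits: all links of the line are measured
at once, each target is coupled with its own qubit of the line, and the missing signs depend on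
sums of the outcomes of all the links up to a target. Corrections may depend on any number of
outcomes without increasing the depth, so the depth of this pattern is bounded by a constant
(`prob_fan_core`, `prob_gateBlock`, `chainDepth_gateBlock_le`).

*Uniformity* (`LogSpaceGenerated.em`). The letters of the given description cannot be stored; each
of them is recomputed, when it is needed, by running the machine which generates the description
from the beginning. A small language `Em` of nested scans of the description, with comparisons of
the fields of the scanned positions, is compiled into machines of this kind, whose further memory
consists of finitely many binary counters. The counters stay polynomially small, because a word
generated in logarithmic space is not longer than the number of configurations
(`LogSpaceGenerated.polyBounded_length`). Programs in this language compute the descriptions of the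
simulating objects (`Pattern.den_circuitEm`, `Circuit.den_patternEm`); to this end the qubits of the
simulating registers are numbered such that their numbers are sums of numbers in the given
description and multiples of the size of the register (`lab`).
-/

set_option linter.unusedSectionVars false

namespace MBQC

/-! ### Structured programs for transducers -/

/-- The memory of a transducer with input alphabet `Unit`: the position of the input head, and for
each work tape its contents and the position of its head. -/
structure Store (T Γ : Type) where
  inPos : ℕ
  tp : T → (ℤ → Γ) × ℤ

/-- The effect of one machine step on the memory and the output. -/
structure Instr (T Γ Ω : Type) where
  inMove : Move
  write : T → Γ
  move : T → Move
  emit : Option Ω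

/-- What the machine sees in one step: the input symbol and the scanned symbol of each tape. -/
abbrev Reads (T Γ : Type) : Type := InSymbol Unit × (T → Γ)

/-- Structured programs over single machine steps. Tests look at the scanned symbols only. -/
inductive Cmd (T Γ Ω A : Type)
  | skip
  | act (f : Reads T Γ → Instr T Γ Ω)
  | seq (c d : Cmd T Γ Ω A)
  | ite (t : Reads T Γ → Bool) (c d : Cmd T Γ Ω A)
  | case (t : Reads T Γ → A) (c : A → Cmd T Γ Ω A)
  | loop (t : Reads T Γ → Bool) (c : Cmd T Γ Ω A)

section Structured

variable {T Γ Ω A : Type}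

namespace Store

/-- What the machine sees on the input `1ⁿ`. -/
def reads (n : ℕ) (σ : Store T Γ) : Reads T Γ :=
  (Transducer.readInput (List.replicate n ()) σ.inPos, fun t => (σ.tp t).1 (σ.tp t).2)

/-- The memory after an instruction. -/
def exec (n : ℕ) (i : Instr T Γ Ω) (σ : Store T Γ) : Store T Γ where
  inPos := Transducer.moveInput n i.inMove σ.inPos
  tp t := (Function.update (σ.tp t).1 (σ.tp t).2 (i.write t),
    Transducer.moveWork (i.move t) (σ.tp t).2)

/-- All the work heads are within the cells `-s, …, s`. -/
def Bounded (s : ℕ) (σ : Store T Γ) : Prop := ∀ t, |(σ.tp t).2| ≤ (s : ℤ)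

end Store

/-- The instruction without any effect. -/
def Instr.noop (r : Reads T Γ) : Instr T Γ Ω := ⟨.stay, r.2, fun _ => .stay, none⟩

theorem Store.exec_noop (n : ℕ) (σ : Store T Γ) :
    σ.exec n (Instr.noop (σ.reads n) : Instr T Γ Ω) = σ := by
  cases σ
  simp [Store.exec, Instr.noop, Store.reads, Transducer.moveInput, Transducer.moveWork]

/-- `Run n s c σ o σ'`: on the input `1ⁿ`, the program `c` started in the memory `σ` terminates in
`σ'` with output `o`, and all heads stay within the cells `-s, …, s`. -/
inductive Run (n s : ℕ) : Cmd T Γ Ω A → Store T Γ → List Ω → Store T Γ → Prop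
  | skip (σ) : Run n s .skip σ [] σ
  | act (f) (σ : Store T Γ) (h : (σ.exec n (f (σ.reads n))).Bounded s) :
      Run n s (.act f) σ (f (σ.reads n)).emit.toList (σ.exec n (f (σ.reads n)))
  | seq {c d σ o σ' o' σ''} : Run n s c σ o σ' → Run n s d σ' o' σ'' →
      Run n s (.seq c d) σ (o ++ o') σ''
  | ite_true {t c d} {σ : Store T Γ} {o σ'} : t (σ.reads n) = true → Run n s c σ o σ' →
      Run n s (.ite t c d) σ o σ'
  | ite_false {t c d} {σ : Store T Γ} {o σ'} : t (σ.reads n) = false → Run n s d σ o σ' →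
      Run n s (.ite t c d) σ o σ'
  | case {t c} {σ : Store T Γ} {o σ'} : Run n s (c (t (σ.reads n))) σ o σ' →
      Run n s (.case t c) σ o σ'
  | loop_false {t c} {σ : Store T Γ} : t (σ.reads n) = false → Run n s (.loop t c) σ [] σ
  | loop_true {t c} {σ : Store T Γ} {o σ' o' σ''} : t (σ.reads n) = true → Run n s c σ o σ' →
      Run n s (.loop t c) σ' o' σ'' → Run n s (.loop t c) σ (o ++ o') σ''

namespace Cmd

/-- The first machine step of a list of programs to be executed one after the other. -/
def advance (r : Reads T Γ) : List (Cmd T Γ Ω A) → Option (List (Cmd T Γ Ω A) × Instr T Γ Ω)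
  | [] => none
  | .skip :: k => some (k, .noop r)
  | .act f :: k => some (k, f r)
  | .seq c d :: k => some (c :: d :: k, .noop r)
  | .ite t c d :: k => some ((if t r then c else d) :: k, .noop r)
  | .case t c :: k => some (c (t r) :: k, .noop r)
  | .loop t c :: k => some (if t r then c :: .loop t c :: k else k, .noop r)

/-- The lists of remaining programs that occur while the program is executed before the list `k`, except `k`. -/
def conts : Cmd T Γ Ω A → List (Cmd T Γ Ω A) → Set (List (Cmd T Γ Ω A))
  | .skip, k => {.skip :: k}
  | .act f, k => {.act f :: k}
  | .seq c d, k => {.seq c d :: k} ∪ conts c (d :: k) ∪ conts d k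
  | .ite t c d, k => {.ite t c d :: k} ∪ conts c k ∪ conts d k
  | .case t c, k => {.case t c :: k} ∪ ⋃ a, conts (c a) k
  | .loop t c, k => {.loop t c :: k} ∪ conts c (.loop t c :: k)

theorem conts_finite [Finite A] (c : Cmd T Γ Ω A) : ∀ k, (c.conts k).Finite := by
  induction c with
  | skip => intro k; simp [conts]
  | act f => intro k; simp [conts]
  | seq c d hc hd => intro k; simpa [conts] using ⟨hc _, hd _⟩
  | ite t c d hc hd => intro k; simpa [conts] using ⟨hc _, hd _⟩
  | case t c hc =>
    intro k
    simp only [conts]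
    exact (Set.finite_singleton _).union (Set.finite_iUnion fun a => hc a k)
  | loop t c hc => intro k; simpa [conts] using hc _

theorem cons_mem_conts (c : Cmd T Γ Ω A) (k) : c :: k ∈ c.conts k := by
  cases c <;> simp [conts]

open Classical in
/-- The transducer which executes the program `c`; its states are the lists of programs that
remain to be executed. -/
noncomputable def toTransducer [Finite A] [Fintype T] [Finite Γ] (c : Cmd T Γ Ω A) (blank : Γ) :
    Transducer Unit Ω where
  Q := {k : List (Cmd T Γ Ω A) // k ∈ insert [] (c.conts [])}
  Γ := Γ
  k := Fintype.card T
  finite_Q := ((c.conts_finite []).insert []).to_subtype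
  finite_Γ := inferInstance
  start := ⟨[c], Set.mem_insert_of_mem _ (cons_mem_conts c [])⟩
  blank := blank
  δ q x g :=
    match advance (x, fun t => g (Fintype.equivFin T t)) q.1 with
    | none => none
    | some (k, i) =>
      if h : k ∈ insert [] (c.conts []) then
        some ⟨⟨k, h⟩, i.inMove, fun j => i.write ((Fintype.equivFin T).symm j),
          fun j => i.move ((Fintype.equivFin T).symm j), i.emit⟩
      else none

variable [Finite A] [Fintype T] [Finite Γ]

/-- The configuration of `toTransducer` with the list `k` of remaining programs. -/
noncomputable def config (c : Cmd T Γ Ω A) (blank : Γ) (k : List (Cmd T Γ Ω A))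
    (hk : k ∈ insert [] (c.conts [])) (σ : Store T Γ) (o : List Ω) :
    (c.toTransducer blank).Config where
  state := ⟨k, hk⟩
  inPos := σ.inPos
  tape j := (σ.tp ((Fintype.equivFin T).symm j)).1
  head j := (σ.tp ((Fintype.equivFin T).symm j)).2
  out := o

theorem step_config (c : Cmd T Γ Ω A) (blank : Γ) (n : ℕ) {k k' : List (Cmd T Γ Ω A)} {i}
    (hk : k ∈ insert [] (c.conts [])) (hk' : k' ∈ insert [] (c.conts [])) (σ : Store T Γ)
    (o : List Ω) (h : advance (σ.reads n) k = some (k', i)) :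
    (c.toTransducer blank).step (List.replicate n ()) (config c blank k hk σ o) =
      some (config c blank k' hk' (σ.exec n i) (o ++ i.emit.toList)) := by
  have e : (fun t => (σ.tp ((Fintype.equivFin T).symm (Fintype.equivFin T t))).1
      (σ.tp ((Fintype.equivFin T).symm (Fintype.equivFin T t))).2) = (σ.reads n).2 := by
    funext t; simp [Store.reads]
  simp only [Transducer.step]
  have : (c.toTransducer blank).δ (config c blank k hk σ o).state
      (Transducer.readInput (List.replicate n ()) (config c blank k hk σ o).inPos)
      (fun j => (config c blank k hk σ o).tape j ((config c blank k hk σ o).head j)) =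
      some ⟨⟨k', hk'⟩, i.inMove, fun j => i.write ((Fintype.equivFin T).symm j),
          fun j => i.move ((Fintype.equivFin T).symm j), i.emit⟩ := by
    simp only [toTransducer, config]
    rw [e]
    have h' : advance (Transducer.readInput (List.replicate n ()) σ.inPos, (σ.reads n).2) k =
      some (k', i) := h
    rw [h']
    simp only [dif_pos hk']
  rw [this]
  simp only [Option.map_some, config, Store.exec, List.length_replicate]
  rfl

/-- The steps of a machine into configurations with heads in the cells `-s, …, s`. -/
def BStep {ι Ω : Type} (M : Transducer ι Ω) (w : List ι) (s : ℕ) (a b : M.Config) : Prop :=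
  b ∈ M.step w a ∧ ∀ i, |b.head i| ≤ (s : ℤ)

/-- A run of a structured program is a computation of its transducer, for any programs that remain to
be executed afterwards. -/
theorem reaches_of_run (c₀ : Cmd T Γ Ω A) (blank : Γ) {n s : ℕ} {c : Cmd T Γ Ω A}
    {σ : Store T Γ} {o : List Ω} {σ' : Store T Γ} (h : Run n s c σ o σ') (hσ : σ.Bounded s) :
    σ'.Bounded s ∧ ∀ (k) (hk : k ∈ insert [] (c₀.conts []))
      (hc : c.conts k ⊆ insert [] (c₀.conts [])) (u : List Ω),
      Relation.ReflTransGen (BStep (c₀.toTransducer blank) (List.replicate n ()) s)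
        (config c₀ blank (c :: k) (hc (cons_mem_conts c k)) σ u)
        (config c₀ blank k hk σ' (u ++ o)) := by
  -- one step which leaves the memory unchanged
  have noop : ∀ {k k' : List (Cmd T Γ Ω A)} (hk : k ∈ insert [] (c₀.conts []))
      (hk' : k' ∈ insert [] (c₀.conts [])) (σ : Store T Γ) (_ : σ.Bounded s) (u : List Ω)
      (_ : advance (σ.reads n) k = some (k', .noop (σ.reads n))),
      BStep (c₀.toTransducer blank) (List.replicate n ()) s (config c₀ blank k hk σ u)
        (config c₀ blank k' hk' σ u) := by
    intro k k' hk hk' σ hσ u h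
    have := step_config c₀ blank n hk hk' σ u h
    rw [Store.exec_noop] at this
    refine ⟨?_, fun i => hσ _⟩
    rw [this]; simp [Instr.noop]
  induction h with
  | skip σ =>
    refine ⟨hσ, fun k hk hc u => ?_⟩
    simpa using Relation.ReflTransGen.single (noop _ hk σ hσ u rfl)
  | act f σ h =>
    refine ⟨h, fun k hk hc u => Relation.ReflTransGen.single ⟨?_, fun i => h _⟩⟩
    rw [step_config c₀ blank n (hc (cons_mem_conts _ k)) hk σ u rfl]
    rfl
  | @seq c d σ o σ' o' σ'' _ _ ih₁ ih₂ =>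
    obtain ⟨b₁, ih₁⟩ := ih₁ hσ
    obtain ⟨b₂, ih₂⟩ := ih₂ b₁
    refine ⟨b₂, fun k hk hc u => ?_⟩
    have h1 : c.conts (d :: k) ⊆ insert [] (c₀.conts []) := fun x hx => hc (by simp [conts, hx])
    have h2 : d.conts k ⊆ insert [] (c₀.conts []) := fun x hx => hc (by simp [conts, hx])
    refine .head (noop _ (h1 (cons_mem_conts _ _)) σ hσ u rfl) ?_
    have := (ih₁ (d :: k) (h2 (cons_mem_conts _ _)) h1 u).trans (ih₂ k hk h2 (u ++ o))
    simpa using this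
  | @ite_true t c d σ o σ' ht _ ih =>
    obtain ⟨b, ih⟩ := ih hσ
    refine ⟨b, fun k hk hc u => ?_⟩
    have h1 : c.conts k ⊆ insert [] (c₀.conts []) := fun x hx => hc (by simp [conts, hx])
    exact .head (noop _ (h1 (cons_mem_conts _ _)) σ hσ u (by simp [advance, ht])) (ih k hk h1 u)
  | @ite_false t c d σ o σ' ht _ ih =>
    obtain ⟨b, ih⟩ := ih hσ
    refine ⟨b, fun k hk hc u => ?_⟩
    have h1 : d.conts k ⊆ insert [] (c₀.conts []) := fun x hx => hc (by simp [conts, hx])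
    exact .head (noop _ (h1 (cons_mem_conts _ _)) σ hσ u (by simp [advance, ht])) (ih k hk h1 u)
  | @case t c σ o σ' _ ih =>
    obtain ⟨b, ih⟩ := ih hσ
    refine ⟨b, fun k hk hc u => ?_⟩
    have h1 : (c (t (σ.reads n))).conts k ⊆ insert [] (c₀.conts []) := fun x hx =>
      hc (by simp only [conts]; exact Or.inr (Set.mem_iUnion.2 ⟨_, hx⟩))
    exact .head (noop _ (h1 (cons_mem_conts _ _)) σ hσ u rfl) (ih k hk h1 u)
  | @loop_false t c σ ht =>
    refine ⟨hσ, fun k hk hc u => ?_⟩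
    simpa using Relation.ReflTransGen.single (noop _ hk σ hσ u (by simp [advance, ht]))
  | @loop_true t c σ o σ' o' σ'' ht _ _ ih₁ ih₂ =>
    obtain ⟨b₁, ih₁⟩ := ih₁ hσ
    obtain ⟨b₂, ih₂⟩ := ih₂ b₁
    refine ⟨b₂, fun k hk hc u => ?_⟩
    have h1 : c.conts (.loop t c :: k) ⊆ insert [] (c₀.conts []) :=
      fun x hx => hc (by simp [conts, hx])
    refine .head (noop _ (h1 (cons_mem_conts _ _)) σ hσ u (by simp [advance, ht])) ?_
    have := (ih₁ (.loop t c :: k) (hc (cons_mem_conts _ _)) h1 u).trans (ih₂ k hk hc (u ++ o))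
    simpa using this

end Cmd

theorem reaches_of_bstep {ι : Type} {M : Transducer ι Ω} {w : List ι} {s : ℕ} {a b : M.Config}
    (h : Relation.ReflTransGen (Cmd.BStep M w s) a b) : StateTransition.Reaches (M.step w) a b :=
  h.lift id fun _ _ h => h.1

/-- If a bounded run leads to a halting configuration, then, the machine being deterministic, every
reachable configuration lies on that run. -/
theorem bounded_of_reaches_halt {ι : Type} {M : Transducer ι Ω} {w : List ι} {s : ℕ}
    {a b c : M.Config} (ha : ∀ i, |a.head i| ≤ (s : ℤ))
    (h : Relation.ReflTransGen (Cmd.BStep M w s) a b) (hb : M.step w b = none)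
    (hc : StateTransition.Reaches (M.step w) a c) : ∀ i, |c.head i| ≤ (s : ℤ) := by
  induction h using Relation.ReflTransGen.head_induction_on with
  | refl =>
    rcases Relation.ReflTransGen.cases_head hc with h | ⟨d, hd, _⟩
    · exact h ▸ ha
    · rw [hb] at hd; cases hd
  | @head a a' h1 h2 ih =>
    rcases Relation.ReflTransGen.cases_head hc with h | ⟨d, hd, hdc⟩
    · exact h ▸ ha
    · have : d = a' := by
        have h1' := h1.1
        simp only [Option.mem_def] at hd h1'
        rw [hd] at h1'
        exact Option.some.inj h1'
      subst this
      exact ih h1.2 hdc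

/-- The memory at the start of a computation. -/
def Store.blank (b : Γ) : Store T Γ := ⟨0, fun _ => (fun _ => b, 0)⟩

/-- A structured program which produces `f n` on input `1ⁿ` with heads at distance `O(log n)` from
the origin shows that `f` can be generated in logarithmic space. -/
theorem logSpaceGenerated_of_run [Finite A] [Fintype T] [Finite Γ] {f : ℕ → List Ω} (b : Γ)
    (c : Cmd T Γ Ω A) (a : ℕ)
    (h : ∀ n, ∃ σ', Run n (a * (Nat.log 2 n + 1)) c (Store.blank b) (f n) σ') :
    LogSpaceGenerated f := by
  refine ⟨c.toTransducer b, a, fun n => ?_⟩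
  obtain ⟨σ', hr⟩ := h n
  have hb : (Store.blank b : Store T Γ).Bounded (a * (Nat.log 2 n + 1)) := by
    intro t; simp only [Store.blank, abs_zero]; positivity
  have hreach := (Cmd.reaches_of_run c b hr hb).2 [] (Set.mem_insert _ _)
    (Set.subset_insert _ _) []
  have hinit : Cmd.config c b [c] (Set.mem_insert_of_mem _ (Cmd.cons_mem_conts c []))
      (Store.blank b) [] = (c.toTransducer b).init := rfl
  rw [hinit, List.nil_append] at hreach
  have hhalt : (c.toTransducer b).step (List.replicate n ())
      (Cmd.config c b [] (Set.mem_insert _ _) σ' (f n)) = none := rfl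
  refine ⟨⟨_, reaches_of_bstep hreach, hhalt, rfl⟩, fun d hd => ?_⟩
  exact bounded_of_reaches_halt (fun i => by
    simp only [Transducer.init, abs_zero]; positivity) hreach hhalt hd

end Structured

/-! ### Programs acting on a single tape -/

section SingleTape

variable {T Γ Ω A : Type} [DecidableEq T]

/-- Replace the contents and the head position of the tape `x`. -/
def Store.set (σ : Store T Γ) (x : T) (p : (ℤ → Γ) × ℤ) : Store T Γ :=
  { σ with tp := Function.update σ.tp x p }

theorem Store.Bounded.set {s : ℕ} {σ : Store T Γ} (h : σ.Bounded s) {x : T} {p : (ℤ → Γ) × ℤ}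
    (hp : |p.2| ≤ (s : ℤ)) : (σ.set x p).Bounded s := by
  intro t
  by_cases ht : t = x
  · subst ht; simpa [Store.set] using hp
  · simpa [Store.set, Function.update_of_ne ht] using h t

@[simp] theorem Store.set_tp_self (σ : Store T Γ) (x : T) (p) : (σ.set x p).tp x = p := by
  simp [Store.set]

theorem Store.set_tp_of_ne (σ : Store T Γ) {x y : T} (h : y ≠ x) (p) :
    (σ.set x p).tp y = σ.tp y := by
  simp [Store.set, Function.update_of_ne h]

@[simp] theorem Store.set_set (σ : Store T Γ) (x : T) (p q) : (σ.set x p).set x q = σ.set x q := by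
  simp [Store.set]

theorem Store.set_self (σ : Store T Γ) {x : T} {p} (h : σ.tp x = p) : σ.set x p = σ := by
  cases σ; subst h; simp [Store.set]

namespace Cmd

/-- Rewrite the scanned cell of tape `x` by `f` and move its head. -/
def onTape (x : T) (f : Γ → Γ) (m : Move) : Cmd T Γ Ω A :=
  .act fun r => ⟨.stay, Function.update r.2 x (f (r.2 x)),
    Function.update (fun _ => .stay) x m, none⟩

/-- A loop whose test looks at the scanned cell of tape `x`. -/
def loopOn (x : T) (t : Γ → Bool) (c : Cmd T Γ Ω A) : Cmd T Γ Ω A := .loop (fun r => t (r.2 x)) c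

def iteOn (x : T) (t : Γ → Bool) (c d : Cmd T Γ Ω A) : Cmd T Γ Ω A := .ite (fun r => t (r.2 x)) c d

end Cmd

open Cmd

theorem Store.exec_onTape (n : ℕ) (σ : Store T Γ) (x : T) (f : Γ → Γ) (m : Move) {τ : ℤ → Γ} {h : ℤ}
    (hx : σ.tp x = (τ, h)) :
    σ.exec n (⟨.stay, Function.update (σ.reads n).2 x (f ((σ.reads n).2 x)),
      Function.update (fun _ => .stay) x m, none⟩ : Instr T Γ Ω) =
    σ.set x (Function.update τ h (f (τ h)), Transducer.moveWork m h) := by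
  cases σ with
  | mk ip tp =>
    simp only at hx
    simp only [Store.exec, Store.set, Store.reads, Transducer.moveInput, Store.mk.injEq, true_and]
    funext t
    by_cases ht : t = x
    · subst ht; simp [hx]
    · simp [Function.update_of_ne ht, Transducer.moveWork]

/-- The program `c` acts on the tape `x` alone, without output, and takes its contents and head
position from `p` to `p'`. -/
def RunOn (n s : ℕ) (x : T) (c : Cmd T Γ Ω A) (p p' : (ℤ → Γ) × ℤ) : Prop :=
  |p'.2| ≤ (s : ℤ) ∧
    ∀ σ : Store T Γ, σ.Bounded s → σ.tp x = p → Run n s c σ [] (σ.set x p')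

namespace RunOn

variable {n s : ℕ} {x : T} {c d : Cmd T Γ Ω A} {p p' p'' : (ℤ → Γ) × ℤ} {t : Γ → Bool}

theorem onTape {τ : ℤ → Γ} {h : ℤ} (f : Γ → Γ) (m : Move)
    (hm : |Transducer.moveWork m h| ≤ (s : ℤ)) :
    RunOn n s x (Cmd.onTape x f m : Cmd T Γ Ω A) (τ, h)
      (Function.update τ h (f (τ h)), Transducer.moveWork m h) := by
  refine ⟨hm, fun σ hσ hx => ?_⟩
  have := Run.act (n := n) (s := s) (A := A) (fun r => (⟨.stay, Function.update r.2 x (f (r.2 x)),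
    Function.update (fun _ => .stay) x m, none⟩ : Instr T Γ Ω)) σ
    (by rw [Store.exec_onTape n σ x f m hx]; exact hσ.set hm)
  rw [Store.exec_onTape n σ x f m hx] at this
  exact this

theorem move {τ : ℤ → Γ} {h : ℤ} (m : Move) (hm : |Transducer.moveWork m h| ≤ (s : ℤ)) :
    RunOn n s x (Cmd.onTape x id m : Cmd T Γ Ω A) (τ, h) (τ, Transducer.moveWork m h) := by
  simpa using onTape (n := n) (x := x) (Ω := Ω) (A := A) (τ := τ) id m hm

theorem seq (h₁ : RunOn n s x c p p') (h₂ : RunOn n s x d p' p'') :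
    RunOn n s x (.seq c d) p p'' := by
  refine ⟨h₂.1, fun σ hσ hx => ?_⟩
  simpa using Run.seq (h₁.2 σ hσ hx) (h₂.2 _ (hσ.set h₁.1) (σ.set_tp_self x p'))

theorem loop_false {τ : ℤ → Γ} {h : ℤ} (hh : |h| ≤ (s : ℤ)) (ht : t (τ h) = false) :
    RunOn n s x (loopOn x t c) (τ, h) (τ, h) := by
  refine ⟨hh, fun σ hσ hx => ?_⟩
  rw [σ.set_self hx]
  exact Run.loop_false (by simp [Store.reads, hx, ht])

theorem loop_true {τ : ℤ → Γ} {h : ℤ} (ht : t (τ h) = true) (h₁ : RunOn n s x c (τ, h) p')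
    (h₂ : RunOn n s x (loopOn x t c) p' p'') : RunOn n s x (loopOn x t c) (τ, h) p'' := by
  refine ⟨h₂.1, fun σ hσ hx => ?_⟩
  have := Run.loop_true (t := fun r => t (r.2 x)) (by simp [Store.reads, hx, ht]) (h₁.2 σ hσ hx)
    (h₂.2 _ (hσ.set h₁.1) (σ.set_tp_self x p'))
  simpa [loopOn] using this

theorem ite_true {τ : ℤ → Γ} {h : ℤ} (ht : t (τ h) = true) (h₁ : RunOn n s x c (τ, h) p') :
    RunOn n s x (iteOn x t c d) (τ, h) p' :=
  ⟨h₁.1, fun σ hσ hx => Run.ite_true (by simp [Store.reads, hx, ht]) (h₁.2 σ hσ hx)⟩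

theorem ite_false {τ : ℤ → Γ} {h : ℤ} (ht : t (τ h) = false) (h₁ : RunOn n s x d (τ, h) p') :
    RunOn n s x (iteOn x t c d) (τ, h) p' :=
  ⟨h₁.1, fun σ hσ hx => Run.ite_false (by simp [Store.reads, hx, ht]) (h₁.2 σ hσ hx)⟩

theorem seq_loop_true {τ : ℤ → Γ} {h : ℤ} (ht : t (τ h) = true) (h₁ : RunOn n s x c (τ, h) p')
    (h₂ : RunOn n s x (.seq (loopOn x t c) d) p' p'') :
    RunOn n s x (.seq (loopOn x t c) d) (τ, h) p'' := by
  refine ⟨h₂.1, fun σ hσ hx => ?_⟩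
  have := h₂.2 _ (hσ.set h₁.1) (σ.set_tp_self x p')
  generalize hE : ([] : List Ω) = E at this
  cases this with
  | @seq _ _ _ o1 σ1 o2 _ r1 r2 =>
    have h3 := Run.loop_true (t := fun r => t (r.2 x)) (by simp [Store.reads, hx, ht])
      (h₁.2 σ hσ hx) r1
    have := Run.seq h3 r2
    simpa [loopOn] using this

theorem seq_loop_false {τ : ℤ → Γ} {h : ℤ} (hh : |h| ≤ (s : ℤ)) (ht : t (τ h) = false)
    (h₂ : RunOn n s x d (τ, h) p'') :
    RunOn n s x (.seq (loopOn x t c) d) (τ, h) p'' :=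
  seq (loop_false hh ht) h₂

theorem loop_iterate (N : ℕ) (p : ℕ → (ℤ → Γ) × ℤ)
    (hb : ∀ i < N, RunOn n s x c (p i) (p (i + 1)))
    (ht : ∀ i < N, t ((p i).1 (p i).2) = true) (hf : t ((p N).1 (p N).2) = false)
    (h0 : |(p N).2| ≤ (s : ℤ)) : RunOn n s x (loopOn x t c) (p 0) (p N) := by
  have key : ∀ k ≤ N, RunOn n s x (loopOn x t c) (p (N - k)) (p N) := by
    intro k
    induction k with
    | zero => intro _; exact loop_false h0 hf
    | succ k ih =>
      intro hk
      refine loop_true (ht _ (by omega)) (hb _ (by omega)) ?_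
      have : N - (k + 1) + 1 = N - k := by omega
      rw [this]; exact ih (by omega)
  simpa using key N le_rfl

/-- Moving left to the first cell on which the test fails. -/
theorem scan_left {τ : ℤ → Γ} {a h : ℤ} (hah : a ≤ h) (ha : |a| ≤ (s : ℤ)) (hh : |h| ≤ (s : ℤ))
    (ht : ∀ j, a < j → j ≤ h → t (τ j) = true) (hf : t (τ a) = false) :
    RunOn n s x (loopOn x t (Cmd.onTape x id .left : Cmd T Γ Ω A)) (τ, h) (τ, a) := by
  have := loop_iterate (n := n) (s := s) (x := x) (t := t)
    (c := (Cmd.onTape x id .left : Cmd T Γ Ω A)) (h - a).toNat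
    (fun i => (τ, h - i)) (fun i hi => ?_) (fun i hi => ht _ ?_ ?_) ?_ ?_
  · have e : h - ((h - a).toNat : ℤ) = a := by omega
    simp only [e, Nat.cast_zero, sub_zero] at this
    exact this
  · have e : h - ((i + 1 : ℕ) : ℤ) = Transducer.moveWork .left (h - i) := by
      simp [Transducer.moveWork]; ring
    rw [e]
    refine move _ ?_
    simp only [Transducer.moveWork]
    rw [abs_le] at *; omega
  · simp only; omega
  · simp only; omega
  · have e : h - ((h - a).toNat : ℤ) = a := by omega
    simp only [e]; exact hf
  · have e : h - ((h - a).toNat : ℤ) = a := by omega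
    simp only [e]; exact ha

theorem scan_right {τ : ℤ → Γ} {a h : ℤ} (hah : h ≤ a) (ha : |a| ≤ (s : ℤ)) (hh : |h| ≤ (s : ℤ))
    (ht : ∀ j, h ≤ j → j < a → t (τ j) = true) (hf : t (τ a) = false) :
    RunOn n s x (loopOn x t (Cmd.onTape x id .right : Cmd T Γ Ω A)) (τ, h) (τ, a) := by
  have := loop_iterate (n := n) (s := s) (x := x) (t := t)
    (c := (Cmd.onTape x id .right : Cmd T Γ Ω A)) (a - h).toNat
    (fun i => (τ, h + i)) (fun i hi => ?_) (fun i hi => ht _ ?_ ?_) ?_ ?_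
  · have e : h + ((a - h).toNat : ℤ) = a := by omega
    simp only [e, Nat.cast_zero, add_zero] at this
    exact this
  · have e : h + ((i + 1 : ℕ) : ℤ) = Transducer.moveWork .right (h + i) := by
      simp [Transducer.moveWork]; ring
    rw [e]
    refine move _ ?_
    simp only [Transducer.moveWork]
    rw [abs_le] at *; omega
  · simp only; omega
  · simp only; omega
  · have e : h + ((a - h).toNat : ℤ) = a := by omega
    simp only [e]; exact hf
  · have e : h + ((a - h).toNat : ℤ) = a := by omega
    simp only [e]; exact ha

end RunOn

end SingleTape

/-! ### Binary counters -/

/-- The successor in the bijective binary numeration with the digits 1 (`false`) and 2 (`true`),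
least significant digit first. -/
def incList : List Bool → List Bool
  | [] => [false]
  | false :: l => true :: l
  | true :: l => false :: incList l

/-- The predecessor of a numeral. -/
def decList : List Bool → List Bool
  | [] => []
  | true :: l => false :: l
  | false :: l => if l = [] then [] else true :: decList l

theorem incList_ne_nil (l : List Bool) : incList l ≠ [] := by
  rcases l with _ | ⟨_ | _, l⟩ <;> simp [incList]

theorem decList_incList (l : List Bool) : decList (incList l) = l := by
  induction l with
  | nil => rfl
  | cons b l ih => cases b <;> simp [incList, decList, incList_ne_nil, ih]

/-- The bijective binary numeral of `n`. -/
def bits (n : ℕ) : List Bool := incList^[n] []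

theorem bits_succ (n : ℕ) : bits (n + 1) = incList (bits n) := Function.iterate_succ_apply' _ _ _

theorem decList_bits_succ (n : ℕ) : decList (bits (n + 1)) = bits n := by
  rw [bits_succ, decList_incList]

theorem bits_eq_nil {n : ℕ} : bits n = [] ↔ n = 0 := by
  cases n with
  | zero => simp [bits]
  | succ n => simp [bits_succ, incList_ne_nil]

/-- The value of a numeral. -/
def valList : List Bool → ℕ
  | [] => 0
  | b :: l => (if b then 2 else 1) + 2 * valList l

theorem valList_incList (l : List Bool) : valList (incList l) = valList l + 1 := by
  induction l with
  | nil => rfl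
  | cons b l ih => cases b <;> simp [incList, valList, ih] <;> omega

theorem valList_bits (n : ℕ) : valList (bits n) = n := by
  induction n with
  | zero => rfl
  | succ n ih => rw [bits_succ, valList_incList, ih]

theorem two_pow_length_le (l : List Bool) : 2 ^ l.length ≤ valList l + 1 := by
  induction l with
  | nil => simp [valList]
  | cons b l ih => cases b <;> simp [valList, pow_succ] <;> omega

theorem length_bits_le {n s : ℕ} (h : n + 1 < 2 ^ s) : (bits n).length < s := by
  have := two_pow_length_le (bits n)
  rw [valList_bits] at this
  exact (Nat.pow_lt_pow_iff_right (by norm_num)).1 (this.trans_lt h)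

/-- The tape symbols of the machine which simulates the generator of a word: digits of counters,
cells of the simulated work tapes that have been visited (with a mark on the origin), the
origin of a simulated tape that has been erased, and a cell that holds the state of the
simulated machine and the symbol emitted by its last step. -/
inductive Cell (Q Γ Ω : Type)
  | blank
  | dig (b : Bool)
  | sim (g : Γ) (o : Bool)
  | org
  | ctl (q : Q) (e : Option Ω)

namespace Cell

variable {Q Γ Ω : Type}

instance [Finite Q] [Finite Γ] [Finite Ω] : Finite (Cell Q Γ Ω) := by
  let g : Cell Q Γ Ω → Unit ⊕ Bool ⊕ (Γ × Bool) ⊕ Unit ⊕ (Q × Option Ω) := fun c =>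
    match c with
    | .blank => .inl ()
    | .dig b => .inr (.inl b)
    | .sim g o => .inr (.inr (.inl (g, o)))
    | .org => .inr (.inr (.inr (.inl ())))
    | .ctl q e => .inr (.inr (.inr (.inr (q, e))))
  refine Finite.of_injective g fun a b h => ?_
  cases a <;> cases b <;> simp [g] at h <;> simp [h]

/-- The digit 1, written as `false`. -/
def isOne : Cell Q Γ Ω → Bool
  | .dig false => true
  | _ => false

/-- The digit 2, written as `true`. -/
def isTwo : Cell Q Γ Ω → Bool
  | .dig true => true
  | _ => false

def nonblank : Cell Q Γ Ω → Bool
  | .blank => false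
  | _ => true

def isSim : Cell Q Γ Ω → Bool
  | .sim _ _ => true
  | _ => false

def isOrg : Cell Q Γ Ω → Bool
  | .org => true
  | _ => false

/-- What remains of a visited cell when a simulated tape is erased. -/
def erase : Cell Q Γ Ω → Cell Q Γ Ω
  | .sim _ true => .org
  | _ => .blank

end Cell

section Counter

variable {Q Γ Ω : Type}

/-- The tape contents with the digits `l` in the cells `0, 1, …`. -/
def digitTape (l : List Bool) : ℤ → Cell Q Γ Ω
  | .ofNat k => (l[k]?).elim .blank .dig
  | .negSucc _ => .blank

theorem digitTape_natCast (l : List Bool) (k : ℕ) :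
    (digitTape l (k : ℤ) : Cell Q Γ Ω) = (l[k]?).elim .blank .dig := rfl

theorem update_digitTape_append_cons (l : List Bool) (a b : Bool) (r : List Bool) :
    Function.update (digitTape (l ++ a :: r) : ℤ → Cell Q Γ Ω) (l.length : ℤ) (.dig b) =
      digitTape (l ++ b :: r) := by
  funext i
  rcases i with k | k
  · by_cases h : k = l.length
    · subst h; simp [digitTape]
    · have h' : (Int.ofNat k) ≠ (l.length : ℤ) := fun e => h (by simpa using e)
      rw [Function.update_of_ne h']
      simp only [digitTape]
      rcases lt_or_gt_of_ne h with h1 | h1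
      · simp [List.getElem?_append_left h1]
      · obtain ⟨d, rfl⟩ := Nat.exists_eq_add_of_lt h1
        simp [List.getElem?_append_right, Nat.add_assoc]
  · rw [Function.update_of_ne (by simp)]; rfl

theorem update_digitTape_append (l : List Bool) (b : Bool) :
    Function.update (digitTape l : ℤ → Cell Q Γ Ω) (l.length : ℤ) (.dig b) =
      digitTape (l ++ [b]) := by
  funext i
  rcases i with k | k
  · by_cases h : k = l.length
    · subst h; simp [digitTape]
    · have h' : (Int.ofNat k) ≠ (l.length : ℤ) := fun e => h (by simpa using e)
      rw [Function.update_of_ne h']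
      simp only [digitTape]
      rcases lt_or_gt_of_ne h with h1 | h1
      · simp [List.getElem?_append_left h1]
      · rw [List.getElem?_eq_none h1.le, List.getElem?_eq_none (by simp; omega)]
  · rw [Function.update_of_ne (by simp)]; rfl

theorem update_digitTape_blank (l : List Bool) (b : Bool) :
    Function.update (digitTape (l ++ [b]) : ℤ → Cell Q Γ Ω) (l.length : ℤ) .blank =
      digitTape l := by
  rw [← update_digitTape_append, Function.update_idem, Function.update_eq_self_iff]
  simp [digitTape_natCast]

/-- The contents and head position of a tape used as a counter with value `n`. -/
def counter (n : ℕ) : (ℤ → Cell Q Γ Ω) × ℤ := (digitTape (bits n), 0)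

theorem nonblank_counter (n : ℕ) :
    ((counter n : (ℤ → Cell Q Γ Ω) × ℤ).1 (counter n : (ℤ → Cell Q Γ Ω) × ℤ).2).nonblank =
      decide (n ≠ 0) := by
  have : (digitTape (bits n) (0 : ℤ) : Cell Q Γ Ω) = ((bits n)[0]?).elim .blank .dig := rfl
  simp only [counter, this]
  by_cases h : n = 0
  · subst h; simp [bits, Cell.nonblank]
  · obtain ⟨b, l, e⟩ := List.exists_cons_of_ne_nil (mt bits_eq_nil.1 h)
    simp [e, Cell.nonblank, h]

variable {T Ω' A : Type} [DecidableEq T]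

/-- Bring the head of a counter back to the least significant digit. -/
def Cmd.home (x : T) : Cmd T (Cell Q Γ Ω) Ω' A :=
  .seq (.loopOn x Cell.nonblank (.onTape x id .left)) (.onTape x id .right)

/-- Add one to a counter: digits 2 become 1 until a digit 1 or a blank cell is found. -/
def Cmd.incr (x : T) : Cmd T (Cell Q Γ Ω) Ω' A :=
  .seq (.seq (.loopOn x Cell.isTwo (.onTape x (fun _ => .dig false) .right))
    (.onTape x (fun c => .dig c.isOne) .left)) (.home x)

/-- Subtract one from a positive counter: digits 1 become 2 until a digit 2 is found, or the end, where
the most significant digit is erased. -/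
def Cmd.decr (x : T) : Cmd T (Cell Q Γ Ω) Ω' A :=
  .seq (.seq (.loopOn x Cell.isOne (.onTape x (fun _ => .dig true) .right))
    (.iteOn x Cell.isTwo (.onTape x (fun _ => .dig false) .left)
      (.seq (.onTape x id .left) (.onTape x (fun _ => .blank) .left)))) (.home x)

variable {n s : ℕ} {x : T}

theorem RunOn.home {l : List Bool} {h : ℤ} (h0 : -1 ≤ h) (h1 : h < l.length)
    (hl : l.length < s) :
    RunOn n s x (Cmd.home x : Cmd T (Cell Q Γ Ω) Ω' A) (digitTape l, h) (digitTape l, 0) := by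
  refine .seq (p' := (digitTape l, -1)) (scan_left (by omega) ?_ ?_ ?_ rfl) ?_
  · rw [abs_le]; omega
  · rw [abs_le]; omega
  · intro j hj hj'
    obtain ⟨k, rfl⟩ := Int.eq_ofNat_of_zero_le (by omega : 0 ≤ j)
    have : k < l.length := by omega
    simp [digitTape_natCast, this, Cell.nonblank]
  · have := move (n := n) (s := s) (x := x) (Ω := Ω') (A := A)
      (τ := (digitTape l : ℤ → Cell Q Γ Ω)) (h := -1) .right (by simp [Transducer.moveWork])
    simpa [Transducer.moveWork] using this

/-- The carry propagates through `l`; the digits `pre` are already in their final form. -/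
theorem RunOn.incr_carry (l : List Bool) : ∀ pre : List Bool, (pre ++ incList l).length < s →
    ∃ h : ℤ, -1 ≤ h ∧ h < (pre ++ incList l).length ∧
    RunOn n s x (.seq (.loopOn x Cell.isTwo (.onTape x (fun _ => .dig false) .right))
      (.onTape x (fun c => .dig c.isOne) .left) : Cmd T (Cell Q Γ Ω) Ω' A)
      (digitTape (pre ++ l), (pre.length : ℤ)) (digitTape (pre ++ incList l), h) := by
  induction l with
  | nil =>
    intro pre hp
    simp only [incList, List.length_append, List.length_singleton] at hp
    refine ⟨pre.length - 1, by omega, by simp [incList], ?_⟩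
    refine .seq_loop_false (by rw [abs_le]; omega) (by simp [digitTape_natCast, Cell.isTwo]) ?_
    have := onTape (n := n) (s := s) (x := x) (Ω := Ω') (A := A)
      (τ := (digitTape pre : ℤ → Cell Q Γ Ω)) (h := pre.length) (fun c => .dig c.isOne) .left
      (by simp only [Transducer.moveWork]; rw [abs_le]; omega)
    simpa [incList, digitTape_natCast, Cell.isOne, update_digitTape_append, Transducer.moveWork]
      using this
  | cons b l ih =>
    intro pre hp
    cases b with
    | false =>
      simp only [incList, List.length_append, List.length_cons] at hp
      refine ⟨pre.length - 1, by omega, by simp [incList]; omega, ?_⟩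
      refine .seq_loop_false (by rw [abs_le]; omega) (by simp [digitTape_natCast, Cell.isTwo]) ?_
      have := onTape (n := n) (s := s) (x := x) (Ω := Ω') (A := A)
        (τ := (digitTape (pre ++ false :: l) : ℤ → Cell Q Γ Ω)) (h := pre.length)
        (fun c => .dig c.isOne) .left
        (by simp only [Transducer.moveWork]; rw [abs_le]; omega)
      simpa [incList, digitTape_natCast, Cell.isOne, update_digitTape_append_cons,
        Transducer.moveWork] using this
    | true =>
      obtain ⟨h, h0, h1, hr⟩ := ih (pre ++ [false]) (by simpa [incList] using hp)
      have e : pre ++ [false] ++ incList l = pre ++ incList (true :: l) := by simp [incList]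
      rw [e] at h1 hr
      refine ⟨h, h0, h1, .seq_loop_true (p' := (digitTape (pre ++ [false] ++ l),
        ((pre ++ [false]).length : ℤ))) (by simp [digitTape_natCast, Cell.isTwo]) ?_ hr⟩
      simp only [incList, List.length_append, List.length_cons] at hp
      have := onTape (n := n) (s := s) (x := x) (Ω := Ω') (A := A)
        (τ := (digitTape (pre ++ true :: l) : ℤ → Cell Q Γ Ω)) (h := pre.length)
        (fun _ => .dig false) .right
        (by simp only [Transducer.moveWork]; rw [abs_le]; omega)
      simpa [update_digitTape_append_cons, Transducer.moveWork] using this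

theorem RunOn.incr {v : ℕ} (hv : v + 2 < 2 ^ s) :
    RunOn n s x (Cmd.incr x : Cmd T (Cell Q Γ Ω) Ω' A) (counter v) (counter (v + 1)) := by
  have hl : (incList (bits v)).length < s := by
    rw [← bits_succ]; exact length_bits_le (by omega)
  obtain ⟨h, h0, h1, hr⟩ := RunOn.incr_carry (n := n) (s := s) (x := x) (Q := Q) (Γ := Γ) (Ω := Ω)
    (Ω' := Ω') (A := A) (bits v) [] (by simpa using hl)
  refine .seq hr ?_
  simp only [counter, bits_succ]
  exact .home h0 h1 hl

/-- The borrow propagates through `l`; the digits `pre` are already in their final form. -/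
theorem RunOn.decr_borrow (l : List Bool) (hl : l ≠ []) : ∀ pre : List Bool,
    (pre ++ l).length < s →
    ∃ h : ℤ, -1 ≤ h ∧ h < (pre ++ decList l).length ∧
    RunOn n s x (.seq (.loopOn x Cell.isOne (.onTape x (fun _ => .dig true) .right))
      (.iteOn x Cell.isTwo (.onTape x (fun _ => .dig false) .left)
      (.seq (.onTape x id .left) (.onTape x (fun _ => .blank) .left))) :
        Cmd T (Cell Q Γ Ω) Ω' A)
      (digitTape (pre ++ l), (pre.length : ℤ)) (digitTape (pre ++ decList l), h) := by
  induction l with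
  | nil => exact absurd rfl hl
  | cons b l ih =>
    intro pre hp
    simp only [List.length_append, List.length_cons] at hp
    cases b with
    | true =>
      refine ⟨pre.length - 1, by omega, by simp [decList]; omega, ?_⟩
      refine .seq_loop_false (by rw [abs_le]; omega) (by simp [digitTape_natCast, Cell.isOne]) ?_
      refine .ite_true (by simp [digitTape_natCast, Cell.isTwo]) ?_
      have := onTape (n := n) (s := s) (x := x) (Ω := Ω') (A := A)
        (τ := (digitTape (pre ++ true :: l) : ℤ → Cell Q Γ Ω)) (h := pre.length)
        (fun _ => .dig false) .left
        (by simp only [Transducer.moveWork]; rw [abs_le]; omega)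
      simpa [decList, update_digitTape_append_cons, Transducer.moveWork] using this
    | false =>
      have step := onTape (n := n) (s := s) (x := x) (Ω := Ω') (A := A)
        (τ := (digitTape (pre ++ false :: l) : ℤ → Cell Q Γ Ω)) (h := pre.length)
        (fun _ => .dig true) .right
        (by simp only [Transducer.moveWork]; rw [abs_le]; omega)
      simp only [update_digitTape_append_cons, Transducer.moveWork] at step
      by_cases hl' : l = []
      · subst hl'
        refine ⟨pre.length - 1, by omega, by simp [decList], ?_⟩
        refine .seq_loop_true (by simp [digitTape_natCast, Cell.isOne]) step ?_
        have e : (digitTape (pre ++ [true]) ((pre.length : ℤ) + 1) : Cell Q Γ Ω) = .blank := by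
          have := digitTape_natCast (Q := Q) (Γ := Γ) (Ω := Ω) (pre ++ [true]) (pre.length + 1)
          simpa using this
        refine .seq_loop_false (by rw [abs_le]; omega) (by simp [e, Cell.isOne]) ?_
        refine .ite_false (by simp [e, Cell.isTwo]) ?_
        have m := move (n := n) (s := s) (x := x) (Ω := Ω') (A := A)
          (τ := (digitTape (pre ++ [true]) : ℤ → Cell Q Γ Ω)) (h := pre.length + 1) .left
          (by simp only [Transducer.moveWork]; rw [abs_le]; omega)
        have o := onTape (n := n) (s := s) (x := x) (Ω := Ω') (A := A)
          (τ := (digitTape (pre ++ [true]) : ℤ → Cell Q Γ Ω)) (h := pre.length)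
          (fun _ => .blank) .left
          (by simp only [Transducer.moveWork]; rw [abs_le]; omega)
        simp only [Transducer.moveWork, add_sub_cancel_right] at m
        refine .seq m ?_
        simpa [decList, update_digitTape_blank, Transducer.moveWork] using o
      · obtain ⟨h, h0, h1, hr⟩ := ih hl' (pre ++ [true]) (by simp; omega)
        have e : pre ++ [true] ++ decList l = pre ++ decList (false :: l) := by
          simp [decList, hl']
        rw [e] at h1 hr
        refine ⟨h, h0, h1, .seq_loop_true (by simp [digitTape_natCast, Cell.isOne]) step ?_⟩
        simpa using hr

theorem RunOn.decr {v : ℕ} (hv : v + 2 < 2 ^ s) :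
    RunOn n s x (Cmd.decr x : Cmd T (Cell Q Γ Ω) Ω' A) (counter (v + 1)) (counter v) := by
  have hl : (bits (v + 1)).length < s := length_bits_le (by omega)
  obtain ⟨h, h0, h1, hr⟩ := RunOn.decr_borrow (n := n) (s := s) (x := x) (Q := Q) (Γ := Γ) (Ω := Ω)
    (Ω' := Ω') (A := A) (bits (v + 1)) (mt bits_eq_nil.1 (by omega)) [] (by simpa using hl)
  refine .seq hr ?_
  simp only [counter, List.nil_append, decList_bits_succ] at h1 ⊢
  exact .home h0 h1 (length_bits_le (by omega))

end Counter

/-! ### Simulation of the generator of a word -/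

section SimTape

variable {Q Γ Ω T Ω' A : Type} [DecidableEq T] {n s : ℕ} {x : T}

/-- A tape of the simulated machine, contents and head position: the visited cells form an
interval around the origin, which contains the head up to one cell, and the origin is marked. -/
def Visited (r : ℕ) (p : (ℤ → Cell Q Γ Ω) × ℤ) : Prop :=
  ∃ lo hi : ℤ, lo ≤ 0 ∧ 0 ≤ hi ∧ -(r : ℤ) ≤ lo ∧ hi ≤ r ∧ lo - 1 ≤ p.2 ∧ p.2 ≤ hi + 1 ∧
    (∀ j, lo ≤ j → j ≤ hi → ∃ g, p.1 j = .sim g (decide (j = 0))) ∧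
    ∀ j, (j < lo ∨ hi < j) → p.1 j = .blank

/-- An empty tape of the simulated machine, with blank symbol `g`. -/
def freshTape (g : Γ) : (ℤ → Cell Q Γ Ω) × ℤ :=
  (fun j => if j = 0 then .sim g true else .blank, 0)

theorem visited_freshTape (r : ℕ) (g : Γ) : Visited r (freshTape g : (ℤ → Cell Q Γ Ω) × ℤ) := by
  refine ⟨0, 0, le_rfl, le_rfl, by simp, by simp, by simp [freshTape], by simp [freshTape],
    fun j h1 h2 => ⟨g, ?_⟩, fun j hj => ?_⟩
  · have : j = 0 := le_antisymm h2 h1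
    subst this; simp [freshTape]
  · have : j ≠ 0 := by omega
    simp [freshTape, this]

/-- Erase a tape of the simulated machine. -/
def Cmd.wipe (g : Γ) (x : T) : Cmd T (Cell Q Γ Ω) Ω' A :=
  .seq (.onTape x id .left) <|
  .seq (.loopOn x Cell.isSim (.onTape x id .left)) <|
  .seq (.loopOn x (fun c => !c.isSim) (.onTape x id .right)) <|
  .seq (.loopOn x Cell.isSim (.onTape x Cell.erase .right)) <|
  .seq (.onTape x id .left) <|
  .seq (.loopOn x (fun c => !c.isOrg) (.onTape x id .left)) <|
  .onTape x (fun _ => .sim g true) .stay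

theorem RunOn.wipe {r : ℕ} (hr : r + 2 ≤ s) (g : Γ) {p : (ℤ → Cell Q Γ Ω) × ℤ}
    (hp : Visited r p) :
    RunOn n s x (Cmd.wipe g x : Cmd T (Cell Q Γ Ω) Ω' A) p (freshTape g) := by
  obtain ⟨τ, h⟩ := p
  obtain ⟨lo, hi, hlo, hhi, hlo', hhi', h1, h2, hsim, hbl⟩ := hp
  simp only at h1 h2 hsim hbl
  have bd : ∀ j : ℤ, lo - 2 ≤ j → j ≤ hi + 1 → |j| ≤ (s : ℤ) := by
    intro j _ _; rw [abs_le]; omega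
  have issim : ∀ j, lo ≤ j → j ≤ hi → (τ j).isSim = true := by
    intro j a b; obtain ⟨g, e⟩ := hsim j a b; simp [e, Cell.isSim]
  have notsim : ∀ j, (j < lo ∨ hi < j) → (τ j).isSim = false := by
    intro j a; simp [hbl j a, Cell.isSim]
  refine .seq (p' := (τ, h - 1)) (move .left (bd _ (by simp only [Transducer.moveWork]; omega)
    (by simp only [Transducer.moveWork]; omega))) ?_
  -- the first blank cell to the left
  refine .seq (p' := (τ, min (h - 1) (lo - 1))) (scan_left (by omega) (bd _ (by omega) (by omega))
    (bd _ (by omega) (by omega)) (fun j a b => issim j (by omega) (by omega))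
    (notsim _ (by omega))) ?_
  refine .seq (p' := (τ, lo)) (scan_right (by omega) (bd _ (by omega) (by omega))
    (bd _ (by omega) (by omega)) (fun j a b => by simp [notsim j (by omega)])
    (by simp [issim lo le_rfl (by omega)])) ?_
  -- erasing from left to right, keeping the mark on the origin
  let q : ℕ → (ℤ → Cell Q Γ Ω) × ℤ := fun i =>
    (fun j => if lo ≤ j ∧ j < lo + i then (if j = 0 then .org else .blank) else τ j, lo + i)
  have hN : lo + ((hi + 1 - lo).toNat : ℤ) = hi + 1 := by omega
  have hq : RunOn n s x (Cmd.loopOn x Cell.isSim (Cmd.onTape x Cell.erase .right) :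
      Cmd T (Cell Q Γ Ω) Ω' A) (q 0) (q (hi + 1 - lo).toNat) := by
    refine loop_iterate _ q (fun i hi' => ?_) (fun i hi' => ?_) ?_ ?_
    · have := onTape (n := n) (s := s) (x := x) (Ω := Ω') (A := A) (τ := (q i).1) (h := (q i).2)
        Cell.erase .right (bd _ (by simp only [Transducer.moveWork, q]; omega)
          (by simp only [Transducer.moveWork, q]; omega))
      have e : (Function.update (q i).1 (q i).2 (Cell.erase ((q i).1 (q i).2)),
          Transducer.moveWork .right (q i).2) = q (i + 1) := by
        refine Prod.ext ?_ (by simp [q, Transducer.moveWork]; ring)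
        funext j
        by_cases hj : j = lo + i
        · subst hj
          obtain ⟨g, e⟩ := hsim (lo + i) (by omega) (by omega)
          have hq' : (q i).1 (q i).2 = .sim g (decide (lo + (i : ℤ) = 0)) := by
            simp only [q]; rw [if_neg (by omega), e]
          have hr' : (q (i + 1)).1 (lo + i) = if lo + (i : ℤ) = 0 then .org else .blank := by
            simp only [q]; rw [if_pos (by push_cast; omega)]
          rw [hr', hq']
          simp only [q, Function.update_self]
          by_cases h0 : lo + (i : ℤ) = 0 <;> simp [h0, Cell.erase]
        · simp only [q]
          rw [Function.update_of_ne hj]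
          have : (lo ≤ j ∧ j < lo + (i : ℤ)) ↔ (lo ≤ j ∧ j < lo + ((i + 1 : ℕ) : ℤ)) := by
            push_cast; omega
          simp only [this]
      rw [e] at this; exact this
    · have := issim (lo + i) (by omega) (by omega)
      simpa [q] using this
    · simp only [q, hN]; rw [if_neg (by omega)]; exact notsim (hi + 1) (by omega)
    · simp only [q, hN]; exact bd _ (by omega) (by omega)
  have e0 : q 0 = (τ, lo) := by
    refine Prod.ext ?_ (by simp [q])
    funext j; simp only [q, Nat.cast_zero, add_zero]
    rw [if_neg (by omega)]
  have e1 : q (hi + 1 - lo).toNat = (fun j => if j = 0 then .org else .blank, hi + 1) := by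
    refine Prod.ext ?_ (by simp only [q, hN])
    funext j; simp only [q, hN]
    split_ifs with a b b
    · rfl
    · rfl
    · omega
    · exact hbl j (by omega)
  rw [e0, e1] at hq
  refine .seq hq ?_
  refine .seq (p' := (fun j => if j = 0 then .org else .blank, hi)) ?_ ?_
  · have := move (n := n) (s := s) (x := x) (Ω := Ω') (A := A)
      (τ := fun j : ℤ => if j = 0 then (.org : Cell Q Γ Ω) else .blank) (h := hi + 1) .left
      (bd _ (by simp only [Transducer.moveWork]; omega) (by simp only [Transducer.moveWork]; omega))
    simpa [Transducer.moveWork] using this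
  refine .seq (p' := (fun j => if j = 0 then .org else .blank, 0)) (scan_left (by omega)
    (by simp) (bd _ (by omega) (by omega)) (fun j a b => ?_) (by simp [Cell.isOrg])) ?_
  · have : j ≠ 0 := by omega
    simp [this, Cell.isOrg]
  have := onTape (n := n) (s := s) (x := x) (Ω := Ω') (A := A)
    (τ := fun j : ℤ => if j = 0 then (.org : Cell Q Γ Ω) else .blank) (h := 0)
    (fun _ => .sim g true) .stay (by simp [Transducer.moveWork])
  have e : (Function.update (fun j : ℤ => if j = 0 then (.org : Cell Q Γ Ω) else .blank) 0
      (.sim g true), Transducer.moveWork .stay 0) = freshTape g := by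
    refine Prod.ext ?_ rfl
    funext j
    by_cases hj : j = 0
    · subst hj; simp [freshTape]
    · simp [freshTape, hj]
  rw [e] at this; exact this

end SimTape

section Sim

variable {Ω Ω' R : Type} [DecidableEq R]

/-- The tapes of the simulating machine: those of the simulated machine `M`, one (`none`) which
holds the state of `M` in one cell, and the counters. -/
abbrev STape (M : Transducer Unit Ω) (R : Type) : Type := Fin M.k ⊕ Option R

abbrev SCell (M : Transducer Unit Ω) : Type := Cell M.Q M.Γ Ω

abbrev SStore (M : Transducer Unit Ω) (R : Type) : Type := Store (STape M R) (SCell M)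

abbrev SCmd (M : Transducer Unit Ω) (R Ω' : Type) : Type :=
  Cmd (STape M R) (SCell M) Ω' (Option Ω)

/-- The tape which holds the state of the simulated machine. -/
abbrev ctlT {M : Transducer Unit Ω} {R : Type} : STape M R := .inr none

/-- The tape of a counter. -/
abbrev regT {M : Transducer Unit Ω} {R : Type} (x : R) : STape M R := .inr (some x)

variable {M : Transducer Unit Ω}

/-- The tape which holds the state `q` of the simulated machine and its last output `e`. -/
def ctlTape (q : M.Q) (e : Option Ω) : (ℤ → SCell M) × ℤ :=
  (fun j => if j = 0 then .ctl q e else .blank, 0)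

/-- The memory of the simulating machine in which the counters have the values `ρ`. -/
structure Good (r : ℕ) (ρ : R → ℕ) (σ : SStore M R) : Prop where
  regs : ∀ x, σ.tp (regT x) = counter (ρ x)
  ctl : ∃ q e, σ.tp ctlT = ctlTape q e
  sim : ∀ i, Visited r (σ.tp (.inl i))

theorem Good.bounded {r s : ℕ} (hr : r + 2 ≤ s) {ρ : R → ℕ} {σ : SStore M R} (h : Good r ρ σ) :
    σ.Bounded s := by
  rintro (i | _ | x)
  · obtain ⟨lo, hi, _, _, _, _, _, _, _⟩ := h.sim i
    rw [abs_le]; omega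
  · obtain ⟨q, e, he⟩ := h.ctl
    rw [he]; simp [ctlTape]
  · rw [h.regs]; simp [counter]

/-- The last output of the simulated machine. -/
def emitted (r : Reads (STape M R) (SCell M)) : Option Ω :=
  match r.2 ctlT with
  | .ctl _ e => e
  | _ => none

theorem emitted_eq {n : ℕ} {σ : SStore M R} {q : M.Q} {e : Option Ω}
    (h : σ.tp ctlT = ctlTape q e) : emitted (σ.reads n) = e := by
  simp [emitted, Store.reads, h, ctlTape]

/-- The symbol of the simulated tape in a cell. -/
def simVal (b : M.Γ) : SCell M → M.Γ
  | .sim g _ => g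
  | _ => b

/-- The mark on the origin of a simulated tape. -/
def simMark : SCell M → Bool
  | .sim _ o => o
  | _ => false

/-- The action of the simulated machine. -/
def simAction (r : Reads (STape M R) (SCell M)) : Option (Action M.Q M.Γ Ω M.k) :=
  match r.2 ctlT with
  | .ctl q _ => M.δ q r.1 fun i => simVal M.blank (r.2 (.inl i))
  | _ => none

/-- One step of the simulated machine. -/
def simStep : SCmd M R Ω' := .act fun r =>
  match simAction r with
  | some a => ⟨a.inMove, fun t => match t with
      | .inl i => .sim (a.write i) (simMark (r.2 (.inl i)))
      | .inr none => .ctl a.next a.emit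
      | .inr (some x) => r.2 (regT x), fun t => match t with
      | .inl i => a.workMove i
      | .inr _ => .stay, none⟩
  | none => .noop r

/-- The memory represents the configuration `c` of the simulated machine, up to its output. -/
structure SimRel (r : ℕ) (σ : SStore M R) (c : M.Config) : Prop where
  inPos : σ.inPos = c.inPos
  ctl : ∃ e, σ.tp ctlT = ctlTape c.state e
  sim : ∀ i, Visited r (σ.tp (.inl i))
  head : ∀ i, (σ.tp (.inl i)).2 = c.head i
  tape : ∀ i j, simVal M.blank ((σ.tp (.inl i)).1 j) = c.tape i j

theorem SimRel.simAction_eq {r n : ℕ} {σ : SStore M R} {c : M.Config} (h : SimRel r σ c) :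
    simAction (σ.reads n) = M.δ c.state (Transducer.readInput (List.replicate n ()) c.inPos)
      (fun i => c.tape i (c.head i)) := by
  obtain ⟨e, he⟩ := h.ctl
  simp only [simAction, Store.reads, he, ctlTape, if_true, h.inPos, h.head, h.tape]

theorem SimRel.step {r n s : ℕ} (hr : r + 2 ≤ s) {σ : SStore M R} {ρ : R → ℕ} {c c' : M.Config}
    (h : SimRel r σ c) (hρ : Good r ρ σ)
    (hc : M.step (List.replicate n ()) c = some c') (hb : ∀ i, |c.head i| ≤ (r : ℤ)) :
    ∃ σ' e, Run n s (simStep : SCmd M R Ω') σ [] σ' ∧ SimRel r σ' c' ∧ Good r ρ σ' ∧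
      σ'.tp ctlT = ctlTape c'.state e ∧ c'.out = c.out ++ e.toList := by
  simp only [Transducer.step, Option.map_eq_some_iff] at hc
  obtain ⟨a, ha, rfl⟩ := hc
  rw [← h.simAction_eq (n := n)] at ha
  let I : Instr (STape M R) (SCell M) Ω' := ⟨a.inMove, fun t => match t with
      | .inl i => .sim (a.write i) (simMark ((σ.reads n).2 (.inl i)))
      | .inr none => .ctl a.next a.emit
      | .inr (some x) => (σ.reads n).2 (regT x), fun t => match t with
      | .inl i => a.workMove i
      | .inr _ => .stay, none⟩
  have hctl : (σ.exec n I).tp ctlT = ctlTape a.next a.emit := by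
    obtain ⟨e, he⟩ := h.ctl
    refine Prod.ext ?_ ?_
    · simp only [Store.exec, I, he, ctlTape]
      funext j
      by_cases hj : j = 0
      · subst hj; simp
      · simp [hj]
    · simp [Store.exec, I, he, ctlTape, Transducer.moveWork]
  have hvis : ∀ i, Visited r ((σ.exec n I).tp (.inl i)) := by
    intro i
    obtain ⟨lo, hi, h1, h2, h3, h4, h5, h6, h7, h8⟩ := h.sim i
    have hh := h.head i
    have hb' := abs_le.1 (hb i)
    rw [← hh] at hb'
    have hm : (σ.tp (.inl i)).2 - 1 ≤ Transducer.moveWork (a.workMove i) (σ.tp (.inl i)).2 ∧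
        Transducer.moveWork (a.workMove i) (σ.tp (.inl i)).2 ≤ (σ.tp (.inl i)).2 + 1 := by
      cases a.workMove i <;> simp only [Transducer.moveWork] <;> omega
    generalize hp : Transducer.moveWork (a.workMove i) (σ.tp (.inl i)).2 = p at hm
    have hmark : simMark ((σ.reads n).2 (.inl i)) = decide ((σ.tp (.inl i)).2 = 0) := by
      simp only [Store.reads]
      by_cases hin : lo ≤ (σ.tp (.inl i)).2 ∧ (σ.tp (.inl i)).2 ≤ hi
      · obtain ⟨g, e⟩ := h7 _ hin.1 hin.2
        rw [e]; rfl
      · rw [h8 _ (by omega)]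
        have : (σ.tp (.inl i)).2 ≠ 0 := by omega
        simp [simMark, this]
    refine ⟨min lo (σ.tp (.inl i)).2, max hi (σ.tp (.inl i)).2, by omega, by omega, by omega,
      by omega, ?_, ?_, fun j j1 j2 => ?_, fun j j1 => ?_⟩
    · simp only [Store.exec, I, hp]; omega
    · simp only [Store.exec, I, hp]; omega
    · simp only [Store.exec, I]
      by_cases hj : j = (σ.tp (.inl i)).2
      · subst hj; exact ⟨a.write i, by rw [Function.update_self, hmark]⟩
      · rw [Function.update_of_ne hj]; exact h7 j (by omega) (by omega)
    · simp only [Store.exec, I]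
      rw [Function.update_of_ne (by omega)]; exact h8 j (by omega)
  have hgood : Good r ρ (σ.exec n I) := by
    refine ⟨fun x => ?_, ⟨_, _, hctl⟩, hvis⟩
    rw [← hρ.regs x]
    refine Prod.ext ?_ ?_
    · simp [Store.exec, I, Store.reads]
    · simp [Store.exec, I, Transducer.moveWork]
  refine ⟨σ.exec n I, a.emit, ?_, ?_, hgood, hctl, rfl⟩
  · have := Run.act (n := n) (s := s) (A := Option Ω) (fun r => (match simAction r with
      | some a => ⟨a.inMove, fun t => match t with
          | .inl i => .sim (a.write i) (simMark (r.2 (.inl i)))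
          | .inr none => .ctl a.next a.emit
          | .inr (some x) => r.2 (regT x), fun t => match t with
          | .inl i => a.workMove i
          | .inr _ => .stay, none⟩
      | none => .noop r : Instr (STape M R) (SCell M) Ω')) σ
    simp only [ha] at this
    exact this (hgood.bounded hr)
  · refine ⟨?_, ⟨_, hctl⟩, hvis, fun i => ?_, fun i j => ?_⟩
    · simp [Store.exec, I, h.inPos]
    · simp [Store.exec, I, h.head]
    · simp only [Store.exec, I, h.head]
      by_cases hj : j = c.head i
      · subst hj; simp [simVal]
      · simp [Function.update_of_ne hj, h.tape]

/-- On input `1ⁿ`, the program `c` leads from counter values `ρ` to `ρ'` with output `o`. -/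
def Exec (n r s : ℕ) (c : SCmd M R Ω') (ρ : R → ℕ) (o : List Ω') (ρ' : R → ℕ) : Prop :=
  ∀ σ : SStore M R, Good r ρ σ → ∃ σ', Run n s c σ o σ' ∧ Good r ρ' σ'

theorem Good.set_reg {r : ℕ} {ρ : R → ℕ} {σ : SStore M R} (h : Good r ρ σ) (x : R) (v : ℕ) :
    Good r (Function.update ρ x v) (σ.set (regT x) (counter v)) := by
  refine ⟨fun y => ?_, ?_, fun i => ?_⟩
  · by_cases hy : y = x
    · subst hy; simp
    · rw [Store.set_tp_of_ne _ (by simpa using hy), Function.update_of_ne hy]; exact h.regs y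
  · rw [Store.set_tp_of_ne _ (by simp)]; exact h.ctl
  · rw [Store.set_tp_of_ne _ (by simp)]; exact h.sim i

theorem Good.set_ctl {r : ℕ} {ρ : R → ℕ} {σ : SStore M R} (h : Good r ρ σ) (q e) :
    Good r ρ (σ.set ctlT (ctlTape q e)) := by
  refine ⟨fun y => ?_, ⟨q, e, by simp⟩, fun i => ?_⟩
  · rw [Store.set_tp_of_ne _ (by simp)]; exact h.regs y
  · rw [Store.set_tp_of_ne _ (by simp)]; exact h.sim i

theorem SimRel.set_reg {r : ℕ} {σ : SStore M R} {c : M.Config} (h : SimRel r σ c) (x : R) (p) :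
    SimRel r (σ.set (regT x) p) c := by
  refine ⟨h.inPos, ?_, fun i => ?_, fun i => ?_, fun i j => ?_⟩
  · rw [Store.set_tp_of_ne _ (by simp)]; exact h.ctl
  · rw [Store.set_tp_of_ne _ (by simp)]; exact h.sim i
  · rw [Store.set_tp_of_ne _ (by simp)]; exact h.head i
  · rw [Store.set_tp_of_ne _ (by simp)]; exact h.tape i j

theorem SimRel.set_ctl {r : ℕ} {σ : SStore M R} {c : M.Config} (h : SimRel r σ c) (e) :
    SimRel r (σ.set ctlT (ctlTape c.state e)) c := by
  refine ⟨h.inPos, ⟨e, by simp⟩, fun i => ?_, fun i => ?_, fun i j => ?_⟩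
  · rw [Store.set_tp_of_ne _ (by simp)]; exact h.sim i
  · rw [Store.set_tp_of_ne _ (by simp)]; exact h.head i
  · rw [Store.set_tp_of_ne _ (by simp)]; exact h.tape i j

/-- Test whether a counter is not zero. -/
def nz (x : R) (r : Reads (STape M R) (SCell M)) : Bool := (r.2 (regT x)).nonblank

theorem Good.nz_eq {r n : ℕ} {ρ : R → ℕ} {σ : SStore M R} (h : Good r ρ σ) (x : R) :
    nz x (σ.reads n) = decide (ρ x ≠ 0) := by
  simp only [nz, Store.reads, h.regs x]
  exact nonblank_counter _

namespace Exec

variable {n r s : ℕ} {c d : SCmd M R Ω'} {ρ ρ' ρ'' : R → ℕ} {o o' : List Ω'}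

theorem skip : Exec n r s (.skip : SCmd M R Ω') ρ [] ρ := fun σ h => ⟨σ, .skip σ, h⟩

theorem seq (h₁ : Exec n r s c ρ o ρ') (h₂ : Exec n r s d ρ' o' ρ'') :
    Exec n r s (.seq c d) ρ (o ++ o') ρ'' := by
  intro σ h
  obtain ⟨σ', r1, g1⟩ := h₁ σ h
  obtain ⟨σ'', r2, g2⟩ := h₂ σ' g1
  exact ⟨σ'', r1.seq r2, g2⟩

theorem seq_nil_left (h₁ : Exec n r s c ρ [] ρ') (h₂ : Exec n r s d ρ' o' ρ'') :
    Exec n r s (.seq c d) ρ o' ρ'' := by simpa using seq h₁ h₂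

theorem incr (hr : r + 2 ≤ s) (x : R) (hx : ρ x + 2 < 2 ^ s) :
    Exec n r s (.incr (regT x) : SCmd M R Ω') ρ [] (Function.update ρ x (ρ x + 1)) :=
  fun σ h => ⟨_, (RunOn.incr hx).2 σ (h.bounded hr) (h.regs x), h.set_reg x _⟩

theorem decr (hr : r + 2 ≤ s) (x : R) {v : ℕ} (hv : ρ x = v + 1) (hx : v + 2 < 2 ^ s) :
    Exec n r s (.decr (regT x) : SCmd M R Ω') ρ [] (Function.update ρ x v) :=
  fun σ h => ⟨_, (RunOn.decr hx).2 σ (h.bounded hr) (by rw [h.regs x, hv]), h.set_reg x _⟩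

theorem loop_false {t : Reads (STape M R) (SCell M) → Bool}
    (ht : ∀ σ : SStore M R, Good r ρ σ → t (σ.reads n) = false) :
    Exec n r s (.loop t c) ρ [] ρ := fun σ h => ⟨σ, .loop_false (ht σ h), h⟩

theorem loop_true {t : Reads (STape M R) (SCell M) → Bool}
    (ht : ∀ σ : SStore M R, Good r ρ σ → t (σ.reads n) = true)
    (h₁ : Exec n r s c ρ o ρ') (h₂ : Exec n r s (.loop t c) ρ' o' ρ'') :
    Exec n r s (.loop t c) ρ (o ++ o') ρ'' := by
  intro σ h
  obtain ⟨σ', r1, g1⟩ := h₁ σ h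
  obtain ⟨σ'', r2, g2⟩ := h₂ σ' g1
  exact ⟨σ'', r1.loop_true (ht σ h) r2, g2⟩

theorem ite_true {t : Reads (STape M R) (SCell M) → Bool}
    (ht : ∀ σ : SStore M R, Good r ρ σ → t (σ.reads n) = true)
    (h₁ : Exec n r s c ρ o ρ') : Exec n r s (.ite t c d) ρ o ρ' := by
  intro σ h
  obtain ⟨σ', r1, g1⟩ := h₁ σ h
  exact ⟨σ', r1.ite_true (ht σ h), g1⟩

theorem ite_false {t : Reads (STape M R) (SCell M) → Bool}
    (ht : ∀ σ : SStore M R, Good r ρ σ → t (σ.reads n) = false)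
    (h₁ : Exec n r s d ρ o ρ') : Exec n r s (.ite t c d) ρ o ρ' := by
  intro σ h
  obtain ⟨σ', r1, g1⟩ := h₁ σ h
  exact ⟨σ', r1.ite_false (ht σ h), g1⟩

end Exec

/-- Output one symbol. -/
def Cmd.emit {T Γ Ω' A : Type} (u : Ω') : Cmd T Γ Ω' A :=
  .act fun r => { (Instr.noop r : Instr T Γ Ω') with emit := some u }

theorem Exec.emit {n r s : ℕ} (hr : r + 2 ≤ s) {ρ : R → ℕ} (u : Ω') :
    Exec n r s (.emit u : SCmd M R Ω') ρ [u] ρ := by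
  intro σ h
  have e : σ.exec n ({ (Instr.noop (σ.reads n) : Instr (STape M R) (SCell M) Ω') with
    emit := some u }) = σ := σ.exec_noop (Ω := Ω') n
  have := Run.act (n := n) (s := s) (A := Option Ω)
    (fun r => { (Instr.noop r : Instr (STape M R) (SCell M) Ω') with emit := some u }) σ
    (by rw [e]; exact h.bounded hr)
  rw [e] at this
  exact ⟨σ, this, h⟩

/-- Set a counter to zero. -/
def Cmd.zero (x : R) : SCmd M R Ω' := .loop (nz x) (.decr (regT x))

/-- Copy the counter `x` to `y`, with the auxiliary counter `t`. -/
def Cmd.copy (x y t : R) : SCmd M R Ω' :=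
  .seq (.zero y) <| .seq (.zero t) <|
  .seq (.loop (nz x) (.seq (.decr (regT x)) (.seq (.incr (regT y)) (.incr (regT t)))))
    (.loop (nz t) (.seq (.decr (regT t)) (.incr (regT x))))

/-- Set a counter to a constant. -/
def Cmd.const (y : R) : ℕ → SCmd M R Ω'
  | 0 => .zero y
  | k + 1 => .seq (const y k) (.incr (regT y))

theorem update_eq_of_eq {ρ : R → ℕ} {x : R} {v : ℕ} (h : ρ x = v) : Function.update ρ x v = ρ := by
  subst h; simp

theorem Exec.zero {n r s : ℕ} (hr : r + 2 ≤ s) (x : R) : ∀ {ρ : R → ℕ}, ρ x + 2 < 2 ^ s →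
    Exec n r s (.zero x : SCmd M R Ω') ρ [] (Function.update ρ x 0) := by
  suffices ∀ v (ρ : R → ℕ), ρ x = v → v + 2 < 2 ^ s →
      Exec n r s (.zero x : SCmd M R Ω') ρ [] (Function.update ρ x 0) from
    fun {ρ} h => this _ ρ rfl h
  intro v
  induction v with
  | zero =>
    intro ρ hv _
    rw [update_eq_of_eq hv]
    exact loop_false fun σ h => by simp [h.nz_eq, hv]
  | succ v ih =>
    intro ρ hv hs
    have := ih (Function.update ρ x v) (by simp) (by omega)
    rw [Function.update_idem] at this
    exact loop_true (o := []) (fun σ h => by simp [h.nz_eq, hv]) (decr hr x hv (by omega)) this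

theorem Exec.const {n r s : ℕ} (hr : r + 2 ≤ s) (x : R) {ρ : R → ℕ} (hx : ρ x + 2 < 2 ^ s) (k : ℕ)
    (hk : k + 2 < 2 ^ s) :
    Exec n r s (.const x k : SCmd M R Ω') ρ [] (Function.update ρ x k) := by
  induction k with
  | zero => exact zero hr x hx
  | succ k ih =>
    have := (ih (by omega)).seq (incr (Ω' := Ω') (M := M) (n := n) hr x
      (ρ := Function.update ρ x k) (by simp; omega))
    simpa [Cmd.const] using this

theorem Exec.copy {n r s : ℕ} (hr : r + 2 ≤ s) {x y t : R} (hxy : x ≠ y) (hxt : x ≠ t)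
    (hyt : y ≠ t) {ρ : R → ℕ} (hx : ρ x + 2 < 2 ^ s) (hy : ρ y + 2 < 2 ^ s)
    (ht : ρ t + 2 < 2 ^ s) :
    Exec n r s (.copy x y t : SCmd M R Ω') ρ []
      (Function.update (Function.update ρ y (ρ x)) t 0) := by
  have e1 := zero (n := n) (Ω' := Ω') (M := M) hr y hy
  have e2 := zero (n := n) (Ω' := Ω') (M := M) hr t (ρ := Function.update ρ y 0)
    (by rwa [Function.update_of_ne hyt.symm])
  -- the first loop moves `x` into both `y` and `t`
  have e3 : ∀ a b, a + b + 2 < 2 ^ s → ∀ ρ' : R → ℕ, ρ' x = a → ρ' y = b → ρ' t = b →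
      Exec n r s (.loop (nz x) (.seq (.decr (regT x)) (.seq (.incr (regT y)) (.incr (regT t)))) :
        SCmd M R Ω') ρ' []
        (Function.update (Function.update (Function.update ρ' x 0) y (a + b)) t (a + b)) := by
    intro a
    induction a with
    | zero =>
      intro b hb ρ' h1 h2 h3
      rw [update_eq_of_eq h1, Nat.zero_add, update_eq_of_eq h2, update_eq_of_eq h3]
      exact loop_false fun σ h => by simp [h.nz_eq, h1]
    | succ a ih =>
      intro b hb ρ' h1 h2 h3
      have d1 := decr (n := n) (Ω' := Ω') (M := M) hr x h1 (by omega)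
      have d2 := incr (n := n) (Ω' := Ω') (M := M) hr y (ρ := Function.update ρ' x a)
        (by rw [Function.update_of_ne hxy.symm, h2]; omega)
      have d3 := incr (n := n) (Ω' := Ω') (M := M) hr t
        (ρ := Function.update (Function.update ρ' x a) y ((Function.update ρ' x a) y + 1))
        (by rw [Function.update_of_ne hyt.symm, Function.update_of_ne hxt.symm, h3]; omega)
      have := loop_true (o := []) (fun σ h => by simp [h.nz_eq, h1])
        (d1.seq (d2.seq d3)) (ih (b + 1) (by omega) _ (by
          rw [Function.update_of_ne hxt, Function.update_of_ne hxy, Function.update_self])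
          (by rw [Function.update_of_ne hyt, Function.update_self,
            Function.update_of_ne hxy.symm, h2])
          (by rw [Function.update_self, Function.update_of_ne hyt.symm,
            Function.update_of_ne hxt.symm, h3]))
      simp only [List.nil_append] at this
      convert this using 1
      funext z
      by_cases z1 : z = x
      · subst z1; simp [Function.update_of_ne hxy, Function.update_of_ne hxt]
      by_cases z2 : z = y
      · subst z2; simp [Function.update_of_ne hyt]; omega
      by_cases z3 : z = t
      · subst z3; simp; omega
      simp [z1, z2, z3]
  -- the second loop moves `t` back into `x`
  have e4 : ∀ a b, a + b + 2 < 2 ^ s → ∀ ρ' : R → ℕ, ρ' t = a → ρ' x = b →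
      Exec n r s (.loop (nz t) (.seq (.decr (regT t)) (.incr (regT x))) : SCmd M R Ω') ρ' []
        (Function.update (Function.update ρ' t 0) x (a + b)) := by
    intro a
    induction a with
    | zero =>
      intro b hb ρ' h1 h2
      rw [update_eq_of_eq h1, Nat.zero_add, update_eq_of_eq h2]
      exact loop_false fun σ h => by simp [h.nz_eq, h1]
    | succ a ih =>
      intro b hb ρ' h1 h2
      have d1 := decr (n := n) (Ω' := Ω') (M := M) hr t h1 (by omega)
      have d2 := incr (n := n) (Ω' := Ω') (M := M) hr x (ρ := Function.update ρ' t a)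
        (by rw [Function.update_of_ne hxt, h2]; omega)
      have := loop_true (o := []) (fun σ h => by simp [h.nz_eq, h1])
        (d1.seq d2) (ih (b + 1) (by omega) _ (by
          rw [Function.update_of_ne hxt.symm, Function.update_self])
          (by rw [Function.update_self, Function.update_of_ne hxt, h2]))
      simp only [List.nil_append] at this
      convert this using 1
      funext z
      by_cases z1 : z = x
      · subst z1; simp; omega
      by_cases z3 : z = t
      · subst z3; simp [z1]
      simp [z1, z3]
  have h3 := e3 (ρ x) 0 (by omega) (Function.update (Function.update ρ y 0) t 0)
    (by rw [Function.update_of_ne hxt, Function.update_of_ne hxy])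
    (by rw [Function.update_of_ne hyt, Function.update_self]) (by simp)
  have h4 := e4 (ρ x) 0 (by omega) (Function.update (Function.update (Function.update
    (Function.update (Function.update ρ y 0) t 0) x 0) y (ρ x + 0)) t (ρ x + 0)) (by simp) (by
    rw [Function.update_of_ne hxt, Function.update_of_ne hxy, Function.update_self])
  have := e1.seq (e2.seq (h3.seq h4))
  simp only [List.nil_append] at this
  rw [Cmd.copy]
  convert this using 1
  funext z
  by_cases z1 : z = x
  · subst z1; simp [Function.update_of_ne hxt, Function.update_of_ne hxy]
  by_cases z2 : z = y
  · subst z2; simp [Function.update_of_ne hyt, Function.update_of_ne hxy.symm]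
  by_cases z3 : z = t
  · subst z3; simp [z1]
  simp [z1, z2, z3]

end Sim

section Fetch

variable {Ω Ω' R : Type} [DecidableEq R] {M : Transducer Unit Ω}

theorem Good.of_sim {r : ℕ} {ρ : R → ℕ} {σ σ' : SStore M R} (h : Good r ρ σ)
    (hr : ∀ x : Option R, σ'.tp (.inr x) = σ.tp (.inr x)) (hs : ∀ i, Visited r (σ'.tp (.inl i))) :
    Good r ρ σ' := by
  refine ⟨fun x => ?_, ?_, hs⟩
  · rw [hr]; exact h.regs x
  · rw [hr]; exact h.ctl

/-- Erase the tapes `xs` of the simulated machine. -/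
def Cmd.wipeAll : List (Fin M.k) → SCmd M R Ω'
  | [] => .skip
  | i :: xs => .seq (.wipe M.blank (.inl i)) (wipeAll xs)

theorem run_wipeAll {n r s : ℕ} (hr : r + 2 ≤ s) {ρ : R → ℕ} (xs : List (Fin M.k)) :
    ∀ σ : SStore M R, Good r ρ σ → ∃ σ', Run n s (.wipeAll xs : SCmd M R Ω') σ [] σ' ∧
      Good r ρ σ' ∧ (∀ i ∈ xs, σ'.tp (.inl i) = freshTape M.blank) ∧
      ∀ i ∉ xs, σ'.tp (.inl i) = σ.tp (.inl i) := by
  induction xs with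
  | nil => intro σ h; exact ⟨σ, .skip σ, h, by simp, fun _ _ => rfl⟩
  | cons i xs ih =>
    intro σ h
    have h1 := (RunOn.wipe (n := n) (x := (.inl i : STape M R)) (Ω' := Ω') (A := Option Ω) hr
      M.blank (h.sim i)).2 σ (h.bounded hr) rfl
    have hg : Good r ρ (σ.set (.inl i) (freshTape M.blank)) := by
      refine h.of_sim (fun x => ?_) (fun j => ?_)
      · rw [Store.set_tp_of_ne _ (by simp)]
      · by_cases hj : j = i
        · subst hj; simpa using visited_freshTape r _
        · rw [Store.set_tp_of_ne _ (by simpa using hj)]; exact h.sim j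
    obtain ⟨σ', r', g', a, b⟩ := ih _ hg
    refine ⟨σ', h1.seq r', g', fun j hj => ?_, fun j hj => ?_⟩
    · by_cases hj' : j ∈ xs
      · exact a j hj'
      · have : j = i := by simpa [hj'] using hj
        subst this
        rw [b j hj']; simp
    · simp only [List.mem_cons, not_or] at hj
      rw [b j hj.2, Store.set_tp_of_ne _ (by simpa using hj.1)]

/-- Move the input head to the left end. -/
def Cmd.rewind : SCmd M R Ω' :=
  .loop (fun r => match r.1 with | .leftEnd => false | _ => true)
    (.act fun r => { (Instr.noop r : Instr (STape M R) (SCell M) Ω') with inMove := .left })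

theorem run_rewind {n s : ℕ} : ∀ (p : ℕ) (σ : SStore M R), σ.inPos = p → σ.Bounded s →
    Run n s (.rewind : SCmd M R Ω') σ [] { σ with inPos := 0 } := by
  intro p
  induction p with
  | zero =>
    intro σ hp hb
    have : ({ σ with inPos := 0 } : SStore M R) = σ := by cases σ; simp_all
    rw [this]
    exact Run.loop_false (by simp [Store.reads, hp, Transducer.readInput])
  | succ p ih =>
    intro σ hp hb
    have e : σ.exec n ({ (Instr.noop (σ.reads n) : Instr (STape M R) (SCell M) Ω') with
        inMove := .left }) = { σ with inPos := p } := by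
      have := σ.exec_noop (Ω := Ω') n
      cases σ
      simp only [Store.exec, Instr.noop, Store.mk.injEq] at this hp ⊢
      exact ⟨by simp [Transducer.moveInput, hp], this.2⟩
    have h1 := Run.act (n := n) (s := s) (A := Option Ω)
      (fun r => { (Instr.noop r : Instr (STape M R) (SCell M) Ω') with inMove := .left }) σ
      (by rw [e]; exact hb)
    rw [e] at h1
    refine Run.loop_true (o := []) (o' := []) ?_ h1 (ih { σ with inPos := p } rfl hb)
    simp only [Store.reads, hp, Transducer.readInput]
    cases (List.replicate n ())[p]? <;> rfl

/-- Put the simulated machine into its initial configuration. -/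
def Cmd.restart : SCmd M R Ω' :=
  .seq (.wipeAll (List.finRange M.k)) <| .seq .rewind <|
    .onTape ctlT (fun _ => .ctl M.start none) .stay

theorem update_ctlTape (q q' : M.Q) (e e' : Option Ω) :
    Function.update (ctlTape q e : (ℤ → SCell M) × ℤ).1 0 (.ctl q' e') = (ctlTape q' e').1 := by
  funext j
  by_cases hj : j = 0
  · subst hj; simp [ctlTape]
  · simp [ctlTape, hj]

theorem runOn_ctl {n s : ℕ} (f : SCell M → SCell M) {q q' : M.Q} {e e' : Option Ω}
    (hf : f (.ctl q e) = .ctl q' e') :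
    RunOn n s (ctlT : STape M R) (Cmd.onTape ctlT f .stay : SCmd M R Ω') (ctlTape q e)
      (ctlTape q' e') := by
  have := RunOn.onTape (n := n) (s := s) (x := (ctlT : STape M R)) (Ω := Ω') (A := Option Ω)
    (τ := (ctlTape q e : (ℤ → SCell M) × ℤ).1) (h := 0) f .stay (by simp [Transducer.moveWork])
  have e0 : (ctlTape q e : (ℤ → SCell M) × ℤ).1 0 = .ctl q e := by simp [ctlTape]
  rw [e0, hf, update_ctlTape] at this
  exact this

theorem run_restart {n r s : ℕ} (hr : r + 2 ≤ s) {ρ : R → ℕ} (σ : SStore M R)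
    (h : Good r ρ σ) : ∃ σ', Run n s (.restart : SCmd M R Ω') σ [] σ' ∧ Good r ρ σ' ∧
      SimRel r σ' M.init ∧ emitted (σ'.reads n) = none := by
  obtain ⟨σ₁, r1, g1, t1, -⟩ := run_wipeAll (n := n) (Ω' := Ω') hr (List.finRange M.k) σ h
  have r2 := run_rewind (n := n) (s := s) (Ω' := Ω') _ σ₁ rfl (g1.bounded hr)
  have g2 : Good r ρ { σ₁ with inPos := 0 } := ⟨g1.regs, g1.ctl, g1.sim⟩
  obtain ⟨q, e, hq⟩ := g2.ctl
  have r3 := (runOn_ctl (n := n) (s := s) (R := R) (Ω' := Ω') (fun _ => .ctl M.start none)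
    (q := q) (e := e) rfl).2 _ (g2.bounded hr) hq
  refine ⟨_, r1.seq (r2.seq r3), g2.set_ctl _ _, ⟨rfl, ⟨none, by simp [Transducer.init]⟩,
    (g2.set_ctl _ _).sim, fun i => ?_, fun i j => ?_⟩, emitted_eq (q := M.start) (by simp)⟩
  · rw [Store.set_tp_of_ne _ (by simp)]
    simp [t1 i (by simp), freshTape, Transducer.init]
  · rw [Store.set_tp_of_ne _ (by simp)]
    simp only [t1 i (by simp), freshTape, Transducer.init]
    split_ifs <;> simp [simVal]

/-- Run the simulated machine until it has emitted `t + 1` symbols or halts, where `t` is a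
counter. -/
def Cmd.seek (t : R) : SCmd M R Ω' :=
  .loop (fun r => (emitted r).isNone && (simAction r).isSome) <|
    .seq simStep <|
      .ite (fun r => (emitted r).isSome && nz t r)
        (.seq (.onTape ctlT (fun c => match c with | .ctl q _ => .ctl q none | c => c) .stay)
          (.decr (regT t)))
        .skip

/-- Get the symbol with the index given by the counter `x` of the word generated by `M`. -/
def Cmd.fetch (x t u : R) : SCmd M R Ω' := .seq (.copy x t u) <| .seq .restart (.seek t)

/-- The output grows along a computation, so a symbol once emitted is a symbol of the final word. -/
theorem prefix_of_reaches {ι : Type} {N : Transducer ι Ω} {w : List ι} {c d : N.Config}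
    (h : StateTransition.Reaches (N.step w) c d) : c.out <+: d.out := by
  induction h with
  | refl => exact List.prefix_rfl
  | tail _ h ih =>
    simp only [Option.mem_def, Transducer.step, Option.map_eq_some_iff] at h
    obtain ⟨a, _, rfl⟩ := h
    exact ih.trans (List.prefix_append _ _)

theorem run_seek {n r s : ℕ} (hr : r + 2 ≤ s) {t : R} {w : List Ω} {k : ℕ} (hk : k + 2 < 2 ^ s)
    (hspace : M.UsesSpace (List.replicate n ()) r) {d : M.Config}
    (hd : M.step (List.replicate n ()) d = none) (hw : d.out = w) {c : M.Config}
    (hcd : StateTransition.Reaches (M.step (List.replicate n ())) c d) :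
    StateTransition.Reaches (M.step (List.replicate n ())) M.init c →
    c.out.length ≤ k → ∀ (ρ : R → ℕ) (σ : SStore M R), ρ t + c.out.length = k → Good r ρ σ →
      SimRel r σ c → emitted (σ.reads n) = none →
      ∃ σ' v, Run n s (.seek t : SCmd M R Ω') σ [] σ' ∧ v ≤ k ∧ Good r (Function.update ρ t v) σ' ∧
        emitted (σ'.reads n) = w[k]? := by
  induction hcd using Relation.ReflTransGen.head_induction_on with
  | refl =>
    intro _ hle ρ σ hρ hg hs he
    refine ⟨σ, ρ t, .loop_false ?_, by omega, by simpa using hg, ?_⟩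
    · have : simAction (σ.reads n) = none := by
        rw [hs.simAction_eq]
        simpa [Transducer.step] using hd
      simp [this]
    · rw [he, ← hw, List.getElem?_eq_none hle]
  | @head c c' h1 h2 ih =>
    intro hc hle ρ σ hρ hg hs he
    have hc' : StateTransition.Reaches (M.step (List.replicate n ())) M.init c' := hc.tail h1
    have htest : ((emitted (σ.reads n)).isNone && (simAction (σ.reads n)).isSome) = true := by
      have h1' := h1
      simp only [Option.mem_def, Transducer.step, Option.map_eq_some_iff] at h1'
      obtain ⟨a, ha, -⟩ := h1'
      rw [hs.simAction_eq, he, ha]; rfl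
    obtain ⟨σ₁, e, r1, s1, g1, c1, o1⟩ := hs.step (s := s) (Ω' := Ω') hr hg h1 (hspace c hc)
    have em1 : emitted (σ₁.reads n) = e := emitted_eq c1
    cases e with
    | none =>
      have ho : c'.out.length = c.out.length := by simp [o1]
      obtain ⟨σ', v, r', hv, g', e'⟩ := ih hc' (by omega) ρ σ₁ (by omega) g1 s1 em1
      refine ⟨σ', v, ?_, hv, g', e'⟩
      exact Run.loop_true (o := []) (o' := []) htest
        (r1.seq (o' := []) (Run.ite_false (by simp [em1]) (.skip _))) r'
    | some u =>
      have ho : c'.out.length = c.out.length + 1 := by simp [o1]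
      by_cases ht : ρ t = 0
      · refine ⟨σ₁, 0, ?_, by omega, by rw [update_eq_of_eq ht]; exact g1, ?_⟩
        · exact Run.loop_true (o := []) (o' := []) htest
            (r1.seq (o' := []) (Run.ite_false (by simp [em1, g1.nz_eq, ht]) (.skip _)))
            (.loop_false (by simp [em1]))
        · obtain ⟨l, hl⟩ := prefix_of_reaches h2
          have hk' : k = c.out.length := by omega
          rw [em1, ← hw, ← hl, o1, hk']
          simp
      · obtain ⟨v, hv⟩ := Nat.exists_eq_succ_of_ne_zero ht
        have r2 := (runOn_ctl (n := n) (s := s) (R := R) (Ω' := Ω')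
          (fun c => match c with | .ctl q _ => .ctl q none | c => c) (q := c'.state)
          (e := some u) rfl).2 σ₁ (g1.bounded hr) c1
        have g2 := g1.set_ctl c'.state none
        have r3 := (RunOn.decr (n := n) (x := (regT t : STape M R)) (Ω' := Ω') (A := Option Ω)
          (v := v) (s := s) (by omega)).2 _ (g2.bounded hr) (by rw [g2.regs, hv])
        have g3 := g2.set_reg t v
        have s3 := (s1.set_ctl none).set_reg t (counter v)
        obtain ⟨σ', v', r', hv', g', e'⟩ := ih hc' (by omega) _ _ (by simp; omega) g3 s3
          (emitted_eq (q := c'.state) (e := none) (by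
            rw [Store.set_tp_of_ne _ (by simp)]; simp))
        refine ⟨σ', v', ?_, hv', by simpa using g', e'⟩
        exact Run.loop_true (o := []) (o' := []) htest
          (r1.seq (o' := []) (Run.ite_true (by simp [em1, g1.nz_eq, ht])
            (r2.seq (o' := []) r3))) r'

/-- The last output of the simulated machine becomes the letter of `w` whose index is the value of `x`,
or none beyond the end of `w`. The counters other than the auxiliary ones `t` and `u` keep their
values. -/
theorem run_fetch {n r s : ℕ} (hr : r + 2 ≤ s) {x t u : R} (hxt : x ≠ t) (hxu : x ≠ u)
    (htu : t ≠ u) {w : List Ω} (hspace : M.UsesSpace (List.replicate n ()) r)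
    (hout : M.Outputs (List.replicate n ()) w) {ρ : R → ℕ} (hx : ρ x + 2 < 2 ^ s)
    (ht : ρ t + 2 < 2 ^ s) (hu : ρ u + 2 < 2 ^ s) (σ : SStore M R) (hσ : Good r ρ σ) :
    ∃ σ' v, Run n s (.fetch x t u : SCmd M R Ω') σ [] σ' ∧ v ≤ ρ x ∧
      Good r (Function.update (Function.update ρ u 0) t v) σ' ∧
      emitted (σ'.reads n) = w[ρ x]? := by
  obtain ⟨d, hcd, hd, hw⟩ := hout
  have hcopy := Exec.copy (n := n) (r := r) (M := M) (Ω' := Ω') hr hxt hxu htu hx ht hu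
  obtain ⟨σ₁, r1, g1⟩ := hcopy σ hσ
  obtain ⟨σ₂, r2, g2, s2, e2⟩ := run_restart (n := n) (Ω' := Ω') hr σ₁ g1
  obtain ⟨σ', v, r3, hv, g3, e3⟩ := run_seek (Ω' := Ω') (t := t) hr hx hspace hd hw hcd .refl
    (by simp [Transducer.init]) _ σ₂
    (by rw [Function.update_of_ne htu, Function.update_self]; simp [Transducer.init]) g2 s2 e2
  refine ⟨σ', v, r1.seq (o' := []) (r2.seq (o' := []) r3), hv, ?_, e3⟩
  rw [Function.update_comm htu, Function.update_idem] at g3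
  exact g3

end Fetch

/-! ### A language of nested scans -/

instance : Finite Angle := by
  let g : Angle → Fin 3 := fun a => match a with
    | .zero => 0
    | .pi => 1
    | .irr => 2
  refine Finite.of_injective g fun a b h => ?_
  cases a <;> cases b <;> simp [g] at h <;> rfl

instance : Finite Token := by
  let g : Token → Fin 10 ⊕ Angle := fun t => match t with
    | .tick => .inl 0
    | .endNum => .inl 1
    | .endList => .inl 2
    | .cE => .inl 3
    | .cM a => .inr a
    | .cX => .inl 4
    | .cZ => .inl 5
    | .gH => .inl 6
    | .gRz => .inl 7
    | .gCZ => .inl 8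
    | .gFan => .inl 9
  refine Finite.of_injective g fun a b h => ?_
  cases a <;> cases b <;> simp [g] at h <;> simp [h]

/-- A position in a description, seen by a scan from left to right: the code of the last name of a
command or gate (`0` if there is none), the number of these names so far, the number of list
delimiters since the last name, the number of complete numbers since the last name or delimiter,
and the number of letters `tick` since the last complete number. -/
structure Ent where
  kd : ℕ
  g : ℕ
  l : ℕ
  j : ℕ
  v : ℕ

/-- The names of the fields of `Ent`. -/
inductive Fld
  | kd
  | g
  | l
  | j
  | v
  deriving DecidableEq

instance : Fintype Fld := ⟨{.kd, .g, .l, .j, .v}, fun x => by cases x <;> simp⟩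

def Ent.get (e : Ent) : Fld → ℕ
  | .kd => e.kd
  | .g => e.g
  | .l => e.l
  | .j => e.j
  | .v => e.v

def Ent.zero : Ent := ⟨0, 0, 0, 0, 0⟩

/-- The codes of the names; the letters which are not names have the code `0`. -/
def Token.code : Token → ℕ
  | .cE => 1
  | .cM .zero => 2
  | .cM .pi => 3
  | .cM .irr => 4
  | .cX => 5
  | .cZ => 6
  | .gH => 7
  | .gRz => 8
  | .gCZ => 9
  | .gFan => 10
  | _ => 0

/-- The effect of reading a letter. -/
def Ent.upd (e : Ent) : Token → Ent
  | .tick => { e with v := e.v + 1 }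
  | .endNum => { e with j := e.j + 1, v := 0 }
  | .endList => { e with l := e.l + 1, j := 0 }
  | t => { e with kd := t.code, g := e.g + 1, l := 0, j := 0 }

/-- The letters at which a scan stops: `tick` if `b` holds and `endNum` otherwise. -/
def fires (b : Bool) : Token → Bool
  | .tick => b
  | .endNum => !b
  | _ => false

/-- The positions in the word at which a scan stops. -/
def scanList (b : Bool) : Ent → List Token → List Ent
  | _, [] => []
  | e, t :: w => (if fires b t then [e] else []) ++ scanList b (e.upd t) w

/-- An operand: a field of the position of the scan of nesting depth `ℓ`, or the predecessor of its
value (`0` for the value `0`), or a constant. -/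
inductive Opd
  | fld (ℓ : ℕ) (f : Fld)
  | pred (ℓ : ℕ) (f : Fld)
  | const (c : ℕ)

def Opd.eval (env : ℕ → Ent) : Opd → ℕ
  | .fld ℓ f => (env ℓ).get f
  | .pred ℓ f => (env ℓ).get f - 1
  | .const c => c

/-- Programs which transform a word over `Token` into another one by nested scans of the given
word, comparisons of the fields of the positions of these scans, and output. -/
inductive Em
  | nil
  | emit (u : Token)
  | rep (u : Token) (x : Opd)
  | seq (P Q : Em)
  | iflt (x y : Opd) (P Q : Em)
  | scan (b : Bool) (P : Em)

namespace Em

/-- The output of a program at nesting depth `ℓ`. -/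
def den (w : List Token) : ℕ → (ℕ → Ent) → Em → List Token
  | _, _, .nil => []
  | _, _, .emit u => [u]
  | _, env, .rep u x => List.replicate (x.eval env) u
  | ℓ, env, .seq P Q => den w ℓ env P ++ den w ℓ env Q
  | ℓ, env, .iflt x y P Q => if x.eval env < y.eval env then den w ℓ env P else den w ℓ env Q
  | ℓ, env, .scan b P =>
    (scanList b Ent.zero w).flatMap fun e => den w (ℓ + 1) (Function.update env ℓ e) P

/-- The nesting depth of the scans. -/
def height : Em → ℕ
  | .seq P Q => max P.height Q.height
  | .iflt _ _ P Q => max P.height Q.height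
  | .scan _ P => P.height + 1
  | _ => 0

def _root_.MBQC.Opd.bound : Opd → ℕ
  | .const c => c
  | _ => 0

/-- A bound on the constants of a program. -/
def bound : Em → ℕ
  | .rep _ x => x.bound
  | .seq P Q => max P.bound Q.bound
  | .iflt x y P Q => max (max x.bound y.bound) (max P.bound Q.bound)
  | .scan _ P => P.bound
  | _ => 0

end Em

/-- The counters of the machine for programs of height at most `d + 1`: auxiliary ones, and for each
scan its position in the word (`none`) and the fields of `Ent`. -/
abbrev Reg (d : ℕ) : Type := Fin 3 ⊕ (Fin (d + 1) × Option Fld)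

section Compile

variable {M : Transducer Unit Token} {d : ℕ}

/-- The counter for a field of the scan of depth `ℓ`, or for its position in the word. -/
def lev (d ℓ : ℕ) (f : Option Fld) : Reg d := .inr (Fin.ofNat (d + 1) ℓ, f)

/-- The auxiliary counters. -/
def tmp (d : ℕ) (i : Fin 3) : Reg d := .inl i

theorem lev_inj {ℓ ℓ' : ℕ} (h : ℓ ≤ d) (h' : ℓ' ≤ d) {f f' : Option Fld} :
    lev d ℓ f = lev d ℓ' f' ↔ ℓ = ℓ' ∧ f = f' := by
  have e : Fin.ofNat (d + 1) ℓ = Fin.ofNat (d + 1) ℓ' ↔ ℓ = ℓ' := by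
    simp only [Fin.ofNat, Fin.mk.injEq]
    rw [Nat.mod_eq_of_lt (by omega), Nat.mod_eq_of_lt (by omega)]
  simp only [lev, Sum.inr.injEq, Prod.mk.injEq, e]

theorem lev_ne_tmp {ℓ : ℕ} {f : Option Fld} {i : Fin 3} : lev d ℓ f ≠ tmp d i := by
  simp [lev, tmp]

/-- Load an operand into a counter. The fields of a scan which is not active at depth `ℓ` are `0`. -/
def Cmd.load (ℓ : ℕ) (y : Reg d) : Opd → SCmd M (Reg d) Token
  | .fld ℓ' f => if ℓ' < ℓ then .copy (lev d ℓ' (some f)) y (tmp d 2) else .zero y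
  | .pred ℓ' f => .seq
      (if ℓ' < ℓ then .copy (lev d ℓ' (some f)) y (tmp d 2) else .zero y)
      (.ite (nz y) (.decr (regT y)) .skip)
  | .const c => .const y c

/-- Update the fields of the scan at depth `ℓ` after the letter `t`. -/
def Cmd.upd (ℓ : ℕ) : Token → SCmd M (Reg d) Token
  | .tick => .incr (regT (lev d ℓ (some .v)))
  | .endNum => .seq (.incr (regT (lev d ℓ (some .j)))) (.zero (lev d ℓ (some .v)))
  | .endList => .seq (.incr (regT (lev d ℓ (some .l)))) (.zero (lev d ℓ (some .j)))
  | t => .seq (.const (lev d ℓ (some .kd)) t.code) <|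
      .seq (.incr (regT (lev d ℓ (some .g)))) <|
      .seq (.zero (lev d ℓ (some .l))) (.zero (lev d ℓ (some .j)))

/-- The machine program for a program at nesting depth `ℓ`. -/
def Em.compile (d : ℕ) : ℕ → Em → SCmd M (Reg d) Token
  | _, .nil => .skip
  | _, .emit u => .emit u
  | ℓ, .rep u x => .seq (.load ℓ (tmp d 0) x)
      (.loop (nz (tmp d 0)) (.seq (.decr (regT (tmp d 0))) (.emit u)))
  | ℓ, .seq P Q => .seq (compile d ℓ P) (compile d ℓ Q)
  | ℓ, .iflt x y P Q => .seq (.load ℓ (tmp d 0) x) <| .seq (.load ℓ (tmp d 1) y) <|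
      .seq (.loop (fun r => nz (tmp d 0) r && nz (tmp d 1) r)
        (.seq (.decr (regT (tmp d 0))) (.decr (regT (tmp d 1))))) <|
      .ite (nz (tmp d 1)) (compile d ℓ P) (compile d ℓ Q)
  | ℓ, .scan b P =>
      .seq (.zero (lev d ℓ (some .kd))) <| .seq (.zero (lev d ℓ (some .g))) <|
      .seq (.zero (lev d ℓ (some .l))) <| .seq (.zero (lev d ℓ (some .j))) <|
      .seq (.zero (lev d ℓ (some .v))) <| .seq (.zero (lev d ℓ none)) <|
      .seq (.fetch (lev d ℓ none) (tmp d 0) (tmp d 1)) <|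
      .loop (fun r => (emitted r).isSome) <|
        .seq (.case emitted fun t => match t with
          | none => .skip
          | some t => .seq (if fires b t then compile d (ℓ + 1) P else .skip) (.upd ℓ t)) <|
        .seq (.incr (regT (lev d ℓ none))) (.fetch (lev d ℓ none) (tmp d 0) (tmp d 1))

variable {n r s B : ℕ}

/-- From `ρ` to `ρ'`, the counters of the scans of depth less than `ℓ` are not changed, and all the
counters of `ρ'` are bounded by `B`. -/
def Keeps (d ℓ B : ℕ) (ρ ρ' : Reg d → ℕ) : Prop :=
  (∀ ℓ' < ℓ, ∀ f, ρ' (lev d ℓ' f) = ρ (lev d ℓ' f)) ∧ ∀ x, ρ' x ≤ B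

theorem Keeps.trans {ℓ : ℕ} {ρ ρ' ρ'' : Reg d → ℕ} (h : Keeps d ℓ B ρ ρ')
    (h' : Keeps d ℓ B ρ' ρ'') : Keeps d ℓ B ρ ρ'' :=
  ⟨fun ℓ' hl f => (h'.1 ℓ' hl f).trans (h.1 ℓ' hl f), h'.2⟩

/-- The program `c` started with counter values `ρ` has output `o` and does not change the counters
of the scans of depth less than `ℓ`. -/
def ExecK (n r s d ℓ B : ℕ) (c : SCmd M (Reg d) Token) (ρ : Reg d → ℕ) (o : List Token) : Prop :=
  ∀ σ : SStore M (Reg d), Good r ρ σ →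
    ∃ σ' ρ', Run n s c σ o σ' ∧ Good r ρ' σ' ∧ Keeps d ℓ B ρ ρ'

theorem Exec.toK {ℓ : ℕ} {c : SCmd M (Reg d) Token} {ρ ρ' : Reg d → ℕ} {o : List Token}
    (h : Exec n r s c ρ o ρ') (hk : Keeps d ℓ B ρ ρ') : ExecK n r s d ℓ B c ρ o := fun σ hσ => by
  obtain ⟨σ', r', g'⟩ := h σ hσ
  exact ⟨σ', ρ', r', g', hk⟩

theorem ExecK.seq {ℓ : ℕ} {c c' : SCmd M (Reg d) Token} {ρ : Reg d → ℕ} {o o' : List Token}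
    (h : ExecK n r s d ℓ B c ρ o) (h' : ∀ ρ', Keeps d ℓ B ρ ρ' → ExecK n r s d ℓ B c' ρ' o') :
    ExecK n r s d ℓ B (.seq c c') ρ (o ++ o') := fun σ hσ => by
  obtain ⟨σ₁, ρ₁, r1, g1, k1⟩ := h σ hσ
  obtain ⟨σ₂, ρ₂, r2, g2, k2⟩ := h' ρ₁ k1 σ₁ g1
  exact ⟨σ₂, ρ₂, r1.seq r2, g2, k1.trans k2⟩

theorem Exec.seqK {ℓ : ℕ} {c c' : SCmd M (Reg d) Token} {ρ ρ' : Reg d → ℕ} {o : List Token}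
    (h : Exec n r s c ρ [] ρ') (hk : Keeps d ℓ B ρ ρ') (h' : ExecK n r s d ℓ B c' ρ' o) :
    ExecK n r s d ℓ B (.seq c c') ρ o := fun σ hσ => by
  obtain ⟨σ₁, r1, g1⟩ := h σ hσ
  obtain ⟨σ₂, ρ₂, r2, g2, k2⟩ := h' σ₁ g1
  exact ⟨σ₂, ρ₂, r1.seq (o := []) r2, g2, hk.trans k2⟩

theorem update_le {R : Type} [DecidableEq R] {ρ : R → ℕ} (h : ∀ x, ρ x ≤ B) {y : R} {v : ℕ}
    (hv : v ≤ B) : ∀ x, Function.update ρ y v x ≤ B := by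
  intro x
  by_cases hx : x = y
  · subst hx; simpa using hv
  · simpa [hx] using h x

theorem Exec.load (hr : r + 2 ≤ s) (hB : B + 2 < 2 ^ s) {ℓ : ℕ} {i : Fin 3} (hi : i ≠ 2)
    {ρ : Reg d → ℕ} (hρ : ∀ x, ρ x ≤ B) {env : ℕ → Ent}
    (henv : ∀ ℓ' < ℓ, ∀ f, ρ (lev d ℓ' (some f)) = (env ℓ').get f)
    (hzero : ∀ ℓ', ℓ ≤ ℓ' → env ℓ' = Ent.zero) (x : Opd) (hx : x.bound ≤ B) :
    ∃ ρ', Exec n r s (.load ℓ (tmp d i) x : SCmd M (Reg d) Token) ρ [] ρ' ∧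
      ρ' (tmp d i) = x.eval env ∧ (∀ j, j ≠ i → j ≠ 2 → ρ' (tmp d j) = ρ (tmp d j)) ∧
      (∀ ℓ f, ρ' (lev d ℓ f) = ρ (lev d ℓ f)) ∧ ∀ x, ρ' x ≤ B := by
  have hb : ∀ x, ρ x + 2 < 2 ^ s := fun x => by have := hρ x; omega
  have hi2 : tmp d i ≠ tmp d 2 := by simpa [tmp] using hi
  have hz : ∃ ρ', Exec n r s (.zero (tmp d i) : SCmd M (Reg d) Token) ρ [] ρ' ∧
      ρ' (tmp d i) = 0 ∧ (∀ j, j ≠ i → j ≠ 2 → ρ' (tmp d j) = ρ (tmp d j)) ∧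
      (∀ ℓ f, ρ' (lev d ℓ f) = ρ (lev d ℓ f)) ∧ ∀ x, ρ' x ≤ B :=
    ⟨_, .zero hr _ (hb _), by simp, fun j hj _ => by simp [tmp, hj],
      fun ℓ f => by simp [lev, tmp], update_le hρ (Nat.zero_le _)⟩
  have hfld : ∀ ℓ' f, ∃ ρ', Exec n r s (.load ℓ (tmp d i) (.fld ℓ' f) : SCmd M (Reg d) Token) ρ [] ρ' ∧
      ρ' (tmp d i) = (env ℓ').get f ∧ (∀ j, j ≠ i → j ≠ 2 → ρ' (tmp d j) = ρ (tmp d j)) ∧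
      (∀ ℓ f, ρ' (lev d ℓ f) = ρ (lev d ℓ f)) ∧ ∀ x, ρ' x ≤ B := by
    intro ℓ' f
    by_cases hl : ℓ' < ℓ
    · refine ⟨_, by
        rw [Cmd.load, if_pos hl]
        exact .copy hr lev_ne_tmp lev_ne_tmp hi2 (hb _) (hb _) (hb _), ?_, ?_, ?_, ?_⟩
      · rw [Function.update_of_ne hi2, Function.update_self, henv _ hl]
      · intro j hj hj2; simp [tmp, hj, hj2]
      · intro ℓ f; simp [lev, tmp]
      · exact update_le (update_le hρ (hρ _)) (Nat.zero_le _)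
    · have : (env ℓ').get f = 0 := by
        simp only [hzero ℓ' (by omega), Ent.zero]; cases f <;> rfl
      rw [Cmd.load, if_neg hl, this]
      exact hz
  cases x with
  | fld ℓ' f => exact hfld ℓ' f
  | pred ℓ' f =>
    obtain ⟨ρ', h1, h2, h3, h4, h5⟩ := hfld ℓ' f
    have e : (Opd.pred ℓ' f).eval env = (env ℓ').get f - 1 := rfl
    rw [e]
    rcases Nat.eq_zero_or_pos ((env ℓ').get f) with h0 | h0
    · refine ⟨ρ', .seq_nil_left h1 (.ite_false (fun σ h => ?_) .skip), by omega, h3, h4, h5⟩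
      simp [h.nz_eq, h2, h0]
    · have h6 : (env ℓ').get f ≤ B := h2 ▸ h5 _
      refine ⟨_, .seq_nil_left h1 (.ite_true (fun σ h => ?_)
        (.decr hr _ (v := (env ℓ').get f - 1) (by omega) (by omega))), by simp, fun j hj hj2 => ?_,
        fun ℓ f => ?_, update_le h5 (by omega)⟩
      · simp [h.nz_eq, h2]; omega
      · rw [Function.update_of_ne (by simpa [tmp] using hj), h3 j hj hj2]
      · rw [Function.update_of_ne lev_ne_tmp, h4]
  | const c =>
    refine ⟨_, .const hr _ (hb _) c (by simp only [Opd.bound] at hx; omega), by simp [Opd.eval],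
      fun j hj _ => by simp [tmp, hj], fun ℓ f => by simp [lev, tmp], update_le hρ hx⟩

theorem Ent.upd_get_le (e : Ent) (t : Token) {p : ℕ} (h : ∀ f, e.get f ≤ p + 16) (f : Fld) :
    (e.upd t).get f ≤ p + 1 + 16 := by
  have h' := h f
  rcases t with _ | _ | _ | _ | (_ | _ | _) | _ | _ | _ | _ | _ | _ <;> cases f <;>
    simp only [Ent.upd, Ent.get, Token.code] at h' ⊢ <;> omega

theorem Exec.upd (hr : r + 2 ≤ s) (hB : B + 3 < 2 ^ s) (hB' : 16 ≤ B) {ℓ : ℕ} (hℓ : ℓ ≤ d)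
    {ρ : Reg d → ℕ} (hρ : ∀ x, ρ x ≤ B) {e : Ent} (he : ∀ f, ρ (lev d ℓ (some f)) = e.get f)
    (t : Token) (hb : ∀ f, (e.upd t).get f ≤ B) :
    ∃ ρ', Exec n r s (.upd ℓ t : SCmd M (Reg d) Token) ρ [] ρ' ∧
      (∀ f, ρ' (lev d ℓ (some f)) = (e.upd t).get f) ∧ ρ' (lev d ℓ none) = ρ (lev d ℓ none) ∧
      Keeps d ℓ B ρ ρ' := by
  have inc : ∀ f {ρ : Reg d → ℕ}, (∀ x, ρ x ≤ B) →
      Exec n r s (.incr (regT (lev d ℓ (some f))) : SCmd M (Reg d) Token) ρ []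
      (Function.update ρ (lev d ℓ (some f)) (ρ (lev d ℓ (some f)) + 1)) :=
    fun f ρ h => .incr hr _ (by have := h (lev d ℓ (some f)); omega)
  have zer : ∀ f {ρ : Reg d → ℕ}, (∀ x, ρ x ≤ B) →
      Exec n r s (.zero (lev d ℓ (some f)) : SCmd M (Reg d) Token) ρ []
      (Function.update ρ (lev d ℓ (some f)) 0) :=
    fun f ρ h => .zero hr _ (by have := h (lev d ℓ (some f)); omega)
  have ne : ∀ ℓ' < ℓ, ∀ f f', lev d ℓ' f ≠ lev d ℓ f' := fun ℓ' h f f' e => by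
    rw [lev_inj (by omega) hℓ] at e; omega
  have inj : ∀ f f', lev d ℓ (some f) = lev d ℓ (some f') ↔ f = f' := fun f f' => by
    rw [lev_inj hℓ hℓ]; simp
  have inj' : ∀ f, lev d ℓ none ≠ lev d ℓ (some f) := fun f => by
    rw [Ne, lev_inj hℓ hℓ]; simp
  have key : ∀ t : Token, t.code ≤ B → (∀ f, (⟨t.code, e.g + 1, 0, 0, e.v⟩ : Ent).get f ≤ B) →
      ∃ ρ', Exec n r s (.seq (.const (lev d ℓ (some .kd)) t.code) <|
      .seq (.incr (regT (lev d ℓ (some .g)))) <|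
      .seq (.zero (lev d ℓ (some .l))) (.zero (lev d ℓ (some .j))) : SCmd M (Reg d) Token) ρ [] ρ' ∧
      (∀ f, ρ' (lev d ℓ (some f)) = (⟨t.code, e.g + 1, 0, 0, e.v⟩ : Ent).get f) ∧
      ρ' (lev d ℓ none) = ρ (lev d ℓ none) ∧ Keeps d ℓ B ρ ρ' := by
    intro t ht hf
    have b1 := update_le (y := lev d ℓ (some .kd)) hρ ht
    have b2 := update_le (y := lev d ℓ (some .g)) (v := e.g + 1) b1 (hf .g)
    have b3 := update_le (y := lev d ℓ (some .l)) b2 (Nat.zero_le _)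
    have b4 := update_le (y := lev d ℓ (some .j)) b3 (Nat.zero_le _)
    have i2 := inc .g b1
    rw [Function.update_of_ne (by rw [Ne, inj]; simp), he] at i2
    refine ⟨_, .seq (o := []) (.const hr _ (by have := hρ (lev d ℓ (some .kd)); omega) _ (by omega))
      (.seq (o := []) i2 (.seq (o := []) (zer .l b2) (zer .j b3))), fun f => ?_, ?_, ?_, b4⟩
    · cases f <;> simp [inj, Ent.get, he]
    · simp [inj']
    · intro ℓ' hl f; simp [ne ℓ' hl]
  have key' : ∀ t : Token, e.upd t = ⟨t.code, e.g + 1, 0, 0, e.v⟩ → t.code ≤ 16 →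
      (Cmd.upd ℓ t : SCmd M (Reg d) Token) = .seq (.const (lev d ℓ (some .kd)) t.code) (
      .seq (.incr (regT (lev d ℓ (some .g)))) (
      .seq (.zero (lev d ℓ (some .l))) (.zero (lev d ℓ (some .j))))) →
      (∀ f, (e.upd t).get f ≤ B) →
      ∃ ρ', Exec n r s (.upd ℓ t : SCmd M (Reg d) Token) ρ [] ρ' ∧
      (∀ f, ρ' (lev d ℓ (some f)) = (e.upd t).get f) ∧ ρ' (lev d ℓ none) = ρ (lev d ℓ none) ∧
      Keeps d ℓ B ρ ρ' := by
    intro t h1 h2 h3 h4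
    rw [h1] at h4
    rw [h3, h1]
    exact key t (h2.trans hB') h4
  rcases t with _ | _ | _ | _ | (_ | _ | _) | _ | _ | _ | _ | _ | _
  case tick =>
    have b1 := update_le (y := lev d ℓ (some .v)) (v := e.v + 1) hρ (hb .v)
    have i1 := inc .v hρ
    rw [he] at i1
    refine ⟨_, i1, fun f => ?_, ?_, ?_, b1⟩
    · cases f <;> simp [inj, Ent.get, he, Ent.upd]
    · simp [inj']
    · intro ℓ' hl f; simp [ne ℓ' hl]
  case endNum =>
    have b1 := update_le (y := lev d ℓ (some .j)) (v := e.j + 1) hρ (hb .j)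
    have b2 := update_le (y := lev d ℓ (some .v)) b1 (Nat.zero_le _)
    have i1 := inc .j hρ
    rw [he] at i1
    refine ⟨_, .seq (o := []) i1 (zer .v b1), fun f => ?_, ?_, ?_, b2⟩
    · cases f <;> simp [inj, Ent.get, he, Ent.upd]
    · simp [inj']
    · intro ℓ' hl f; simp [ne ℓ' hl]
  case endList =>
    have b1 := update_le (y := lev d ℓ (some .l)) (v := e.l + 1) hρ (hb .l)
    have b2 := update_le (y := lev d ℓ (some .j)) b1 (Nat.zero_le _)
    have i1 := inc .l hρ
    rw [he] at i1
    refine ⟨_, .seq (o := []) i1 (zer .j b1), fun f => ?_, ?_, ?_, b2⟩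
    · cases f <;> simp [inj, Ent.get, he, Ent.upd]
    · simp [inj']
    · intro ℓ' hl f; simp [ne ℓ' hl]
  all_goals exact key' _ rfl (by simp [Token.code]) rfl hb

/-- The compiled program has the intended output if the counters represent the positions of the active
scans and `B` bounds the operands and the length of the word. -/
theorem Exec.compile (hr : r + 2 ≤ s) (hB : B + 3 < 2 ^ s) {w : List Token}
    (hw : w.length + 17 ≤ B) (hspace : M.UsesSpace (List.replicate n ()) r)
    (hout : M.Outputs (List.replicate n ()) w) (P : Em) (hP : P.bound ≤ B) :
    ∀ (ℓ : ℕ) (ρ : Reg d → ℕ) (env : ℕ → Ent), ℓ + P.height ≤ d + 1 → (∀ x, ρ x ≤ B) →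
      (∀ ℓ' < ℓ, ∀ f, ρ (lev d ℓ' (some f)) = (env ℓ').get f) →
      (∀ ℓ', ℓ ≤ ℓ' → env ℓ' = Ent.zero) →
      ExecK n r s d ℓ B (P.compile d ℓ : SCmd M (Reg d) Token) ρ (P.den w ℓ env) := by
  induction P with
  | nil => intro ℓ ρ env _ hρ _ _; exact Exec.skip.toK ⟨fun _ _ _ => rfl, hρ⟩
  | emit u => intro ℓ ρ env _ hρ _ _; exact (Exec.emit hr u).toK ⟨fun _ _ _ => rfl, hρ⟩
  | rep u x =>
    intro ℓ ρ env _ hρ henv hz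
    obtain ⟨ρ₁, e1, v1, -, l1, b1⟩ := Exec.load (n := n) (M := M) (i := 0) hr (by omega)
      (by decide) hρ henv hz x hP
    have key : ∀ k (ρ : Reg d → ℕ), (∀ x, ρ x ≤ B) → ρ (tmp d 0) = k →
        Exec n r s (.loop (nz (tmp d 0)) (.seq (.decr (regT (tmp d 0))) (.emit u)) :
          SCmd M (Reg d) Token) ρ (List.replicate k u) (Function.update ρ (tmp d 0) 0) := by
      intro k
      induction k with
      | zero =>
        intro ρ _ h0
        rw [update_eq_of_eq h0]
        exact .loop_false fun σ h => by simp [h.nz_eq, h0]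
      | succ k ih =>
        intro ρ hb h0
        have hk := hb (tmp d 0)
        have := ih (Function.update ρ (tmp d 0) k) (update_le hb (by omega)) (by simp)
        rw [Function.update_idem] at this
        exact .loop_true (o := [u]) (fun σ h => by simp [h.nz_eq, h0])
          (.seq (o := []) (.decr hr _ h0 (by omega)) (.emit hr u)) this
    refine (Exec.seq (o := []) e1 (key _ ρ₁ b1 v1)).toK ⟨fun ℓ' _ f => ?_,
      update_le b1 (Nat.zero_le _)⟩
    rw [Function.update_of_ne lev_ne_tmp, l1]
  | seq P Q ihP ihQ =>
    intro ℓ ρ env hd hρ henv hz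
    simp only [Em.bound, Em.height] at hP hd
    exact (ihP (by omega) ℓ ρ env (by omega) hρ henv hz).seq fun ρ₁ k1 =>
      ihQ (by omega) ℓ ρ₁ env (by omega) k1.2 (fun ℓ' h f => by rw [k1.1 ℓ' h, henv ℓ' h]) hz
  | iflt x y P Q ihP ihQ =>
    intro ℓ ρ env hd hρ henv hz
    simp only [Em.bound, Em.height] at hP hd
    obtain ⟨ρ₁, e1, v1, -, l1, b1⟩ := Exec.load (n := n) (M := M) (i := 0) hr (by omega)
      (by decide) hρ henv hz x (by omega)
    obtain ⟨ρ₂, e2, v2, t2, l2, b2⟩ := Exec.load (n := n) (M := M) (i := 1) hr (by omega)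
      (by decide) b1 (fun ℓ' h f => by rw [l1, henv ℓ' h]) hz y (by omega)
    have v1' := (t2 0 (by decide) (by decide)).trans v1
    have ht : tmp d 0 ≠ tmp d 1 := by simp [tmp]
    -- both counters are decremented until one of them vanishes
    have key : ∀ a b (ρ : Reg d → ℕ), (∀ x, ρ x ≤ B) → ρ (tmp d 0) = a → ρ (tmp d 1) = b →
        Exec n r s (.loop (fun r => nz (tmp d 0) r && nz (tmp d 1) r)
        (.seq (.decr (regT (tmp d 0))) (.decr (regT (tmp d 1)))) : SCmd M (Reg d) Token) ρ []
        (Function.update (Function.update ρ (tmp d 0) (a - b)) (tmp d 1) (b - a)) := by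
      intro a
      induction a with
      | zero =>
        intro b ρ hb h0 h1
        rw [Nat.zero_sub, Nat.sub_zero, update_eq_of_eq h0, update_eq_of_eq h1]
        exact .loop_false fun σ h => by simp [h.nz_eq, h0]
      | succ a ih =>
        intro b ρ hb h0 h1
        have ha := hb (tmp d 0)
        have hb1 := hb (tmp d 1)
        cases b with
        | zero =>
          rw [Nat.zero_sub, Nat.sub_zero, update_eq_of_eq h0, update_eq_of_eq h1]
          exact .loop_false fun σ h => by simp [h.nz_eq, h1]
        | succ b =>
          have d1 := Exec.decr (n := n) (M := M) (Ω' := Token) hr (tmp d 0) h0 (by omega)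
          have d2 := Exec.decr (n := n) (M := M) (Ω' := Token) hr (tmp d 1) (v := b)
            (ρ := Function.update ρ (tmp d 0) a) (by rw [Function.update_of_ne ht.symm, h1])
            (by omega)
          have := ih b _ (update_le (y := tmp d 1) (v := b)
            (update_le (y := tmp d 0) (v := a) hb (by omega)) (by omega))
            (by rw [Function.update_of_ne ht, Function.update_self]) (by simp)
          have e : a + 1 - (b + 1) = a - b ∧ b + 1 - (a + 1) = b - a := by omega
          rw [e.1, e.2]
          have e' : Function.update (Function.update (Function.update (Function.update ρ (tmp d 0) a)
              (tmp d 1) b) (tmp d 0) (a - b)) (tmp d 1) (b - a) =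
              Function.update (Function.update ρ (tmp d 0) (a - b)) (tmp d 1) (b - a) := by
            funext z
            by_cases z1 : z = tmp d 1
            · simp [z1]
            · by_cases z0 : z = tmp d 0
              · subst z0; simp [Function.update_of_ne ht]
              · simp [z0, z1]
          rw [e'] at this
          exact .loop_true (o := []) (fun σ h => by simp [h.nz_eq, h0, h1]) (.seq (o := []) d1 d2)
            this
    have e3 := key _ _ ρ₂ b2 v1' v2
    have hb0 := b2 (tmp d 0)
    have hb1 := b2 (tmp d 1)
    rw [v1'] at hb0
    rw [v2] at hb1
    set ρ₃ := Function.update (Function.update ρ₂ (tmp d 0) (x.eval env - y.eval env)) (tmp d 1)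
      (y.eval env - x.eval env) with hρ₃
    have k01 : Keeps d ℓ B ρ ρ₁ := ⟨fun ℓ' _ f => l1 _ _, b1⟩
    have k12 : Keeps d ℓ B ρ₁ ρ₂ := ⟨fun ℓ' _ f => l2 _ _, b2⟩
    have k23 : Keeps d ℓ B ρ₂ ρ₃ := by
      refine ⟨fun ℓ' _ f => ?_, update_le (update_le b2 (by omega)) (by omega)⟩
      rw [hρ₃, Function.update_of_ne lev_ne_tmp, Function.update_of_ne lev_ne_tmp]
    have k3 := (k01.trans k12).trans k23
    have henv3 : ∀ ℓ' < ℓ, ∀ f, ρ₃ (lev d ℓ' (some f)) = (env ℓ').get f :=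
      fun ℓ' h f => by rw [k3.1 ℓ' h, henv ℓ' h]
    have h31 : ρ₃ (tmp d 1) = y.eval env - x.eval env := by simp [hρ₃]
    by_cases hlt : x.eval env < y.eval env
    · have e4 := ihP (by omega) ℓ ρ₃ env (by omega) k3.2 henv3 hz
      simp only [Em.den, if_pos hlt]
      refine (e1.seqK k01 (e2.seqK k12 (e3.seqK k23 fun σ h => ?_)))
      obtain ⟨σ', ρ', r', g', k'⟩ := e4 σ h
      exact ⟨σ', ρ', r'.ite_true (by simp [h.nz_eq, h31]; omega), g', k'⟩
    · have e4 := ihQ (by omega) ℓ ρ₃ env (by omega) k3.2 henv3 hz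
      simp only [Em.den, if_neg hlt]
      refine (e1.seqK k01 (e2.seqK k12 (e3.seqK k23 fun σ h => ?_)))
      obtain ⟨σ', ρ', r', g', k'⟩ := e4 σ h
      exact ⟨σ', ρ', r'.ite_false (by simp [h.nz_eq, h31]; omega), g', k'⟩
  | scan b P ih =>
    intro ℓ ρ env hd hρ henv hz
    simp only [Em.bound, Em.height] at hP hd
    have hℓ : ℓ ≤ d := by omega
    have ne : ∀ ℓ' < ℓ, ∀ f f', lev d ℓ' f ≠ lev d ℓ f' := fun ℓ' h f f' e => by
      rw [lev_inj (by omega) hℓ] at e; omega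
    have ht01 : tmp d 0 ≠ tmp d 1 := by simp [tmp]
    have fetch : ∀ (ρ : Reg d → ℕ), (∀ x, ρ x ≤ B) → ∀ σ : SStore M (Reg d), Good r ρ σ →
        ∃ σ' ρ', Run n s (.fetch (lev d ℓ none) (tmp d 0) (tmp d 1) : SCmd M (Reg d) Token) σ [] σ'
          ∧ Good r ρ' σ' ∧ emitted (σ'.reads n) = w[ρ (lev d ℓ none)]? ∧
          (∀ ℓ' f, ρ' (lev d ℓ' f) = ρ (lev d ℓ' f)) ∧ ∀ x, ρ' x ≤ B := by
      intro ρ hb σ hσ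
      have hb' : ∀ x, ρ x + 2 < 2 ^ s := fun x => by have := hb x; omega
      obtain ⟨σ', v, r1, hv, g1, m1⟩ := run_fetch (Ω' := Token) hr
        (lev_ne_tmp (d := d) (ℓ := ℓ) (f := none) (i := 0)) (lev_ne_tmp (i := 1)) ht01
        hspace hout (hb' _) (hb' _) (hb' _) σ hσ
      refine ⟨σ', _, r1, g1, m1, fun ℓ' f => ?_, update_le (update_le hb (Nat.zero_le _))
        (hv.trans (hb _))⟩
      rw [Function.update_of_ne lev_ne_tmp, Function.update_of_ne lev_ne_tmp]
    -- the main loop, by induction on the number of letters that remain to be read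
    have main : ∀ k p (e : Ent) (ρ : Reg d → ℕ) (σ : SStore M (Reg d)), p + k = w.length →
        (∀ x, ρ x ≤ B) → (∀ ℓ' < ℓ, ∀ f, ρ (lev d ℓ' (some f)) = (env ℓ').get f) →
        (∀ f, ρ (lev d ℓ (some f)) = e.get f) → (∀ f, e.get f ≤ p + 16) →
        ρ (lev d ℓ none) = p → Good r ρ σ → emitted (σ.reads n) = w[p]? →
        ∃ σ' ρ', Run n s (.loop (fun r => (emitted r).isSome) <|
        .seq (.case emitted fun t => match t with
          | none => .skip
          | some t => .seq (if fires b t then P.compile d (ℓ + 1) else .skip) (.upd ℓ t)) <|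
        .seq (.incr (regT (lev d ℓ none))) (.fetch (lev d ℓ none) (tmp d 0) (tmp d 1)) :
          SCmd M (Reg d) Token) σ
          ((scanList b e (w.drop p)).flatMap fun e =>
            P.den w (ℓ + 1) (Function.update env ℓ e)) σ' ∧ Good r ρ' σ' ∧ Keeps d ℓ B ρ ρ' := by
      intro k
      induction k with
      | zero =>
        intro p e ρ σ hp hb _ _ _ _ hσ hem
        have hp' : w.length ≤ p := by omega
        rw [List.getElem?_eq_none hp'] at hem
        refine ⟨σ, ρ, ?_, hσ, fun _ _ _ => rfl, hb⟩
        rw [List.drop_eq_nil_of_le hp']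
        exact .loop_false (by simp [hem])
      | succ k ihk =>
        intro p e ρ σ hp hb henv' he hele hpos hσ hem
        have hp' : p < w.length := by omega
        rw [List.getElem?_eq_getElem hp'] at hem
        rw [List.drop_eq_getElem_cons hp']
        set t := w[p] with htdef
        simp only [scanList, List.flatMap_append]
        -- the body of the scan
        have h1 : ExecK n r s d (ℓ + 1) B (if fires b t then P.compile d (ℓ + 1) else .skip :
            SCmd M (Reg d) Token) ρ ((if fires b t then [e] else []).flatMap fun e =>
            P.den w (ℓ + 1) (Function.update env ℓ e)) := by
          by_cases hf : fires b t = true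
          · have e1 := ih (by omega) (ℓ + 1) ρ (Function.update env ℓ e) (by omega) hb
              (fun ℓ' hl f => by
                by_cases h : ℓ' = ℓ
                · subst h; rw [he, Function.update_self]
                · rw [Function.update_of_ne h, henv' ℓ' (by omega)])
              (fun ℓ' hl => by rw [Function.update_of_ne (by omega)]; exact hz ℓ' (by omega))
            simpa [hf] using e1
          · simpa [hf] using Exec.skip.toK (n := n) (r := r) (s := s) (M := M)
              (⟨fun _ _ _ => rfl, hb⟩ : Keeps d (ℓ + 1) B ρ ρ)
        obtain ⟨σ₀, ρ₁, r0, g0, k1⟩ := h1 σ hσ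
        have hupd : ∀ f, (e.upd t).get f ≤ p + 1 + 16 := e.upd_get_le t hele
        obtain ⟨ρ₂, e2, f2, p2, k2⟩ := Exec.upd (n := n) (M := M) hr hB (by omega) hℓ k1.2
          (fun f => by rw [k1.1 ℓ (by omega), he]) t (fun f => (hupd f).trans (by omega))
        have hpos2 : ρ₂ (lev d ℓ none) = p := by rw [p2, k1.1 ℓ (by omega), hpos]
        have e3 := Exec.incr (n := n) (M := M) (Ω' := Token) hr (lev d ℓ none) (ρ := ρ₂)
          (by omega)
        rw [hpos2] at e3
        have b3 := update_le (y := lev d ℓ none) (v := p + 1) k2.2 (by omega)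
        obtain ⟨σ₁, r1, g1⟩ := e2 σ₀ g0
        have r1 := r0.seq r1
        rw [List.append_nil] at r1
        obtain ⟨σ₂, r2, g2⟩ := e3 σ₁ g1
        obtain ⟨σ₃, ρ₃, r3, g3, m3, l3, b3'⟩ := fetch _ b3 σ₂ g2
        rw [Function.update_self] at m3
        have low : ∀ ℓ' < ℓ, ∀ f, ρ₃ (lev d ℓ' f) = ρ (lev d ℓ' f) := fun ℓ' hl f => by
          rw [l3, Function.update_of_ne (ne ℓ' hl _ _), k2.1 ℓ' hl, k1.1 ℓ' (by omega)]
        obtain ⟨σ', ρ', r', g', k'⟩ := ihk (p + 1) (e.upd t) ρ₃ σ₃ (by omega) b3'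
          (fun ℓ' hl f => by rw [low ℓ' hl, henv' ℓ' hl])
          (fun f => by
            rw [l3, Function.update_of_ne (by rw [Ne, lev_inj hℓ hℓ]; simp), f2])
          hupd (by rw [l3, Function.update_self]) g3 m3
        refine ⟨σ', ρ', ?_, g', fun ℓ' hl f => by rw [k'.1 ℓ' hl, low ℓ' hl], k'.2⟩
        refine Run.loop_true (by simp [hem]) (Run.seq (o' := []) (Run.case ?_)
          (Run.seq (o := []) (o' := []) r2 r3) |> fun h => by simpa using h) r'
        rw [hem]
        exact r1
    have zer : ∀ f (ρ : Reg d → ℕ), (∀ x, ρ x ≤ B) →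
        Exec n r s (.zero (lev d ℓ f) : SCmd M (Reg d) Token) ρ []
        (Function.update ρ (lev d ℓ f) 0) :=
      fun f ρ h => .zero hr _ (by have := h (lev d ℓ f); omega)
    have upd0 : ∀ f (ρ : Reg d → ℕ), (∀ x, ρ x ≤ B) →
        ∀ x, Function.update ρ (lev d ℓ f) 0 x ≤ B := fun f ρ h => update_le h (Nat.zero_le _)
    have b1 := upd0 (some .kd) _ hρ
    have b2 := upd0 (some .g) _ b1
    have b3 := upd0 (some .l) _ b2
    have b4 := upd0 (some .j) _ b3
    have b5 := upd0 (some .v) _ b4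
    have b6 := upd0 none _ b5
    set ρ₆ := Function.update (Function.update (Function.update (Function.update (Function.update
      (Function.update ρ (lev d ℓ (some .kd)) 0) (lev d ℓ (some .g)) 0) (lev d ℓ (some .l)) 0)
      (lev d ℓ (some .j)) 0) (lev d ℓ (some .v)) 0) (lev d ℓ none) 0 with hρ₆
    have low : ∀ ℓ' < ℓ, ∀ f, ρ₆ (lev d ℓ' f) = ρ (lev d ℓ' f) := fun ℓ' hl f => by
      simp [hρ₆, ne ℓ' hl]
    have hf6 : ∀ f, ρ₆ (lev d ℓ f) = 0 := fun f => by
      rcases f with _ | (_ | _ | _ | _ | _) <;> simp [hρ₆, Function.update_apply]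
    refine (zer _ _ hρ).seqK ⟨fun ℓ' hl f => ?_, b1⟩ <| (zer _ _ b1).seqK ⟨fun ℓ' hl f => ?_, b2⟩ <|
      (zer _ _ b2).seqK ⟨fun ℓ' hl f => ?_, b3⟩ <| (zer _ _ b3).seqK ⟨fun ℓ' hl f => ?_, b4⟩ <|
      (zer _ _ b4).seqK ⟨fun ℓ' hl f => ?_, b5⟩ <| (zer _ _ b5).seqK ⟨fun ℓ' hl f => ?_, b6⟩ ?_
    iterate 6 · rw [Function.update_of_ne (ne ℓ' hl _ _)]
    intro σ hσ
    obtain ⟨σ₁, ρ₇, r1, g1, m1, l1, b7⟩ := fetch ρ₆ b6 σ hσ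
    obtain ⟨σ', ρ', r', g', k'⟩ := main w.length 0 Ent.zero ρ₇ σ₁ (by omega) b7
      (fun ℓ' hl f => by rw [l1, low ℓ' hl, henv ℓ' hl])
      (fun f => by rw [l1, hf6]; cases f <;> rfl) (fun f => by cases f <;> simp [Ent.get, Ent.zero])
      (by rw [l1, hf6]) g1 (by rw [m1, hf6])
    refine ⟨σ', ρ', r1.seq (o := []) r', g', fun ℓ' hl f => by rw [k'.1 ℓ' hl, l1], k'.2⟩

end Compile

/-! ### Words generated in logarithmic space have polynomial length -/

section Count

variable {Ω : Type} {M : Transducer Unit Ω}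

/-- The part of a configuration which determines the further course of the computation. -/
def Transducer.Config.core (c : M.Config) : M.Q × ℕ × (Fin M.k → ℤ → M.Γ) × (Fin M.k → ℤ) :=
  (c.state, c.inPos, c.tape, c.head)

theorem Transducer.core_step {w : List Unit} {c d : M.Config} (h : c.core = d.core) :
    (M.step w c).map Config.core = (M.step w d).map Config.core := by
  obtain ⟨q, p, τ, h', o⟩ := c
  obtain ⟨q', p', τ', h'', o'⟩ := d
  simp only [Config.core, Prod.mk.injEq] at h
  obtain ⟨rfl, rfl, rfl, rfl⟩ := h
  simp only [Transducer.step]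
  cases M.δ q (readInput w p) (fun i => τ i (h' i)) <;> rfl

/-- The configuration after `t` steps. -/
def Transducer.after (M : Transducer Unit Ω) (w : List Unit) : ℕ → Option M.Config
  | 0 => some M.init
  | t + 1 => (M.after w t).bind (M.step w)

theorem Transducer.exists_after {w : List Unit} {c : M.Config}
    (h : StateTransition.Reaches (M.step w) M.init c) : ∃ t, M.after w t = some c := by
  induction h with
  | refl => exact ⟨0, rfl⟩
  | tail _ h ih =>
    obtain ⟨t, ht⟩ := ih
    exact ⟨t + 1, by simpa [after, ht] using h⟩

theorem Transducer.reaches_of_after {w : List Unit} : ∀ {t : ℕ} {c : M.Config},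
    M.after w t = some c → StateTransition.Reaches (M.step w) M.init c
  | 0, c, h => by
    simp only [after, Option.some.injEq] at h
    rw [← h]; exact .refl
  | t + 1, c, h => by
    simp only [after, Option.bind_eq_some_iff] at h
    obtain ⟨d, hd, hc⟩ := h
    exact (reaches_of_after hd).tail hc

theorem Transducer.length_out_le {w : List Unit} : ∀ {t : ℕ} {c : M.Config},
    M.after w t = some c → c.out.length ≤ t
  | 0, c, h => by
    simp only [after, Option.some.injEq] at h
    rw [← h]; simp [init]
  | t + 1, c, h => by
    simp only [after, Option.bind_eq_some_iff] at h
    obtain ⟨d, hd, hc⟩ := h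
    have := length_out_le hd
    simp only [step, Option.map_eq_some_iff] at hc
    obtain ⟨a, -, rfl⟩ := hc
    have : a.emit.toList.length ≤ 1 := by cases a.emit <;> simp
    simp only [List.length_append]
    omega

theorem Transducer.inPos_le {w : List Unit} : ∀ {t : ℕ} {c : M.Config},
    M.after w t = some c → c.inPos < w.length + 2
  | 0, c, h => by
    simp only [after, Option.some.injEq] at h
    rw [← h]; simp [init]
  | t + 1, c, h => by
    simp only [after, Option.bind_eq_some_iff] at h
    obtain ⟨d, hd, hc⟩ := h
    have := inPos_le hd
    simp only [step, Option.map_eq_some_iff] at hc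
    obtain ⟨a, -, rfl⟩ := hc
    cases a.inMove <;> simp only [moveInput] <;> omega

theorem Transducer.tape_eq_blank {w : List Unit} {s : ℕ} (hs : M.UsesSpace w s) :
    ∀ {t : ℕ} {c : M.Config}, M.after w t = some c →
      ∀ i (j : ℤ), (s : ℤ) < |j| → c.tape i j = M.blank
  | 0, c, h => by
    simp only [after, Option.some.injEq] at h
    rw [← h]; simp [init]
  | t + 1, c, h => by
    simp only [after, Option.bind_eq_some_iff] at h
    obtain ⟨d, hd, hc⟩ := h
    intro i j hj
    have ih := tape_eq_blank hs hd i j hj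
    have hb := hs d (reaches_of_after hd) i
    simp only [step, Option.map_eq_some_iff] at hc
    obtain ⟨a, -, rfl⟩ := hc
    have : j ≠ d.head i := by rintro rfl; omega
    simp [this, ih]

/-- A computation that repeats a configuration (up to the output) does not halt, so that the
length of the output is less than the number of configurations. -/
theorem Transducer.length_lt_card [Fintype M.Q] [Fintype M.Γ] {w : List Unit} {u : List Ω} {s : ℕ}
    (hs : M.UsesSpace w s) (hu : M.Outputs w u) :
    u.length < Fintype.card M.Q * ((w.length + 2) *
      ((Fintype.card M.Γ ^ (2 * s + 1)) ^ M.k * (2 * s + 1) ^ M.k)) := by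
  classical
  obtain ⟨c, hc, hhalt, rfl⟩ := hu
  obtain ⟨T, hT⟩ := exists_after hc
  have hnone : M.after w (T + 1) = none := by simp [after, hT, hhalt]
  have hmono : ∀ {t m}, M.after w t = none → M.after w (t + m) = none := by
    intro t m h
    induction m with
    | zero => exact h
    | succ m ih => rw [← Nat.add_assoc]; simp [after, ih]
  have hsome : ∀ t : Fin (T + 1), ∃ d, M.after w t = some d := by
    intro t
    by_contra! h
    have h' := hmono (m := T - t) (Option.eq_none_iff_forall_ne_some.2 h)
    rw [show (t : ℕ) + (T - t) = T by omega, hT] at h'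
    exact absurd h' (by simp)
  choose d hd using hsome
  let E := {j : ℤ // j ∈ Finset.Icc (-(s : ℤ)) s}
  have hE : Fintype.card E = 2 * s + 1 := by
    simp only [E, Fintype.card_coe, Int.card_Icc]; omega
  let F : Fin (T + 1) → M.Q × Fin (w.length + 2) × (Fin M.k → E → M.Γ) × (Fin M.k → E) := fun t =>
    ((d t).state, ⟨(d t).inPos, inPos_le (hd t)⟩, fun i j => (d t).tape i j,
      fun i => ⟨(d t).head i, by
        have := abs_le.1 (hs _ (reaches_of_after (hd t)) i)
        simp only [Finset.mem_Icc]; omega⟩)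
  have hF : Function.Injective F := by
    have key : ∀ a b : Fin (T + 1), a < b → F a ≠ F b := by
      intro a b hab h
      have hcore : (d a).core = (d b).core := by
        simp only [F, Prod.mk.injEq, Fin.mk.injEq] at h
        obtain ⟨h1, h2, h3, h4⟩ := h
        simp only [Config.core, Prod.mk.injEq]
        refine ⟨h1, h2, ?_, ?_⟩
        · funext i j
          by_cases hj : |j| ≤ (s : ℤ)
          · exact congrFun (congrFun h3 i) ⟨j, by
              have := abs_le.1 hj
              simp only [Finset.mem_Icc]; omega⟩
          · rw [tape_eq_blank hs (hd a) i j (by omega), tape_eq_blank hs (hd b) i j (by omega)]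
        · funext i
          exact congrArg Subtype.val (congrFun h4 i)
      have hshift : ∀ m : ℕ, (M.after w (a + m)).map Config.core =
          (M.after w (b + m)).map Config.core := by
        intro m
        induction m with
        | zero => simp [hd, hcore]
        | succ m ih =>
          rw [← Nat.add_assoc, ← Nat.add_assoc]
          simp only [after]
          cases h1 : M.after w (a + m) with
          | none =>
            cases h2 : M.after w (b + m) with
            | none => rfl
            | some y => simp [h1, h2] at ih
          | some x =>
            cases h2 : M.after w (b + m) with
            | none => simp [h1, h2] at ih
            | some y =>
              simp only [h1, h2, Option.map_some, Option.some.injEq] at ih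
              simpa using core_step ih
      have h1 := hshift (T + 1 - b)
      rw [show (b : ℕ) + (T + 1 - b) = T + 1 by omega, hnone] at h1
      have h2 := hd ⟨a + (T + 1 - b), by have := b.2; have : (a : ℕ) < b := hab; omega⟩
      simp only at h2
      rw [h2] at h1
      simp at h1
    intro a b h
    rcases lt_trichotomy a b with h' | h' | h'
    · exact absurd h (key _ _ h')
    · exact h'
    · exact absurd h.symm (key _ _ h')
  have hcard := Fintype.card_le_of_injective F hF
  simp only [Fintype.card_prod, Fintype.card_fin, Fintype.card_fun, hE] at hcard
  exact lt_of_lt_of_le (by have := length_out_le hT; omega) hcard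

/-- The number of configurations with heads at distance `O(log n)` from the origin is polynomial. -/
theorem LogSpaceGenerated.exists_length_le {f : ℕ → List Ω} (h : LogSpaceGenerated f) :
    ∃ b, ∀ n, (f n).length ≤ 2 ^ (b * (Nat.log 2 n + 1)) := by
  obtain ⟨M, a, hM⟩ := h
  have := M.finite_Q
  have := M.finite_Γ
  have := Fintype.ofFinite M.Q
  have := Fintype.ofFinite M.Γ
  refine ⟨Fintype.card M.Q + 2 + (Fintype.card M.Γ * M.k + M.k) * (2 * a + 1), fun n => ?_⟩
  have hlt := (Transducer.length_lt_card (hM n).2 (hM n).1).le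
  set L := Nat.log 2 n + 1 with hL
  have pow2 : ∀ m : ℕ, m ≤ 2 ^ m := fun m => Nat.lt_two_pow_self.le
  have hn : n + 2 ≤ 2 ^ (2 * L) := by
    have h1 : n < 2 ^ L := Nat.lt_pow_succ_log_self (by norm_num) n
    have h2 : 2 ≤ 2 ^ L := by
      calc 2 = 2 ^ 1 := rfl
        _ ≤ 2 ^ L := Nat.pow_le_pow_right (by norm_num) (by omega)
    calc n + 2 ≤ 2 ^ L + 2 ^ L := by omega
      _ = 2 * 2 ^ L := by ring
      _ ≤ 2 ^ L * 2 ^ L := Nat.mul_le_mul_right _ h2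
      _ = 2 ^ (2 * L) := by rw [← pow_add]; congr 1; ring
  rw [List.length_replicate] at hlt
  have hs : 2 * (a * L) + 1 ≤ (2 * a + 1) * L := by
    have : 1 ≤ L := by omega
    nlinarith
  refine hlt.trans ?_
  calc Fintype.card M.Q * ((n + 2) *
      ((Fintype.card M.Γ ^ (2 * (a * L) + 1)) ^ M.k * (2 * (a * L) + 1) ^ M.k))
      ≤ 2 ^ (Fintype.card M.Q * L) * (2 ^ (2 * L) *
        (((2 ^ Fintype.card M.Γ) ^ ((2 * a + 1) * L)) ^ M.k * (2 ^ ((2 * a + 1) * L)) ^ M.k)) := by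
        refine Nat.mul_le_mul ?_ (Nat.mul_le_mul hn (Nat.mul_le_mul ?_ ?_))
        · refine (pow2 _).trans (Nat.pow_le_pow_right (by norm_num) ?_)
          exact Nat.le_mul_of_pos_right _ (by omega)
        · refine Nat.pow_le_pow_left ?_ _
          exact (Nat.pow_le_pow_left (pow2 _) _).trans
            (Nat.pow_le_pow_right (by positivity) hs)
        · exact Nat.pow_le_pow_left (hs.trans (pow2 _)) _
    _ = _ := by
        simp only [← pow_mul, ← pow_add]
        congr 1
        ring

theorem LogSpaceGenerated.polyBounded_length {f : ℕ → List Ω} (h : LogSpaceGenerated f) :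
    PolyBounded fun n => (f n).length := by
  obtain ⟨b, hb⟩ := h.exists_length_le
  refine ⟨(2 * (Polynomial.X + 1)) ^ b, fun n => (hb n).trans ?_⟩
  have e : ((2 * (Polynomial.X + 1)) ^ b : Polynomial ℕ).eval n = (2 * (n + 1)) ^ b := by
    simp
  rw [e, mul_comm b, pow_mul]
  refine Nat.pow_le_pow_left ?_ b
  rw [pow_succ]
  rcases Nat.eq_zero_or_pos n with rfl | hn
  · simp
  · have := Nat.pow_log_le_self 2 hn.ne'
    omega

end Count

/-! ### The transformation of a description by nested scans -/

/-- The fresh memory of the simulating machine. -/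
def setup (M : Transducer Unit Token) (d : ℕ) : SCmd M (Reg d) Token :=
  .act fun _ => ⟨.stay, fun x => match x with
    | .inl _ => .sim M.blank true
    | .inr none => .ctl M.start none
    | .inr (some _) => .blank, fun _ => .stay, none⟩

theorem run_setup {M : Transducer Unit Token} {d n r s : ℕ} (hr : r + 2 ≤ s) :
    ∃ σ', Run n s (setup M d) (Store.blank Cell.blank) [] σ' ∧ Good r (fun _ => 0) σ' := by
  have key : Good r (fun _ => 0) ((Store.blank Cell.blank : SStore M (Reg d)).exec n
      (⟨.stay, fun x => match x with
    | .inl _ => .sim M.blank true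
    | .inr none => .ctl M.start none
    | .inr (some _) => .blank, fun _ => .stay, none⟩ : Instr _ _ Token)) := by
    refine ⟨fun x => ?_, ⟨M.start, none, ?_⟩, fun i => ?_⟩
    · simp only [Store.exec, Store.blank, Transducer.moveWork, counter, Function.update_eq_self]
      refine Prod.ext ?_ rfl
      funext j
      cases j <;> simp [digitTape, bits]
    · refine Prod.ext ?_ rfl
      funext j
      simp [Store.exec, Store.blank, ctlTape, Function.update_apply]
    · convert visited_freshTape r M.blank using 1
      refine Prod.ext ?_ rfl
      funext j
      simp [Store.exec, Store.blank, freshTape, Function.update_apply]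
  exact ⟨_, .act _ _ (key.bounded hr), key⟩

/-- Programs of nested scans preserve generation in logarithmic space. -/
theorem LogSpaceGenerated.em {f : ℕ → List Token} (h : LogSpaceGenerated f) (P : Em) :
    LogSpaceGenerated fun n => P.den (f n) 0 fun _ => Ent.zero := by
  obtain ⟨b, hb⟩ := h.exists_length_le
  obtain ⟨M, a, hM⟩ := h
  have := M.finite_Q
  have := M.finite_Γ
  refine logSpaceGenerated_of_run (A := Option Token) (Γ := SCell M) Cell.blank
    (.seq (setup M P.height) (P.compile P.height 0)) (a + b + P.bound + 21) fun n => ?_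
  set L := Nat.log 2 n + 1 with hL
  have h1 : 1 ≤ L := by omega
  have hr : a * L + 2 ≤ (a + b + P.bound + 21) * L := by nlinarith
  have hB : (f n).length + 17 + P.bound + 3 < 2 ^ ((a + b + P.bound + 21) * L) := by
    have h2 : (f n).length ≤ 2 ^ (b * L) := hb n
    have h3 : P.bound + 22 ≤ 2 ^ (P.bound + 21) := Nat.lt_two_pow_self
    have h4 : 1 ≤ 2 ^ (b * L) := Nat.one_le_two_pow
    have h5 : 2 ^ (P.bound + 21) * 2 ^ (b * L) ≤ 2 ^ ((a + b + P.bound + 21) * L) := by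
      rw [← pow_add]
      exact Nat.pow_le_pow_right (by norm_num) (by nlinarith)
    have h6 := Nat.mul_le_mul_right (2 ^ (b * L)) h3
    nlinarith
  obtain ⟨σ, r1, g1⟩ := run_setup (M := M) (d := P.height) (n := n) hr
  obtain ⟨σ', ρ', r2, -, -⟩ := Exec.compile (M := M) (d := P.height) hr hB (w := f n) (by omega)
    (hM n).2 (hM n).1 P (by omega) 0 (fun _ => 0) (fun _ => Ent.zero) (by omega) (by simp)
    (by simp) (by simp) σ g1
  exact ⟨σ', r1.seq (o := []) r2⟩

/-! ### Operators on single qubits -/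

section OneQubit

variable {V : Type} [Fintype V] [DecidableEq V]

/-- The sign `(-1) ^ b`. -/
def sgn (b : Fin 2) : ℂ := (-1) ^ (b : ℕ)

@[simp] theorem sgn_zero : sgn 0 = 1 := by simp [sgn]

@[simp] theorem sgn_one : sgn 1 = -1 := by simp [sgn]

theorem sgn_add (a b : Fin 2) : sgn (a + b) = sgn a * sgn b := by
  fin_cases a <;> fin_cases b <;> simp

theorem norm_sgn (b : Fin 2) : ‖sgn b‖ = 1 := by
  fin_cases b <;> simp

theorem sgn_mul_self (b : Fin 2) : sgn b * sgn b = 1 := by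
  fin_cases b <;> simp

theorem applyCZ_apply (i j : V) (ψ : QState V) (y : V → Fin 2) :
    applyCZ i j ψ y = sgn (y i * y j) * ψ y := by
  have : ∀ a b : Fin 2, (if a = 1 ∧ b = 1 then -ψ y else ψ y) = sgn (a * b) * ψ y := by
    intro a b
    fin_cases a <;> fin_cases b <;> simp
  exact this _ _

theorem applyOne_mul (A B : Matrix (Fin 2) (Fin 2) ℂ) (i : V) (ψ : QState V) :
    applyOne A i (applyOne B i ψ) = applyOne (A * B) i ψ := by
  funext y
  simp only [applyOne, Matrix.mul_apply, Function.update_self, Function.update_idem,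
    Fin.sum_univ_two]
  ring

theorem applyOne_smul (A : Matrix (Fin 2) (Fin 2) ℂ) (i : V) (c : ℂ) (ψ : QState V) :
    applyOne A i (c • ψ) = c • applyOne A i ψ := by
  funext y
  simp only [applyOne, Pi.smul_apply, smul_eq_mul, Fin.sum_univ_two]
  ring

theorem applyOne_add (A : Matrix (Fin 2) (Fin 2) ℂ) (i : V) (φ ψ : QState V) :
    applyOne A i (φ + ψ) = applyOne A i φ + applyOne A i ψ := by
  funext y
  simp only [applyOne, Pi.add_apply, Fin.sum_univ_two]
  ring

theorem applyCZ_smul (i j : V) (c : ℂ) (ψ : QState V) :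
    applyCZ i j (c • ψ) = c • applyCZ i j ψ := by
  funext y
  simp only [applyCZ_apply, Pi.smul_apply, smul_eq_mul]
  ring

theorem applyCZ_add (i j : V) (φ ψ : QState V) :
    applyCZ i j (φ + ψ) = applyCZ i j φ + applyCZ i j ψ := by
  funext y
  simp only [applyCZ_apply, Pi.add_apply]
  ring

theorem applyOne_comm {i j : V} (h : i ≠ j) (A B : Matrix (Fin 2) (Fin 2) ℂ) (ψ : QState V) :
    applyOne A i (applyOne B j ψ) = applyOne B j (applyOne A i ψ) := by
  funext y
  simp only [applyOne, Function.update_of_ne h, Function.update_of_ne h.symm, Fin.sum_univ_two,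
    Function.update_comm h]
  ring

theorem applyOne_applyCZ {q i j : V} (hi : q ≠ i) (hj : q ≠ j) (A : Matrix (Fin 2) (Fin 2) ℂ)
    (ψ : QState V) : applyOne A q (applyCZ i j ψ) = applyCZ i j (applyOne A q ψ) := by
  funext y
  simp only [applyOne, applyCZ_apply, Function.update_of_ne hi.symm, Function.update_of_ne hj.symm,
    Fin.sum_univ_two]
  ring

theorem pauliX_pow_apply (k : Fin 2) (i : V) (ψ : QState V) (y : V → Fin 2) :
    applyOne (pauliX ^ k.val) i ψ y = ψ (Function.update y i (y i + k)) := by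
  have : ∀ a : Fin 2, ∑ b, (pauliX ^ k.val) a b * ψ (Function.update y i b) =
      ψ (Function.update y i (a + k)) := by
    intro a
    fin_cases k <;> fin_cases a <;> simp [pauliX]
  exact this _

theorem pauliZ_pow_apply (k : Fin 2) (i : V) (ψ : QState V) (y : V → Fin 2) :
    applyOne (pauliZ ^ k.val) i ψ y = sgn (y i * k) * ψ y := by
  have : ∀ a : Fin 2, y i = a → ∑ b, (pauliZ ^ k.val) a b * ψ (Function.update y i b) =
      sgn (a * k) * ψ y := by
    intro a ha
    have hu : Function.update y i a = y := by rw [← ha, Function.update_eq_self]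
    fin_cases k <;> fin_cases a <;> simp [pauliZ] <;> exact congrArg ψ hu
  exact this _ rfl

theorem sum_update (q : V) (f : (V → Fin 2) → ℝ) :
    ∑ y, ∑ b, f (Function.update y q b) = 2 * ∑ y, f y := by
  have h : ∀ b, ∑ y, f (Function.update y q b) =
      ∑ c : Fin 2, ∑ r : {j // j ≠ q} → Fin 2, f ((Equiv.funSplitAt q (Fin 2)).symm (b, r)) := by
    intro b
    rw [← (Equiv.funSplitAt q (Fin 2)).symm.sum_comp, Fintype.sum_prod_type]
    refine Finset.sum_congr rfl fun c _ => Finset.sum_congr rfl fun r _ => congrArg f ?_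
    funext j
    by_cases hj : j = q
    · subst hj; simp [Equiv.funSplitAt, Equiv.piSplitAt]
    · simp [Equiv.funSplitAt, Equiv.piSplitAt, hj]
  have h' : ∑ y, f y =
      ∑ c : Fin 2, ∑ r : {j // j ≠ q} → Fin 2, f ((Equiv.funSplitAt q (Fin 2)).symm (c, r)) := by
    rw [← (Equiv.funSplitAt q (Fin 2)).symm.sum_comp, Fintype.sum_prod_type]
  rw [Finset.sum_comm, h']
  simp only [h, Fin.sum_univ_two]
  ring

/-- The norm of the image of a vector is determined by the Gram matrix. -/
theorem sum_norm_sq_eq {K K' : Matrix (Fin 2) (Fin 2) ℂ} (h : Kᴴ * K = K'ᴴ * K')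
    (x : Fin 2 → ℂ) :
    ∑ b, ‖∑ c, K b c * x c‖ ^ 2 = ∑ b, ‖∑ c, K' b c * x c‖ ^ 2 := by
  have key : ∀ K : Matrix (Fin 2) (Fin 2) ℂ, ((∑ b, ‖∑ c, K b c * x c‖ ^ 2 : ℝ) : ℂ) =
      star x ⬝ᵥ ((Kᴴ * K) *ᵥ x) := by
    intro K
    simp only [Matrix.mulVec, dotProduct, Matrix.mul_apply, conjTranspose_apply, Fin.sum_univ_two,
      Pi.star_apply, Complex.ofReal_add, Complex.ofReal_pow, ← Complex.mul_conj',
      Complex.star_def, map_add, map_mul]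
    ring
  have := key K
  rw [h, ← key K'] at this
  exact_mod_cast this

theorem probOnes_applyOne_eq {outputs : List V} {q : V} (hq : q ∉ outputs)
    {K K' : Matrix (Fin 2) (Fin 2) ℂ} (h : Kᴴ * K = K'ᴴ * K') (ψ : QState V) :
    probOnes outputs (applyOne K q ψ) = probOnes outputs (applyOne K' q ψ) := by
  have key : ∀ K : Matrix (Fin 2) (Fin 2) ℂ, 2 * probOnes outputs (applyOne K q ψ) =
      ∑ y : V → Fin 2, if ∀ o ∈ outputs, y o = 1 then
        ∑ b, ‖∑ c, K b c * ψ (Function.update y q c)‖ ^ 2 else 0 := by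
    intro K
    rw [probOnes, ← sum_update q]
    refine Finset.sum_congr rfl fun y _ => ?_
    have : ∀ b, (∀ o ∈ outputs, Function.update y q b o = 1) ↔ ∀ o ∈ outputs, y o = 1 := by
      intro b
      refine forall₂_congr fun o ho => ?_
      rw [Function.update_of_ne]
      rintro rfl; exact hq ho
    simp only [this, applyOne, Function.update_self, Function.update_idem]
    split_ifs <;> simp
  have := key K
  simp only [sum_norm_sq_eq h, ← key K'] at this
  linarith

theorem probOnes_smul (outputs : List V) (c : ℂ) (ψ : QState V) :
    probOnes outputs (c • ψ) = ‖c‖ ^ 2 * probOnes outputs ψ := by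
  simp only [probOnes, Finset.mul_sum, Pi.smul_apply, smul_eq_mul, norm_mul, mul_pow, mul_ite,
    mul_zero]

namespace Pattern

/-- Once a qubit is not acted upon any more, the acceptance probability only depends on the Gram
matrix of the last operator applied to this qubit. -/
theorem prob_applyOne_eq (α₀ : ℝ) {outputs : List V} {q : V} (hq : q ∉ outputs)
    {K K' : Matrix (Fin 2) (Fin 2) ℂ} (h : Kᴴ * K = K'ᴴ * K') :
    ∀ (A : List (Command V)) (ψ : QState V) (s : V → Fin 2), (∀ c ∈ A, q ∉ c.acts) →
      prob α₀ outputs A (applyOne K q ψ) s = prob α₀ outputs A (applyOne K' q ψ) s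
  | [], ψ, s, _ => probOnes_applyOne_eq hq h ψ
  | .E i j :: A, ψ, s, hA => by
    have h1 := hA _ List.mem_cons_self
    simp only [Command.acts, List.mem_cons, List.not_mem_nil, or_false, not_or] at h1
    simp only [prob]
    rw [← applyOne_applyCZ h1.1 h1.2, ← applyOne_applyCZ h1.1 h1.2]
    exact prob_applyOne_eq α₀ hq h A _ s fun c hc => hA c (List.mem_cons_of_mem _ hc)
  | .M i a :: A, ψ, s, hA => by
    have h1 := hA _ List.mem_cons_self
    simp only [Command.acts, List.mem_cons, List.not_mem_nil, or_false] at h1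
    simp only [prob]
    refine Finset.sum_congr rfl fun b _ => ?_
    rw [← applyOne_comm h1, ← applyOne_comm h1]
    exact prob_applyOne_eq α₀ hq h A _ _ fun c hc => hA c (List.mem_cons_of_mem _ hc)
  | .X i σ :: A, ψ, s, hA => by
    have h1 := hA _ List.mem_cons_self
    simp only [Command.acts, List.mem_cons, List.not_mem_nil, or_false] at h1
    simp only [prob]
    rw [← applyOne_comm h1, ← applyOne_comm h1]
    exact prob_applyOne_eq α₀ hq h A _ _ fun c hc => hA c (List.mem_cons_of_mem _ hc)
  | .Z i σ :: A, ψ, s, hA => by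
    have h1 := hA _ List.mem_cons_self
    simp only [Command.acts, List.mem_cons, List.not_mem_nil, or_false] at h1
    simp only [prob]
    rw [← applyOne_comm h1, ← applyOne_comm h1]
    exact prob_applyOne_eq α₀ hq h A _ _ fun c hc => hA c (List.mem_cons_of_mem _ hc)

theorem prob_smul (α₀ : ℝ) (outputs : List V) (k : ℂ) :
    ∀ (A : List (Command V)) (ψ : QState V) (s : V → Fin 2),
      prob α₀ outputs A (k • ψ) s = ‖k‖ ^ 2 * prob α₀ outputs A ψ s
  | [], ψ, s => probOnes_smul _ _ _
  | .E i j :: A, ψ, s => by simp only [prob, applyCZ_smul, prob_smul α₀ outputs k A]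
  | .M i a :: A, ψ, s => by
    simp only [prob, applyOne_smul, prob_smul α₀ outputs k A, Finset.mul_sum]
  | .X i σ :: A, ψ, s => by simp only [prob, applyOne_smul, prob_smul α₀ outputs k A]
  | .Z i σ :: A, ψ, s => by simp only [prob, applyOne_smul, prob_smul α₀ outputs k A]

/-- A measurement may be replaced by any operators with the right Gram matrices, if the measured
qubit is not used any more. -/
theorem prob_M_eq (α₀ : ℝ) {outputs : List V} {q : V} (hq : q ∉ outputs) (a : Angle)
    {A : List (Command V)} (hA : ∀ c ∈ A, q ∉ c.acts) (K : Fin 2 → Matrix (Fin 2) (Fin 2) ℂ)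
    (hK : ∀ b, (K b)ᴴ * K b = projAngle (a.val α₀) b) (ψ : QState V) (s : V → Fin 2) :
    prob α₀ outputs (.M q a :: A) ψ s =
      ∑ b, prob α₀ outputs A (applyOne (K b) q ψ) (Function.update s q b) := by
  simp only [prob]
  refine Finset.sum_congr rfl fun b _ => prob_applyOne_eq α₀ hq ?_ A ψ _ hA
  rw [hK]
  have hs : (1 / (Real.sqrt 2 : ℂ)) * (1 / (Real.sqrt 2 : ℂ)) = 1 / 2 := by
    rw [div_mul_div_comm, ← Complex.ofReal_mul, Real.mul_self_sqrt (by norm_num)]; norm_num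
  have hn : star (ketAngle (a.val α₀) b) ⬝ᵥ ketAngle (a.val α₀) b = 1 := by
    have he : ∀ x : ℝ, Complex.exp (-(Complex.I * x)) * Complex.exp (Complex.I * x) = 1 := by
      intro x; rw [← Complex.exp_add]; simp
    have he' : ∀ x : ℝ, (starRingEnd ℂ) (Complex.exp (Complex.I * x)) =
        Complex.exp (-(Complex.I * x)) := by
      intro x; rw [← Complex.exp_conj]; simp
    simp only [ketAngle, dotProduct, Fin.sum_univ_two, Pi.star_apply, Matrix.cons_val_zero,
      Matrix.cons_val_one, Complex.star_def, map_mul, map_div₀, map_pow, map_neg, map_one,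
      Complex.conj_ofReal, he']
    rw [hs]
    have : ((-1 : ℂ) ^ (b : ℕ)) * (-1) ^ (b : ℕ) = 1 := sgn_mul_self b
    linear_combination (1 / (Real.sqrt 2 : ℂ)) * (1 / (Real.sqrt 2 : ℂ)) * (this *
      (Complex.exp (-(Complex.I * (a.val α₀))) * Complex.exp (Complex.I * (a.val α₀)))) +
      (1 / (Real.sqrt 2 : ℂ)) * (1 / (Real.sqrt 2 : ℂ)) * he (a.val α₀) + hs
  have hst : (projAngle (a.val α₀) b)ᴴ = projAngle (a.val α₀) b := by
    simp [projAngle, conjTranspose_vecMulVec]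
  rw [hst, projAngle, vecMulVec_mul_vecMulVec, hn, one_smul]

/-- The operator which replaces the state `|±_α⟩` of a qubit by `|+⟩` and annihilates the orthogonal
state. -/
noncomputable def resetMat (α : ℝ) (b : Fin 2) : Matrix (Fin 2) (Fin 2) ℂ :=
  Matrix.of fun _ x => 1 / 2 * sgn (b * x) * Complex.exp (-(Complex.I * (α : ℂ))) ^ (x : ℕ)

theorem resetMat_gram (α : ℝ) (b : Fin 2) :
    (resetMat α b)ᴴ * resetMat α b = projAngle α b := by
  have hs : (Real.sqrt 2 : ℂ)⁻¹ * (Real.sqrt 2 : ℂ)⁻¹ = 1 / 2 := by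
    rw [← mul_inv, ← Complex.ofReal_mul, Real.mul_self_sqrt (by norm_num)]; norm_num
  have he : (starRingEnd ℂ) (Complex.exp (Complex.I * α)) = Complex.exp (-(Complex.I * α)) := by
    rw [← Complex.exp_conj]; simp
  have he' : (starRingEnd ℂ) (Complex.exp (-(Complex.I * α))) = Complex.exp (Complex.I * α) := by
    rw [← Complex.exp_conj]; simp
  have h2 : (starRingEnd ℂ) 2 = 2 := Complex.conj_ofNat 2
  ext x y
  simp only [Matrix.mul_apply, conjTranspose_apply, resetMat, Matrix.of_apply, projAngle,
    vecMulVec_apply, Pi.star_apply, Fin.sum_univ_two, Complex.star_def, map_mul, map_pow, he']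
  fin_cases b <;> fin_cases x <;> fin_cases y <;>
    simp [ketAngle, he, h2, div_eq_mul_inv] <;> first
      | linear_combination -hs
      | linear_combination (-Complex.exp (Complex.I * α)) * hs
      | linear_combination (Complex.exp (Complex.I * α)) * hs
      | linear_combination (-Complex.exp (-(Complex.I * α))) * hs
      | linear_combination (Complex.exp (-(Complex.I * α))) * hs
      | linear_combination (-Complex.exp (Complex.I * α) * Complex.exp (-(Complex.I * α))) * hs

/-- A measured qubit may be put into the state `|+⟩` afterwards; the projection onto the basis of the
measurement then becomes a sum over the values of this qubit. -/
theorem prob_M_reset (α₀ : ℝ) {outputs : List V} {q : V} (hq : q ∉ outputs) (a : Angle)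
    {A : List (Command V)} (hA : ∀ c ∈ A, q ∉ c.acts) (ψ : QState V) (s : V → Fin 2) :
    prob α₀ outputs (.M q a :: A) ψ s = ∑ b, prob α₀ outputs A (fun y =>
      1 / 2 * ∑ x, sgn (b * x) * Complex.exp (-(Complex.I * (a.val α₀ : ℂ))) ^ (x : ℕ) *
        ψ (Function.update y q x)) (Function.update s q b) := by
  rw [prob_M_eq α₀ hq a hA _ (resetMat_gram _)]
  refine Finset.sum_congr rfl fun b _ => congrArg (fun φ => prob α₀ outputs A φ _) ?_
  funext y
  simp only [applyOne, resetMat, Matrix.of_apply, Fin.sum_univ_two]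
  ring

end Pattern

/-! ### Registers in product states -/

/-- Summation over a register `W` of a function which depends on the subregister `m`, weighted by a
product over the other qubits. -/
theorem sum_comp_mul_prod {W : Type} [Fintype W] [DecidableEq W] {m : V → W}
    (hm : Function.Injective m) (f : (V → Fin 2) → ℝ) (g : W → Fin 2 → ℝ)
    (hg : ∀ v b, g (m v) b = 1) :
    ∑ z : W → Fin 2, f (z ∘ m) * ∏ w, g w (z w) =
      (∑ y, f y) * ∏ w, if w ∈ Set.range m then 1 else ∑ b, g w b := by
  classical
  have h1 : ∀ z : W → Fin 2, f (z ∘ m) * ∏ w, g w (z w) =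
      ∑ y : V → Fin 2, f y * ∏ w, if ∀ v, m v = w → y v = z w then g w (z w) else 0 := by
    intro z
    rw [Finset.sum_eq_single (z ∘ m)]
    · congr 1
      refine Finset.prod_congr rfl fun w _ => ?_
      rw [if_pos]
      rintro v rfl; rfl
    · intro y _ hy
      obtain ⟨v, hv⟩ := Function.ne_iff.1 hy
      rw [Finset.prod_eq_zero (Finset.mem_univ (m v)), mul_zero]
      rw [if_neg]
      intro h; exact hv (h v rfl)
    · simp
  simp only [h1]
  rw [Finset.sum_comm, Finset.sum_mul]
  refine Finset.sum_congr rfl fun y _ => ?_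
  rw [← Finset.mul_sum]
  congr 1
  have := Finset.prod_univ_sum (t := fun _ : W => (Finset.univ : Finset (Fin 2)))
    (f := fun w b => if ∀ v, m v = w → y v = b then g w b else 0)
  rw [Fintype.piFinset_univ] at this
  rw [← this]
  refine Finset.prod_congr rfl fun w _ => ?_
  by_cases hw : w ∈ Set.range m
  · obtain ⟨v, rfl⟩ := hw
    rw [if_pos ⟨v, rfl⟩, Finset.sum_eq_single (y v)]
    · rw [if_pos, hg]
      intro v' h; rw [hm h]
    · intro b _ hb
      rw [if_neg]
      intro h; exact hb (h v rfl).symm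
    · simp
  · rw [if_neg hw]
    refine Finset.sum_congr rfl fun b _ => ?_
    rw [if_pos]
    rintro v rfl; exact absurd ⟨v, rfl⟩ hw

end OneQubit

/-! ### Depth -/

section Depth

variable {β γ : Type} {R : β → β → Prop} {T : γ → γ → Prop}

theorem chainDepth_le {l : List β} {K : ℕ}
    (h : ∀ l' : List β, l'.Sublist l → l'.IsChain R → l'.length ≤ K) : chainDepth R l ≤ K := by
  refine csSup_le ⟨0, [], List.nil_sublist _, List.isChain_nil, rfl⟩ ?_
  rintro d ⟨l', h1, h2, rfl⟩
  exact h l' h1 h2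

theorem length_le_chainDepth {l l' : List β} (h : l'.Sublist l) (h' : l'.IsChain R) :
    l'.length ≤ chainDepth R l := by
  refine le_csSup ⟨l.length, ?_⟩ ⟨l', h, h', rfl⟩
  rintro d ⟨l'', h1, -, rfl⟩
  exact h1.length_le

theorem chainDepth_append_le (l l' : List β) :
    chainDepth R (l ++ l') ≤ chainDepth R l + chainDepth R l' := by
  refine chainDepth_le fun k hk hc => ?_
  obtain ⟨k₁, k₂, rfl, h1, h2⟩ := List.sublist_append_iff.1 hk
  rw [List.length_append]
  exact Nat.add_le_add (length_le_chainDepth h1 hc.left_of_append)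
    (length_le_chainDepth h2 hc.right_of_append)

/-- If dependent elements have increasing levels, the depth is at most the number of levels. -/
theorem chainDepth_le_of_level {l : List β} {K : ℕ} (lev : β → ℕ) (hK : ∀ p ∈ l, lev p < K)
    (h : l.Pairwise fun p q => R p q → lev p < lev q) : chainDepth R l ≤ K := by
  refine chainDepth_le fun k hk hc => ?_
  have key : ∀ (k : List β), (k.Pairwise fun p q => R p q → lev p < lev q) → k.IsChain R →
      (∀ p ∈ k, lev p < K) → ∀ p ∈ k.head?, k.length + lev p ≤ K := by
    intro k
    induction k with
    | nil => simp
    | cons a k ih =>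
      intro hp hc hK p hpa
      simp only [List.head?_cons, Option.mem_some_iff] at hpa
      subst hpa
      cases k with
      | nil => have := hK a (by simp); simp; omega
      | cons b k =>
        rw [List.isChain_cons_cons] at hc
        have h1 := ih (List.pairwise_cons.1 hp).2 hc.2
          (fun p hp => hK p (List.mem_cons_of_mem _ hp)) b (by simp)
        have h2 := (List.pairwise_cons.1 hp).1 b (by simp) hc.1
        simp only [List.length_cons] at h1 ⊢
        omega
  cases k with
  | nil => simp
  | cons a k =>
    have := key _ (h.sublist hk) hc (fun p hp => hK p (hk.subset hp)) a (by simp)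
    omega

/-- A list of blocks, in which elements of different blocks depend on each other only if the
labels of their blocks do. -/
theorem chainDepth_flatMap_le {l : List (β × List γ)} {K : ℕ}
    (hK : ∀ x ∈ l, chainDepth T x.2 ≤ K)
    (h : l.Pairwise fun x y => ∀ p ∈ x.2, ∀ q ∈ y.2, T p q → R x.1 y.1) :
    chainDepth T (l.flatMap Prod.snd) ≤ K * chainDepth R (l.map Prod.fst) := by
  have key : ∀ (l : List (β × List γ)), (∀ x ∈ l, chainDepth T x.2 ≤ K) →
      (l.Pairwise fun x y => ∀ p ∈ x.2, ∀ q ∈ y.2, T p q → R x.1 y.1) →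
      ∀ k : List γ, k.Sublist (l.flatMap Prod.snd) → k.IsChain T → ∀ a ∈ k.head?,
        ∃ l' : List (β × List γ), l'.Sublist l ∧ (l'.map Prod.fst).IsChain R ∧
          k.length ≤ K * l'.length ∧ ∃ x ∈ l'.head?, a ∈ x.2 := by
    intro l
    induction l with
    | nil =>
      intro _ _ k hk _ a ha
      simp only [List.flatMap_nil, List.sublist_nil] at hk
      simp [hk] at ha
    | cons x l ih =>
      intro hK hp k hk hc a ha
      rw [List.flatMap_cons] at hk
      obtain ⟨k₁, k₂, rfl, h1, h2⟩ := List.sublist_append_iff.1 hk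
      have ih' := ih (fun y hy => hK y (List.mem_cons_of_mem _ hy)) (List.pairwise_cons.1 hp).2 k₂
        h2 hc.right_of_append
      have hl := (length_le_chainDepth h1 hc.left_of_append).trans (hK x (by simp))
      cases k₁ with
      | nil =>
        obtain ⟨l', s1, s2, s3, s4⟩ := ih' a (by simpa using ha)
        exact ⟨l', s1.cons _, s2, by simpa using s3, s4⟩
      | cons b k₁ =>
        simp only [List.cons_append, List.head?_cons, Option.mem_some_iff] at ha
        subst ha
        cases k₂ with
        | nil =>
          refine ⟨[x], by simp, by simp, by simpa using hl, x, by simp, h1.subset (by simp)⟩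
        | cons c k₂ =>
          obtain ⟨l', s1, s2, s3, y, hy, hcy⟩ := ih' c (by simp)
          have hyl : y ∈ l := s1.subset (List.mem_of_mem_head? hy)
          refine ⟨x :: l', s1.cons_cons _, ?_, ?_, x, by simp, h1.subset (by simp)⟩
          · rw [List.map_cons, List.isChain_cons]
            refine ⟨?_, s2⟩
            intro r hr
            rw [List.head?_map, Option.mem_def.1 hy] at hr
            simp only [Option.map_some, Option.mem_some_iff] at hr
            subst hr
            have hb := (List.isChain_append.1 hc).2.2 _ (List.getLast?_eq_some_getLast (by simp))
              c (by simp)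
            exact (List.pairwise_cons.1 hp).1 y hyl _ (h1.subset (List.getLast_mem (by simp))) c hcy
              hb
          · rw [List.length_append]
            have : K * (x :: l').length = K + K * l'.length := by rw [List.length_cons]; ring
            omega
  refine chainDepth_le fun k hk hc => ?_
  cases hk' : k with
  | nil => simp
  | cons a k' =>
    obtain ⟨l', h1, h2, h3, -⟩ := key l hK h k hk hc a (by simp [hk'])
    rw [← hk']
    refine h3.trans (Nat.mul_le_mul_left K ?_)
    rw [← List.length_map (f := Prod.fst)]
    exact length_le_chainDepth (h1.map _) h2

theorem IsBigOLogPow.of_le {k : ℕ} {d d' : ℕ → ℕ} (h : IsBigOLogPow k d) (K K' : ℕ)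
    (hd : ∀ n, d' n ≤ K * d n + K') : IsBigOLogPow k d' := by
  unfold IsBigOLogPow at h ⊢
  have h1 : (fun n : ℕ => (K' : ℝ)) =O[atTop] fun n : ℕ => Real.log (n : ℝ) ^ k := by
    refine IsBigO.of_bound K' ?_
    filter_upwards [eventually_ge_atTop 3] with n hn
    have hlog : 1 ≤ Real.log n := by
      rw [Real.le_log_iff_exp_le (by positivity)]
      have h3 : (3 : ℝ) ≤ n := by exact_mod_cast hn
      linarith [Real.exp_one_lt_d9]
    have := one_le_pow₀ hlog (n := k)
    rw [Real.norm_of_nonneg (by positivity), Real.norm_of_nonneg (by positivity)]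
    exact le_mul_of_one_le_right (by positivity) this
  refine IsBigO.trans ?_ ((h.const_mul_left (K : ℝ)).add h1)
  refine IsBigO.of_bound 1 (Eventually.of_forall fun n => ?_)
  rw [Real.norm_of_nonneg (by positivity), Real.norm_of_nonneg (by positivity), one_mul]
  exact_mod_cast hd n

end Depth

section ProductStates

variable {V W : Type} [Fintype V] [DecidableEq V] [Fintype W] [DecidableEq W]

/-- The product state of the vectors `κ w`. -/
def prodState (κ : W → Fin 2 → ℂ) : QState W := fun z => ∏ w, κ w (z w)

/-- The state `ψ` of the subregister `m`, all other qubits `w` being in the state `κ w`; on the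
subregister the factors `κ w` are supposed to be `1`. -/
def prodLift (m : V → W) (κ : W → Fin 2 → ℂ) (ψ : QState V) : QState W :=
  fun z => ψ (z ∘ m) * prodState κ z

theorem prodState_update (κ : W → Fin 2 → ℂ) (w : W) (z : W → Fin 2) (b : Fin 2) :
    prodState κ (Function.update z w b) =
      κ w b * ∏ x ∈ Finset.univ.erase w, κ x (z x) := by
  rw [prodState, ← Finset.mul_prod_erase _ _ (Finset.mem_univ w), Function.update_self]
  congr 1
  refine Finset.prod_congr rfl fun x hx => ?_
  rw [Function.update_of_ne (Finset.ne_of_mem_erase hx)]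

theorem applyOne_mul_prodState (U : Matrix (Fin 2) (Fin 2) ℂ) (w : W) (g : QState W)
    (κ : W → Fin 2 → ℂ) (hg : ∀ z b, g (Function.update z w b) = g z) :
    applyOne U w (fun z => g z * prodState κ z) =
      fun z => g z * prodState (Function.update κ w (U *ᵥ κ w)) z := by
  funext z
  have h : prodState (Function.update κ w (U *ᵥ κ w)) z =
      (U *ᵥ κ w) (z w) * ∏ x ∈ Finset.univ.erase w, κ x (z x) := by
    rw [prodState, ← Finset.mul_prod_erase _ _ (Finset.mem_univ w), Function.update_self]
    congr 1
    refine Finset.prod_congr rfl fun x hx => ?_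
    rw [Function.update_of_ne (Finset.ne_of_mem_erase hx)]
  rw [h]
  simp only [applyOne, hg, prodState_update, mulVec, dotProduct, Fin.sum_univ_two]
  ring

/-- Applying the same operator to several qubits of a product state. -/
theorem foldl_applyOne_prodState (U : Matrix (Fin 2) (Fin 2) ℂ) (g : QState W) :
    ∀ (l : List W) (κ : W → Fin 2 → ℂ), l.Nodup →
      (∀ w ∈ l, ∀ z b, g (Function.update z w b) = g z) →
      l.foldl (fun ψ w => applyOne U w ψ) (fun z => g z * prodState κ z) =
        fun z => g z * prodState (fun w => if w ∈ l then U *ᵥ κ w else κ w) z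
  | [], κ, _, _ => by simp
  | w :: l, κ, hl, hg => by
    obtain ⟨h1, h2⟩ := List.nodup_cons.1 hl
    rw [List.foldl_cons, applyOne_mul_prodState U w g κ (hg w List.mem_cons_self),
      foldl_applyOne_prodState U g l _ h2 fun x hx => hg x (List.mem_cons_of_mem _ hx)]
    funext z
    refine congrArg (fun κ => g z * prodState κ z) ?_
    funext x
    by_cases hx : x = w
    · subst hx; simp [h1]
    · simp [hx]

theorem applyOne_prodLift {m : V → W} (hm : Function.Injective m) {κ : W → Fin 2 → ℂ}
    (hκ : ∀ v, κ (m v) = 1) (U : Matrix (Fin 2) (Fin 2) ℂ) (i : V) (ψ : QState V) :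
    applyOne U (m i) (prodLift m κ ψ) = prodLift m κ (applyOne U i ψ) := by
  funext z
  have h : ∀ b, prodState κ (Function.update z (m i) b) = prodState κ z := by
    intro b
    refine Finset.prod_congr rfl fun x _ => ?_
    by_cases hx : x = m i
    · subst hx; simp [hκ]
    · rw [Function.update_of_ne hx]
  simp only [applyOne, prodLift, h, Function.update_comp_eq_of_injective z hm, Fin.sum_univ_two,
    Function.comp_apply]
  ring

theorem applyCZ_prodLift (m : V → W) (κ : W → Fin 2 → ℂ) (i j : V) (ψ : QState V) :
    applyCZ (m i) (m j) (prodLift m κ ψ) = prodLift m κ (applyCZ i j ψ) := by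
  funext z
  simp only [applyCZ_apply, prodLift, Function.comp_apply]
  ring

theorem probOnes_prodLift {m : V → W} (hm : Function.Injective m) {κ : W → Fin 2 → ℂ}
    (hκ : ∀ v, κ (m v) = 1) (hn : ∀ w, w ∉ Set.range m → ∑ b, ‖κ w b‖ ^ 2 = 1)
    (outputs : List V) (ψ : QState V) :
    probOnes (outputs.map m) (prodLift m κ ψ) = probOnes outputs ψ := by
  classical
  have h := sum_comp_mul_prod hm (fun y => if ∀ o ∈ outputs, y o = 1 then ‖ψ y‖ ^ 2 else 0)
    (fun w b => ‖κ w b‖ ^ 2) (fun v b => by simp [hκ])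
  have h1 : (∏ w : W, if w ∈ Set.range m then (1 : ℝ) else ∑ b, ‖κ w b‖ ^ 2) = 1 := by
    refine Finset.prod_eq_one fun w _ => ?_
    split_ifs with hw
    · rfl
    · exact hn w hw
  rw [h1, mul_one] at h
  rw [probOnes, probOnes, ← h]
  refine Finset.sum_congr rfl fun z _ => ?_
  simp only [List.forall_mem_map, Function.comp_apply, prodLift, prodState, norm_mul, norm_prod,
    mul_pow, Finset.prod_pow]
  split_ifs <;> simp

theorem prod_eq_prod_mul_prod {m : V → W} (hm : Function.Injective m) (F : W → ℂ)
    (G : W → ℂ) (h1 : ∀ v, G (m v) = 1) (h2 : ∀ w, w ∉ Set.range m → G w = F w) :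
    ∏ w, F w = (∏ v, F (m v)) * ∏ w, G w := by
  classical
  rw [← Finset.prod_mul_prod_compl (Finset.univ.image m) F,
    ← Finset.prod_mul_prod_compl (Finset.univ.image m) G,
    Finset.prod_image fun a _ b _ h => hm h, Finset.prod_image fun a _ b _ h => hm h]
  simp only [h1, Finset.prod_const_one, one_mul]
  congr 1
  refine Finset.prod_congr rfl fun w hw => (h2 w ?_).symm
  simpa using hw

/-- The factors of the initial state. -/
def initKet (anc : Fin 2 → ℂ) (inputs : List V) (w : List (Fin 2)) (v : V) : Fin 2 → ℂ :=
  if v ∈ inputs then Pi.single (w.getD (inputs.idxOf v) 0) 1 else anc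

theorem initState_eq (anc : Fin 2 → ℂ) (inputs : List V) (w : List (Fin 2)) :
    initState anc inputs w = prodState (initKet anc inputs w) := by
  funext y
  refine Finset.prod_congr rfl fun v _ => ?_
  simp only [initKet]
  split_ifs with _ h2
  · rw [h2, Pi.single_eq_same]
  · rw [Pi.single_eq_of_ne' h2]
  · rfl

theorem idxOf_map_of_injective {m : V → W} (hm : Function.Injective m) (v : V) :
    ∀ l : List V, (l.map m).idxOf (m v) = l.idxOf v
  | [] => rfl
  | a :: l => by
    rw [List.map_cons, List.idxOf_cons, List.idxOf_cons, idxOf_map_of_injective hm v l]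
    by_cases h : a = v
    · simp [h]
    · have : m a ≠ m v := fun e => h (hm e)
      rw [beq_false_of_ne h, beq_false_of_ne this]

theorem initKet_map {m : V → W} (hm : Function.Injective m) (anc : Fin 2 → ℂ) (inputs : List V)
    (w : List (Fin 2)) (v : V) : initKet anc (inputs.map m) w (m v) = initKet anc inputs w v := by
  simp only [initKet, idxOf_map_of_injective hm, List.mem_map_of_injective hm]

theorem hadamard_mul_self : hadamard * hadamard = 1 := by
  have hs : (Real.sqrt 2 : ℂ)⁻¹ * (Real.sqrt 2 : ℂ)⁻¹ = 1 / 2 := by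
    rw [← mul_inv, ← Complex.ofReal_mul, Real.mul_self_sqrt (by norm_num)]; norm_num
  ext i j
  fin_cases i <;> fin_cases j <;> simp [hadamard, Matrix.mul_apply, hs] <;> norm_num

theorem hadamard_mulVec_ketZero : hadamard *ᵥ ketZero = ketPlus := by
  funext i
  fin_cases i <;> simp [hadamard, ketZero, ketPlus, Matrix.mulVec, dotProduct]

theorem hadamard_mulVec_ketPlus : hadamard *ᵥ ketPlus = ketZero := by
  rw [← hadamard_mulVec_ketZero, mulVec_mulVec, hadamard_mul_self, one_mulVec]

theorem hadamard_apply (a b : Fin 2) : hadamard a b = sgn (a * b) * (1 / (Real.sqrt 2 : ℂ)) := by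
  fin_cases a <;> fin_cases b <;> simp [hadamard]

theorem hadamard_mulVec_single (b x : Fin 2) :
    (hadamard *ᵥ Pi.single b 1) x = sgn (b * x) * (1 / (Real.sqrt 2 : ℂ)) := by
  rw [mulVec_single_one, col_apply, hadamard_apply, mul_comm x b]

end ProductStates

/-! ### Labels of the qubits of the simulating register -/

/-- The `j`-th qubit (for `j ≤ K`) attached to the qubit `v`. -/
def lab {N : ℕ} (K : ℕ) (v : Fin N) (j : ℕ) : Fin ((K + 1) * N) :=
  finProdFinEquiv (Fin.ofNat (K + 1) j, v)

section Lab

variable {N K : ℕ}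

theorem lab_val {v : Fin N} {j : ℕ} (hj : j ≤ K) : (lab K v j : ℕ) = v + N * j := by
  simp only [lab, finProdFinEquiv_apply_val, Fin.ofNat]
  rw [Nat.mod_eq_of_lt (by omega)]

theorem lab_inj {v v' : Fin N} {j j' : ℕ} (hj : j ≤ K) (hj' : j' ≤ K) :
    lab K v j = lab K v' j' ↔ v = v' ∧ j = j' := by
  simp only [lab, EmbeddingLike.apply_eq_iff_eq, Prod.mk.injEq, Fin.ofNat, Fin.mk.injEq]
  rw [Nat.mod_eq_of_lt (by omega), Nat.mod_eq_of_lt (by omega), and_comm]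

theorem exists_lab (w : Fin ((K + 1) * N)) : ∃ v : Fin N, ∃ j ≤ K, w = lab K v j := by
  obtain ⟨⟨j, v⟩, rfl⟩ := finProdFinEquiv.surjective w
  refine ⟨v, j, by omega, ?_⟩
  simp [lab]

end Lab

theorem Command.WellFormedFrom.not_mem_acts {V : Type} : ∀ {S : List V} {A : List (Command V)},
    WellFormedFrom S A → ∀ v ∈ S, ∀ q ∈ A, v ∉ q.acts
  | _, [], _, _, _, _, hq => absurd hq (by simp)
  | S, c :: A, h, v, hv, q, hq => by
    rcases List.mem_cons.1 hq with rfl | hq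
    · exact fun h' => h.1.2.2.1 v h' hv
    · exact h.2.not_mem_acts v (List.mem_append_right _ hv) q hq

/-! ### Circuits which simulate measurement patterns -/

namespace Pattern

section Simulation

variable {N : ℕ}

/-- The Pauli operator `Z` on `(i, 0)`, by means of an arbitrary second qubit: the alternating
product of four `ΛZ` and four `H` is `1` or `(HZ)⁴ = -1` on the second qubit. -/
def zGates (L : ℕ) (i : Fin N) : List (Gate (Fin ((L + 1) * N))) :=
  [.CZ (lab L i 1) (lab L i 0), .H (lab L i 1), .CZ (lab L i 1) (lab L i 0), .H (lab L i 1),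
   .CZ (lab L i 1) (lab L i 0), .H (lab L i 1), .CZ (lab L i 1) (lab L i 0), .H (lab L i 1)]

/-- Gates which, followed by `H`, map the basis of a measurement to the standard basis. -/
def rotGates (L : ℕ) (i : Fin N) : Angle → List (Gate (Fin ((L + 1) * N)))
  | .zero => []
  | .pi => zGates L i
  | .irr => [.H (lab L i 0)] ++ zGates L i ++ [.H (lab L i 0), .Rz (lab L i 0)]

/-- The qubits which hold copies of the outcome of `i`, one for each command of the pattern. -/
def copies (L : ℕ) (i : Fin N) : List (Fin ((L + 1) * N)) :=
  (List.range L).map fun c => lab L i (c + 1)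

/-- The gates for the `c`-th command. The outcome `s_i` is present in the copies as the state
`H |s_i⟩`, so that a fan-out gate onto copies of the terms of a signal adds the sign given by the
signal. -/
def block (L c : ℕ) : Command (Fin N) → List (Gate (Fin ((L + 1) * N)))
  | .E i j => [.CZ (lab L i 0) (lab L j 0)]
  | .M i a => rotGates L i a ++ [.H (lab L i 0), .fan (copies L i) (lab L i 0)] ++
      (copies L i).map .H
  | .X i σ => [.H (lab L i 0), .fan (σ.map fun v => lab L v (c + 1)) (lab L i 0), .H (lab L i 0)]
  | .Z i σ => [.fan (σ.map fun v => lab L v (c + 1)) (lab L i 0)]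

/-- The commands, numbered from `c`, with their gates. -/
def blocks (L : ℕ) : ℕ → List (Command (Fin N)) → List (Command (Fin N) × List (Gate (Fin ((L + 1) * N))))
  | _, [] => []
  | c, q :: A => (q, block L c q) :: blocks L (c + 1) A

theorem mem_blocks {L : ℕ} {x : Command (Fin N) × List (Gate (Fin ((L + 1) * N)))} :
    ∀ {c : ℕ} {A : List (Command (Fin N))}, x ∈ blocks L c A →
      x.1 ∈ A ∧ ∃ c', c ≤ c' ∧ c' < c + A.length ∧ x.2 = block L c' x.1
  | _, [], h => by simp [blocks] at h
  | c, q :: A, h => by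
    rcases List.mem_cons.1 h with rfl | h
    · exact ⟨by simp, c, le_rfl, by simp, rfl⟩
    · obtain ⟨h1, c', h2, h3, h4⟩ := mem_blocks h
      exact ⟨List.mem_cons_of_mem _ h1, c', by omega, by simp only [List.length_cons]; omega, h4⟩

theorem map_fst_blocks (L : ℕ) : ∀ (c : ℕ) (A : List (Command (Fin N))),
    (blocks L c A).map Prod.fst = A
  | _, [] => rfl
  | c, q :: A => by rw [blocks, List.map_cons, map_fst_blocks L]

/-- The gates of the simulating circuit. Its inputs and all the other qubits `(v, 0)` are brought
into their initial states in the pattern first. -/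
def simGates (t : Pattern) : List (Gate (Fin ((t.commands.length + 1) * t.numQubits))) :=
  (List.finRange t.numQubits).map (fun v => Gate.H (lab _ v 0)) ++
    t.inputs.map (fun v => Gate.H (lab _ v 0)) ++
    (blocks t.commands.length 0 t.commands).flatMap Prod.snd

/-- The simulating circuit. The outcome of a measured qubit is stored in the qubit itself. -/
def toCircuit (t : Pattern) : Circuit where
  numQubits := (t.commands.length + 1) * t.numQubits
  inputs := t.inputs.map fun v => lab _ v 0
  outputs := t.outputs.map fun v => lab _ v 0
  gates := t.simGates

variable {L c : ℕ}

theorem mem_acts_block {q : Command (Fin N)} (hc : c < L) {p : Gate (Fin ((L + 1) * N))}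
    (hp : p ∈ block L c q) {w : Fin ((L + 1) * N)} (hw : w ∈ p.acts) :
    (∃ v ∈ q.acts, w = lab L v 0) ∨
      (∃ v ∈ q.measured, ∃ j < L, w = lab L v (j + 1)) ∨
      ∃ v ∈ q.signals, w = lab L v (c + 1) := by
  cases q with
  | E i j =>
    simp only [block, List.mem_singleton] at hp
    subst hp
    simp only [Gate.acts, List.mem_cons, List.not_mem_nil, or_false] at hw
    left
    rcases hw with rfl | rfl
    · exact ⟨i, by simp [Command.acts], rfl⟩
    · exact ⟨j, by simp [Command.acts], rfl⟩
  | M i a =>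
    have h0 : (∃ v ∈ (Command.M i a).acts, lab L i 0 = lab L v 0) :=
      ⟨i, by simp [Command.acts], rfl⟩
    have h1 : ∀ j < L, ∃ v ∈ (Command.M i a).measured, ∃ j' < L, lab L i (j + 1) = lab L v (j' + 1) :=
      fun j hj => ⟨i, by simp [Command.measured], j, hj, rfl⟩
    have h1' := h1 0 (by omega)
    simp only [block, List.mem_append, List.mem_cons, List.not_mem_nil, or_false, copies,
      List.map_map, List.mem_map, List.mem_range, Function.comp_apply] at hp
    rcases hp with (hp | rfl | rfl) | ⟨j, hj, rfl⟩
    · cases a <;> simp only [rotGates, zGates, List.mem_cons, List.not_mem_nil,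
        or_false, List.cons_append, List.nil_append] at hp
      · rcases hp with rfl | rfl | rfl | rfl | rfl | rfl | rfl | rfl <;>
        · simp only [Gate.acts, List.mem_cons, List.not_mem_nil, or_false] at hw
          rcases hw with rfl | rfl <;> simp only [h0, h1', true_or, or_true]
      · rcases hp with rfl | rfl | rfl | rfl | rfl | rfl | rfl | rfl | rfl | rfl | rfl <;>
        · simp only [Gate.acts, List.mem_cons, List.not_mem_nil, or_false] at hw
          rcases hw with rfl | rfl <;> simp only [h0, h1', true_or, or_true]
    · simp only [Gate.acts, List.mem_singleton] at hw
      subst hw; exact .inl h0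
    · simp only [Gate.acts, List.mem_append, List.mem_map, List.mem_range, List.mem_singleton] at hw
      rcases hw with ⟨j, hj, rfl⟩ | rfl
      · exact .inr (.inl (h1 j hj))
      · exact .inl h0
    · simp only [Gate.acts, List.mem_singleton] at hw
      subst hw; exact .inr (.inl (h1 j hj))
  | X i σ =>
    have h0 : (∃ v ∈ (Command.X i σ).acts, lab L i 0 = lab L v 0) :=
      ⟨i, by simp [Command.acts], rfl⟩
    simp only [block, List.mem_cons, List.not_mem_nil, or_false] at hp
    rcases hp with rfl | rfl | rfl
    · simp only [Gate.acts, List.mem_singleton] at hw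
      subst hw; exact .inl h0
    · simp only [Gate.acts, List.mem_append, List.mem_map, List.mem_singleton] at hw
      rcases hw with ⟨v, hv, rfl⟩ | rfl
      · exact .inr (.inr ⟨v, hv, rfl⟩)
      · exact .inl h0
    · simp only [Gate.acts, List.mem_singleton] at hw
      subst hw; exact .inl h0
  | Z i σ =>
    simp only [block, List.mem_singleton] at hp
    subst hp
    simp only [Gate.acts, List.mem_append, List.mem_map, List.mem_singleton] at hw
    rcases hw with ⟨v, hv, rfl⟩ | rfl
    · exact .inr (.inr ⟨v, hv, rfl⟩)
    · exact .inl ⟨i, by simp [Command.acts], rfl⟩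

theorem nodup_acts_block {q : Command (Fin N)} (hc : c < L) (hq : q.acts.Nodup)
    (hq' : q.signals.Nodup) : ∀ p ∈ block L c q, p.acts.Nodup := by
  have hfan : ∀ (i : Fin N) (σ : List (Fin N)), σ.Nodup →
      (Gate.fan (σ.map fun v => lab L v (c + 1)) (lab L i 0)).acts.Nodup := by
    intro i σ hσ
    simp only [Gate.acts, List.nodup_append, List.nodup_singleton, List.mem_map,
      List.mem_singleton]
    refine ⟨hσ.map fun a b h => ((lab_inj (by omega) (by omega)).1 h).1, trivial, ?_⟩
    rintro _ ⟨v, -, rfl⟩ _ rfl h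
    have := ((lab_inj (by omega) (by omega)).1 h).2
    omega
  cases q with
  | E i j =>
    intro p hp
    simp only [block, List.mem_singleton] at hp
    subst hp
    simp only [Command.acts, Gate.acts, List.nodup_cons, List.mem_singleton, List.not_mem_nil,
      not_false_eq_true, List.nodup_nil, and_true] at hq ⊢
    rwa [lab_inj (by omega) (by omega), and_iff_left rfl]
  | M i a =>
    have h10 : lab L i 1 ≠ lab L i 0 := by
      rw [Ne, lab_inj (by omega) (by omega)]; simp
    intro p hp
    simp only [block, List.mem_append, List.mem_cons, List.not_mem_nil, or_false,
      List.mem_map] at hp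
    rcases hp with (hp | rfl | rfl) | ⟨j, hj, rfl⟩
    · cases a <;> simp only [rotGates, zGates, List.mem_cons, List.not_mem_nil,
        or_false, List.cons_append, List.nil_append] at hp
      · rcases hp with rfl | rfl | rfl | rfl | rfl | rfl | rfl | rfl <;> simp [Gate.acts, h10]
      · rcases hp with rfl | rfl | rfl | rfl | rfl | rfl | rfl | rfl | rfl | rfl | rfl <;>
          simp [Gate.acts, h10]
    · simp [Gate.acts]
    · simp only [Gate.acts, copies, List.nodup_append, List.nodup_singleton, List.mem_map,
        List.mem_singleton, List.mem_range]
      refine ⟨List.Nodup.map_on ?_ List.nodup_range, trivial, ?_⟩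
      · intro a ha b hb h
        rw [List.mem_range] at ha hb
        have := ((lab_inj (by omega) (by omega)).1 h).2
        omega
      · rintro _ ⟨j, hj, rfl⟩ _ rfl h
        have := ((lab_inj (by omega) (by omega)).1 h).2
        omega
    · simp [Gate.acts]
  | X i σ =>
    intro p hp
    simp only [block, List.mem_cons, List.not_mem_nil, or_false] at hp
    rcases hp with rfl | rfl | rfl
    · simp [Gate.acts]
    · exact hfan i σ hq'
    · simp [Gate.acts]
  | Z i σ =>
    intro p hp
    simp only [block, List.mem_singleton] at hp
    subst hp
    exact hfan i σ hq'

theorem chainDepth_map_H_le {V β : Type} (f : β → V) (l : List β) (h : (l.map f).Nodup) :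
    chainDepth Gate.Dep (l.map fun v => Gate.H (f v)) ≤ 1 := by
  refine chainDepth_le_of_level (fun _ => 0) (by simp) ?_
  rw [List.pairwise_map]
  rw [List.Nodup, List.pairwise_map] at h
  refine h.imp fun {a b} hab => ?_
  rintro ⟨v, h1, h2⟩
  simp only [Gate.acts, List.mem_singleton] at h1 h2
  exact absurd (h1.symm.trans h2) hab

theorem copies_nodup (i : Fin N) : (copies L i).Nodup := by
  refine List.Nodup.map_on ?_ List.nodup_range
  intro a ha b hb h
  rw [List.mem_range] at ha hb
  have := ((lab_inj (by omega) (by omega)).1 h).2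
  omega

theorem chainDepth_block_le (q : Command (Fin N)) :
    chainDepth Gate.Dep (block L c q) ≤ 14 := by
  have hlen : ∀ l : List (Gate (Fin ((L + 1) * N))), chainDepth Gate.Dep l ≤ l.length :=
    fun l => chainDepth_le fun l' h _ => h.length_le
  cases q with
  | E i j => exact (hlen _).trans (by simp [block])
  | X i σ => exact (hlen _).trans (by simp [block])
  | Z i σ => exact (hlen _).trans (by simp [block])
  | M i a =>
    have h1 : (rotGates L i a ++
        [Gate.H (lab L i 0), Gate.fan (copies L i) (lab L i 0)]).length ≤ 13 := by
      cases a <;> simp [rotGates, zGates]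
    have h2 := chainDepth_map_H_le id (copies L i) (by simpa using copies_nodup i)
    exact (chainDepth_append_le _ _).trans (Nat.add_le_add ((hlen _).trans h1) h2)

theorem _root_.MBQC.Command.measured_subset_acts {V : Type} (q : Command V) :
    ∀ v ∈ q.measured, v ∈ q.acts := by
  cases q <;> simp [Command.measured, Command.acts]

theorem pairwise_blocks : ∀ {c : ℕ} {S : List (Fin N)} {A : List (Command (Fin N))},
    Command.WellFormedFrom S A → c + A.length ≤ L →
    (blocks L c A).Pairwise fun x y => ∀ p ∈ x.2, ∀ q ∈ y.2, Gate.Dep p q → Command.Dep x.1 y.1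
  | _, _, [], _, _ => by simp [blocks]
  | c, S, a :: A, h, hL => by
    rw [List.length_cons] at hL
    rw [blocks, List.pairwise_cons]
    refine ⟨?_, pairwise_blocks h.2 (by omega)⟩
    rintro ⟨b, l⟩ hy p hp q hq ⟨w, hwp, hwq⟩
    obtain ⟨hb, c', hc, hc', hl⟩ := mem_blocks hy
    simp only at hp hq hb hl ⊢
    subst hl
    have dom : ∀ v ∈ a.acts, v ∈ b.acts → Command.Dep a b := fun v h1 h2 =>
      ⟨v, h1, List.mem_append_left _ h2⟩
    rcases mem_acts_block (by omega) hp hwp with ⟨v, hv, rfl⟩ | ⟨v, hv, j, hj, rfl⟩ | ⟨v, hv, rfl⟩ <;>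
    rcases mem_acts_block (by omega) hq hwq with ⟨v', hv', e⟩ | ⟨v', hv', j', hj', e⟩ |
      ⟨v', hv', e⟩ <;>
    rw [lab_inj (by omega) (by omega)] at e <;> obtain ⟨rfl, e⟩ := e
    · exact dom v hv hv'
    · omega
    · omega
    · omega
    · exact dom v (Command.measured_subset_acts _ _ hv) (Command.measured_subset_acts _ _ hv')
    · exact ⟨v, Command.measured_subset_acts _ _ hv, List.mem_append_right _ hv'⟩
    · omega
    · exact absurd (Command.measured_subset_acts _ _ hv')
        (h.2.not_mem_acts v (List.mem_append_right _ (h.1.2.2.2 v hv)) b hb)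
    · omega

theorem _root_.MBQC.Command.WellFormedFrom.nodup {V : Type} : ∀ {S : List V}
    {A : List (Command V)}, Command.WellFormedFrom S A →
      ∀ q ∈ A, q.acts.Nodup ∧ q.signals.Nodup
  | _, [], _, _, hq => absurd hq (by simp)
  | S, c :: A, h, q, hq => by
    rcases List.mem_cons.1 hq with rfl | hq
    · exact ⟨h.1.1, h.1.2.1⟩
    · exact h.2.nodup q hq

theorem lab_injective {K j : ℕ} (hj : j ≤ K) :
    Function.Injective fun v : Fin N => lab K v j :=
  fun _ _ h => ((lab_inj hj hj).1 h).1

theorem nodup_acts_simGates {t : Pattern} (h : t.WellFormed) :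
    ∀ g ∈ t.simGates, g.acts.Nodup := by
  intro g hg
  simp only [simGates, List.mem_append, List.mem_map, List.mem_flatMap] at hg
  rcases hg with (⟨v, -, rfl⟩ | ⟨v, -, rfl⟩) | ⟨x, hx, hg⟩
  · simp [Gate.acts]
  · simp [Gate.acts]
  · obtain ⟨h1, c, -, h2, h3⟩ := mem_blocks hx
    rw [h3] at hg
    have := h.commands_wf.nodup _ h1
    exact nodup_acts_block (by omega) this.1 this.2 g hg

theorem toCircuit_wellFormed {t : Pattern} (h : t.WellFormed) : t.toCircuit.WellFormed where
  inputs_nodup := h.inputs_nodup.map (lab_injective (Nat.zero_le _))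
  outputs_nodup := h.outputs_nodup.map (lab_injective (Nat.zero_le _))
  gates_wf := nodup_acts_simGates h

/-- Each command becomes a block of depth at most `14`. The two additional layers put the qubits which
are not inputs into the state `|+⟩`: `H` is applied to all the qubits and once more to the inputs. -/
theorem toCircuit_depth_le {t : Pattern} (h : t.WellFormed) :
    t.toCircuit.depth ≤ 14 * t.depth + 2 := by
  have h1 := chainDepth_map_H_le (fun v => lab t.commands.length v 0) (List.finRange t.numQubits)
    ((List.nodup_finRange _).map (lab_injective (Nat.zero_le _)))
  have h2 := chainDepth_map_H_le (fun v => lab t.commands.length v 0) t.inputs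
    (h.inputs_nodup.map (lab_injective (Nat.zero_le _)))
  have h3 := chainDepth_flatMap_le (T := Gate.Dep) (R := Command.Dep) (K := 14)
    (l := blocks t.commands.length 0 t.commands)
    (fun x hx => by
      obtain ⟨-, c, -, -, h3⟩ := mem_blocks hx
      rw [h3]; exact chainDepth_block_le _)
    (pairwise_blocks h.commands_wf (by omega))
  rw [map_fst_blocks] at h3
  have h4 := chainDepth_append_le (R := Gate.Dep)
    ((List.finRange t.numQubits).map (fun v => Gate.H (lab t.commands.length v 0)))
    (t.inputs.map (fun v => Gate.H (lab t.commands.length v 0)))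
  have h5 := chainDepth_append_le (R := Gate.Dep)
    ((List.finRange t.numQubits).map (fun v => Gate.H (lab t.commands.length v 0)) ++
      t.inputs.map (fun v => Gate.H (lab t.commands.length v 0)))
    ((blocks t.commands.length 0 t.commands).flatMap Prod.snd)
  have h6 : t.toCircuit.depth = chainDepth Gate.Dep t.simGates := rfl
  rw [h6, simGates, depth]
  omega

end Simulation
end Pattern

/-! ### Superpositions of different outcomes -/

section Run

variable {W : Type} [Fintype W] [DecidableEq W]

/-- The result of a sequence of gates. -/
noncomputable def runGates (α₀ : ℝ) (l : List (Gate W)) (ψ : QState W) : QState W :=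
  l.foldl (fun ψ g => g.apply α₀ ψ) ψ

theorem runGates_append (α₀ : ℝ) (l l' : List (Gate W)) (ψ : QState W) :
    runGates α₀ (l ++ l') ψ = runGates α₀ l' (runGates α₀ l ψ) := List.foldl_append

theorem Gate.apply_add (α₀ : ℝ) (g : Gate W) (φ ψ : QState W) :
    g.apply α₀ (φ + ψ) = g.apply α₀ φ + g.apply α₀ ψ := by
  cases g with
  | H i => exact applyOne_add _ _ _ _
  | Rz i => exact applyOne_add _ _ _ _
  | CZ i j => exact applyCZ_add _ _ _ _
  | fan ts c => rfl

theorem runGates_add (α₀ : ℝ) : ∀ (l : List (Gate W)) (φ ψ : QState W),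
    runGates α₀ l (φ + ψ) = runGates α₀ l φ + runGates α₀ l ψ
  | [], _, _ => rfl
  | g :: l, φ, ψ => by
    simp only [runGates, List.foldl_cons, Gate.apply_add]
    exact runGates_add α₀ l _ _

/-- The qubit `q` is in the basis state `b`. -/
def SuppAt (q : W) (b : Fin 2) (χ : QState W) : Prop := ∀ z, z q ≠ b → χ z = 0

theorem SuppAt.apply {q : W} {b : Fin 2} {χ : QState W} (h : SuppAt q b χ) (α₀ : ℝ) {g : Gate W}
    (hq : q ∉ g.acts) : SuppAt q b (g.apply α₀ χ) := by
  have one : ∀ U i, q ≠ i → SuppAt q b (applyOne U i χ) := by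
    intro U i hi z hz
    refine Finset.sum_eq_zero fun c _ => ?_
    rw [h _ (by rwa [Function.update_of_ne hi]), mul_zero]
  cases g with
  | H i => exact one _ i (by simpa [Gate.acts] using hq)
  | Rz i => exact one _ i (by simpa [Gate.acts] using hq)
  | CZ i j =>
    intro z hz
    simp [Gate.apply, applyCZ_apply, h z hz]
  | fan ts c =>
    intro z hz
    simp only [Gate.acts, List.mem_append, not_or] at hq
    exact h _ (by simpa [fanBasis, hq.1] using hz)

theorem SuppAt.runGates (α₀ : ℝ) {q : W} {b : Fin 2} : ∀ {l : List (Gate W)} {χ : QState W},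
    SuppAt q b χ → (∀ g ∈ l, q ∉ g.acts) → SuppAt q b (runGates α₀ l χ)
  | [], _, h, _ => h
  | g :: l, χ, h, hl => by
    change SuppAt q b (MBQC.runGates α₀ l (g.apply α₀ χ))
    exact SuppAt.runGates α₀ (h.apply α₀ (hl g List.mem_cons_self))
      fun g hg => hl g (List.mem_cons_of_mem _ hg)

/-- Different basis states of one qubit do not interfere. -/
theorem probOnes_add_of_suppAt {q : W} {φ ψ : QState W} (hφ : SuppAt q 0 φ) (hψ : SuppAt q 1 ψ)
    (outputs : List W) : probOnes outputs (φ + ψ) = probOnes outputs φ + probOnes outputs ψ := by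
  simp only [probOnes, ← Finset.sum_add_distrib]
  refine Finset.sum_congr rfl fun z _ => ?_
  have h : ‖(φ + ψ) z‖ ^ 2 = ‖φ z‖ ^ 2 + ‖ψ z‖ ^ 2 := by
    by_cases hz : z q = 0
    · have : ψ z = 0 := hψ z (by rw [hz]; decide)
      simp [this]
    · simp [hφ z hz]
  split_ifs <;> simp only [h, add_zero]

/-- The operator `M x` on the qubit `a`, controlled by the value `x` of the qubit `w`. -/
def applyCtl (M : Fin 2 → Matrix (Fin 2) (Fin 2) ℂ) (w a : W) (χ : QState W) : QState W :=
  fun y => ∑ c, M (y w) (y a) c * χ (Function.update y a c)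

theorem applyCtl_applyCtl {w a : W} (h : w ≠ a) (M M' : Fin 2 → Matrix (Fin 2) (Fin 2) ℂ)
    (χ : QState W) : applyCtl M w a (applyCtl M' w a χ) = applyCtl (M * M') w a χ := by
  funext y
  simp only [applyCtl, Function.update_of_ne h, Function.update_self, Function.update_idem,
    Fin.sum_univ_two, Pi.mul_apply, Matrix.mul_apply]
  ring

theorem inv_sqrt_two_mul_self : (Real.sqrt 2 : ℂ)⁻¹ * (Real.sqrt 2 : ℂ)⁻¹ = 1 / 2 := by
  rw [← mul_inv, ← Complex.ofReal_mul, Real.mul_self_sqrt (by norm_num)]; norm_num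

end Run

namespace Pattern

section Simulation

variable {N L : ℕ}

theorem runGates_zGates (α₀ : ℝ) (hL : 1 ≤ L) (i : Fin N) (χ : QState (Fin ((L + 1) * N))) :
    runGates α₀ (zGates L i) χ = applyOne pauliZ (lab L i 0) χ := by
  have hne : lab L i 0 ≠ lab L i 1 := by
    rw [Ne, lab_inj (by omega) hL]; simp
  let M : Fin 2 → Matrix (Fin 2) (Fin 2) ℂ := fun x => Matrix.of fun b c =>
    hadamard b c * sgn (c * x)
  have h1 : ∀ χ : QState (Fin ((L + 1) * N)),
      applyOne hadamard (lab L i 1) (applyCZ (lab L i 1) (lab L i 0) χ) =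
        applyCtl M (lab L i 0) (lab L i 1) χ := by
    intro χ
    funext y
    simp only [applyOne, applyCZ_apply, applyCtl, M, Matrix.of_apply, Function.update_self,
      Function.update_of_ne hne, mul_assoc]
  have hM : ∀ x, (M * (M * (M * M))) x = sgn x • (1 : Matrix (Fin 2) (Fin 2) ℂ) := by
    intro x
    have h2 : (M * M) x = if x = 0 then 1 else !![0, -1; 1, 0] := by
      ext b c
      fin_cases x <;> fin_cases b <;> fin_cases c <;>
        simp [M, Matrix.mul_apply, hadamard, inv_sqrt_two_mul_self] <;> norm_num
    rw [← mul_assoc, Pi.mul_apply, h2]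
    ext b c
    fin_cases x <;> fin_cases b <;> fin_cases c <;> simp
  simp only [zGates, runGates, List.foldl_cons, List.foldl_nil, Gate.apply, h1,
    applyCtl_applyCtl hne]
  funext y
  simp only [applyCtl, hM, Matrix.smul_apply, smul_eq_mul]
  have e := pauliZ_pow_apply 1 (lab L i 0) χ y
  simp only [Fin.val_one, pow_one, mul_one] at e
  rw [e, Finset.sum_eq_single (y (lab L i 1))]
  · simp
  · intro c _ hc
    rw [Matrix.one_apply_ne hc.symm]; simp
  · simp

/-- The operator implemented by `rotGates`. -/
noncomputable def rotMat (α₀ : ℝ) : Angle → Matrix (Fin 2) (Fin 2) ℂ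
  | .zero => 1
  | .pi => pauliZ
  | .irr => rotZ α₀ * (hadamard * (pauliZ * hadamard))

theorem runGates_rotGates (α₀ : ℝ) (hL : 1 ≤ L) (i : Fin N) (a : Angle)
    (χ : QState (Fin ((L + 1) * N))) :
    runGates α₀ (rotGates L i a) χ = applyOne (rotMat α₀ a) (lab L i 0) χ := by
  cases a with
  | zero =>
    funext y
    simp only [rotGates, rotMat, applyOne]
    rw [Finset.sum_eq_single (y (lab L i 0))]
    · simp [runGates]
    · intro c _ hc
      rw [Matrix.one_apply_ne hc.symm]; simp
    · simp
  | pi => exact runGates_zGates α₀ hL i χ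
  | irr =>
    rw [rotGates, runGates_append, runGates_append, runGates_zGates α₀ hL, rotMat,
      ← applyOne_mul, ← applyOne_mul, ← applyOne_mul]
    rfl

/-- The operator on the measured qubit for the outcome `b`: a change of basis followed by the
projection to `|b⟩`. -/
noncomputable def outcomeMat (α₀ : ℝ) (a : Angle) (b : Fin 2) : Matrix (Fin 2) (Fin 2) ℂ :=
  Matrix.single b b 1 * (hadamard * rotMat α₀ a)

/-- The change of basis followed by the projection onto a basis state has the same Gram matrix as the
measurement operator, so it yields the same probabilities. -/
theorem outcomeMat_gram (α₀ : ℝ) (a : Angle) (b : Fin 2) :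
    (outcomeMat α₀ a b)ᴴ * outcomeMat α₀ a b = projAngle (a.val α₀) b := by
  have he : ∀ x : ℝ, (starRingEnd ℂ) (Complex.exp (Complex.I * x)) =
      Complex.exp (-(Complex.I * x)) := by
    intro x; rw [← Complex.exp_conj]; simp
  have hc : ∀ x : ℝ, Complex.exp (Complex.I * x) * Complex.exp (-(Complex.I * x)) = 1 := by
    intro x; rw [← Complex.exp_add]; simp
  have hpi : Complex.exp (Complex.I * (Real.pi : ℝ)) = -1 := by
    rw [mul_comm, Complex.exp_pi_mul_I]
  -- the `b`-th row is the adjoint of the vector of the measurement basis, up to a phase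
  have key : ∃ u : ℂ, star u * u = 1 ∧ ∀ x, (hadamard * rotMat α₀ a) b x =
      u * star (ketAngle (a.val α₀) b x) := by
    cases a with
    | zero =>
      refine ⟨1, by simp, fun x => ?_⟩
      fin_cases b <;> fin_cases x <;> simp [rotMat, hadamard, ketAngle, Angle.val, div_eq_mul_inv]
    | pi =>
      refine ⟨1, by simp, fun x => ?_⟩
      fin_cases b <;> fin_cases x <;>
        simp [rotMat, hadamard, ketAngle, Angle.val, pauliZ, hpi, Matrix.mul_apply,
          div_eq_mul_inv]
    | irr =>
      refine ⟨sgn b * Complex.exp (Complex.I * α₀), ?_, fun x => ?_⟩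
      · have hb : star (sgn b) = sgn b := by fin_cases b <;> simp
        rw [star_mul', hb, Complex.star_def, he]
        linear_combination sgn b * sgn b * hc α₀ + sgn_mul_self b
      · have h3 : ∀ i j, (hadamard * (pauliZ * hadamard)) i j = pauliX i j := by
          intro i j
          fin_cases i <;> fin_cases j <;>
            simp [hadamard, pauliZ, pauliX, Matrix.mul_apply, inv_sqrt_two_mul_self] <;> norm_num
        have h3' : hadamard * (pauliZ * hadamard) = pauliX := Matrix.ext h3
        rw [rotMat, h3']
        have hc' := hc α₀
        fin_cases b <;> fin_cases x <;>
          simp [hadamard, ketAngle, Angle.val, pauliX, rotZ, Matrix.mul_apply, he,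
            div_eq_mul_inv] <;> first | ring1 | linear_combination -(Real.sqrt 2 : ℂ)⁻¹ * hc'
  obtain ⟨u, hu, h⟩ := key
  have hrow : ∀ k x, outcomeMat α₀ a b k x =
      if k = b then u * star (ketAngle (a.val α₀) b x) else 0 := by
    intro k x
    rw [outcomeMat]
    split_ifs with hk
    · subst hk; rw [Matrix.single_mul_apply_same, one_mul, h]
    · rw [Matrix.single_mul_apply_of_ne _ _ _ _ _ hk]
  ext x y
  rw [Matrix.mul_apply, Finset.sum_eq_single b]
  · rw [conjTranspose_apply, hrow, if_pos rfl, hrow, if_pos rfl, projAngle, vecMulVec_apply,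
      star_mul', star_star, Pi.star_apply]
    linear_combination ketAngle (a.val α₀) b x * star (ketAngle (a.val α₀) b y) * hu
  · intro k _ hk
    rw [hrow k y, if_neg hk, mul_zero]
  · simp

/-- The states of the auxiliary qubits when the qubits in `S` have been measured with outcomes `s`,
with factors `1` for the qubits `(v, 0)`. -/
noncomputable def ancState (L : ℕ) (S : List (Fin N)) (s : Fin N → Fin 2) (w : Fin ((L + 1) * N)) :
    Fin 2 → ℂ :=
  if (finProdFinEquiv.symm w).1 = 0 then 1
  else if (finProdFinEquiv.symm w).2 ∈ S then hadamard *ᵥ Pi.single (s (finProdFinEquiv.symm w).2) 1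
  else ketZero

theorem ancState_zero (S : List (Fin N)) (s : Fin N → Fin 2) (v : Fin N) :
    ancState L S s (lab L v 0) = 1 := by
  simp [ancState, lab]

theorem ancState_succ (S : List (Fin N)) (s : Fin N → Fin 2) (v : Fin N) {j : ℕ} (hj : j < L) :
    ancState L S s (lab L v (j + 1)) =
      if v ∈ S then hadamard *ᵥ Pi.single (s v) 1 else ketZero := by
  have : Fin.ofNat (L + 1) (j + 1) ≠ 0 := by
    rw [Ne, Fin.ext_iff]
    simp only [Fin.ofNat, Fin.val_zero]
    rw [Nat.mod_eq_of_lt (by omega)]; omega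
  simp only [ancState, lab, Equiv.symm_apply_apply, if_neg this]

theorem not_mem_range_lab {w : Fin ((L + 1) * N)} :
    w ∉ Set.range (fun v : Fin N => lab L v 0) → ∃ v, ∃ j < L, w = lab L v (j + 1) := by
  intro hw
  obtain ⟨v, j, hj, rfl⟩ := exists_lab w
  cases j with
  | zero => exact absurd ⟨v, rfl⟩ hw
  | succ j => exact ⟨v, j, by omega, rfl⟩

/-- Fan-out gates onto copies of outcomes act as a power of `Z`. -/
theorem applyFan_signal {c : ℕ} (hc : c < L) {S : List (Fin N)} (s : Fin N → Fin 2)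
    {σ : List (Fin N)} (hσ : σ.Nodup) (hS : ∀ v ∈ σ, v ∈ S) (i : Fin N) (ψ : QState (Fin N)) :
    applyFan (σ.map fun v => lab L v (c + 1)) (lab L i 0)
      (prodLift (fun v => lab L v 0) (ancState L S s) ψ) =
    prodLift (fun v => lab L v 0) (ancState L S s)
      (applyOne (pauliZ ^ ((σ.map s).sum : Fin 2).val) i ψ) := by
  funext z
  set ts := σ.map fun v => lab L v (c + 1) with hts
  have hmain : (fanBasis ts (lab L i 0) z) ∘ (fun v => lab L v 0) = z ∘ fun v => lab L v 0 := by
    funext v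
    simp only [Function.comp_apply, fanBasis]
    rw [if_neg]
    simp only [hts, List.mem_map, not_exists, not_and]
    intro v' _ h
    have := ((lab_inj (by omega) (by omega)).1 h).2
    omega
  have hfac : ∀ w, ancState L S s w (fanBasis ts (lab L i 0) z w) =
      ancState L S s w (z w) * if w ∈ ts then sgn (z (lab L i 0) *
        s (finProdFinEquiv.symm w).2) else 1 := by
    intro w
    by_cases hw : w ∈ ts
    · rw [if_pos hw, fanBasis, if_pos hw]
      rw [hts, List.mem_map] at hw
      obtain ⟨v, hv, rfl⟩ := hw
      rw [ancState_succ _ _ _ hc, if_pos (hS v hv), hadamard_mulVec_single,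
        hadamard_mulVec_single, mul_add, sgn_add]
      simp only [lab, Equiv.symm_apply_apply, mul_comm (s v)]
      ring
    · rw [if_neg hw, fanBasis, if_neg hw, mul_one]
  have hprod : (∏ w, if w ∈ ts then sgn (z (lab L i 0) * s (finProdFinEquiv.symm w).2) else 1) =
      sgn (z (lab L i 0) * (σ.map s).sum) := by
    have hnd : ts.Nodup := hσ.map (lab_injective (by omega))
    have h1 : (∏ w, if w ∈ ts then sgn (z (lab L i 0) * s (finProdFinEquiv.symm w).2) else 1) =
        (ts.map fun w => sgn (z (lab L i 0) * s (finProdFinEquiv.symm w).2)).prod := by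
      rw [← List.prod_toFinset _ hnd]
      rw [← Finset.prod_filter]
      refine Finset.prod_congr ?_ fun _ _ => rfl
      ext w; simp
    rw [h1, hts, List.map_map]
    have h2 : ((fun w : Fin ((L + 1) * N) => sgn (z (lab L i 0) * s (finProdFinEquiv.symm w).2)) ∘
        fun v => lab L v (c + 1)) = fun v => sgn (z (lab L i 0) * s v) := by
      funext v; simp only [lab, Function.comp_apply, Equiv.symm_apply_apply]
    rw [h2]
    have h3 : ∀ (σ : List (Fin N)) (x : Fin 2),
        (σ.map fun v => sgn (x * s v)).prod = sgn (x * (σ.map s).sum) := by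
      intro σ x
      induction σ with
      | nil => simp
      | cons v σ ih => simp only [List.map_cons, List.prod_cons, List.sum_cons, ih, mul_add, sgn_add]
    exact h3 σ _
  simp only [applyFan, prodLift, hmain, prodState, hfac, Finset.prod_mul_distrib, hprod,
    pauliZ_pow_apply, Function.comp_apply]
  ring

theorem hadamard_pauliZ_pow_hadamard (k : Fin 2) :
    hadamard * (pauliZ ^ k.val * hadamard) = pauliX ^ k.val := by
  ext i j
  fin_cases k <;> fin_cases i <;> fin_cases j <;>
    simp [hadamard, pauliZ, pauliX, Matrix.mul_apply, inv_sqrt_two_mul_self] <;> norm_num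

theorem mem_copies {i : Fin N} {w : Fin ((L + 1) * N)} :
    w ∈ copies L i ↔ ∃ j < L, w = lab L i (j + 1) := by
  simp [copies, eq_comm]

/-- The outcome of a measured qubit is copied. -/
theorem runGates_copies (α₀ : ℝ) {S : List (Fin N)} (s : Fin N → Fin 2) {i : Fin N} (hi : i ∉ S)
    (ψ : QState (Fin N)) :
    runGates α₀ (Gate.fan (copies L i) (lab L i 0) :: (copies L i).map .H)
      (prodLift (fun v => lab L v 0) (ancState L S s) ψ) =
    ∑ b, prodLift (fun v => lab L v 0) (ancState L (i :: S) (Function.update s i b))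
      (applyOne (Matrix.single b b 1) i ψ) := by
  have hcm : ∀ v, lab L v 0 ∉ copies L i := by
    intro v h
    obtain ⟨j, hj, e⟩ := mem_copies.1 h
    have := ((lab_inj (by omega) (by omega)).1 e).2
    omega
  let κ : Fin 2 → Fin ((L + 1) * N) → Fin 2 → ℂ := fun b w =>
    if w ∈ copies L i then Pi.single b 1 else ancState L S s w
  have hproj : ∀ (b : Fin 2) (z : Fin ((L + 1) * N) → Fin 2),
      applyOne (Matrix.single b b 1) i ψ (z ∘ fun v => lab L v 0) =
        if z (lab L i 0) = b then ψ (z ∘ fun v => lab L v 0) else 0 := by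
    intro b z
    simp only [applyOne]
    rw [Finset.sum_eq_single b]
    · by_cases hz : z (lab L i 0) = b
      · rw [if_pos hz]
        simp only [Function.comp_apply, hz, Matrix.single_apply_same, one_mul]
        congr 1
        exact Function.update_eq_self_iff.2 hz.symm
      · rw [if_neg hz, Function.comp_apply, Matrix.single_apply_of_row_ne (Ne.symm hz), zero_mul]
    · intro c _ hc
      rw [Matrix.single_apply_of_col_ne _ _ (Ne.symm hc), zero_mul]
    · simp
  have hfan : applyFan (copies L i) (lab L i 0)
      (prodLift (fun v => lab L v 0) (ancState L S s) ψ) =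
      ∑ b, prodLift (fun v => lab L v 0) (κ b) (applyOne (Matrix.single b b 1) i ψ) := by
    funext z
    have hmain : (fanBasis (copies L i) (lab L i 0) z) ∘ (fun v => lab L v 0) =
        z ∘ fun v => lab L v 0 := by
      funext v
      simp only [Function.comp_apply, fanBasis, if_neg (hcm v)]
    rw [Finset.sum_apply, Finset.sum_eq_single (z (lab L i 0))]
    · simp only [applyFan, prodLift, hmain, hproj, if_true]
      congr 1
      refine Finset.prod_congr rfl fun w _ => ?_
      by_cases hw : w ∈ copies L i
      · simp only [κ, if_pos hw, fanBasis]
        obtain ⟨j, hj, rfl⟩ := mem_copies.1 hw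
        rw [ancState_succ _ _ _ hj, if_neg hi]
        have : ∀ x y : Fin 2, ketZero (x + y) = (Pi.single y 1 : Fin 2 → ℂ) x := by
          intro x y
          fin_cases x <;> fin_cases y <;> simp [ketZero]
        exact this _ _
      · simp only [κ, if_neg hw, fanBasis]
    · intro b _ hb
      simp only [prodLift, hproj, if_neg hb.symm, zero_mul]
    · simp
  have hH : ∀ b, runGates α₀ ((copies L i).map .H)
      (prodLift (fun v => lab L v 0) (κ b) (applyOne (Matrix.single b b 1) i ψ)) =
      prodLift (fun v => lab L v 0) (ancState L (i :: S) (Function.update s i b))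
        (applyOne (Matrix.single b b 1) i ψ) := by
    intro b
    simp only [runGates, List.foldl_map, Gate.apply]
    unfold prodLift
    rw [foldl_applyOne_prodState hadamard
      (fun z => applyOne (Matrix.single b b 1) i ψ (z ∘ fun v => lab L v 0)) _ _ (copies_nodup i)]
    · funext z
      refine congrArg (fun κ => _ * prodState κ z) ?_
      funext w
      by_cases hw : w ∈ copies L i
      · simp only [κ, if_pos hw]
        obtain ⟨j, hj, rfl⟩ := mem_copies.1 hw
        rw [ancState_succ _ _ _ hj, if_pos List.mem_cons_self, Function.update_self]
      · simp only [κ, if_neg hw]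
        obtain ⟨v, j, hj, rfl⟩ := exists_lab w
        cases j with
        | zero => rw [ancState_zero, ancState_zero]
        | succ j =>
          have hv : v ≠ i := by
            rintro rfl
            exact hw (mem_copies.2 ⟨j, by omega, rfl⟩)
          rw [ancState_succ _ _ _ (by omega), ancState_succ _ _ _ (by omega),
            Function.update_of_ne hv]
          simp [hv]
    · intro w hw z b'
      congr 1
      funext v
      rw [Function.comp_apply, Function.comp_apply, Function.update_of_ne]
      rintro rfl
      exact hcm v hw
  simp only [runGates, List.foldl_cons, Gate.apply]
  rw [hfan, Fin.sum_univ_two, Fin.sum_univ_two]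
  exact (runGates_add α₀ _ _ _).trans (by rw [hH, hH])

theorem ancState_norm (S : List (Fin N)) (s : Fin N → Fin 2) (w : Fin ((L + 1) * N))
    (hw : w ∉ Set.range fun v : Fin N => lab L v 0) : ∑ b, ‖ancState L S s w b‖ ^ 2 = 1 := by
  obtain ⟨v, j, hj, rfl⟩ := not_mem_range_lab hw
  rw [ancState_succ _ _ _ hj]
  split_ifs
  · simp only [hadamard_mulVec_single, norm_mul, norm_sgn, Fin.sum_univ_two, one_mul]
    have : ‖(1 / (Real.sqrt 2 : ℂ))‖ ^ 2 = 1 / 2 := by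
      rw [norm_div, norm_one, Complex.norm_real, Real.norm_of_nonneg (Real.sqrt_nonneg _), div_pow,
        Real.sq_sqrt (by norm_num), one_pow]
    rw [this]; norm_num
  · simp [ketZero, Fin.sum_univ_two]

/-- The gates for the remaining commands reproduce the acceptance probability of the pattern. -/
theorem probOnes_runGates_blocks (α₀ : ℝ) (outputs : List (Fin N)) :
    ∀ (A : List (Command (Fin N))) (c : ℕ) (S : List (Fin N)) (s : Fin N → Fin 2)
      (ψ : QState (Fin N)), Command.WellFormedFrom S A → c + A.length ≤ L →
      (∀ q ∈ A, ∀ v ∈ q.measured, v ∉ outputs) →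
      probOnes (outputs.map fun v => lab L v 0) (runGates α₀ ((blocks L c A).flatMap Prod.snd)
        (prodLift (fun v => lab L v 0) (ancState L S s) ψ)) = prob α₀ outputs A ψ s
  | [], _, S, s, ψ, _, _, _ => by
    exact probOnes_prodLift (lab_injective (Nat.zero_le _)) (ancState_zero S s) (ancState_norm S s)
      outputs ψ
  | q :: A, c, S, s, ψ, h, hL, ho => by
    rw [List.length_cons] at hL
    have hinj : Function.Injective fun v : Fin N => lab L v 0 := lab_injective (Nat.zero_le _)
    have ih := fun S s ψ h => probOnes_runGates_blocks α₀ outputs A (c + 1) S s ψ h (by omega)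
      fun q hq => ho q (List.mem_cons_of_mem _ hq)
    rw [blocks, List.flatMap_cons, runGates_append]
    have one := fun U i ψ => applyOne_prodLift hinj (ancState_zero (L := L) S s) U i ψ
    cases q with
    | E i j =>
      rw [prob, ← ih S s _ h.2]
      congr 2
      exact applyCZ_prodLift (fun v => lab L v 0) _ i j ψ
    | X i σ =>
      rw [prob, ← ih S s _ h.2]
      congr 2
      simp only [block, runGates, List.foldl_cons, List.foldl_nil, Gate.apply]
      have hfan := applyFan_signal (L := L) (c := c) (by omega) s (σ := σ) h.1.2.1 h.1.2.2.2 i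
        (applyOne hadamard i ψ)
      rw [one, hfan, one, applyOne_mul, applyOne_mul, mul_assoc,
        hadamard_pauliZ_pow_hadamard]
    | Z i σ =>
      rw [prob, ← ih S s _ h.2]
      congr 2
      exact applyFan_signal (by omega) s h.1.2.1 h.1.2.2.2 i ψ
    | M i a =>
      have hi : i ∉ S := h.1.2.2.1 i (by simp [Command.acts])
      have hA : ∀ c ∈ A, i ∉ c.acts := h.2.not_mem_acts i (by simp [Command.measured])
      rw [prob_M_eq α₀ (ho _ List.mem_cons_self i (by simp [Command.measured])) a hA
        (outcomeMat α₀ a) (outcomeMat_gram α₀ a)]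
      have hb : runGates α₀ (block L c (.M i a))
          (prodLift (fun v => lab L v 0) (ancState L S s) ψ) =
          ∑ b, prodLift (fun v => lab L v 0) (ancState L (i :: S) (Function.update s i b))
            (applyOne (outcomeMat α₀ a b) i ψ) := by
        have h1 : block L c (.M i a) = rotGates L i a ++ (.H (lab L i 0) ::
            (Gate.fan (copies L i) (lab L i 0) :: (copies L i).map .H)) := by
          simp [block]
        rw [h1, runGates_append, runGates_rotGates α₀ (by omega)]
        have h2 : ∀ l ψ, runGates α₀ (Gate.H (lab L i 0) :: l) ψ =
            runGates α₀ l (applyOne hadamard (lab L i 0) ψ) := fun _ _ => rfl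
        rw [h2, one, one, runGates_copies α₀ s hi]
        simp only [applyOne_mul, outcomeMat]
      rw [hb, Fin.sum_univ_two, runGates_add, Fin.sum_univ_two, ← ih (i :: S) _ _ h.2,
        ← ih (i :: S) _ _ h.2]
      -- the two outcomes are told apart by the measured qubit, on which no further gate acts
      have hsupp : ∀ b, SuppAt (lab L i 0) b
          (runGates α₀ ((blocks L (c + 1) A).flatMap Prod.snd)
            (prodLift (fun v => lab L v 0) (ancState L (i :: S) (Function.update s i b))
              (applyOne (outcomeMat α₀ a b) i ψ))) := by
        intro b
        refine SuppAt.runGates α₀ ?_ ?_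
        · intro z hz
          have : applyOne (outcomeMat α₀ a b) i ψ (z ∘ fun v => lab L v 0) = 0 := by
            refine Finset.sum_eq_zero fun x _ => ?_
            have : outcomeMat α₀ a b (z (lab L i 0)) x = 0 := by
              rw [outcomeMat, Matrix.single_mul_apply_of_ne _ _ _ _ _ hz]
            exact mul_eq_zero_of_left this _
          rw [prodLift, this, zero_mul]
        · intro g hg hact
          rw [List.mem_flatMap] at hg
          obtain ⟨x, hx, hg⟩ := hg
          obtain ⟨h1, c', h2, h3, h4⟩ := mem_blocks hx
          rw [h4] at hg
          rcases mem_acts_block (by omega) hg hact with ⟨v, hv, e⟩ | ⟨v, _, j, hj, e⟩ | ⟨v, _, e⟩ <;>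
            rw [lab_inj (by omega) (by omega)] at e
          · exact hA _ h1 (e.1 ▸ hv)
          · omega
          · omega
      exact probOnes_add_of_suppAt (hsupp 0) (hsupp 1) _

theorem toCircuit_acceptProb (α₀ : ℝ) {t : Pattern} (h : t.WellFormed) (w : List (Fin 2)) :
    t.toCircuit.acceptProb α₀ w = t.acceptProb α₀ w := by
  set L := t.commands.length with hL
  have hinj : Function.Injective fun v : Fin t.numQubits => lab L v 0 :=
    lab_injective (Nat.zero_le _)
  have hH : ∀ l : List (Fin t.numQubits), l.Nodup → ∀ κ : Fin ((L + 1) * t.numQubits) → Fin 2 → ℂ,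
      runGates α₀ (l.map fun v => Gate.H (lab L v 0)) (prodState κ) =
        prodState fun x => if x ∈ l.map (fun v => lab L v 0) then hadamard *ᵥ κ x else κ x := by
    intro l hl κ
    have := foldl_applyOne_prodState hadamard (fun _ => 1) (l.map fun v => lab L v 0) κ
      (hl.map hinj) (by simp)
    simp only [one_mul, List.foldl_map] at this
    rw [runGates, List.foldl_map]
    exact this
  have hinit : runGates α₀ ((List.finRange t.numQubits).map (fun v => Gate.H (lab L v 0)) ++
      t.inputs.map (fun v => Gate.H (lab L v 0)))
      (initState ketZero (t.inputs.map fun v => lab L v 0) w) =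
      prodLift (fun v => lab L v 0) (ancState L [] fun _ => 0) (initState ketPlus t.inputs w) := by
    rw [runGates_append, initState_eq, hH _ (List.nodup_finRange _), hH _ h.inputs_nodup,
      initState_eq]
    funext z
    rw [prodLift, prodState, prodState, prodState]
    refine (prod_eq_prod_mul_prod hinj _ (fun x => ancState L [] (fun _ => 0) x (z x))
      (fun v => by simp [ancState_zero]) (fun x hx => ?_)).trans ?_
    · obtain ⟨v, j, hj, rfl⟩ := not_mem_range_lab hx
      have hx' : ∀ l : List (Fin t.numQubits), lab L v (j + 1) ∉ l.map fun v => lab L v 0 := by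
        intro l hl
        rw [List.mem_map] at hl
        obtain ⟨v', -, e⟩ := hl
        exact hx ⟨v', e⟩
      simp only [ancState_succ _ _ _ hj, if_neg (hx' _), initKet, List.not_mem_nil, if_false]
    · congr 1
      refine Finset.prod_congr rfl fun v _ => ?_
      have h1 : lab L v 0 ∈ (List.finRange t.numQubits).map fun v => lab L v 0 :=
        List.mem_map_of_mem (List.mem_finRange v)
      have h2 : lab L v 0 ∈ t.inputs.map (fun v => lab L v 0) ↔ v ∈ t.inputs :=
        List.mem_map_of_injective hinj
      rw [if_pos h1, initKet_map hinj ketZero t.inputs w v]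
      by_cases hv : v ∈ t.inputs
      · rw [if_pos (h2.2 hv), mulVec_mulVec, hadamard_mul_self, one_mulVec]
        simp [initKet, hv]
      · rw [if_neg (fun h => hv (h2.1 h))]
        simp only [initKet, hv, if_false, hadamard_mulVec_ketZero, Function.comp_apply]
  have key : t.toCircuit.acceptProb α₀ w = probOnes (t.outputs.map fun v => lab L v 0)
      (runGates α₀ t.simGates (initState ketZero (t.inputs.map fun v => lab L v 0) w)) := rfl
  rw [key, simGates, runGates_append, hinit,
    probOnes_runGates_blocks α₀ t.outputs t.commands 0 [] _ _ h.commands_wf (by omega)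
      h.outputs_unmeasured]
  rfl

end Simulation
end Pattern

/-! ### Measurement patterns which simulate gates -/

namespace Command

variable {V : Type}

/-- The qubits measured by a sequence of commands. -/
def measuredBy (A : List (Command V)) : List V := A.flatMap measured

theorem WellFormedFrom.mono : ∀ {A : List (Command V)} {S S' : List V}, WellFormedFrom S A →
    (∀ v ∈ S, v ∈ S') → (∀ v ∈ S', v ∉ S → ∀ q ∈ A, v ∉ q.acts) → WellFormedFrom S' A
  | [], _, _, _, _, _ => trivial
  | c :: A, S, S', ⟨⟨h1, h2, h3, h4⟩, h5⟩, hS, hA => by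
    refine ⟨⟨h1, h2, fun v hv hv' => ?_, fun v hv => hS v (h4 v hv)⟩, h5.mono ?_ ?_⟩
    · exact hA v hv' (h3 v hv) c List.mem_cons_self hv
    · intro v hv
      rcases List.mem_append.1 hv with hv | hv
      · exact List.mem_append_left _ hv
      · exact List.mem_append_right _ (hS v hv)
    · intro v hv hv' q hq
      rw [List.mem_append, not_or] at hv'
      exact hA v ((List.mem_append.1 hv).resolve_left hv'.1) hv'.2 q (List.mem_cons_of_mem _ hq)

theorem WellFormedFrom.congr {A : List (Command V)} {S S' : List V} (h : WellFormedFrom S A)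
    (hS : ∀ v, v ∈ S ↔ v ∈ S') : WellFormedFrom S' A :=
  h.mono (fun v hv => (hS v).1 hv) fun v hv hv' => absurd ((hS v).2 hv) hv'

theorem wellFormedFrom_append : ∀ {A B : List (Command V)} {S : List V},
    WellFormedFrom S (A ++ B) ↔ WellFormedFrom S A ∧ WellFormedFrom (measuredBy A ++ S) B
  | [], B, S => by simp [measuredBy, WellFormedFrom]
  | c :: A, B, S => by
    rw [List.cons_append, WellFormedFrom, WellFormedFrom, wellFormedFrom_append, and_assoc (b := WellFormedFrom _ A)]
    refine and_congr_right fun _ => and_congr_right fun _ =>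
      ⟨fun h => WellFormedFrom.congr h ?_, fun h => WellFormedFrom.congr h ?_⟩ <;>
    · intro v
      simp only [measuredBy, List.flatMap_cons, List.mem_append]
      tauto

/-- Sequences of commands on separate qubits. -/
theorem wellFormedFrom_flatMap {β : Type} {f : β → List (Command V)} {S : List V} :
    ∀ {l : List β}, (∀ x ∈ l, WellFormedFrom S (f x)) →
      (l.Pairwise fun x y => ∀ v ∈ measuredBy (f x), ∀ q ∈ f y, v ∉ q.acts) →
      WellFormedFrom S (l.flatMap f)
  | [], _, _ => trivial
  | x :: l, h1, h2 => by
    rw [List.pairwise_cons] at h2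
    have ih := wellFormedFrom_flatMap (fun y hy => h1 y (List.mem_cons_of_mem _ hy)) h2.2
    rw [List.flatMap_cons, wellFormedFrom_append]
    refine ⟨h1 x List.mem_cons_self, ih.mono (fun v hv => List.mem_append_right _ hv) ?_⟩
    intro v hv hv' q hq
    obtain ⟨y, hy, hq⟩ := List.mem_flatMap.1 hq
    exact h2.1 y hy v ((List.mem_append.1 hv).resolve_right hv') q hq

theorem measuredBy_append (A B : List (Command V)) :
    measuredBy (A ++ B) = measuredBy A ++ measuredBy B := List.flatMap_append

theorem measuredBy_flatMap {β : Type} (f : β → List (Command V)) (l : List β) :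
    measuredBy (l.flatMap f) = l.flatMap fun x => measuredBy (f x) := by
  simp only [measuredBy, List.flatMap_assoc]

end Command

theorem chainDepth_append_le_of {β : Type} {R : β → β → Prop} {l l' : List β} {a b : ℕ}
    (h : chainDepth R l ≤ a) (h' : chainDepth R l' ≤ b) : chainDepth R (l ++ l') ≤ a + b :=
  (chainDepth_append_le l l').trans (Nat.add_le_add h h')

theorem chainDepth_flatMap_le_of_indep {β γ : Type} {T : γ → γ → Prop} {K : ℕ} {l : List β}
    (f : β → List γ) (hK : ∀ x ∈ l, (f x).length ≤ K)
    (h : l.Pairwise fun x y => ∀ p ∈ f x, ∀ q ∈ f y, ¬ T p q) :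
    chainDepth T (l.flatMap f) ≤ K := by
  have h1 := chainDepth_flatMap_le (T := T) (R := fun _ _ : β => False) (K := K)
    (l := l.map fun x => (x, f x)) (fun x hx => by
      obtain ⟨y, hy, rfl⟩ := List.mem_map.1 hx
      exact (chainDepth_le fun l' h _ => h.length_le).trans (hK y hy))
    (List.pairwise_map.2 h)
  have h2 : chainDepth (fun _ _ : β => False) ((l.map fun x => (x, f x)).map Prod.fst) ≤ 1 := by
    refine chainDepth_le fun l' _ hc => ?_
    rcases l' with _ | ⟨a, _ | ⟨b, l'⟩⟩
    · simp
    · simp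
    · simp at hc
  rw [List.flatMap_map] at h1
  exact h1.trans (by nlinarith)

section Blocks

variable {V W : Type} (q : V → ℕ → W)

/-- The state of the qubit `x` is moved to `y`, up to the operators `R_z(-α)` and `H`. -/
def hop (x y : W) (a : Angle) : List (Command W) := [.E x y, .M x a, .X y [x]]

/-- The states of the qubits `q v d` are moved to `q v d'`. -/
def hops (l : List V) (d d' : ℕ) : List (Command W) :=
  l.flatMap fun v => hop (q v d) (q v d') .zero

/-- Pairs `q t 2`, `q t 3` of new qubits, the second one coupled with the target. -/
def couplings (ts : List V) : List (Command W) :=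
  ts.flatMap fun t => [.E (q t 2) (q t 3), .E (q t 3) (q t 1)]

/-- The targets with the qubits from which they receive the value of the control `p`. -/
def chain : W → List V → List (W × V)
  | _, [] => []
  | p, t :: ts => (p, t) :: chain (q t 3) ts

/-- The value of the control is passed on from each pair of new qubits to the next one. -/
def links (l : List (W × V)) : List (Command W) :=
  l.flatMap fun x => [.E x.1 (q x.2 2), .M (q x.2 2) .zero]

/-- The corrections on the targets, for the values of the control up to the outcomes `σ`. -/
def fixes : List W → List V → List (Command W)
  | _, [] => []
  | σ, t :: ts => .Z (q t 1) (σ ++ [q t 2]) :: fixes (σ ++ [q t 2]) ts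

/-- The commands for a gate, by which the state of each qubit `v` of the gate is moved from `q v 0`
to `q v 4`. For the fan-out gate, the value of the control is propagated along the line
`q c 0`, `q t₁ 2`, `q t₁ 3`, `q t₂ 2`, `q t₂ 3`, … by entangling all neighbours at once. -/
def gateBlock : Gate V → List (Command W)
  | .H i => hop (q i 0) (q i 4) .zero
  | .Rz i => hop (q i 0) (q i 1) .zero ++ hop (q i 1) (q i 2) .pi ++ hop (q i 2) (q i 3) .irr ++
      hop (q i 3) (q i 4) .pi
  | .CZ i j => .E (q i 0) (q j 0) :: (hops q [i, j] 0 1 ++ hops q [i, j] 1 4)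
  | .fan ts c => hops q ts 0 1 ++ (couplings q ts ++ (links q (chain q (q c 0) ts) ++
      (ts.map (fun t => Command.M (q t 3) .zero) ++ (fixes q [] ts ++
      (.Z (q c 0) (ts.map fun t => q t 3) :: (hops q [c] 0 1 ++ hops q (c :: ts) 1 4))))))

variable {q}

/-- The first five qubits attached to the elements of `V` are distinct. -/
def Labelling (q : V → ℕ → W) : Prop :=
  ∀ v v' d d', d ≤ 4 → d' ≤ 4 → (q v d = q v' d' ↔ v = v' ∧ d = d')

theorem mem_chain_snd : ∀ {p : W} {ts : List V} {x : W × V}, x ∈ chain q p ts → x.2 ∈ ts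
  | _, [], _, h => by simp [chain] at h
  | p, t :: ts, x, h => by
    rcases List.mem_cons.1 h with rfl | h
    · exact List.mem_cons_self
    · exact List.mem_cons_of_mem _ (mem_chain_snd h)

theorem mem_chain_fst : ∀ {p : W} {ts : List V} {x : W × V}, x ∈ chain q p ts →
    x.1 = p ∨ ∃ t ∈ ts, x.1 = q t 3 ∧ (ts.Nodup → t ≠ x.2)
  | _, [], _, h => by simp [chain] at h
  | p, t :: ts, x, h => by
    rcases List.mem_cons.1 h with rfl | h
    · exact .inl rfl
    · right
      rcases mem_chain_fst h with h1 | ⟨t', h1, h2, h3⟩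
      · refine ⟨t, List.mem_cons_self, h1, fun hnd => ?_⟩
        rintro rfl
        exact (List.nodup_cons.1 hnd).1 (mem_chain_snd h)
      · exact ⟨t', List.mem_cons_of_mem _ h1, h2, fun hnd => h3 (List.nodup_cons.1 hnd).2⟩

theorem mem_fixes : ∀ {σ : List W} {ts : List V} {c : Command W}, c ∈ fixes q σ ts →
    ∃ t ∈ ts, ∃ τ : List W, c = .Z (q t 1) τ ∧ (∀ w ∈ τ, w ∈ σ ∨ ∃ t' ∈ ts, w = q t' 2)
  | _, [], _, h => by simp [fixes] at h
  | σ, t :: ts, c, h => by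
    rcases List.mem_cons.1 h with rfl | h
    · refine ⟨t, List.mem_cons_self, _, rfl, fun w hw => ?_⟩
      rcases List.mem_append.1 hw with hw | hw
      · exact .inl hw
      · exact .inr ⟨t, List.mem_cons_self, List.mem_singleton.1 hw⟩
    · obtain ⟨t', h1, τ, h2, h3⟩ := mem_fixes h
      refine ⟨t', List.mem_cons_of_mem _ h1, τ, h2, fun w hw => ?_⟩
      rcases h3 w hw with h4 | ⟨t'', h4, h5⟩
      · rcases List.mem_append.1 h4 with h4 | h4
        · exact .inl h4
        · exact .inr ⟨t, List.mem_cons_self, List.mem_singleton.1 h4⟩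
      · exact .inr ⟨t'', List.mem_cons_of_mem _ h4, h5⟩

/-- The commands for a gate only involve the qubits attached to those of the gate. -/
theorem exists_of_mem_dom {g : Gate V} {c : Command W} (hc : c ∈ gateBlock q g) {w : W}
    (hw : w ∈ c.dom) : ∃ v ∈ g.acts, ∃ d ≤ 4, w = q v d := by
  have hop' : ∀ v ∈ g.acts, ∀ d ≤ 4, ∀ d' ≤ 4, ∀ a, c ∈ hop (q v d) (q v d') a →
      ∃ v ∈ g.acts, ∃ d ≤ 4, w = q v d := by
    intro v hv d hd d' hd' a hc
    simp only [hop, List.mem_cons, List.not_mem_nil, or_false] at hc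
    rcases hc with rfl | rfl | rfl <;> simp only [Command.dom, Command.acts, Command.signals,
      List.mem_append, List.mem_cons, List.not_mem_nil, or_false] at hw
    · rcases hw with rfl | rfl
      exacts [⟨v, hv, d, hd, rfl⟩, ⟨v, hv, d', hd', rfl⟩]
    · subst hw; exact ⟨v, hv, d, hd, rfl⟩
    · rcases hw with rfl | rfl
      exacts [⟨v, hv, d', hd', rfl⟩, ⟨v, hv, d, hd, rfl⟩]
  have hops' : ∀ l : List V, (∀ v ∈ l, v ∈ g.acts) → ∀ d ≤ 4, ∀ d' ≤ 4, c ∈ hops q l d d' →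
      ∃ v ∈ g.acts, ∃ d ≤ 4, w = q v d := by
    intro l hl d hd d' hd' hc
    obtain ⟨v, hv, hc⟩ := List.mem_flatMap.1 hc
    exact hop' v (hl v hv) d hd d' hd' _ hc
  cases g with
  | H i => exact hop' i (by simp [Gate.acts]) 0 (by omega) 4 (by omega) _ hc
  | Rz i =>
    have hi : i ∈ (Gate.Rz i).acts := by simp [Gate.acts]
    simp only [gateBlock, List.mem_append] at hc
    rcases hc with ((hc | hc) | hc) | hc
    · exact hop' i hi 0 (by omega) 1 (by omega) _ hc
    · exact hop' i hi 1 (by omega) 2 (by omega) _ hc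
    · exact hop' i hi 2 (by omega) 3 (by omega) _ hc
    · exact hop' i hi 3 (by omega) 4 (by omega) _ hc
  | CZ i j =>
    simp only [gateBlock, List.mem_append, List.mem_cons] at hc
    rcases hc with rfl | hc | hc
    · simp only [Command.dom, Command.acts, Command.signals, List.mem_append, List.mem_cons,
        List.not_mem_nil, or_false] at hw
      rcases hw with rfl | rfl
      exacts [⟨i, by simp [Gate.acts], 0, by omega, rfl⟩, ⟨j, by simp [Gate.acts], 0, by omega, rfl⟩]
    · exact hops' [i, j] (by simp [Gate.acts]) 0 (by omega) 1 (by omega) hc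
    · exact hops' [i, j] (by simp [Gate.acts]) 1 (by omega) 4 (by omega) hc
  | fan ts c' =>
    have ht : ∀ t ∈ ts, t ∈ (Gate.fan ts c').acts := fun t ht => List.mem_append_left _ ht
    have hc' : c' ∈ (Gate.fan ts c').acts := by simp [Gate.acts]
    simp only [gateBlock, List.mem_append, List.mem_cons] at hc
    rcases hc with hc | hc | hc | hc | hc | rfl | hc | hc
    · exact hops' ts ht 0 (by omega) 1 (by omega) hc
    · obtain ⟨t, htt, hc⟩ := List.mem_flatMap.1 hc
      simp only [List.mem_cons, List.not_mem_nil, or_false] at hc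
      rcases hc with rfl | rfl <;> simp only [Command.dom, Command.acts, Command.signals,
        List.mem_append, List.mem_cons, List.not_mem_nil, or_false] at hw <;>
      rcases hw with rfl | rfl
      exacts [⟨t, ht t htt, 2, by omega, rfl⟩, ⟨t, ht t htt, 3, by omega, rfl⟩,
        ⟨t, ht t htt, 3, by omega, rfl⟩, ⟨t, ht t htt, 1, by omega, rfl⟩]
    · obtain ⟨⟨p, t⟩, htt, hc⟩ := List.mem_flatMap.1 hc
      have h2 := mem_chain_snd htt
      have h1 := mem_chain_fst htt
      simp only [List.mem_cons, List.not_mem_nil, or_false] at hc h1 h2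
      have h3 : ∃ v ∈ (Gate.fan ts c').acts, ∃ d ≤ 4, q t 2 = q v d :=
        ⟨t, ht t h2, 2, by omega, rfl⟩
      rcases hc with rfl | rfl <;> simp only [Command.dom, Command.acts, Command.signals,
        List.mem_append, List.mem_cons, List.not_mem_nil, or_false] at hw
      · rcases hw with rfl | rfl
        · rcases h1 with rfl | ⟨t', h4, h5, -⟩
          · exact ⟨c', hc', 0, by omega, rfl⟩
          · exact ⟨t', ht t' h4, 3, by omega, h5⟩
        · exact h3
      · subst hw; exact h3
    · obtain ⟨t, htt, rfl⟩ := List.mem_map.1 hc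
      simp only [Command.dom, Command.acts, Command.signals, List.append_nil,
        List.mem_singleton] at hw
      exact ⟨t, ht t htt, 3, by omega, hw⟩
    · obtain ⟨t, htt, τ, rfl, hτ⟩ := mem_fixes hc
      simp only [Command.dom, Command.acts, Command.signals, List.mem_append,
        List.mem_singleton] at hw
      rcases hw with rfl | hw
      · exact ⟨t, ht t htt, 1, by omega, rfl⟩
      · rcases hτ w hw with h | ⟨t', h1, h2⟩
        · simp at h
        · exact ⟨t', ht t' h1, 2, by omega, h2⟩
    · simp only [Command.dom, Command.acts, Command.signals, List.mem_append, List.mem_singleton,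
        List.mem_map] at hw
      rcases hw with rfl | ⟨t, h1, rfl⟩
      · exact ⟨c', hc', 0, by omega, rfl⟩
      · exact ⟨t, ht t h1, 3, by omega, rfl⟩
    · exact hops' [c'] (by simp [Gate.acts]) 0 (by omega) 1 (by omega) hc
    · exact hops' (c' :: ts) (by simp +contextual [Gate.acts]) 1 (by omega) 4 (by omega) hc

/-! ### Depth of the patterns for gates -/

theorem chainDepth_hops_le (hq : Labelling q) {l : List V} (hl : l.Nodup) {d d' : ℕ} (hd : d ≤ 4)
    (hd' : d' ≤ 4) : chainDepth Command.Dep (hops q l d d') ≤ 3 := by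
  refine chainDepth_flatMap_le_of_indep _ (fun x _ => by simp [hop]) (hl.imp fun {v v'} h => ?_)
  have h1 : ∀ x ∈ [d, d'], ∀ y ∈ [d, d'], q v x ≠ q v' y := by
    intro x hx y hy e
    simp only [List.mem_cons, List.not_mem_nil, or_false] at hx hy
    exact h ((hq _ _ _ _ (by omega) (by omega)).1 e).1
  simp only [List.mem_cons, List.not_mem_nil, or_false, forall_eq_or_imp, forall_eq] at h1
  intro p hp p' hp'
  simp only [hop, List.mem_cons, List.not_mem_nil, or_false] at hp hp'
  rcases hp with rfl | rfl | rfl <;> rcases hp' with rfl | rfl | rfl <;>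
    simp [Command.Dep, Command.acts, Command.dom, Command.signals, h1, eq_comm (a := q v' _)]

theorem chain_pairwise (hq : Labelling q) {c : V} : ∀ {d : ℕ} {ts : List V}, d ≤ 3 →
    (c :: ts).Nodup → (d = 3 ∨ d = 0) →
    (chain q (q c d) ts).Pairwise fun x y => x.2 ≠ y.2 ∧ x.1 ≠ y.1
  | _, [], _, _, _ => by simp [chain]
  | d, t :: ts, hd, hnd, hd' => by
    rw [chain, List.pairwise_cons]
    have hnd' := (List.nodup_cons.1 hnd).2
    refine ⟨fun y hy => ⟨?_, ?_⟩, chain_pairwise hq (le_refl 3) hnd' (.inl rfl)⟩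
    · rintro rfl
      exact (List.nodup_cons.1 hnd').1 (mem_chain_snd hy)
    · intro e
      have hc := (List.nodup_cons.1 hnd).1
      rcases mem_chain_fst hy with h | ⟨t', h1, h, -⟩
      · rw [h] at e
        obtain ⟨rfl, -⟩ := (hq _ _ _ _ (by omega) (by omega)).1 e
        exact hc List.mem_cons_self
      · rw [h] at e
        obtain ⟨rfl, -⟩ := (hq _ _ _ _ (by omega) (by omega)).1 e
        exact hc (List.mem_cons_of_mem _ h1)

/-- The links are measured in one layer and the corrections read any number of outcomes, so the depth
of a fan-out gate does not depend on the number of targets. -/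
theorem chainDepth_gateBlock_le (hq : Labelling q) {g : Gate V} (hg : g.acts.Nodup) :
    chainDepth Command.Dep (gateBlock q g) ≤ 16 := by
  have hlen : ∀ l : List (Command W), chainDepth Command.Dep l ≤ l.length :=
    fun l => chainDepth_le fun l' h _ => h.length_le
  cases g with
  | H i => exact (hlen _).trans (by simp [gateBlock, hop])
  | Rz i => exact (hlen _).trans (by simp [gateBlock, hop])
  | CZ i j => exact (hlen _).trans (by simp [gateBlock, hops, hop])
  | fan ts c =>
    rw [Gate.acts, List.nodup_append] at hg
    obtain ⟨hts, -, hc⟩ := hg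
    have hcts : (c :: ts).Nodup := List.nodup_cons.2 ⟨fun h => hc c h c (by simp) rfl, hts⟩
    have hne : ∀ d ≤ 4, ∀ d' ≤ 4, ∀ {v v' : V}, v ≠ v' → q v d ≠ q v' d' :=
      fun d hd d' hd' v v' h e => h ((hq _ _ _ _ hd hd').1 e).1
    have h1 := chainDepth_hops_le hq hts (d := 0) (d' := 1) (by omega) (by omega)
    have h2 : chainDepth Command.Dep (couplings q ts) ≤ 2 := by
      refine chainDepth_flatMap_le_of_indep _ (fun x _ => by simp) (hts.imp fun {v v'} h => ?_)
      intro p hp p' hp'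
      simp only [List.mem_cons, List.not_mem_nil, or_false] at hp hp'
      rcases hp with rfl | rfl <;> rcases hp' with rfl | rfl <;>
        simp [Command.Dep, Command.acts, Command.dom, Command.signals, hq _ _ _ _, h]
    have h3 : chainDepth Command.Dep (links q (chain q (q c 0) ts)) ≤ 2 := by
      refine chainDepth_flatMap_le_of_indep _ (fun x _ => by simp) ?_
      have hp : ∀ x ∈ chain q (q c 0) ts, ∀ t, x.1 ≠ q t 2 := by
        intro x hx t e
        rcases mem_chain_fst hx with h | ⟨t', -, h, -⟩ <;> rw [h] at e
        · exact absurd ((hq _ _ _ _ (by omega) (by omega)).1 e).2 (by omega)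
        · exact absurd ((hq _ _ _ _ (by omega) (by omega)).1 e).2 (by omega)
      refine (chain_pairwise hq (by omega) hcts (.inr rfl)).imp_of_mem fun {x y} hx hy h => ?_
      have hx' := hp x hx y.2
      have hy' := (hp y hy x.2).symm
      have h4 := hne 2 (by omega) 2 (by omega) h.1
      intro p hp p' hp'
      simp only [List.mem_cons, List.not_mem_nil, or_false] at hp hp'
      rcases hp with rfl | rfl <;> rcases hp' with rfl | rfl <;>
        simp [Command.Dep, Command.acts, Command.dom, Command.signals, hx', hy', h4, h.2,
          eq_comm (a := q y.2 _)]
    have h4 : chainDepth Command.Dep (ts.map fun t => Command.M (q t 3) .zero) ≤ 1 := by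
      rw [List.map_eq_flatMap]
      refine chainDepth_flatMap_le_of_indep _ (fun x _ => by simp) (hts.imp fun {v v'} h => ?_)
      simp [Command.Dep, Command.acts, Command.dom, Command.signals, hq _ _ _ _, h]
    have h5 : ∀ (ts : List V) (σ : List W), ts.Nodup → (∀ w ∈ σ, ∃ t, w = q t 2) →
        (fixes q σ ts).Pairwise fun x y => ¬ Command.Dep x y := by
      intro ts
      induction ts with
      | nil => intro _ _ _; simp [fixes]
      | cons t ts ih =>
        intro σ hnd hσ
        obtain ⟨hn1, hn2⟩ := List.nodup_cons.1 hnd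
        have hσ' : ∀ w ∈ σ ++ [q t 2], ∃ t, w = q t 2 := by
          intro w hw
          rcases List.mem_append.1 hw with hw | hw
          · exact hσ w hw
          · exact ⟨t, List.mem_singleton.1 hw⟩
        rw [fixes, List.pairwise_cons]
        refine ⟨fun y hy => ?_, ih _ hn2 hσ'⟩
        obtain ⟨t', h1, τ, rfl, h2⟩ := mem_fixes hy
        rintro ⟨v, hv, hv'⟩
        simp only [Command.acts, Command.dom, Command.signals, List.mem_append,
          List.mem_singleton] at hv hv'
        subst hv
        rcases hv' with e | hv'
        · obtain ⟨rfl, -⟩ := (hq _ _ _ _ (by omega) (by omega)).1 e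
          exact hn1 h1
        · have : ∃ t', q t 1 = q t' 2 := by
            rcases h2 _ hv' with h | ⟨t'', -, h⟩
            · exact hσ' _ h
            · exact ⟨t'', h⟩
          obtain ⟨t'', e⟩ := this
          exact absurd ((hq _ _ _ _ (by omega) (by omega)).1 e).2 (by omega)
    have h5' : chainDepth Command.Dep (fixes q [] ts) ≤ 1 :=
      chainDepth_le_of_level (fun _ => 0) (by simp)
        ((h5 ts [] hts (by simp)).imp fun {x y} h h' => absurd h' h)
    have h6 : chainDepth Command.Dep [Command.Z (q c 0) (ts.map fun t => q t 3)] ≤ 1 := hlen _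
    have h7 := chainDepth_hops_le hq (List.nodup_singleton c) (d := 0) (d' := 1) (by omega) (by omega)
    have h8 := chainDepth_hops_le hq hcts (d := 1) (d' := 4) (by omega) (by omega)
    have h := chainDepth_append_le_of h1 (chainDepth_append_le_of h2 (chainDepth_append_le_of h3
      (chainDepth_append_le_of h4 (chainDepth_append_le_of h5' (chainDepth_append_le_of h6
      (chainDepth_append_le_of h7 h8))))))
    exact h.trans (by omega)

end Blocks

/-! ### Well-formedness of the patterns for gates -/

section Blocks

variable {V W : Type} {q : V → ℕ → W}

open Command

theorem wellFormedFrom_hop {S : List W} {x y : W} (hxy : x ≠ y) (hx : x ∉ S) (hy : y ∉ S)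
    (a : Angle) : WellFormedFrom S (hop x y a) := by
  simp [hop, WellFormedFrom, acts, signals, measured, hx, hy, hxy, hxy.symm]

theorem mem_measuredBy_hop {x y w : W} {a : Angle} : w ∈ measuredBy (hop x y a) ↔ w = x := by
  simp [measuredBy, hop, measured]

theorem mem_measuredBy_hops {l : List V} {d d' : ℕ} {w : W} :
    w ∈ measuredBy (hops q l d d') ↔ ∃ v ∈ l, w = q v d := by
  simp only [hops, measuredBy_flatMap, List.mem_flatMap, mem_measuredBy_hop]

theorem mem_measuredBy_couplings {ts : List V} {w : W} : w ∈ measuredBy (couplings q ts) ↔ False := by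
  simp only [couplings, measuredBy_flatMap]
  simp [measuredBy, measured]

theorem mem_measuredBy_links {w : W} : ∀ {p : W} {ts : List V},
    w ∈ measuredBy (links q (chain q p ts)) ↔ ∃ t ∈ ts, w = q t 2
  | _, [] => by simp [measuredBy, links, chain]
  | p, t :: ts => by
    have ih := mem_measuredBy_links (w := w) (p := q t 3) (ts := ts)
    rw [links] at ih
    rw [links, chain, List.flatMap_cons, measuredBy_append, List.mem_append, ih]
    simp [measuredBy, measured]

theorem mem_measuredBy_M {ts : List V} {w : W} :
    w ∈ measuredBy (ts.map fun t => Command.M (q t 3) .zero) ↔ ∃ t ∈ ts, w = q t 3 := by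
  simp [measuredBy, measured, List.flatMap_map]

theorem mem_measuredBy_fixes {w : W} : ∀ {σ : List W} {ts : List V},
    w ∈ measuredBy (fixes q σ ts) ↔ False
  | _, [] => by simp [measuredBy, fixes]
  | σ, t :: ts => by
    have ih := mem_measuredBy_fixes (w := w) (σ := σ ++ [q t 2]) (ts := ts)
    rw [measuredBy] at ih
    rw [fixes, measuredBy, List.flatMap_cons, List.mem_append, ih]
    simp [measured]

theorem acts_hops {l : List V} {d d' : ℕ} {c : Command W} (hc : c ∈ hops q l d d') :
    ∀ w ∈ c.acts, ∃ v ∈ l, w = q v d ∨ w = q v d' := by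
  obtain ⟨v, hv, hc⟩ := List.mem_flatMap.1 hc
  simp only [hop, List.mem_cons, List.not_mem_nil, or_false] at hc
  rcases hc with rfl | rfl | rfl <;> intro w hw <;> simp only [acts, List.mem_cons,
    List.not_mem_nil, or_false] at hw
  · exact ⟨v, hv, hw⟩
  · exact ⟨v, hv, .inl hw⟩
  · exact ⟨v, hv, .inr hw⟩

theorem wellFormedFrom_hops (hq : Labelling q) {S : List W} {l : List V} (hl : l.Nodup) {d d' : ℕ}
    (hd : d ≤ 4) (hd' : d' ≤ 4) (hdd : d ≠ d') (h : ∀ v ∈ l, q v d ∉ S) (h' : ∀ v ∈ l, q v d' ∉ S) :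
    WellFormedFrom S (hops q l d d') := by
  refine wellFormedFrom_flatMap (fun v hv => wellFormedFrom_hop (fun e =>
    hdd ((hq _ _ _ _ hd hd').1 e).2) (h v hv) (h' v hv) _) (hl.imp fun {v v'} hne => ?_)
  intro w hw c hc hwc
  rw [mem_measuredBy_hop] at hw
  subst hw
  obtain ⟨u, hu, e | e⟩ := acts_hops (q := q) (l := [v']) (d := d) (d' := d') (by simpa [hops] using hc)
    _ hwc <;> rw [List.mem_singleton] at hu <;> subst hu
  · exact hne ((hq _ _ _ _ hd hd).1 e).1
  · exact hne ((hq _ _ _ _ hd hd').1 e).1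

theorem wellFormedFrom_fixes (hq : Labelling q) : ∀ {S σ : List W} {ts : List V}, σ.Nodup →
    (∀ w ∈ σ, w ∈ S) → ts.Nodup → (∀ t ∈ ts, q t 1 ∉ S) → (∀ t ∈ ts, q t 2 ∈ S) →
    (∀ t ∈ ts, q t 2 ∉ σ) → WellFormedFrom S (fixes q σ ts)
  | _, _, [], _, _, _, _, _, _ => trivial
  | S, σ, t :: ts, h1, h2, h3, h4, h5, h6 => by
    rw [List.nodup_cons] at h3
    have hσ : (σ ++ [q t 2]).Nodup := by
      rw [List.nodup_append]
      refine ⟨h1, List.nodup_singleton _, ?_⟩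
      rintro a ha b hb rfl
      rw [List.mem_singleton] at hb
      subst hb
      exact h6 t List.mem_cons_self ha
    have hS : ∀ w ∈ σ ++ [q t 2], w ∈ S := by
      intro w hw
      rcases List.mem_append.1 hw with hw | hw
      · exact h2 w hw
      · rw [List.mem_singleton] at hw
        subst hw; exact h5 t List.mem_cons_self
    refine ⟨⟨by simp [acts], hσ, ?_, hS⟩, ?_⟩
    · intro v hv
      simp only [acts, List.mem_singleton] at hv
      subst hv; exact h4 t List.mem_cons_self
    · refine wellFormedFrom_fixes hq hσ hS h3.2 (fun t ht => h4 t (List.mem_cons_of_mem _ ht))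
        (fun t ht => h5 t (List.mem_cons_of_mem _ ht)) fun t' ht' hm => ?_
      rcases List.mem_append.1 hm with hm | hm
      · exact h6 t' (List.mem_cons_of_mem _ ht') hm
      · rw [List.mem_singleton] at hm
        obtain ⟨rfl, -⟩ := (hq _ _ _ _ (by omega) (by omega)).1 hm
        exact h3.1 ht'

theorem wellFormedFrom_gateBlock (hq : Labelling q) {g : Gate V} (hg : g.acts.Nodup) {S : List W}
    (hS : ∀ v ∈ g.acts, ∀ d ≤ 4, q v d ∉ S) : WellFormedFrom S (gateBlock q g) := by
  have hne : ∀ d d' v v', d ≤ 4 → d' ≤ 4 → d ≠ d' → q v d ≠ q v' d' :=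
    fun d d' v v' h h' hd e => hd ((hq _ _ _ _ h h').1 e).2
  cases g with
  | H i =>
    have hi := hS i (by simp [Gate.acts])
    exact wellFormedFrom_hop (hne 0 4 _ _ (by omega) (by omega) (by omega)) (hi 0 (by omega))
      (hi 4 (by omega)) _
  | Rz i =>
    have hi := hS i (by simp [Gate.acts])
    simp only [gateBlock, wellFormedFrom_append, measuredBy_append]
    refine ⟨⟨⟨?_, ?_⟩, ?_⟩, ?_⟩ <;> refine wellFormedFrom_hop (hne _ _ _ _ (by omega) (by omega)
      (by omega)) ?_ ?_ _ <;> simp [mem_measuredBy_hop, hq _ _ _ _, hi _]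
  | CZ i j =>
    have hi := hS i (by simp [Gate.acts])
    have hj := hS j (by simp [Gate.acts])
    have hij : i ≠ j := by simpa [Gate.acts] using hg
    have hnd : [i, j].Nodup := by simpa using hij
    refine ⟨⟨?_, by simp [signals], ?_, by simp [signals]⟩, ?_⟩
    · simp [acts, hq _ _ _ _, hij]
    · simp [acts, hi _, hj _]
    · rw [wellFormedFrom_append]
      constructor <;> refine wellFormedFrom_hops hq hnd (by omega) (by omega) (by omega) ?_ ?_ <;>
        simp [mem_measuredBy_hops, hi _, hj _, hq _ _ _ _, measured]
  | fan ts c =>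
    rw [Gate.acts, List.nodup_append] at hg
    obtain ⟨hts, -, hc⟩ := hg
    have hcts' : c ∉ ts := fun h => hc c h c (by simp) rfl
    have hcts : (c :: ts).Nodup := List.nodup_cons.2 ⟨hcts', hts⟩
    have hSt : ∀ t ∈ ts, ∀ d ≤ 4, q t d ∉ S := fun t ht => hS t (by simp [Gate.acts, ht])
    have hSc : ∀ d ≤ 4, q c d ∉ S := hS c (by simp [Gate.acts])
    rw [gateBlock]
    simp only [wellFormedFrom_append]
    refine ⟨?_, ?_, ?_, ?_, ?_, ?_⟩
    · exact wellFormedFrom_hops hq hts (by omega) (by omega) (by omega)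
        (fun t ht => hSt t ht 0 (by omega)) (fun t ht => hSt t ht 1 (by omega))
    · refine wellFormedFrom_flatMap (fun t ht => ?_) (hts.imp fun {a b} _ => by
        simp [measuredBy, measured])
      simp only [WellFormedFrom, acts, signals, measured]
      simp [mem_measuredBy_hops, hq _ _ _ _, hSt t ht _]
    · refine wellFormedFrom_flatMap (fun x hx => ?_) ?_
      · have h2 := mem_chain_snd hx
        have h1 := mem_chain_fst hx
        have h3 : ∀ w, w = q c 0 ∨ (∃ t ∈ ts, w = q t 3 ∧ (ts.Nodup → t ≠ x.2)) →
            w ∉ S ∧ (∀ t ∈ ts, w ≠ q t 0) ∧ w ≠ q x.2 2 := by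
          rintro w (rfl | ⟨t, ht, rfl, -⟩)
          · refine ⟨hSc 0 (by omega), fun t ht e => ?_, hne _ _ _ _ (by omega) (by omega) (by omega)⟩
            obtain ⟨rfl, -⟩ := (hq _ _ _ _ (by omega) (by omega)).1 e
            exact hcts' ht
          · exact ⟨hSt t ht 3 (by omega), fun t ht => hne _ _ _ _ (by omega) (by omega) (by omega),
              hne _ _ _ _ (by omega) (by omega) (by omega)⟩
        obtain ⟨h4, h5, h6⟩ := h3 _ h1
        simp only [WellFormedFrom, acts, signals, measured]
        simp [mem_measuredBy_hops, mem_measuredBy_couplings, hq _ _ _ _, hSt _ h2 _, h4, h6]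
        exact fun t ht e => h5 t ht e
      · refine (chain_pairwise hq (by omega) hcts (.inr rfl)).imp_of_mem fun {x y} hx hy h => ?_
        have h1 : y.1 ≠ q x.2 2 := by
          rcases mem_chain_fst hy with h | ⟨t, -, h, -⟩ <;> rw [h] <;>
            exact hne _ _ _ _ (by omega) (by omega) (by omega)
        simp [measuredBy, measured, acts, hq _ _ _ _, h.1, h1.symm]
    · rw [List.map_eq_flatMap]
      refine wellFormedFrom_flatMap (fun t ht => ?_) (hts.imp fun {a b} h => by
        simp [measuredBy, measured, acts, hq _ _ _ _, h])
      simp [WellFormedFrom, acts, signals, mem_measuredBy_hops, mem_measuredBy_couplings,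
        mem_measuredBy_links, hq _ _ _ _, hSt t ht _]
    · refine wellFormedFrom_fixes hq List.nodup_nil (by simp) hts (fun t ht => ?_) (fun t ht => ?_)
        (by simp)
      · simp [mem_measuredBy_hops, mem_measuredBy_couplings, mem_measuredBy_links,
          mem_measuredBy_M, hq _ _ _ _, hSt t ht _]
      · simp [mem_measuredBy_links, hq _ _ _ _, ht]
    · have hp : measuredBy [Command.Z (q c 0) (ts.map fun t => q t 3)] = [] := rfl
      refine ⟨⟨by simp [acts], hts.map fun a b h => ((hq _ _ _ _ (by omega) (by omega)).1 h).1,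
        ?_, ?_⟩, ?_⟩
      · simp [acts, mem_measuredBy_hops, mem_measuredBy_couplings, mem_measuredBy_links,
          mem_measuredBy_M, mem_measuredBy_fixes, hq _ _ _ _, hSc _]
        rintro x hx rfl
        exact hcts' hx
      · simp +contextual [signals, mem_measuredBy_M, hq _ _ _ _]
      · rw [wellFormedFrom_append]
        constructor
        · refine wellFormedFrom_hops hq (List.nodup_singleton c) (by omega) (by omega) (by omega)
            ?_ ?_ <;>
          simp [measured, mem_measuredBy_hops, mem_measuredBy_couplings, mem_measuredBy_links,
            mem_measuredBy_M, mem_measuredBy_fixes, hq _ _ _ _, hSc _, hcts']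
        · refine wellFormedFrom_hops hq hcts (by omega) (by omega) (by omega)
            ?_ ?_ <;>
          simp +contextual [measured, mem_measuredBy_hops, mem_measuredBy_couplings,
            mem_measuredBy_links, mem_measuredBy_M, mem_measuredBy_fixes, hq _ _ _ _, hSc _, hSt _ _]

theorem exists_of_mem_measuredBy_gateBlock {g : Gate V} {w : W}
    (hw : w ∈ measuredBy (gateBlock q g)) : ∃ v ∈ g.acts, ∃ d ≤ 3, w = q v d := by
  cases g with
  | H i =>
    rw [gateBlock, mem_measuredBy_hop] at hw
    exact ⟨i, by simp [Gate.acts], 0, by omega, hw⟩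
  | Rz i =>
    simp only [gateBlock, measuredBy_append, List.mem_append, mem_measuredBy_hop] at hw
    refine ⟨i, by simp [Gate.acts], ?_⟩
    rcases hw with ((rfl | rfl) | rfl) | rfl
    exacts [⟨0, by omega, rfl⟩, ⟨1, by omega, rfl⟩, ⟨2, by omega, rfl⟩, ⟨3, by omega, rfl⟩]
  | CZ i j =>
    have e : measuredBy (gateBlock q (.CZ i j)) =
        measuredBy (hops q [i, j] 0 1 ++ hops q [i, j] 1 4) := rfl
    rw [e, measuredBy_append, List.mem_append, mem_measuredBy_hops, mem_measuredBy_hops] at hw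
    rcases hw with ⟨v, hv, rfl⟩ | ⟨v, hv, rfl⟩
    exacts [⟨v, by simpa [Gate.acts] using hv, 0, by omega, rfl⟩,
      ⟨v, by simpa [Gate.acts] using hv, 1, by omega, rfl⟩]
  | fan ts c =>
    have e : gateBlock q (.fan ts c) = hops q ts 0 1 ++ (couplings q ts ++
      (links q (chain q (q c 0) ts) ++ (ts.map (fun t => Command.M (q t 3) .zero) ++
      (fixes q [] ts ++ ([.Z (q c 0) (ts.map fun t => q t 3)] ++ (hops q [c] 0 1 ++
      hops q (c :: ts) 1 4)))))) := rfl
    have e' : w ∈ measuredBy [Command.Z (q c 0) (ts.map fun t => q t 3)] ↔ False := by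
      simp [measuredBy, measured]
    simp only [e, e', measuredBy_append, List.mem_append, mem_measuredBy_hops,
      mem_measuredBy_couplings, mem_measuredBy_links, mem_measuredBy_M, mem_measuredBy_fixes,
      false_or] at hw
    rcases hw with ⟨v, hv, rfl⟩ | ⟨v, hv, rfl⟩ | ⟨v, hv, rfl⟩ | ⟨v, hv, rfl⟩ | ⟨v, hv, rfl⟩
    · exact ⟨v, by simp [Gate.acts, hv], 0, by omega, rfl⟩
    · exact ⟨v, by simp [Gate.acts, hv], 2, by omega, rfl⟩
    · exact ⟨v, by simp [Gate.acts, hv], 3, by omega, rfl⟩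
    · exact ⟨v, by simp_all [Gate.acts], 0, by omega, rfl⟩
    · refine ⟨v, ?_, 1, by omega, rfl⟩
      rcases List.mem_cons.1 hv with rfl | hv
      · simp [Gate.acts]
      · simp [Gate.acts, hv]

end Blocks

/-! ### Moving a state to other qubits -/

section BlockSemantics

variable {V W : Type} [Fintype V] [DecidableEq V] [Fintype W] [DecidableEq W]

open Pattern Command

/-- The commands `A` can be part of a pattern with the outputs `outs`. -/
def Runs (outs : List W) (A : List (Command W)) : Prop :=
  (∃ S, WellFormedFrom S A) ∧ ∀ c ∈ A, ∀ v ∈ c.measured, v ∉ outs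

theorem Runs.append_right {outs : List W} {A B : List (Command W)} (h : Runs outs (A ++ B)) :
    Runs outs B :=
  ⟨⟨_, (wellFormedFrom_append.1 h.1.choose_spec).2⟩,
    fun c hc => h.2 c (List.mem_append_right _ hc)⟩

theorem Runs.tail {outs : List W} {c : Command W} {A : List (Command W)} (h : Runs outs (c :: A)) :
    Runs outs A := Runs.append_right (A := [c]) h

theorem Runs.not_mem_outs {outs : List W} {i : W} {a : Angle} {A : List (Command W)}
    (h : Runs outs (.M i a :: A)) : i ∉ outs := h.2 _ List.mem_cons_self i (by simp [measured])

theorem Runs.not_mem_acts {outs : List W} {i : W} {a : Angle} {A : List (Command W)}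
    (h : Runs outs (.M i a :: A)) : ∀ c ∈ A, i ∉ c.acts :=
  WellFormedFrom.not_mem_acts h.1.choose_spec.2 i (by simp [measured])

/-- The state `ψ` of the register `V` carried by the qubits `q v (δ v)`, all other qubits being in
states proportional to `|+⟩`. -/
def place (q : V → ℕ → W) (δ : V → ℕ) (ψ : QState V) : QState W :=
  fun z => ψ fun v => z (q v (δ v))

/-- The operator which `hop` applies to the state it moves. -/
noncomputable def hopMat (α₀ : ℝ) (a : Angle) : Matrix (Fin 2) (Fin 2) ℂ := hadamard * rotZ (-a.val α₀)

theorem hopMat_zero (α₀ : ℝ) : hopMat α₀ .zero = hadamard := by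
  have : rotZ 0 = 1 := by ext i j; fin_cases i <;> fin_cases j <;> simp [rotZ]
  simp [hopMat, Angle.val, this]

theorem hopMat_apply (α₀ : ℝ) (a : Angle) (x u : Fin 2) : hopMat α₀ a x u =
    sgn (x * u) * (1 / (Real.sqrt 2 : ℂ)) *
      Complex.exp (-(Complex.I * (a.val α₀ : ℂ))) ^ (u : ℕ) := by
  rw [hopMat, Matrix.mul_apply, Fin.sum_univ_two, hadamard_apply, hadamard_apply]
  fin_cases u <;> simp [rotZ]

variable {q : V → ℕ → W} {α₀ : ℝ} {outs : List W}

/-- A move applies `hopMat` to the state; both outcomes have probability `1 / 2` and the same effect. -/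
theorem prob_hop (hq : Labelling q) {δ : V → ℕ} (hδ : ∀ v, δ v ≤ 4) {v : V} {d' : ℕ} (hd' : d' ≤ 4)
    (hne : δ v ≠ d') {a : Angle} {A : List (Command W)}
    (h : Runs outs (hop (q v (δ v)) (q v d') a ++ A)) {ψ : QState V} {s : W → Fin 2} {P : ℝ}
    (hA : ∀ s', prob α₀ outs A (place q (Function.update δ v d') (applyOne (hopMat α₀ a) v ψ)) s'
      = P) :
    prob α₀ outs (hop (q v (δ v)) (q v d') a ++ A) (place q δ ψ) s = P := by
  have hxy : q v (δ v) ≠ q v d' := fun e => hne ((hq _ _ _ _ (hδ v) hd').1 e).2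
  have hM : Runs outs (.M (q v (δ v)) a :: .X (q v d') [q v (δ v)] :: A) := h.tail
  have h2 : ‖(1 / (Real.sqrt 2 : ℂ))‖ ^ 2 = 1 / 2 := by simp
  simp only [hop, List.cons_append, List.nil_append]
  rw [prob, prob_M_reset α₀ hM.not_mem_outs a hM.not_mem_acts]
  simp only [prob]
  have key : ∀ b : Fin 2, applyOne (pauliX ^ (([q v (δ v)].map (Function.update s (q v (δ v)) b)).sum
      : Fin 2).val) (q v d') (fun y => 1 / 2 * ∑ x, sgn (b * x) *
        Complex.exp (-(Complex.I * (a.val α₀ : ℂ))) ^ (x : ℕ) *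
        applyCZ (q v (δ v)) (q v d') (place q δ ψ) (Function.update y (q v (δ v)) x)) =
      (1 / (Real.sqrt 2 : ℂ)) •
        place q (Function.update δ v d') (applyOne (hopMat α₀ a) v ψ) := by
    intro b
    funext z
    have hs : ([q v (δ v)].map (Function.update s (q v (δ v)) b)).sum = b := by simp
    have hz : ∀ u : Fin 2, (fun w => Function.update (Function.update z (q v d') (z (q v d') + b))
        (q v (δ v)) u (q w (δ w))) =
        Function.update (fun w => z (q w (Function.update δ v d' w))) v u := by
      intro u
      funext w
      by_cases hw : w = v
      · subst hw; simp
      · have h1 : q w (δ w) ≠ q v (δ v) := fun e => hw ((hq _ _ _ _ (hδ _) (hδ _)).1 e).1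
        have h2 : q w (δ w) ≠ q v d' := fun e => hw ((hq _ _ _ _ (hδ _) hd').1 e).1
        simp [hw, h1, h2]
    rw [hs, pauliX_pow_apply]
    simp only [applyCZ_apply, place, hz, Function.update_self, Function.update_of_ne hxy.symm,
      Pi.smul_apply, smul_eq_mul, applyOne, hopMat_apply, Fin.sum_univ_two]
    have hr : (1 : ℂ) / 2 = 1 / (Real.sqrt 2 : ℂ) * (1 / (Real.sqrt 2 : ℂ)) := by
      rw [one_div (Real.sqrt 2 : ℂ), inv_sqrt_two_mul_self]
    rw [hr]
    generalize z (q v d') = x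
    fin_cases b <;> fin_cases x <;> simp <;> ring
  simp only [key, prob_smul, hA, h2, Finset.sum_const, Finset.card_univ, Fintype.card_fin]
  simp

theorem foldl_applyOne_comm (U : Matrix (Fin 2) (Fin 2) ℂ) (f : QState V → QState V) :
    ∀ (l : List V) (ψ : QState V), (∀ v ∈ l, ∀ ψ, f (applyOne U v ψ) = applyOne U v (f ψ)) →
      f (l.foldl (fun ψ v => applyOne U v ψ) ψ) = l.foldl (fun ψ v => applyOne U v ψ) (f ψ)
  | [], _, _ => rfl
  | v :: l, ψ, h => by
    rw [List.foldl_cons, List.foldl_cons,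
      foldl_applyOne_comm U f l _ fun w hw => h w (List.mem_cons_of_mem _ hw),
      h v List.mem_cons_self]

theorem prob_hops (hq : Labelling q) {d d' : ℕ} (hd' : d' ≤ 4) (hne : d ≠ d')
    {A : List (Command W)} {P : ℝ} : ∀ {l : List V} {δ : V → ℕ} {ψ : QState V} {s : W → Fin 2},
    (∀ v, δ v ≤ 4) → l.Nodup → (∀ v ∈ l, δ v = d) → Runs outs (hops q l d d' ++ A) →
    (∀ s', prob α₀ outs A (place q (fun v => if v ∈ l then d' else δ v)
      (l.foldl (fun ψ v => applyOne hadamard v ψ) ψ)) s' = P) →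
    prob α₀ outs (hops q l d d' ++ A) (place q δ ψ) s = P
  | [], δ, ψ, s, hδ, hl, hld, h, hA => by simpa [hops] using hA s
  | v :: l, δ, ψ, s, hδ, hl, hld, h, hA => by
    rw [List.nodup_cons] at hl
    have e : hops q (v :: l) d d' ++ A = hop (q v (δ v)) (q v d') .zero ++ (hops q l d d' ++ A) := by
      rw [hops, List.flatMap_cons, List.append_assoc, hld v List.mem_cons_self]; rfl
    rw [e] at h ⊢
    refine prob_hop hq hδ hd' (by rwa [hld v List.mem_cons_self]) h fun s' => ?_
    rw [hopMat_zero]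
    refine prob_hops hq hd' hne (fun w => ?_) hl.2 (fun w hw => ?_) h.append_right fun s'' => ?_
    · rw [Function.update_apply]; split_ifs
      exacts [hd', hδ w]
    · rw [Function.update_of_ne (by rintro rfl; exact hl.1 hw), hld w (List.mem_cons_of_mem _ hw)]
    · rw [← hA s'', List.foldl_cons]
      congr 2
      funext w
      by_cases hw : w = v
      · subst hw; simp
      · simp [hw]

end BlockSemantics

/-! ### The fan-out of a control along a line -/

section FanSemantics

variable {V W : Type} [Fintype V] [DecidableEq V] [Fintype W] [DecidableEq W]
variable {q : V → ℕ → W} {α₀ : ℝ} {outs : List W}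

open Pattern Command

theorem prob_couplings {A : List (Command W)} : ∀ (ts : List V) (Φ : QState W) (s : W → Fin 2),
    prob α₀ outs (couplings q ts ++ A) Φ s = prob α₀ outs A (fun z => Φ z * (ts.map fun t =>
      sgn (z (q t 3) * z (q t 1)) * sgn (z (q t 2) * z (q t 3))).prod) s
  | [], Φ, s => by simp [couplings]
  | t :: ts, Φ, s => by
    have e : couplings q (t :: ts) ++ A =
        .E (q t 2) (q t 3) :: .E (q t 3) (q t 1) :: (couplings q ts ++ A) := rfl
    rw [e, prob, prob, prob_couplings ts]
    congr 1
    funext z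
    simp only [applyCZ_apply, List.map_cons, List.prod_cons]
    ring

variable (q) in
/-- The amplitude `1` if the qubits `p`, `q t₁ 3`, `q t₂ 3`, … carry the same value up to the
outcomes of the qubits between them, and `0` otherwise. -/
def follows (s : W → Fin 2) : W → List V → (W → Fin 2) → ℂ
  | _, [], _ => 1
  | p, t :: ts, z => (if z (q t 3) = z p + s (q t 2) then 1 else 0) * follows s (q t 3) ts z

/-- Measuring the links leaves the line in a state where all the qubits `q t 3` carry the value of `p` up
to the outcomes; the amplitudes do not depend on the outcomes otherwise. -/
theorem prob_links (hq : Labelling q) {A : List (Command W)} {P : ℝ} : ∀ {ts : List V} {p : W}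
    {F : QState W} {s : W → Fin 2}, Runs outs (links q (chain q p ts) ++ A) → ts.Nodup →
    (∀ t ∈ ts, p ≠ q t 2) → (∀ t ∈ ts, ∀ z u, F (Function.update z (q t 2) u) = F z) →
    (∀ s', (∀ w, (∀ t ∈ ts, w ≠ q t 2) → s' w = s w) →
      prob α₀ outs A (fun z => F z * follows q s' p ts z) s' = P) →
    prob α₀ outs (links q (chain q p ts) ++ A)
      (fun z => F z * (ts.map fun t => sgn (z (q t 2) * z (q t 3))).prod) s = 2 ^ ts.length * P
  | [], p, F, s, _, _, _, _, hA => by simpa [links, chain, follows] using hA s fun _ _ => rfl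
  | t :: ts, p, F, s, h, hts, hp, hF, hA => by
    have e : links q (chain q p (t :: ts)) ++ A = .E p (q t 2) :: .M (q t 2) .zero ::
      (links q (chain q (q t 3) ts) ++ A) := rfl
    rw [List.nodup_cons] at hts
    have hpt := hp t List.mem_cons_self
    have h32 : ∀ t', q t' 3 ≠ q t 2 := fun t' e =>
      absurd ((hq _ _ _ _ (by omega) (by omega)).1 e).2 (by omega)
    rw [e] at h ⊢
    have hM := h.tail
    rw [prob, prob_M_reset α₀ hM.not_mem_outs _ hM.not_mem_acts]
    have key : ∀ b : Fin 2, (fun y => 1 / 2 * ∑ x, sgn (b * x) *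
        Complex.exp (-(Complex.I * (Angle.zero.val α₀ : ℂ))) ^ (x : ℕ) *
        applyCZ p (q t 2) (fun z => F z * ((t :: ts).map fun t =>
          sgn (z (q t 2) * z (q t 3))).prod) (Function.update y (q t 2) x)) =
        fun z => (F z * if z (q t 3) = z p + b then 1 else 0) *
          (ts.map fun t => sgn (z (q t 2) * z (q t 3))).prod := by
      intro b
      funext z
      have h1 : ∀ u, (ts.map fun t' => sgn (Function.update z (q t 2) u (q t' 2) *
          Function.update z (q t 2) u (q t' 3))) = ts.map fun t => sgn (z (q t 2) * z (q t 3)) := by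
        refine fun u => List.map_congr_left fun t' ht' => ?_
        rw [Function.update_of_ne (h32 _), Function.update_of_ne fun e => ?_]
        obtain ⟨rfl, -⟩ := (hq _ _ _ _ (by omega) (by omega)).1 e
        exact hts.1 ht'
      simp only [applyCZ_apply, List.map_cons, List.prod_cons, h1]
      simp only [hF t List.mem_cons_self,
        Function.update_self, Function.update_of_ne (h32 _), Function.update_of_ne hpt,
        Fin.sum_univ_two, Angle.val]
      generalize z p = x
      generalize z (q t 3) = y
      fin_cases b <;> fin_cases x <;> fin_cases y <;> simp <;> ring
    simp only [key]
    have ih : ∀ b, prob α₀ outs (links q (chain q (q t 3) ts) ++ A)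
        (fun z => (F z * if z (q t 3) = z p + b then 1 else 0) *
          (ts.map fun t => sgn (z (q t 2) * z (q t 3))).prod) (Function.update s (q t 2) b) =
        2 ^ ts.length * P := by
      intro b
      refine prob_links hq hM.tail hts.2 (fun t' _ e =>
        absurd ((hq _ _ _ _ (by omega) (by omega)).1 e).2 (by omega)) (fun t' ht' z u => ?_)
        fun s' hs' => ?_
      · have h32' : q t 3 ≠ q t' 2 := fun e =>
          absurd ((hq _ _ _ _ (by omega) (by omega)).1 e).2 (by omega)
        rw [hF t' (List.mem_cons_of_mem _ ht'), Function.update_of_ne h32',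
          Function.update_of_ne (hp t' (List.mem_cons_of_mem _ ht'))]
      · have hb : s' (q t 2) = b := by
          rw [hs' _ fun t' ht' e => ?_, Function.update_self]
          obtain ⟨rfl, -⟩ := (hq _ _ _ _ (by omega) (by omega)).1 e
          exact hts.1 ht'
        rw [← hA s' fun w hw => ?_]
        · simp only [follows, hb, mul_assoc]
        · rw [hs' w fun t' ht' => hw t' (List.mem_cons_of_mem _ ht'),
            Function.update_of_ne (hw t List.mem_cons_self)]
    simp only [ih, Fin.sum_univ_two, List.length_cons]
    ring

variable (q) in
/-- The targets with the sums of the outcomes of the qubits `q t 2` up to them. -/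
def sums (s : W → Fin 2) : Fin 2 → List V → List (V × Fin 2)
  | _, [] => []
  | σ, t :: ts => (t, σ + s (q t 2)) :: sums s (σ + s (q t 2)) ts

theorem sums_map_fst (s : W → Fin 2) : ∀ (σ : Fin 2) (ts : List V), (sums q s σ ts).map Prod.fst = ts
  | _, [] => rfl
  | σ, t :: ts => by rw [sums, List.map_cons, sums_map_fst]

theorem sums_congr {s s' : W → Fin 2} : ∀ {σ : Fin 2} {ts : List V},
    (∀ t ∈ ts, s (q t 2) = s' (q t 2)) → sums q s σ ts = sums q s' σ ts
  | _, [], _ => rfl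
  | σ, t :: ts, h => by
    rw [sums, sums, h t List.mem_cons_self, sums_congr fun t ht => h t (List.mem_cons_of_mem _ ht)]

/-- The values along the line, expressed by the value of `p` and the sums of the outcomes. -/
theorem follows_mul (s : W → Fin 2) (p : W) (z : W → Fin 2) : ∀ (p' : W) (σ : Fin 2) (ts : List V),
    z p' = z p + σ → follows q s p' ts z =
      ((sums q s σ ts).map fun x => if z (q x.1 3) = z p + x.2 then (1 : ℂ) else 0).prod
  | _, _, [], _ => rfl
  | p', σ, t :: ts, h => by
    rw [follows, sums, List.map_cons, List.prod_cons, h, add_assoc]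
    split_ifs with h1
    · rw [follows_mul s p z _ _ ts h1]
    · simp

theorem prob_fixes {A : List (Command W)} (s : W → Fin 2) : ∀ (ts : List V) (τ : List W)
    (Φ : QState W), prob α₀ outs (fixes q τ ts ++ A) Φ s = prob α₀ outs A (fun z => Φ z *
      ((sums q s (τ.map s).sum ts).map fun x => sgn (z (q x.1 1) * x.2)).prod) s
  | [], τ, Φ => by simp [fixes, sums]
  | t :: ts, τ, Φ => by
    have e : fixes q τ (t :: ts) ++ A =
        .Z (q t 1) (τ ++ [q t 2]) :: (fixes q (τ ++ [q t 2]) ts ++ A) := rfl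
    have e' : ((τ ++ [q t 2]).map s).sum = (τ.map s).sum + s (q t 2) := by simp
    rw [e, prob, prob_fixes s ts, e', sums]
    congr 1
    funext z
    rw [pauliZ_pow_apply, List.map_cons, List.prod_cons]
    ring

/-- Measuring the qubits of the line leaves signs on the targets given by the value of `p`, the sums of
the outcomes of the links and the new outcomes. -/
theorem prob_M_targets (hq : Labelling q) {A : List (Command W)} {P : ℝ} {p : W} :
    ∀ {L : List (V × Fin 2)} {F : QState W} {s : W → Fin 2},
    Runs outs (((L.map Prod.fst).map fun t => Command.M (q t 3) .zero) ++ A) →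
    (L.map Prod.fst).Nodup → (∀ x ∈ L, p ≠ q x.1 3) →
    (∀ x ∈ L, ∀ z u, F (Function.update z (q x.1 3) u) = F z) →
    (∀ s', (∀ w, (∀ x ∈ L, w ≠ q x.1 3) → s' w = s w) →
      prob α₀ outs A (fun z => F z *
        (L.map fun x => sgn ((z p + x.2) * (z (q x.1 1) + s' (q x.1 3)))).prod) s' = P) →
    prob α₀ outs (((L.map Prod.fst).map fun t => Command.M (q t 3) .zero) ++ A)
      (fun z => F z * (L.map fun x => sgn (z (q x.1 3) * z (q x.1 1)) *
        if z (q x.1 3) = z p + x.2 then (1 : ℂ) else 0).prod) s = (1 / 2) ^ L.length * P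
  | [], F, s, _, _, _, _, hA => by simpa using hA s fun _ _ => rfl
  | (t, σ) :: L, F, s, h, hL, hp, hF, hA => by
    have e : (((t, σ) :: L).map Prod.fst).map (fun t => Command.M (q t 3) .zero) ++ A =
      .M (q t 3) .zero :: ((L.map Prod.fst).map (fun t => Command.M (q t 3) .zero) ++ A) := rfl
    rw [List.map_cons, List.nodup_cons] at hL
    have hpt : p ≠ q t 3 := hp _ List.mem_cons_self
    have h13 : ∀ t', q t' 1 ≠ q t 3 := fun t' e =>
      absurd ((hq _ _ _ _ (by omega) (by omega)).1 e).2 (by omega)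
    have h33 : ∀ x ∈ L, q x.1 3 ≠ q t 3 := by
      intro x hx e
      obtain ⟨rfl, -⟩ := (hq _ _ _ _ (by omega) (by omega)).1 e
      exact hL.1 (List.mem_map.2 ⟨x, hx, rfl⟩)
    rw [e] at h ⊢
    rw [prob_M_reset α₀ h.not_mem_outs _ h.not_mem_acts]
    have key : ∀ b : Fin 2, (fun y => 1 / 2 * ∑ x, sgn (b * x) *
        Complex.exp (-(Complex.I * (Angle.zero.val α₀ : ℂ))) ^ (x : ℕ) *
        (F (Function.update y (q t 3) x) * (((t, σ) :: L).map fun x' =>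
          sgn (Function.update y (q t 3) x (q x'.1 3) * Function.update y (q t 3) x (q x'.1 1)) *
          if Function.update y (q t 3) x (q x'.1 3) = Function.update y (q t 3) x p + x'.2
            then (1 : ℂ) else 0).prod)) =
        (1 / 2 : ℂ) • fun z => (F z * sgn ((z p + σ) * (z (q t 1) + b))) *
          (L.map fun x => sgn (z (q x.1 3) * z (q x.1 1)) *
            if z (q x.1 3) = z p + x.2 then (1 : ℂ) else 0).prod := by
      intro b
      funext z
      have h1 : ∀ u, (L.map fun x' =>
          sgn (Function.update z (q t 3) u (q x'.1 3) * Function.update z (q t 3) u (q x'.1 1)) *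
          if Function.update z (q t 3) u (q x'.1 3) = Function.update z (q t 3) u p + x'.2
            then (1 : ℂ) else 0) = L.map fun x => sgn (z (q x.1 3) * z (q x.1 1)) *
            if z (q x.1 3) = z p + x.2 then (1 : ℂ) else 0 := by
        refine fun u => List.map_congr_left fun x hx => ?_
        rw [Function.update_of_ne (h33 x hx), Function.update_of_ne (h13 _),
          Function.update_of_ne hpt]
      have hFt : ∀ z u, F (Function.update z (q t 3) u) = F z := hF _ List.mem_cons_self
      simp only [List.map_cons, List.prod_cons, h1]
      simp only [hFt, Pi.smul_apply, smul_eq_mul,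
        Function.update_self, Function.update_of_ne (h13 _), Function.update_of_ne hpt,
        Fin.sum_univ_two, Angle.val]
      generalize z p = x
      generalize z (q t 1) = y
      fin_cases b <;> fin_cases x <;> fin_cases y <;> fin_cases σ <;> simp
    simp only [key, prob_smul]
    have ih : ∀ b, prob α₀ outs ((L.map Prod.fst).map (fun t => Command.M (q t 3) .zero) ++ A)
        (fun z => (F z * sgn ((z p + σ) * (z (q t 1) + b))) *
          (L.map fun x => sgn (z (q x.1 3) * z (q x.1 1)) *
            if z (q x.1 3) = z p + x.2 then (1 : ℂ) else 0).prod) (Function.update s (q t 3) b) =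
        (1 / 2) ^ L.length * P := by
      intro b
      refine prob_M_targets hq h.tail hL.2 (fun x hx => hp x (List.mem_cons_of_mem _ hx))
        (fun x hx z u => ?_) fun s' hs' => ?_
      · have h13' : q t 1 ≠ q x.1 3 := fun e =>
          absurd ((hq _ _ _ _ (by omega) (by omega)).1 e).2 (by omega)
        rw [hF x (List.mem_cons_of_mem _ hx), Function.update_of_ne h13',
          Function.update_of_ne (hp x (List.mem_cons_of_mem _ hx))]
      · have hb : s' (q t 3) = b := by
          rw [hs' _ fun x hx e => h33 x hx e.symm, Function.update_self]
        rw [← hA s' fun w hw => ?_]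
        · simp only [List.map_cons, List.prod_cons, hb, mul_assoc]
        · rw [hs' w fun x hx => hw x (List.mem_cons_of_mem _ hx),
            Function.update_of_ne (hw _ List.mem_cons_self)]
    have hn : ‖(1 / 2 : ℂ)‖ = 1 / 2 := by norm_num
    simp only [ih, hn, Fin.sum_univ_two, List.length_cons]
    ring

/-- The signs collected from the outcomes combine to the one of `ΛZ` on the control and each target. -/
theorem prod_sgn_sums (s z : W → Fin 2) (p : W) : ∀ L : List (V × Fin 2),
    (L.map fun x => sgn ((z p + x.2) * (z (q x.1 1) + s (q x.1 3)))).prod *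
      (L.map fun x => sgn (z (q x.1 1) * x.2)).prod *
      sgn (z p * ((L.map Prod.fst).map fun t => s (q t 3)).sum) =
    (L.map fun x => sgn (x.2 * s (q x.1 3))).prod *
      ((L.map Prod.fst).map fun t => sgn (z p * z (q t 1))).prod
  | [] => by simp
  | x :: L => by
    have ih := prod_sgn_sums s z p L
    simp only [List.map_cons, List.prod_cons, List.sum_cons, mul_add, sgn_add] at ih ⊢
    have key : ∀ a b c d : Fin 2, sgn ((a + b) * c) * sgn ((a + b) * d) * sgn (c * b) *
        sgn (a * d) = sgn (b * d) * sgn (a * c) := by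
      intro a b c d
      fin_cases a <;> fin_cases b <;> fin_cases c <;> fin_cases d <;> simp
    have := key (z p) x.2 (z (q x.1 1)) (s (q x.1 3))
    linear_combination (L.map fun x => sgn (x.2 * s (q x.1 3))).prod *
      ((L.map Prod.fst).map fun t => sgn (z p * z (q t 1))).prod * this +
      sgn ((z p + x.2) * z (q x.1 1)) * sgn ((z p + x.2) * s (q x.1 3)) * sgn (z (q x.1 1) * x.2) *
        sgn (z p * s (q x.1 3)) * ih

theorem norm_prod_sgn {β : Type} (f : β → Fin 2) : ∀ L : List β,
    ‖(L.map fun x => sgn (f x)).prod‖ = 1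
  | [] => by simp
  | x :: L => by rw [List.map_cons, List.prod_cons, norm_mul, norm_sgn, norm_prod_sgn f L, one_mul]

/-- Up to a global sign, `ΛZ` is applied to `p` and each target. -/
theorem prob_fan_core (hq : Labelling q) {A : List (Command W)} {P : ℝ} {ts : List V} {c : V}
    (hts : (c :: ts).Nodup) {F : QState W} {s : W → Fin 2}
    (h : Runs outs (couplings q ts ++ (links q (chain q (q c 0) ts) ++
      (ts.map (fun t => Command.M (q t 3) .zero) ++ (fixes q [] ts ++
      (.Z (q c 0) (ts.map fun t => q t 3) :: A))))))
    (hF2 : ∀ t ∈ ts, ∀ z u, F (Function.update z (q t 2) u) = F z)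
    (hF3 : ∀ t ∈ ts, ∀ z u, F (Function.update z (q t 3) u) = F z)
    (hA : ∀ s', prob α₀ outs A
      (fun z => (ts.map fun t => sgn (z (q c 0) * z (q t 1))).prod * F z) s' = P) :
    prob α₀ outs (couplings q ts ++ (links q (chain q (q c 0) ts) ++
      (ts.map (fun t => Command.M (q t 3) .zero) ++ (fixes q [] ts ++
      (.Z (q c 0) (ts.map fun t => q t 3) :: A))))) F s = P := by
  have hne : ∀ d d' v v', d ≤ 4 → d' ≤ 4 → d ≠ d' → q v d ≠ q v' d' :=
    fun d d' v v' h h' hd e => hd ((hq _ _ _ _ h h').1 e).2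
  have hnd := (List.nodup_cons.1 hts).2
  have h2 := h.append_right
  have h3 := h2.append_right
  rw [prob_couplings]
  have e1 : (fun z => F z * (ts.map fun t =>
      sgn (z (q t 3) * z (q t 1)) * sgn (z (q t 2) * z (q t 3))).prod) = fun z =>
      (F z * (ts.map fun t => sgn (z (q t 3) * z (q t 1))).prod) *
        (ts.map fun t => sgn (z (q t 2) * z (q t 3))).prod := by
    funext z
    rw [List.prod_map_mul, mul_assoc]
  rw [e1]
  have e2 : P = 2 ^ ts.length * ((1 / 2) ^ ts.length * P) := by
    rw [← mul_assoc, ← mul_pow]; norm_num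
  rw [e2]
  refine prob_links hq h2 hnd (fun t _ => hne _ _ _ _ (by omega) (by omega) (by omega))
    (fun t ht z u => ?_) fun s1 _ => ?_
  · rw [hF2 t ht]
    refine congrArg (fun l : List ℂ => F z * l.prod) (List.map_congr_left fun t' _ => ?_)
    rw [Function.update_of_ne (hne _ _ _ _ (by omega) (by omega) (by omega)),
      Function.update_of_ne (hne _ _ _ _ (by omega) (by omega) (by omega))]
  · set L := sums q s1 0 ts with hL
    have hfst : L.map Prod.fst = ts := sums_map_fst s1 0 ts
    have hmem : ∀ x ∈ L, x.1 ∈ ts := fun x hx => hfst ▸ List.mem_map_of_mem hx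
    have e3 : (fun z => F z * (ts.map fun t => sgn (z (q t 3) * z (q t 1))).prod *
        follows q s1 (q c 0) ts z) = fun z => F z * (L.map fun x =>
          sgn (z (q x.1 3) * z (q x.1 1)) *
            if z (q x.1 3) = z (q c 0) + x.2 then (1 : ℂ) else 0).prod := by
      funext z
      rw [List.prod_map_mul, follows_mul s1 (q c 0) z _ 0 ts (add_zero _).symm, mul_assoc, ← hL]
      nth_rewrite 1 [← hfst]
      rw [List.map_map]
      rfl
    have e4 : ts.map (fun t => Command.M (q t 3) .zero) =
        (L.map Prod.fst).map fun t => Command.M (q t 3) .zero := by rw [hfst]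
    have e5 : ts.length = L.length := by rw [← hfst, List.length_map]
    rw [e3, e5]
    rw [e4] at h3 ⊢
    refine prob_M_targets hq h3 (by rwa [hfst])
      (fun x _ => hne _ _ _ _ (by omega) (by omega) (by omega)) (fun x hx => hF3 _ (hmem x hx))
      fun s2 hs2 => ?_
    have hL2 : sums q s2 0 ts = L := sums_congr fun t _ => hs2 _ fun x _ =>
      hne _ _ _ _ (by omega) (by omega) (by omega)
    rw [prob_fixes, prob]
    simp only [List.map_nil, List.sum_nil, hL2]
    rw [← hA s2]
    have e6 : applyOne (pauliZ ^ ((ts.map fun t => q t 3).map s2).sum.val) (q c 0) (fun z => F z *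
        (L.map fun x => sgn ((z (q c 0) + x.2) * (z (q x.1 1) + s2 (q x.1 3)))).prod *
        (L.map fun x => sgn (z (q x.1 1) * x.2)).prod) =
        (L.map fun x => sgn (x.2 * s2 (q x.1 3))).prod •
          fun z => (ts.map fun t => sgn (z (q c 0) * z (q t 1))).prod * F z := by
      funext z
      have h := prod_sgn_sums (q := q) s2 z (q c 0) L
      rw [hfst] at h
      rw [pauliZ_pow_apply, Pi.smul_apply, smul_eq_mul, List.map_map]
      simp only [Function.comp_def]
      linear_combination F z * h
    rw [e6, prob_smul, norm_prod_sgn, one_pow, one_mul]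

end FanSemantics

/-! ### The action of the patterns for gates -/

section GateSemantics

variable {V W : Type} [Fintype V] [DecidableEq V] [Fintype W] [DecidableEq W]

theorem hadamard_mul_pauliZ_pow_mul (k : Fin 2) :
    hadamard * (pauliZ ^ k.val * hadamard) = pauliX ^ k.val :=
  Pattern.hadamard_pauliZ_pow_hadamard k

theorem applyOne_hadamard_hadamard (v : V) (ψ : QState V) :
    applyOne hadamard v (applyOne hadamard v ψ) = ψ := by
  rw [applyOne_mul, hadamard_mul_self]
  funext y
  have : ∀ a, y v = a → ∑ b, (1 : Matrix (Fin 2) (Fin 2) ℂ) a b * ψ (Function.update y v b) = ψ y := by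
    rintro a rfl
    rw [Finset.sum_eq_single (y v)] <;> simp +contextual [eq_comm]
  exact this _ rfl

theorem applyFan_applyOne {ts : List V} {c t : V} (ht : t ∉ ts) (htc : c ≠ t)
    (U : Matrix (Fin 2) (Fin 2) ℂ) (ψ : QState V) :
    applyFan ts c (applyOne U t ψ) = applyOne U t (applyFan ts c ψ) := by
  funext y
  have h : ∀ b, Function.update (fanBasis ts c y) t b = fanBasis ts c (Function.update y t b) := by
    intro b
    funext w
    by_cases hw : w = t
    · subst hw; simp [fanBasis, ht]
    · simp [fanBasis, hw, htc]
  simp only [applyFan, applyOne, h]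
  simp only [fanBasis, if_neg ht]

/-- Conjugating the second qubit of `ΛZ` by Hadamard gates yields a controlled `X`. -/
theorem hadamard_applyCZ_hadamard {c t : V} (htc : c ≠ t) (ψ : QState V) :
    applyOne hadamard t (applyCZ c t (applyOne hadamard t ψ)) =
      fun y => ψ (Function.update y t (y t + y c)) := by
  funext y
  have h1 : ∀ χ : QState V, applyOne hadamard t (applyCZ c t χ) y =
      applyOne hadamard t (applyOne (pauliZ ^ (y c).val) t χ) y := by
    intro χ
    simp only [applyOne.eq_1 hadamard, applyCZ_apply, pauliZ_pow_apply, Function.update_self,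
      Function.update_of_ne htc, mul_comm (y c)]
  rw [h1, applyOne_mul, applyOne_mul, Matrix.mul_assoc, hadamard_mul_pauliZ_pow_mul, pauliX_pow_apply]

/-- A fan-out gate is a product of `ΛZ` conjugated by Hadamard gates on the targets. -/
theorem foldl_hadamard_cz {c : V} : ∀ {ts : List V}, (c :: ts).Nodup → ∀ ψ : QState V,
    ts.foldl (fun ψ v => applyOne hadamard v ψ) (fun y => (ts.map fun t => sgn (y c * y t)).prod *
      ts.foldl (fun ψ v => applyOne hadamard v ψ) ψ y) = applyFan ts c ψ
  | [], _, ψ => by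
    funext y
    have : fanBasis [] c y = y := by funext v; simp [fanBasis]
    simp [applyFan, this]
  | t :: ts, h, ψ => by
    simp only [List.nodup_cons, List.mem_cons, not_or] at h
    obtain ⟨⟨hct, hcts⟩, htts, hts⟩ := h
    have ih := foldl_hadamard_cz (List.nodup_cons.2 ⟨hcts, hts⟩) (applyOne hadamard t ψ)
    have e : (fun y => (((t :: ts).map fun t => sgn (y c * y t)).prod *
        (t :: ts).foldl (fun ψ v => applyOne hadamard v ψ) ψ y)) =
        applyCZ c t fun y => (ts.map fun t => sgn (y c * y t)).prod *
          ts.foldl (fun ψ v => applyOne hadamard v ψ) (applyOne hadamard t ψ) y := by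
      funext y
      rw [applyCZ_apply, List.map_cons, List.prod_cons, List.foldl_cons, mul_assoc]
    have hne : ∀ v ∈ ts, v ≠ t := by rintro v hv rfl; exact htts hv
    have hne' : ∀ v ∈ ts, v ≠ c := by rintro v hv rfl; exact hcts hv
    rw [e, List.foldl_cons, ← foldl_applyOne_comm hadamard (applyOne hadamard t) ts _ fun v hv ψ =>
        applyOne_comm (hne v hv).symm _ _ _,
      ← foldl_applyOne_comm hadamard (applyCZ c t) ts _ fun v hv ψ =>
        (applyOne_applyCZ (hne' v hv) (hne v hv) _ _).symm, ih, applyFan_applyOne htts hct,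
      hadamard_applyCZ_hadamard hct]
    funext y
    simp only [applyFan]
    congr 1
    funext w
    by_cases hw : w = t
    · subst hw; simp [fanBasis, htts]
    · simp [fanBasis, hw, hct]

/-- `R_z(α₀)` is obtained from moves with the angles `0`, `π`, `α₀`, `π`: the angle enters the moves with
a negative sign, which the conjugation by `X` reverses up to a phase. -/
theorem hopMat_Rz (α₀ : ℝ) : hopMat α₀ .pi * (hopMat α₀ .irr * (hopMat α₀ .pi * hopMat α₀ .zero)) =
    Complex.exp (-(Complex.I * (α₀ : ℂ))) • rotZ α₀ := by
  have h1 : rotZ (-Real.pi) = pauliZ ^ (1 : Fin 2).val := by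
    ext i j
    fin_cases i <;> fin_cases j <;> simp [rotZ, pauliZ, Complex.exp_neg, mul_comm Complex.I]
  have h2 := hadamard_mul_pauliZ_pow_mul 1
  have h3 : pauliX ^ (1 : Fin 2).val * (rotZ (-α₀) * pauliX ^ (1 : Fin 2).val) =
      Complex.exp (-(Complex.I * (α₀ : ℂ))) • rotZ α₀ := by
    ext i j
    fin_cases i <;> fin_cases j <;>
      simp [rotZ, pauliX, Matrix.mul_apply, ← Complex.exp_add]
  rw [hopMat_zero, ← h3]
  simp only [hopMat, Angle.val, h1, ← h2, Matrix.mul_assoc]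

open Pattern Command

variable {q : V → ℕ → W} {α₀ : ℝ} {outs : List W}

/-- The block of commands for a gate applies this gate to the state it moves. -/
theorem prob_gateBlock (hq : Labelling q) {g : Gate V} (hg : g.acts.Nodup) {A : List (Command W)}
    (h : Runs outs (gateBlock q g ++ A)) {ψ : QState V} {s : W → Fin 2} {P : ℝ}
    (hA : ∀ s', prob α₀ outs A
      (place q (fun v => if v ∈ g.acts then 4 else 0) (g.apply α₀ ψ)) s' = P) :
    prob α₀ outs (gateBlock q g ++ A) (place q (fun _ => 0) ψ) s = P := by
  cases g with
  | H i =>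
    refine prob_hop (δ := fun _ => 0) (v := i) (d' := 4) (a := .zero) hq (by simp) (by omega)
      (by omega) h fun s' => ?_
    rw [← hA s', hopMat_zero, Gate.apply]
    congr 2
    funext w
    simp [Gate.acts, Function.update_apply]
  | Rz i =>
    simp only [gateBlock, List.append_assoc] at h ⊢
    have hu : ∀ d d', Function.update (Function.update (fun _ : V => 0) i d) i d' =
        Function.update (fun _ => 0) i d' := fun d d' => Function.update_idem ..
    have step : ∀ {d d' : ℕ} {a : Angle} {B : List (Command W)} {φ : QState V} {s : W → Fin 2},
        d ≤ 4 → d' ≤ 4 → d ≠ d' → Runs outs (hop (q i d) (q i d') a ++ B) →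
        (∀ s', prob α₀ outs B (place q (Function.update (fun _ => 0) i d')
          (applyOne (hopMat α₀ a) i φ)) s' = P) →
        prob α₀ outs (hop (q i d) (q i d') a ++ B)
          (place q (Function.update (fun _ => 0) i d) φ) s = P := by
      intro d d' a B φ s hd hd' hne hB hP
      have e : d = Function.update (fun _ : V => 0) i d i := by simp
      rw [show hop (q i d) (q i d') a = hop (q i (Function.update (fun _ : V => 0) i d i)) (q i d') a
        by rw [← e]] at hB ⊢
      refine prob_hop hq (fun v => ?_) hd' (by rwa [← e]) hB fun s' => ?_
      · rw [Function.update_apply]; split_ifs <;> omega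
      · rw [hu]; exact hP s'
    have e0 : (fun _ : V => 0) = Function.update (fun _ => 0) i 0 := by simp
    rw [e0]
    refine step (by omega) (by omega) (by omega) h fun s1 => step (by omega) (by omega) (by omega)
      h.append_right fun s2 => step (by omega) (by omega) (by omega) h.append_right.append_right
      fun s3 => step (by omega) (by omega) (by omega) h.append_right.append_right.append_right
      fun s4 => ?_
    have hn : ‖Complex.exp (-(Complex.I * (α₀ : ℂ)))‖ = 1 := by
      rw [mul_comm, ← neg_mul, ← Complex.ofReal_neg, Complex.norm_exp_ofReal_mul_I]
    rw [applyOne_mul, applyOne_mul, applyOne_mul, Matrix.mul_assoc, Matrix.mul_assoc, hopMat_Rz, ← hA s4, Gate.apply]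
    have e : place q (Function.update (fun _ => 0) i 4)
        (applyOne (Complex.exp (-(Complex.I * (α₀ : ℂ))) • rotZ α₀) i ψ) =
        Complex.exp (-(Complex.I * (α₀ : ℂ))) • place q (fun v => if v ∈ (Gate.Rz i).acts then 4
          else 0) (applyOne (rotZ α₀) i ψ) := by
      funext z
      simp only [place, applyOne, Gate.acts, Function.update_apply, List.mem_singleton,
        Pi.smul_apply, smul_eq_mul, Matrix.smul_apply, Finset.mul_sum, mul_assoc]
    rw [e, prob_smul, hn, one_pow, one_mul]
  | CZ i j =>
    have hij : [i, j].Nodup := hg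
    have e : gateBlock q (.CZ i j) ++ A = .E (q i 0) (q j 0) ::
      (hops q [i, j] 0 1 ++ (hops q [i, j] 1 4 ++ A)) := by simp [gateBlock]
    rw [e] at h ⊢
    have e1 : applyCZ (q i 0) (q j 0) (place q (fun _ => 0) ψ) =
        place q (fun _ => 0) (applyCZ i j ψ) := rfl
    rw [prob, e1]
    refine prob_hops hq (by omega) (by omega) (by simp) hij (by simp) h.tail fun s1 =>
      prob_hops hq (by omega) (by omega) (fun v => ?_) hij (fun v hv => if_pos hv)
        h.tail.append_right fun s2 => ?_
    · split_ifs <;> omega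
    · rw [← hA s2, Gate.apply]
      have hne : i ≠ j := by simpa using hij
      simp only [List.foldl_cons, List.foldl_nil]
      rw [applyOne_comm hne, applyOne_hadamard_hadamard, applyOne_hadamard_hadamard]
      congr 2
      funext w
      by_cases h1 : w ∈ [i, j] <;> simp only [Gate.acts, h1, if_true, if_false]
  | fan ts c =>
    rw [Gate.acts, List.nodup_append] at hg
    have hcts : (c :: ts).Nodup :=
      List.nodup_cons.2 ⟨fun h => hg.2.2 c h c (by simp) rfl, hg.1⟩
    have hc := (List.nodup_cons.1 hcts).1
    have e : gateBlock q (.fan ts c) ++ A = hops q ts 0 1 ++ (couplings q ts ++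
      (links q (chain q (q c 0) ts) ++ (ts.map (fun t => Command.M (q t 3) .zero) ++ (fixes q [] ts ++
      (.Z (q c 0) (ts.map fun t => q t 3) :: (hops q [c] 0 1 ++ (hops q (c :: ts) 1 4 ++ A))))))) := by
      simp [gateBlock]
    rw [e] at h ⊢
    refine prob_hops hq (by omega) (by omega) (by simp) hg.1 (by simp) h fun s1 => ?_
    have hfree : ∀ d, d ≤ 4 → 2 ≤ d → ∀ t (φ : QState V) z u, place q (fun v => if v ∈ ts then 1 else 0) φ
        (Function.update z (q t d) u) = place q (fun v => if v ∈ ts then 1 else 0) φ z := by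
      intro d hd hd' t φ z u
      refine congrArg φ (funext fun v => Function.update_of_ne (fun e => ?_) _ _)
      have := ((hq _ _ _ _ (show (if v ∈ ts then 1 else 0) ≤ 4 by split_ifs <;> omega) hd).1 e).2
      split_ifs at this <;> omega
    refine prob_fan_core hq hcts h.append_right (fun t _ => hfree 2 (by omega) (by omega) t _)
      (fun t _ => hfree 3 (by omega) (by omega) t _) fun s2 => ?_
    have e1 : ∀ φ : QState V, (fun z : W → Fin 2 => (ts.map fun t => sgn (z (q c 0) * z (q t 1))).prod *
        place q (fun v => if v ∈ ts then 1 else 0) φ z) = place q (fun v => if v ∈ ts then 1 else 0)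
          fun y => (ts.map fun t => sgn (y c * y t)).prod * φ y := by
      intro φ
      funext z
      simp only [place, if_neg hc]
      congr 2
      exact List.map_congr_left fun t ht => by rw [if_pos ht]
    rw [e1]
    have h' := h.append_right.append_right.append_right.append_right.append_right.tail
    refine prob_hops hq (by omega) (by omega) (fun v => by split_ifs <;> omega)
      (List.nodup_singleton c) (fun v hv => ?_) h' fun s3 => prob_hops hq (by omega) (by omega)
      (fun v => by split_ifs <;> omega) hcts (fun v hv => ?_) h'.append_right fun s4 => ?_
    · rw [List.mem_singleton] at hv
      subst hv; exact if_neg hc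
    · rcases List.mem_cons.1 hv with rfl | hv
      · simp
      · simp [hv]
    · rw [← hA s4, Gate.apply]
      simp only [List.foldl_cons, List.foldl_nil]
      rw [applyOne_hadamard_hadamard, foldl_hadamard_cz hcts]
      congr 2
      funext w
      simp only [Gate.acts, List.mem_cons, List.mem_append, List.not_mem_nil, or_false]
      split_ifs <;> tauto

end GateSemantics

/-! ### Measurement patterns which simulate circuits -/

namespace Circuit

open Pattern Command

section Simulation

variable {N : ℕ}

/-- The qubits attached to `v` after `k v` gates on `v`. -/
def wire (K : ℕ) (k : Fin N → ℕ) (v : Fin N) (d : ℕ) : Fin ((K + 1) * N) := lab K v (4 * k v + 2 + d)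

/-- The numbers of gates on each qubit are updated for the gate `g`. -/
def tally (k : Fin N → ℕ) (g : Gate (Fin N)) (v : Fin N) : ℕ := if v ∈ g.acts then k v + 1 else k v

/-- The gates with their blocks of commands. -/
def gateBlocks (K : ℕ) : (Fin N → ℕ) → List (Gate (Fin N)) →
    List (Gate (Fin N) × List (Command (Fin ((K + 1) * N))))
  | _, [] => []
  | k, g :: gs => (g, gateBlock (wire K k) g) :: gateBlocks K (tally k g) gs

theorem map_fst_gateBlocks (K : ℕ) : ∀ (k : Fin N → ℕ) (gs : List (Gate (Fin N))),
    (gateBlocks K k gs).map Prod.fst = gs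
  | _, [] => rfl
  | k, g :: gs => by rw [gateBlocks, List.map_cons, map_fst_gateBlocks]

theorem labelling_wire {K : ℕ} {k : Fin N → ℕ} (hk : ∀ v, 4 * k v + 6 ≤ K) :
    Labelling (wire K k) := by
  intro v v' d d' hd hd'
  have h1 := hk v
  have h2 := hk v'
  rw [wire, wire, lab_inj (by omega) (by omega)]
  constructor
  · rintro ⟨rfl, h⟩
    exact ⟨rfl, by omega⟩
  · rintro ⟨rfl, rfl⟩
    exact ⟨rfl, rfl⟩

theorem tally_le (k : Fin N → ℕ) (g : Gate (Fin N)) (v : Fin N) : tally k g v ≤ k v + 1 := by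
  rw [tally]; split_ifs <;> omega

theorem le_tally (k : Fin N → ℕ) (g : Gate (Fin N)) (v : Fin N) : k v ≤ tally k g v := by
  rw [tally]; split_ifs <;> omega

theorem mem_gateBlocks {K : ℕ} {x : Gate (Fin N) × List (Command (Fin ((K + 1) * N)))} :
    ∀ {k : Fin N → ℕ} {gs : List (Gate (Fin N))}, (∀ v, 4 * (k v + gs.length) + 2 ≤ K) →
      x ∈ gateBlocks K k gs → x.1 ∈ gs ∧ ∃ k', (∀ v, 4 * k' v + 6 ≤ K) ∧
        x.2 = gateBlock (wire K k') x.1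
  | _, [], _, h => by simp [gateBlocks] at h
  | k, g :: gs, hk, h => by
    rcases List.mem_cons.1 h with rfl | h
    · exact ⟨by simp, k, fun v => by have := hk v; simp only [List.length_cons] at this; omega, rfl⟩
    · obtain ⟨h1, h2⟩ := mem_gateBlocks (fun v => by
        have := hk v
        have := tally_le k g v
        simp only [List.length_cons] at *; omega) h
      exact ⟨List.mem_cons_of_mem _ h1, h2⟩

theorem pairwise_gateBlocks {K : ℕ} : ∀ {k : Fin N → ℕ} {gs : List (Gate (Fin N))},
    (∀ v, 4 * (k v + gs.length) + 2 ≤ K) →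
    (gateBlocks K k gs).Pairwise fun x y => ∀ p ∈ x.2, ∀ q ∈ y.2, Command.Dep p q →
      Gate.Dep x.1 y.1
  | _, [], _ => by simp [gateBlocks]
  | k, g :: gs, hk => by
    have hk' : ∀ v, 4 * (tally k g v + gs.length) + 2 ≤ K := by
      intro v
      have := hk v
      have := tally_le k g v
      simp only [List.length_cons] at *; omega
    rw [gateBlocks, List.pairwise_cons]
    refine ⟨fun y hy p hp c hc hd => ?_, pairwise_gateBlocks hk'⟩
    obtain ⟨-, k', h1, h2⟩ := mem_gateBlocks hk' hy
    rw [h2] at hc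
    obtain ⟨w, hw, hw'⟩ := hd
    obtain ⟨v, hv, d, hd, e⟩ := exists_of_mem_dom hp (List.mem_append_left _ hw)
    obtain ⟨v', hv', d', hd', e'⟩ := exists_of_mem_dom hc hw'
    have h3 := hk v
    have h4 := h1 v'
    simp only [List.length_cons] at h3
    rw [e, wire, wire, lab_inj (by omega) (by omega)] at e'
    obtain ⟨rfl, -⟩ := e'
    exact ⟨v, hv, hv'⟩

theorem wellFormedFrom_gateBlocks {K : ℕ} : ∀ {k : Fin N → ℕ} {gs : List (Gate (Fin N))}
    {S : List (Fin ((K + 1) * N))}, (∀ v, 4 * (k v + gs.length) + 2 ≤ K) →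
    (∀ g ∈ gs, g.acts.Nodup) → (∀ v j, 4 * k v + 2 ≤ j → j ≤ K → lab K v j ∉ S) →
    WellFormedFrom S ((gateBlocks K k gs).flatMap Prod.snd) ∧
      ∀ v j, 4 * gs.foldl tally k v + 2 ≤ j → j ≤ K →
        lab K v j ∉ measuredBy ((gateBlocks K k gs).flatMap Prod.snd) ++ S
  | _, [], S, _, _, hS => ⟨trivial, by simpa [gateBlocks, measuredBy] using hS⟩
  | k, g :: gs, S, hk, hg, hS => by
    have hk' : ∀ v, 4 * (tally k g v + gs.length) + 2 ≤ K := by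
      intro v
      have := hk v
      have := tally_le k g v
      simp only [List.length_cons] at *; omega
    have hk6 : ∀ v, 4 * k v + 6 ≤ K := by
      intro v
      have := hk v
      simp only [List.length_cons] at this; omega
    have hq := labelling_wire hk6
    obtain ⟨h1, h2⟩ := wellFormedFrom_gateBlocks (S := measuredBy (gateBlock (wire K k) g) ++ S) hk'
      (fun g hg' => hg g (List.mem_cons_of_mem _ hg')) (fun v j hj hjK hm => by
        rcases List.mem_append.1 hm with hm | hm
        · obtain ⟨v', hv', d, hd, e⟩ := exists_of_mem_measuredBy_gateBlock hm
          have := hk6 v'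
          rw [wire, lab_inj hjK (by omega)] at e
          obtain ⟨rfl, e⟩ := e
          rw [tally, if_pos hv'] at hj
          omega
        · exact hS v j ((by have := le_tally k g v; omega)) hjK hm)
    rw [gateBlocks, List.flatMap_cons, wellFormedFrom_append]
    refine ⟨⟨wellFormedFrom_gateBlock hq (hg g List.mem_cons_self) fun v _ d hd =>
      hS v _ (by omega) (by have := hk6 v; omega), h1⟩, fun v j hj hjK hm => ?_⟩
    refine h2 v j hj hjK ?_
    rw [measuredBy_append] at hm
    simp only [List.mem_append] at hm ⊢
    tauto

/-- The commands which apply the gates `gs` to the states of the qubits of a circuit. They start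
from a state in which the inputs and the other qubits are brought into their initial states. -/
def simCommands (C : Circuit) : List (Command (Fin ((4 * C.gates.length + 6 + 1) * C.numQubits))) :=
  hops (lab (4 * C.gates.length + 6)) C.inputs 0 1 ++
    (hops (lab (4 * C.gates.length + 6)) (List.finRange C.numQubits) 1 2 ++
      (gateBlocks (4 * C.gates.length + 6) (fun _ => 0) C.gates).flatMap Prod.snd)

/-- The simulating pattern. -/
def toPattern (C : Circuit) : Pattern where
  numQubits := (4 * C.gates.length + 6 + 1) * C.numQubits
  inputs := C.inputs.map fun v => lab _ v 0
  outputs := C.outputs.map fun v => wire _ (C.gates.foldl tally fun _ => 0) v 0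
  commands := C.simCommands

theorem labelling_lab {K : ℕ} (hK : 4 ≤ K) : Labelling (lab K : Fin N → ℕ → _) :=
  fun _ _ _ _ hd hd' => lab_inj (by omega) (by omega)

theorem foldl_tally_le : ∀ (gs : List (Gate (Fin N))) (k : Fin N → ℕ) (v : Fin N),
    gs.foldl tally k v ≤ k v + gs.length
  | [], _, _ => le_rfl
  | g :: gs, k, v => by
    have := foldl_tally_le gs (tally k g) v
    have := tally_le k g v
    simp only [List.foldl_cons, List.length_cons] at *
    omega

theorem wellFormedFrom_simCommands {C : Circuit} (h : C.WellFormed) :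
    WellFormedFrom [] C.simCommands ∧ ∀ v j, 4 * C.gates.foldl tally (fun _ => 0) v + 2 ≤ j →
      j ≤ 4 * C.gates.length + 6 → lab _ v j ∉ measuredBy C.simCommands := by
  have hq : Labelling (lab (4 * C.gates.length + 6) : Fin C.numQubits → ℕ → _) :=
    labelling_lab (by omega)
  have h1 := wellFormedFrom_hops (S := []) hq h.inputs_nodup (d := 0) (d' := 1) (by omega)
    (by omega) (by omega) (by simp) (by simp)
  have h2 := wellFormedFrom_hops hq (List.nodup_finRange C.numQubits) (d := 1) (d' := 2)
    (S := measuredBy (hops (lab (4 * C.gates.length + 6)) C.inputs 0 1) ++ []) (by omega)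
    (by omega) (by omega) (by simp [mem_measuredBy_hops, hq _ _ _ _])
    (by simp [mem_measuredBy_hops, hq _ _ _ _])
  obtain ⟨h3, h4⟩ := wellFormedFrom_gateBlocks (K := 4 * C.gates.length + 6) (k := fun _ => 0)
    (gs := C.gates) (S := measuredBy (hops (lab (4 * C.gates.length + 6))
      (List.finRange C.numQubits) 1 2) ++
      (measuredBy (hops (lab (4 * C.gates.length + 6)) C.inputs 0 1) ++ [])) (fun v => by
      omega) h.gates_wf (fun v j hj hjK hm => by
      simp only [List.append_nil, List.mem_append, mem_measuredBy_hops] at hm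
      rcases hm with ⟨v', -, e⟩ | ⟨v', -, e⟩ <;> rw [lab_inj hjK (by omega)] at e <;> omega)
  refine ⟨wellFormedFrom_append.2 ⟨h1, wellFormedFrom_append.2 ⟨h2, h3⟩⟩, fun v j hj hjK hm => ?_⟩
  refine h4 v j hj hjK ?_
  rw [simCommands, measuredBy_append, measuredBy_append] at hm
  simp only [List.append_nil, List.mem_append] at hm ⊢
  tauto

theorem toPattern_wellFormed {C : Circuit} (h : C.WellFormed) : C.toPattern.WellFormed where
  inputs_nodup := h.inputs_nodup.map (lab_injective (Nat.zero_le _))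
  outputs_nodup := by
    refine h.outputs_nodup.map fun v v' e => ?_
    have h1 := foldl_tally_le C.gates (fun _ => 0) v
    have h2 := foldl_tally_le C.gates (fun _ => 0) v'
    exact ((lab_inj (by omega) (by omega)).1 e).1
  commands_wf := (wellFormedFrom_simCommands h).1
  outputs_unmeasured c hc w hw hw' := by
    obtain ⟨v, -, rfl⟩ := List.mem_map.1 hw'
    have h1 := foldl_tally_le C.gates (fun _ => 0) v
    simp only [zero_add] at h1
    exact (wellFormedFrom_simCommands h).2 v _ (le_refl _) (by omega)
      (List.mem_flatMap.2 ⟨c, hc, hw⟩)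

theorem toPattern_depth_le {C : Circuit} (h : C.WellFormed) :
    C.toPattern.depth ≤ 16 * C.depth + 6 := by
  have hq : Labelling (lab (4 * C.gates.length + 6) : Fin C.numQubits → ℕ → _) :=
    labelling_lab (by omega)
  have hk : ∀ v : Fin C.numQubits, 4 * ((fun _ => 0 : Fin C.numQubits → ℕ) v + C.gates.length) + 2 ≤
      4 * C.gates.length + 6 := fun v => by dsimp only; omega
  have h1 := chainDepth_hops_le hq h.inputs_nodup (d := 0) (d' := 1) (by omega) (by omega)
  have h2 := chainDepth_hops_le hq (List.nodup_finRange C.numQubits) (d := 1) (d' := 2)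
    (by omega) (by omega)
  have h3 := chainDepth_flatMap_le (T := Command.Dep) (R := Gate.Dep) (K := 16)
    (l := gateBlocks (4 * C.gates.length + 6) (fun _ => 0) C.gates)
    (fun x hx => by
      obtain ⟨h4, k, h5, h6⟩ := mem_gateBlocks hk hx
      rw [h6]; exact chainDepth_gateBlock_le (labelling_wire h5) (h.gates_wf _ h4))
    (pairwise_gateBlocks hk)
  rw [map_fst_gateBlocks] at h3
  have h4 := chainDepth_append_le_of h1 (chainDepth_append_le_of h2 h3)
  have h6 : C.toPattern.depth = chainDepth Command.Dep C.simCommands := rfl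
  rw [h6, simCommands, depth]
  omega

variable {α₀ : ℝ}

/-- The blocks of commands apply the gates of the circuit to the state they move. -/
theorem prob_gateBlocks {K : ℕ} {outs : List (Fin ((K + 1) * N))} {P : ℝ} :
    ∀ {k : Fin N → ℕ} {gs : List (Gate (Fin N))} {ψ : QState (Fin N)}
      {s : Fin ((K + 1) * N) → Fin 2}, (∀ v, 4 * (k v + gs.length) + 2 ≤ K) →
    (∀ g ∈ gs, g.acts.Nodup) → Runs outs ((gateBlocks K k gs).flatMap Prod.snd) →
    probOnes outs (place (wire K (gs.foldl tally k)) (fun _ => 0)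
      (gs.foldl (fun ψ g => g.apply α₀ ψ) ψ)) = P →
    prob α₀ outs ((gateBlocks K k gs).flatMap Prod.snd) (place (wire K k) (fun _ => 0) ψ) s = P
  | _, [], _, _, _, _, _, hP => hP
  | k, g :: gs, ψ, s, hk, hg, h, hP => by
    have hk' : ∀ v, 4 * (tally k g v + gs.length) + 2 ≤ K := by
      intro v
      have := hk v
      have := tally_le k g v
      simp only [List.length_cons] at *; omega
    have hk6 : ∀ v, 4 * k v + 6 ≤ K := by
      intro v
      have := hk v
      simp only [List.length_cons] at this; omega
    rw [gateBlocks, List.flatMap_cons] at h ⊢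
    refine prob_gateBlock (labelling_wire hk6) (hg g List.mem_cons_self) h fun s' => ?_
    have e : ∀ φ : QState (Fin N), place (wire K k) (fun v => if v ∈ g.acts then 4 else 0) φ =
        place (wire K (tally k g)) (fun _ => 0) φ := by
      intro φ
      funext z
      refine congrArg φ (funext fun v => congrArg z ?_)
      simp only [wire, tally]
      split_ifs
      · congr 1
      · rfl
    rw [e]
    exact prob_gateBlocks hk' (fun g hg' => hg g (List.mem_cons_of_mem _ hg')) h.append_right hP

theorem prod_ite_range {V W R : Type} [Fintype V] [Fintype W] [CommMonoid R] {m : V → W}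
    (hm : Function.Injective m) [DecidablePred (· ∈ Set.range m)] (c : R) :
    (∏ w, if w ∈ Set.range m then 1 else c) = c ^ (Fintype.card W - Fintype.card V) := by
  classical
  rw [Finset.prod_ite, Finset.prod_const_one, one_mul, Finset.prod_const]
  congr 1
  have h1 : (Finset.univ.filter fun w => w ∈ Set.range m) = Finset.univ.image m := by
    ext w; simp
  have h2 := Finset.card_filter_add_card_filter_not (s := (Finset.univ : Finset W))
    (fun w => w ∈ Set.range m)
  rw [h1, Finset.card_image_of_injective _ hm, Finset.card_univ, Finset.card_univ] at h2
  omega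

/-- The qubits which carry nothing are proportional to `|+⟩` and are summed over. -/
theorem probOnes_place {V W : Type} [Fintype V] [DecidableEq V] [Fintype W] [DecidableEq W]
    {q : V → ℕ → W} {δ : V → ℕ} (hm : Function.Injective fun v => q v (δ v)) (outs : List V)
    (ψ : QState V) : probOnes (outs.map fun v => q v (δ v)) (place q δ ψ) =
      probOnes outs ψ * 2 ^ (Fintype.card W - Fintype.card V) := by
  classical
  have h := sum_comp_mul_prod hm (fun y => if ∀ o ∈ outs, y o = 1 then ‖ψ y‖ ^ 2 else 0)
    (fun _ _ => 1) (fun _ _ => rfl)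
  simp only [Finset.prod_const_one, mul_one, Finset.sum_const, Finset.card_univ, Fintype.card_fin,
    nsmul_eq_mul] at h
  have h2 := prod_ite_range hm (2 : ℝ)
  simp only [Nat.cast_ofNat] at h
  rw [probOnes, probOnes, ← h2, ← h]
  refine Finset.sum_congr rfl fun z _ => ?_
  simp [place, Function.comp_def]

theorem initState_place {V W : Type} [Fintype V] [DecidableEq V] [Fintype W] [DecidableEq W]
    {q : V → ℕ → W} {δ : V → ℕ} (hq : Function.Injective fun v => q v (δ v)) {inputs : List V}
    {m : V → W} (hm : Function.Injective m) (hi : ∀ v ∈ inputs, q v (δ v) = m v)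
    (hi' : ∀ v ∉ inputs, q v (δ v) ∉ inputs.map m) (w : List (Fin 2)) :
    initState ketPlus (inputs.map m) w =
      (1 / (Real.sqrt 2 : ℂ)) ^ (Fintype.card W - Fintype.card V) •
        place q δ (initState ketPlus inputs w) := by
  classical
  funext z
  rw [initState_eq, initState_eq, Pi.smul_apply, smul_eq_mul, place, prodState, prodState,
    ← prod_ite_range hq, mul_comm]
  refine (prod_eq_prod_mul_prod hq _
    (fun x => if x ∈ Set.range (fun v => q v (δ v)) then 1 else 1 / (Real.sqrt 2 : ℂ))
    (fun v => if_pos ⟨v, rfl⟩) fun x hx => ?_).trans ?_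
  · have hx' : x ∉ inputs.map m := by
      intro h
      obtain ⟨v, hv, rfl⟩ := List.mem_map.1 h
      exact hx ⟨v, hi v hv⟩
    rw [if_neg hx, initKet, if_neg hx']
    generalize z x = b
    fin_cases b <;> rfl
  · congr 1
    refine Finset.prod_congr rfl fun v _ => congrFun ?_ _
    by_cases hv : v ∈ inputs
    · rw [hi v hv, initKet_map hm]
    · rw [initKet, initKet, if_neg hv, if_neg (hi' v hv)]

theorem foldl_hadamard_initState {V : Type} [Fintype V] [DecidableEq V] {inputs l : List V}
    (hi : inputs.Nodup) (hl : l.Nodup) (hl' : ∀ v, v ∈ l) (w : List (Fin 2)) :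
    l.foldl (fun ψ v => applyOne hadamard v ψ) (inputs.foldl (fun ψ v => applyOne hadamard v ψ)
      (initState ketPlus inputs w)) = initState ketZero inputs w := by
  have h : ∀ (l : List V), l.Nodup → ∀ κ : V → Fin 2 → ℂ,
      l.foldl (fun ψ v => applyOne hadamard v ψ) (prodState κ) =
        prodState fun v => if v ∈ l then hadamard *ᵥ κ v else κ v := by
    intro l hl κ
    simpa using foldl_applyOne_prodState hadamard (fun _ => 1) l κ hl (by simp)
  rw [initState_eq, initState_eq, h _ hi, h _ hl]
  congr 1
  funext v
  rw [if_pos (hl' v)]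
  by_cases hv : v ∈ inputs
  · rw [if_pos hv, mulVec_mulVec, hadamard_mul_self, one_mulVec, initKet, initKet, if_pos hv,
      if_pos hv]
  · rw [if_neg hv, initKet, initKet, if_neg hv, if_neg hv, hadamard_mulVec_ketPlus]

theorem toPattern_acceptProb (α₀ : ℝ) {C : Circuit} (h : C.WellFormed) (w : List (Fin 2)) :
    C.toPattern.acceptProb α₀ w = C.acceptProb α₀ w := by
  set K := 4 * C.gates.length + 6 with hK
  have hq : Labelling (lab K : Fin C.numQubits → ℕ → _) := labelling_lab (by omega)
  have hwf := toPattern_wellFormed h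
  let outs : List (Fin ((K + 1) * C.numQubits)) :=
    C.outputs.map fun v => wire K (C.gates.foldl tally fun _ => 0) v 0
  have hruns : Runs outs C.simCommands :=
    ⟨⟨_, hwf.commands_wf⟩, hwf.outputs_unmeasured⟩
  let δ : Fin C.numQubits → ℕ := fun v => if v ∈ C.inputs then 0 else 1
  have hδ : ∀ v, δ v ≤ 4 := fun v => by simp only [δ]; split_ifs <;> omega
  have hinit := initState_place (q := lab K) (δ := δ) (inputs := C.inputs) (m := fun v => lab K v 0)
    (fun v v' e => ((hq _ _ _ _ (hδ v) (hδ v')).1 e).1) (lab_injective (Nat.zero_le _))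
    (fun v hv => by simp [δ, hv]) (fun v hv hm => by
      obtain ⟨v', hv', e⟩ := List.mem_map.1 hm
      have := ((hq _ _ _ _ (by omega) (hδ v)).1 e).1
      exact hv (this ▸ hv')) w
  have hcur : Function.Injective fun v => wire K (C.gates.foldl tally fun _ => 0) v 0 := by
    intro v v' e
    have h1 := foldl_tally_le C.gates (fun _ => 0) v
    have h2 := foldl_tally_le C.gates (fun _ => 0) v'
    exact ((lab_inj (by omega) (by omega)).1 e).1
  have hacc : C.toPattern.acceptProb α₀ w = prob α₀ outs C.simCommands
      (initState ketPlus (C.inputs.map fun v => lab K v 0) w) fun _ => 0 := rfl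
  have hn : ‖(1 / (Real.sqrt 2 : ℂ))‖ ^ 2 = 1 / 2 := by simp
  set M := Fintype.card (Fin ((K + 1) * C.numQubits)) - Fintype.card (Fin C.numQubits) with hM
  have key : prob α₀ outs C.simCommands (place (lab K) δ
      (initState ketPlus C.inputs w)) (fun _ => 0) = C.acceptProb α₀ w * 2 ^ M := by
    rw [simCommands] at hruns ⊢
    refine prob_hops hq (by omega) (by omega) hδ h.inputs_nodup (fun v hv => if_pos hv) hruns
      fun s1 => prob_hops hq (by omega) (by omega) (fun v => ?_) (List.nodup_finRange _)
      (fun v _ => ?_) hruns.append_right fun s2 => ?_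
    · have := hδ v
      split_ifs <;> omega
    · simp only [δ]
      split_ifs <;> rfl
    · rw [foldl_hadamard_initState h.inputs_nodup (List.nodup_finRange _) List.mem_finRange]
      simp only [List.mem_finRange, if_true]
      have hP := probOnes_place hcur C.outputs
        (C.gates.foldl (fun ψ g => g.apply α₀ ψ) (initState ketZero C.inputs w))
      exact prob_gateBlocks (fun v => by simp; omega) h.gates_wf
        hruns.append_right.append_right hP
  rw [hacc, hinit, prob_smul, norm_pow, ← pow_mul, mul_comm _ 2, pow_mul, hn, key]
  rw [mul_left_comm, ← mul_pow]
  norm_num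

end Simulation

end Circuit

/-! ### Scans of descriptions -/

/-- The numbers which describe a command or a gate: its code and a list, or the targets and the
control of a fan-out gate. -/
inductive Item
  | one (kd : ℕ) (hkd : kd < 10) (i : ℕ) (τ : List ℕ)
  | two (ts : List ℕ) (c : ℕ)

/-- The numbers in a description of a pattern or a circuit. -/
structure Desc where
  N : ℕ
  ins : List ℕ
  outs : List ℕ
  items : List Item

/-- The positions of successive numbers, numbered from `j`. -/
def groupEnts (kd g l j : ℕ) (ns : List ℕ) : List Ent :=
  (ns.zipIdx j).map fun x => ⟨kd, g, l, x.2, x.1⟩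

/-- The positions of the numbers of a command or gate, if it is the `g`-th one. -/
def Item.ents (g : ℕ) : Item → List Ent
  | .one kd _ i τ => groupEnts kd g 0 0 (i :: τ)
  | .two ts c => groupEnts 10 g 0 0 ts ++ groupEnts 10 g 1 0 [c]

/-- The main position of the description of a command or gate. -/
def Item.main (g : ℕ) : Item → Ent
  | .one kd _ i _ => ⟨kd, g, 0, 0, i⟩
  | .two _ c => ⟨10, g, 1, 0, c⟩

/-- The numbers of the first list in the description of a command or gate. -/
def Item.first : Item → List ℕ
  | .one _ _ i τ => i :: τ
  | .two ts _ => ts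

/-- The code of the name of a command or gate. -/
def Item.kind : Item → ℕ
  | .one kd _ _ _ => kd
  | .two _ _ => 10

namespace Desc

/-- The positions of all the numbers. -/
def ents (D : Desc) : List Ent :=
  groupEnts 0 0 0 0 (D.N :: D.ins) ++ groupEnts 0 0 1 0 D.outs ++
    (D.items.zipIdx 1).flatMap fun x => x.1.ents x.2

end Desc

/-- The positions at the letters `tick` of a number. -/
def Ent.ticks (e : Ent) : List Ent := (List.range e.v).map fun u => { e with v := u }

/-- The scans of the word `w` stop at the positions of the numbers of `D`. -/
def ReadsAs (w : List Token) (D : Desc) : Prop :=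
  scanList false Ent.zero w = D.ents ∧ scanList true Ent.zero w = D.ents.flatMap Ent.ticks

section Words

/-- The stops of a scan at a number. -/
def Ent.stops (b : Bool) (e : Ent) : List Ent := if b then e.ticks else [e]

theorem scanList_ticks (b : Bool) (e : Ent) (w : List Token) : ∀ k : ℕ,
    scanList b e (List.replicate k .tick ++ w) =
      (if b then (List.range k).map fun u => { e with v := e.v + u } else []) ++
        scanList b { e with v := e.v + k } w
  | 0 => by simp
  | k + 1 => by
    rw [List.replicate_succ', List.append_assoc, scanList_ticks b e _ k, List.singleton_append,
      scanList, List.range_succ]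
    cases b <;> simp [fires, Ent.upd, Nat.add_assoc]

theorem scanList_encodeNum (b : Bool) (e : Ent) (he : e.v = 0) (k : ℕ) (w : List Token) :
    scanList b e (encodeNum k ++ w) =
      { e with v := k }.stops b ++ scanList b { e with j := e.j + 1 } w := by
  obtain ⟨kd, g, l, j, v⟩ := e
  simp only at he
  subst he
  rw [encodeNum, List.append_assoc, scanList_ticks, List.singleton_append, scanList]
  cases b <;> simp [fires, Ent.upd, Ent.stops, Ent.ticks]

theorem scanList_encodeList (b : Bool) (kd g l : ℕ) {m : ℕ} (w : List Token) :
    ∀ (j : ℕ) (ns : List (Fin m)), scanList b ⟨kd, g, l, j, 0⟩ (encodeList ns ++ w) =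
      (groupEnts kd g l j (ns.map Fin.val)).flatMap (Ent.stops b) ++
        scanList b ⟨kd, g, l + 1, 0, 0⟩ w
  | j, [] => by simp [encodeList, scanList, fires, Ent.upd, groupEnts]
  | j, n :: ns => by
    have e : encodeList (n :: ns) ++ w = encodeNum n ++ (encodeList ns ++ w) := by
      simp [encodeList]
    rw [e, scanList_encodeNum b _ rfl, scanList_encodeList b kd g l w (j + 1) ns]
    simp [groupEnts, List.append_assoc]

/-- The numbers in the description of a command. -/
def Command.item {m : ℕ} : Command (Fin m) → Item
  | .E i j => .one 1 (by decide) i [j.val]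
  | .M i .zero => .one 2 (by decide) i []
  | .M i .pi => .one 3 (by decide) i []
  | .M i .irr => .one 4 (by decide) i []
  | .X i σ => .one 5 (by decide) i (σ.map Fin.val)
  | .Z i σ => .one 6 (by decide) i (σ.map Fin.val)

/-- The numbers in the description of a gate. -/
def Gate.item {m : ℕ} : Gate (Fin m) → Item
  | .H i => .one 7 (by decide) i []
  | .Rz i => .one 8 (by decide) i []
  | .CZ i j => .one 9 (by decide) i [j.val]
  | .fan ts c => .two (ts.map Fin.val) c

theorem scanList_encodeCommand {m : ℕ} (b : Bool) (e : Ent) (he : e.v = 0) (c : Command (Fin m))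
    (w : List Token) : ∃ e' : Ent, e'.v = 0 ∧ e'.g = e.g + 1 ∧
      scanList b e (encodeCommand c ++ w) =
        (c.item.ents (e.g + 1)).flatMap (Ent.stops b) ++ scanList b e' w := by
  obtain ⟨kd, g, l, j, v⟩ := e
  simp only at he
  subst he
  have hE : ∀ (t : Token) (w : List Token) (k : ℕ), fires b t = false →
      (⟨kd, g, l, j, 0⟩ : Ent).upd t = ⟨k, g + 1, 0, 0, 0⟩ →
      scanList b ⟨kd, g, l, j, 0⟩ (t :: w) = scanList b ⟨k, g + 1, 0, 0, 0⟩ w := by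
    intro t w k h1 h2
    rw [scanList, h1, h2]; rfl
  cases c with
  | E i j' =>
    refine ⟨⟨1, g + 1, 0, 2, 0⟩, rfl, rfl, ?_⟩
    have e : encodeCommand (.E i j') ++ w = .cE :: (encodeNum i ++ (encodeNum j' ++ w)) := by
      simp [encodeCommand]
    rw [e, hE _ _ 1 rfl rfl, scanList_encodeNum _ _ rfl, scanList_encodeNum _ _ rfl]
    simp [Command.item, Item.ents, groupEnts]
  | M i a =>
    have e : encodeCommand (.M i a) ++ w = .cM a :: (encodeNum i ++ w) := by
      simp [encodeCommand]
    rw [e]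
    cases a with
    | zero =>
      refine ⟨⟨2, g + 1, 0, 1, 0⟩, rfl, rfl, ?_⟩
      rw [hE _ _ 2 rfl rfl, scanList_encodeNum _ _ rfl]
      simp [Command.item, Item.ents, groupEnts]
    | pi =>
      refine ⟨⟨3, g + 1, 0, 1, 0⟩, rfl, rfl, ?_⟩
      rw [hE _ _ 3 rfl rfl, scanList_encodeNum _ _ rfl]
      simp [Command.item, Item.ents, groupEnts]
    | irr =>
      refine ⟨⟨4, g + 1, 0, 1, 0⟩, rfl, rfl, ?_⟩
      rw [hE _ _ 4 rfl rfl, scanList_encodeNum _ _ rfl]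
      simp [Command.item, Item.ents, groupEnts]
  | X i σ =>
    refine ⟨⟨5, g + 1, 1, 0, 0⟩, rfl, rfl, ?_⟩
    have e : encodeCommand (.X i σ) ++ w = .cX :: (encodeNum i ++ (encodeList σ ++ w)) := by
      simp [encodeCommand]
    rw [e, hE _ _ 5 rfl rfl, scanList_encodeNum _ _ rfl, scanList_encodeList]
    simp [Command.item, Item.ents, groupEnts]
  | Z i σ =>
    refine ⟨⟨6, g + 1, 1, 0, 0⟩, rfl, rfl, ?_⟩
    have e : encodeCommand (.Z i σ) ++ w = .cZ :: (encodeNum i ++ (encodeList σ ++ w)) := by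
      simp [encodeCommand]
    rw [e, hE _ _ 6 rfl rfl, scanList_encodeNum _ _ rfl, scanList_encodeList]
    simp [Command.item, Item.ents, groupEnts]

theorem scanList_encodeGate {m : ℕ} (b : Bool) (e : Ent) (he : e.v = 0) (c : Gate (Fin m))
    (w : List Token) : ∃ e' : Ent, e'.v = 0 ∧ e'.g = e.g + 1 ∧
      scanList b e (encodeGate c ++ w) =
        (c.item.ents (e.g + 1)).flatMap (Ent.stops b) ++ scanList b e' w := by
  obtain ⟨kd, g, l, j, v⟩ := e
  simp only at he
  subst he
  have hE : ∀ (t : Token) (w : List Token) (k : ℕ), fires b t = false →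
      (⟨kd, g, l, j, 0⟩ : Ent).upd t = ⟨k, g + 1, 0, 0, 0⟩ →
      scanList b ⟨kd, g, l, j, 0⟩ (t :: w) = scanList b ⟨k, g + 1, 0, 0, 0⟩ w := by
    intro t w k h1 h2
    rw [scanList, h1, h2]; rfl
  cases c with
  | H i =>
    refine ⟨⟨7, g + 1, 0, 1, 0⟩, rfl, rfl, ?_⟩
    have e : encodeGate (.H i) ++ w = .gH :: (encodeNum i ++ w) := by simp [encodeGate]
    rw [e, hE _ _ 7 rfl rfl, scanList_encodeNum _ _ rfl]
    simp [Gate.item, Item.ents, groupEnts]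
  | Rz i =>
    refine ⟨⟨8, g + 1, 0, 1, 0⟩, rfl, rfl, ?_⟩
    have e : encodeGate (.Rz i) ++ w = .gRz :: (encodeNum i ++ w) := by simp [encodeGate]
    rw [e, hE _ _ 8 rfl rfl, scanList_encodeNum _ _ rfl]
    simp [Gate.item, Item.ents, groupEnts]
  | CZ i j' =>
    refine ⟨⟨9, g + 1, 0, 2, 0⟩, rfl, rfl, ?_⟩
    have e : encodeGate (.CZ i j') ++ w = .gCZ :: (encodeNum i ++ (encodeNum j' ++ w)) := by
      simp [encodeGate]
    rw [e, hE _ _ 9 rfl rfl, scanList_encodeNum _ _ rfl, scanList_encodeNum _ _ rfl]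
    simp [Gate.item, Item.ents, groupEnts]
  | fan ts c =>
    refine ⟨⟨10, g + 1, 1, 1, 0⟩, rfl, rfl, ?_⟩
    have e : encodeGate (.fan ts c) ++ w = .gFan :: (encodeList ts ++ (encodeNum c ++ w)) := by
      simp [encodeGate]
    rw [e, hE _ _ 10 rfl rfl, scanList_encodeList, scanList_encodeNum _ _ rfl]
    simp [Gate.item, Item.ents, groupEnts, List.append_assoc]

theorem scanList_flatMap {β : Type} {enc : β → List Token} {item : β → Item} {b : Bool}
    (h : ∀ (e : Ent), e.v = 0 → ∀ (c : β) (w : List Token), ∃ e' : Ent, e'.v = 0 ∧ e'.g = e.g + 1 ∧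
      scanList b e (enc c ++ w) =
        ((item c).ents (e.g + 1)).flatMap (Ent.stops b) ++ scanList b e' w) :
    ∀ (l : List β) (e : Ent), e.v = 0 → scanList b e (l.flatMap enc) =
      (((l.map item).zipIdx (e.g + 1)).flatMap fun x => x.1.ents x.2).flatMap (Ent.stops b)
  | [], e, he => by simp [scanList]
  | c :: l, e, he => by
    obtain ⟨e', h1, h2, h3⟩ := h e he c (l.flatMap enc)
    rw [List.flatMap_cons, h3, scanList_flatMap h l e' h1, h2]
    simp

theorem readsAs_of {β : Type} {enc : β → List Token} {item : β → Item}
    (h : ∀ (b : Bool) (e : Ent), e.v = 0 → ∀ (c : β) (w : List Token), ∃ e' : Ent, e'.v = 0 ∧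
      e'.g = e.g + 1 ∧ scanList b e (enc c ++ w) =
        ((item c).ents (e.g + 1)).flatMap (Ent.stops b) ++ scanList b e' w)
    {m : ℕ} (N : ℕ) (ins outs : List (Fin m)) (l : List β) :
    ReadsAs (encodeNum N ++ encodeList ins ++ encodeList outs ++ l.flatMap enc)
      ⟨N, ins.map Fin.val, outs.map Fin.val, l.map item⟩ := by
  have key : ∀ b, scanList b Ent.zero
      (encodeNum N ++ encodeList ins ++ encodeList outs ++ l.flatMap enc) =
      (Desc.ents ⟨N, ins.map Fin.val, outs.map Fin.val, l.map item⟩).flatMap (Ent.stops b) := by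
    intro b
    rw [List.append_assoc, List.append_assoc, scanList_encodeNum _ _ rfl]
    change _ ++ scanList b ⟨0, 0, 0, 1, 0⟩ _ = _
    rw [scanList_encodeList, scanList_encodeList, scanList_flatMap (h b) l _ rfl]
    simp [Desc.ents, groupEnts, Ent.zero, List.append_assoc]
  refine ⟨(key false).trans ?_, key true⟩
  have : Ent.stops false = fun e => [e] := rfl
  rw [this, List.flatMap_singleton']

theorem Pattern.readsAs (t : Pattern) : ReadsAs t.encode ⟨t.numQubits, t.inputs.map Fin.val,
    t.outputs.map Fin.val, t.commands.map Command.item⟩ :=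
  readsAs_of (fun b e he c w => scanList_encodeCommand b e he c w) _ _ _ _

theorem Circuit.readsAs (C : Circuit) : ReadsAs C.encode ⟨C.numQubits, C.inputs.map Fin.val,
    C.outputs.map Fin.val, C.gates.map Gate.item⟩ :=
  readsAs_of (fun b e he c w => scanList_encodeGate b e he c w) _ _ _ _

end Words

/-! ### Loops over the parts of a description -/

namespace Em

def lt (x y : Opd) (P : Em) : Em := .iflt x y P .nil

def le (x y : Opd) (P : Em) : Em := .iflt y x .nil P

def eq (x y : Opd) (P : Em) : Em := .iflt x y .nil (.iflt y x .nil P)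

variable {w : List Token} {D : Desc} {env : ℕ → Ent} {ℓ : ℕ}

@[simp] theorem den_lt (x y : Opd) (P : Em) : (lt x y P).den w ℓ env =
    if x.eval env < y.eval env then P.den w ℓ env else [] := rfl

@[simp] theorem den_le (x y : Opd) (P : Em) : (le x y P).den w ℓ env =
    if x.eval env ≤ y.eval env then P.den w ℓ env else [] := by
  simp only [le, den]
  split_ifs <;> first | rfl | omega

@[simp] theorem den_eq (x y : Opd) (P : Em) : (eq x y P).den w ℓ env =
    if x.eval env = y.eval env then P.den w ℓ env else [] := by
  simp only [eq, den]
  split_ifs <;> first | rfl | omega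

/-- Run `P` for each `u < N`. -/
def forN (ℓ : ℕ) (P : Em) : Em := .scan true <|
  eq (.fld ℓ .g) (.const 0) <| eq (.fld ℓ .l) (.const 0) <| eq (.fld ℓ .j) (.const 0) P

/-- Run `P` for each input. -/
def forIns (ℓ : ℕ) (P : Em) : Em := .scan false <|
  eq (.fld ℓ .g) (.const 0) <| eq (.fld ℓ .l) (.const 0) <| le (.const 1) (.fld ℓ .j) P

/-- Run `P` for each output. -/
def forOuts (ℓ : ℕ) (P : Em) : Em := .scan false <|
  eq (.fld ℓ .g) (.const 0) <| eq (.fld ℓ .l) (.const 1) P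

/-- Run `P` for each number which belongs to a command or gate. -/
def forNums (ℓ : ℕ) (P : Em) : Em := .scan false <| le (.const 1) (.fld ℓ .g) P

/-- Run `P` for the main position of each command or gate. -/
def forItems (ℓ : ℕ) (P : Em) : Em := forNums ℓ <|
  .iflt (.fld ℓ .kd) (.const 10) (eq (.fld ℓ .l) (.const 0) (eq (.fld ℓ .j) (.const 0) P))
    (eq (.fld ℓ .l) (.const 1) P)

/-- Run `P` for each number in the first list of the command or gate of the scan of depth `0`. -/
def forFirst (ℓ : ℕ) (P : Em) : Em := .scan false <|
  eq (.fld ℓ .g) (.fld 0 .g) <| eq (.fld ℓ .l) (.const 0) P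

theorem mem_groupEnts {kd g l j : ℕ} {ns : List ℕ} {e : Ent} (h : e ∈ groupEnts kd g l j ns) :
    e.kd = kd ∧ e.g = g ∧ e.l = l ∧ j ≤ e.j := by
  obtain ⟨x, hx, rfl⟩ := List.mem_map.1 h
  exact ⟨rfl, rfl, rfl, List.le_snd_of_mem_zipIdx hx⟩

theorem g_of_mem_ents {it : Item} {g : ℕ} {e : Ent} (h : e ∈ it.ents g) : e.g = g := by
  cases it with
  | one kd hkd i τ => exact (mem_groupEnts h).2.1
  | two ts c =>
    rcases List.mem_append.1 h with h | h <;> exact (mem_groupEnts h).2.1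

theorem flatMap_nil {β γ : Type} {f : β → List γ} {l : List β} (h : ∀ x ∈ l, f x = []) :
    l.flatMap f = [] := List.flatMap_eq_nil_iff.2 h

theorem flatMap_congr {β γ : Type} {f f' : β → List γ} {l : List β} (h : ∀ x ∈ l, f x = f' x) :
    l.flatMap f = l.flatMap f' := by
  simp only [List.flatMap_def, List.map_congr_left h]

theorem den_forN (h : ReadsAs w D) (P : Em) : (forN ℓ P).den w ℓ env =
    (List.range D.N).flatMap fun u => P.den w (ℓ + 1) (Function.update env ℓ ⟨0, 0, 0, 0, u⟩) := by
  rw [forN, den, h.2, Desc.ents, List.flatMap_assoc, List.flatMap_append, List.flatMap_append,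
    flatMap_nil (l := groupEnts 0 0 1 0 D.outs), flatMap_nil (l := List.flatMap _ _)]
  · rw [List.append_nil, List.append_nil, groupEnts, List.zipIdx_cons, List.map_cons,
      List.flatMap_cons, flatMap_nil (l := List.map _ _), List.append_nil]
    · simp [Ent.ticks, List.flatMap_map, Opd.eval, Ent.get]
    · intro e he
      have := (mem_groupEnts (ns := D.ins) he)
      refine flatMap_nil fun e' he' => ?_
      obtain ⟨u, -, rfl⟩ := List.mem_map.1 he'
      have h1 : ¬ e.j = 0 := by omega
      simp [Opd.eval, Ent.get, h1]
  · intro e he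
    obtain ⟨x, hx, he⟩ := List.mem_flatMap.1 he
    have h1 := g_of_mem_ents he
    have h2 := List.le_snd_of_mem_zipIdx hx
    refine flatMap_nil fun e' he' => ?_
    obtain ⟨u, -, rfl⟩ := List.mem_map.1 he'
    have h1 : ¬ e.g = 0 := by omega
    simp [Opd.eval, Ent.get, h1]
  · intro e he
    have := mem_groupEnts he
    refine flatMap_nil fun e' he' => ?_
    obtain ⟨u, -, rfl⟩ := List.mem_map.1 he'
    simp [Opd.eval, Ent.get, this]

theorem den_forIns (h : ReadsAs w D) (P : Em) : (forIns ℓ P).den w ℓ env =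
    (D.ins.zipIdx 1).flatMap fun x =>
      P.den w (ℓ + 1) (Function.update env ℓ ⟨0, 0, 0, x.2, x.1⟩) := by
  rw [forIns, den, h.1, Desc.ents, List.flatMap_append, List.flatMap_append,
    flatMap_nil (l := groupEnts 0 0 1 0 D.outs), flatMap_nil (l := List.flatMap _ _)]
  · rw [List.append_nil, List.append_nil, groupEnts, List.zipIdx_cons, List.map_cons,
      List.flatMap_cons, List.flatMap_map]
    have : ∀ x ∈ D.ins.zipIdx (0 + 1), 1 ≤ x.2 := fun x hx => List.le_snd_of_mem_zipIdx hx
    simp only [den_eq, den_le, Opd.eval, Ent.get, Function.update_self, if_true]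
    rw [if_neg (by omega), List.nil_append]
    exact flatMap_congr fun x hx => if_pos (this x hx)
  · intro e he
    obtain ⟨x, hx, he⟩ := List.mem_flatMap.1 he
    have h1 := g_of_mem_ents he
    have h2 := List.le_snd_of_mem_zipIdx hx
    have h1 : ¬ e.g = 0 := by omega
    simp [Opd.eval, Ent.get, h1]
  · intro e he
    have := mem_groupEnts he
    simp [Opd.eval, Ent.get, this]

theorem den_forOuts (h : ReadsAs w D) (P : Em) : (forOuts ℓ P).den w ℓ env =
    D.outs.zipIdx.flatMap fun x =>
      P.den w (ℓ + 1) (Function.update env ℓ ⟨0, 0, 1, x.2, x.1⟩) := by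
  rw [forOuts, den, h.1, Desc.ents, List.flatMap_append, List.flatMap_append,
    flatMap_nil (l := groupEnts 0 0 0 0 _), flatMap_nil (l := List.flatMap _ _)]
  · rw [List.append_nil, List.nil_append, groupEnts, List.flatMap_map]
    simp only [den_eq, Opd.eval, Ent.get, Function.update_self, if_true]
  · intro e he
    obtain ⟨x, hx, he⟩ := List.mem_flatMap.1 he
    have h1 := g_of_mem_ents he
    have h2 := List.le_snd_of_mem_zipIdx hx
    have h1 : ¬ e.g = 0 := by omega
    simp [Opd.eval, Ent.get, h1]
  · intro e he
    have := mem_groupEnts he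
    simp [Opd.eval, Ent.get, this]

theorem den_forNums (h : ReadsAs w D) (P : Em) : (forNums ℓ P).den w ℓ env =
    (D.items.zipIdx 1).flatMap fun x => (x.1.ents x.2).flatMap fun e =>
      P.den w (ℓ + 1) (Function.update env ℓ e) := by
  rw [forNums, den, h.1, Desc.ents, List.flatMap_append, flatMap_nil (l := _ ++ _), List.nil_append,
    List.flatMap_assoc]
  · refine flatMap_congr fun x hx => flatMap_congr fun e he => ?_
    have h1 := g_of_mem_ents he
    have h2 := List.le_snd_of_mem_zipIdx hx
    simp only [den_le, Opd.eval, Ent.get, Function.update_self]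
    exact if_pos (by omega)
  · intro e he
    have : e.g = 0 := by
      rcases List.mem_append.1 he with he | he <;> exact (mem_groupEnts he).2.1
    simp [Opd.eval, Ent.get, this]

theorem den_forItems (h : ReadsAs w D) (P : Em) : (forItems ℓ P).den w ℓ env =
    (D.items.zipIdx 1).flatMap fun x => P.den w (ℓ + 1) (Function.update env ℓ (x.1.main x.2)) := by
  rw [forItems, den_forNums h]
  refine flatMap_congr fun x _ => ?_
  obtain ⟨it, g⟩ := x
  cases it with
  | one kd hkd i τ =>
    simp only [Item.ents, groupEnts, List.zipIdx_cons, List.map_cons, List.flatMap_cons,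
      List.flatMap_map, Item.main, den, den_eq, Opd.eval, Ent.get, Function.update_self, hkd,
      if_true]
    rw [flatMap_nil fun x hx => if_neg ?_, List.append_nil]
    have := List.le_snd_of_mem_zipIdx hx
    omega
  | two ts c =>
    simp [Item.ents, groupEnts, List.flatMap_map, Item.main, den, Opd.eval, Ent.get]

theorem den_forFirst (h : ReadsAs w D) {it : Item} {g : ℕ} (hg : (env 0).g = g) (hℓ : ℓ ≠ 0)
    (hit : (it, g) ∈ D.items.zipIdx 1) (P : Em) : (forFirst ℓ P).den w ℓ env =
    it.first.zipIdx.flatMap fun x =>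
      P.den w (ℓ + 1) (Function.update env ℓ ⟨it.kind, g, 0, x.2, x.1⟩) := by
  have hg1 : 1 ≤ g := List.le_snd_of_mem_zipIdx hit
  have key : ∀ (items : List Item) (k : ℕ) (F : Ent → List Token), (it, g) ∈ items.zipIdx k →
      ((items.zipIdx k).flatMap fun x => x.1.ents x.2).flatMap
        (fun e => if e.g = g then F e else []) = (it.ents g).flatMap F := by
    intro items k F hit
    induction items generalizing k with
    | nil => simp at hit
    | cons a items ih =>
      rw [List.zipIdx_cons] at hit ⊢
      rw [List.flatMap_cons, List.flatMap_append]
      rcases List.mem_cons.1 hit with e | hit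
      · obtain ⟨rfl, rfl⟩ := Prod.mk.inj e
        rw [flatMap_nil (l := List.flatMap _ _) fun e he => ?_, List.append_nil]
        · exact flatMap_congr fun e he => if_pos (g_of_mem_ents he)
        · obtain ⟨x, hx, he⟩ := List.mem_flatMap.1 he
          have h1 := g_of_mem_ents he
          have h2 := List.le_snd_of_mem_zipIdx hx
          exact if_neg (by omega)
      · rw [ih _ hit, flatMap_nil fun e he => ?_, List.nil_append]
        have h1 := g_of_mem_ents he
        have h2 := List.le_snd_of_mem_zipIdx hit
        dsimp only at h1 h2
        exact if_neg (by omega)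
  have h0 : ∀ e, Function.update env ℓ e 0 = env 0 := fun e => Function.update_of_ne hℓ.symm _ _
  rw [forFirst, den, h.1, Desc.ents, List.flatMap_append, flatMap_nil (l := _ ++ _), List.nil_append]
  · simp only [den_eq, Opd.eval, Ent.get, Function.update_self, h0, hg]
    rw [key _ _ (fun e => if e.l = 0 then P.den w (ℓ + 1) (Function.update env ℓ e) else []) hit]
    cases it with
    | one kd hkd i τ => simp [Item.ents, groupEnts, Item.first, Item.kind, List.flatMap_map]
    | two ts c => simp [Item.ents, groupEnts, Item.first, Item.kind, List.flatMap_map]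
  · intro e he
    have : e.g = 0 := by
      rcases List.mem_append.1 he with he | he <;> exact (mem_groupEnts he).2.1
    simp only [den_eq, Opd.eval, Ent.get, Function.update_self, h0, hg]
    exact if_neg (by omega)

/-- The letters for a number which is increased by the size `N` of the register. -/
def unitN (ℓ : ℕ) : Em := forN ℓ (.emit .tick)

theorem flatMap_replicate {β γ : Type} (l : List β) (m : ℕ) (t : γ) :
    l.flatMap (fun _ => List.replicate m t) = List.replicate (m * l.length) t := by
  induction l with
  | nil => simp
  | cons a l ih =>
    rw [List.flatMap_cons, ih, List.replicate_append_replicate, List.length_cons]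
    congr 1; ring

theorem den_unitN (h : ReadsAs w D) : (unitN ℓ).den w ℓ env = List.replicate D.N .tick := by
  rw [unitN, den_forN h]
  have := flatMap_replicate (List.range D.N) 1 Token.tick
  simpa [den] using this

/-- `k` copies of the letters for `N`. -/
def units (ℓ : ℕ) : ℕ → Em
  | 0 => .nil
  | k + 1 => .seq (unitN ℓ) (units ℓ k)

theorem den_units (h : ReadsAs w D) : ∀ k : ℕ,
    (units ℓ k).den w ℓ env = List.replicate (D.N * k) .tick
  | 0 => rfl
  | k + 1 => by
    rw [units, den, den_unitN h, den_units h k, List.replicate_append_replicate]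
    congr 1; ring

end Em

/-! ### Generating the description of the simulating circuit -/

namespace Em

/-- Programs run one after the other. -/
def seqs : List Em → Em
  | [] => .nil
  | P :: Ps => .seq P (seqs Ps)

variable {w : List Token} {D : Desc} {env : ℕ → Ent} {ℓ : ℕ}

@[simp] theorem den_seqs_nil : (seqs []).den w ℓ env = [] := rfl

@[simp] theorem den_seqs_cons (P : Em) (Ps : List Em) :
    (seqs (P :: Ps)).den w ℓ env = P.den w ℓ env ++ (seqs Ps).den w ℓ env := rfl

theorem flatMap_zipIdx_fst {β γ : Type} (f : β → List γ) : ∀ (l : List β) (k : ℕ),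
    (l.zipIdx k).flatMap (fun x => f x.1) = l.flatMap f
  | [], _ => rfl
  | a :: l, k => by
    rw [List.zipIdx_cons, List.flatMap_cons, List.flatMap_cons, flatMap_zipIdx_fst f l]

theorem flatMap_zipIdx_snd {β γ : Type} (f : ℕ → List γ) : ∀ (l : List β) (k : ℕ),
    (l.zipIdx k).flatMap (fun x => f x.2) = (List.range l.length).flatMap fun c => f (c + k)
  | [], _ => rfl
  | a :: l, k => by
    rw [List.zipIdx_cons, List.flatMap_cons, flatMap_zipIdx_snd f l, List.length_cons,
      List.range_succ_eq_map, List.flatMap_cons, List.flatMap_map]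
    simp [Nat.add_assoc, Nat.add_comm 1]

theorem flatMap_zipIdx_le {β γ : Type} (t : γ) (m g : ℕ) : ∀ (l : List β) (k : ℕ),
    (l.zipIdx k).flatMap (fun x => if x.2 ≤ g then List.replicate m t else []) =
      List.replicate (m * min l.length (g + 1 - k)) t
  | [], _ => by simp
  | a :: l, k => by
    rw [List.zipIdx_cons, List.flatMap_cons, flatMap_zipIdx_le t m g l]
    split_ifs with h
    · rw [List.replicate_append_replicate, List.length_cons]
      congr 1
      rw [show min (l.length + 1) (g + 1 - k) = min l.length (g + 1 - (k + 1)) + 1 by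
        dsimp only at h; omega]
      ring
    · rw [List.nil_append, List.length_cons]
      congr 2
      dsimp only at h; omega

theorem main_g (it : Item) (g : ℕ) : (it.main g).g = g := by cases it <;> rfl

/-- The number of the qubit `(v, j)`, if `cols` yields the letters for `N * j`. -/
def numAt (k : ℕ) (cols : Em) : Em :=
  seqs [.rep .tick (.fld k .v), cols, .emit .endNum]

/-- As many copies of the letters for `N` as the number of the command in the scan `k`. -/
def itemCols (ℓ k : ℕ) : Em := forItems ℓ (le (.fld ℓ .g) (.fld k .g) (unitN (ℓ + 1)))

theorem den_itemCols (h : ReadsAs w D) {k : ℕ} (hk : k < ℓ) (hg : (env k).g ≤ D.items.length) :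
    (itemCols ℓ k).den w ℓ env = List.replicate (D.N * (env k).g) .tick := by
  have hku : ∀ e, Function.update env ℓ e k = env k := fun e => Function.update_of_ne hk.ne _ _
  rw [itemCols, den_forItems h]
  simp only [den_le, Opd.eval, Ent.get, Function.update_self, hku, den_unitN h]
  have e := flatMap_zipIdx_le Token.tick D.N (env k).g D.items 1
  rw [Nat.add_sub_cancel, Nat.min_eq_right hg] at e
  rw [← e]
  exact flatMap_congr fun x _ => by
    have := main_g x.1 x.2
    simp only [this]

/-- The number of the qubit `(v, j)` is `v + N * j`. -/
theorem encodeNum_lab {N K j : ℕ} {v : Fin N} (hj : j ≤ K) : encodeNum (lab K v j : ℕ) =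
    List.replicate (v : ℕ) .tick ++ (List.replicate (N * j) .tick ++ [.endNum]) := by
  rw [encodeNum, lab_val hj, ← List.append_assoc, List.replicate_append_replicate]

theorem encodeList_eq {m : ℕ} (l : List (Fin m)) :
    encodeList l = l.flatMap (fun v : Fin m => encodeNum (v : ℕ)) ++ [.endList] := by
  simp [encodeList, List.flatMap_assoc]

/-- Run `P` for the numbers of the list except the first one. -/
def forRest (ℓ : ℕ) (P : Em) : Em := forFirst ℓ (le (.const 1) (.fld ℓ .j) P)

theorem den_forRest (h : ReadsAs w D) {kd : ℕ} {hkd : kd < 10} {i : ℕ} {τ : List ℕ} {g : ℕ}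
    (hg : (env 0).g = g) (hℓ : ℓ ≠ 0) (hit : (.one kd hkd i τ, g) ∈ D.items.zipIdx 1) (P : Em) :
    (forRest ℓ P).den w ℓ env = (τ.zipIdx 1).flatMap fun x =>
      P.den w (ℓ + 1) (Function.update env ℓ ⟨kd, g, 0, x.2, x.1⟩) := by
  rw [forRest, den_forFirst h hg hℓ hit]
  simp only [Item.first, Item.kind, List.zipIdx_cons, List.flatMap_cons, den_le, Opd.eval, Ent.get,
    Function.update_self]
  rw [if_neg (by omega), List.nil_append]
  exact flatMap_congr fun x hx => if_pos (List.le_snd_of_mem_zipIdx hx)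

/-- The gates for `Z`, by a program run at depth `1`. -/
def zGatesEm : Em :=
  let P := seqs [.emit .gCZ, numAt 0 (unitN 1), numAt 0 .nil, .emit .gH, numAt 0 (unitN 1)]
  seqs [P, P, P, P]

/-- The gates for a measurement, after the change of the basis. -/
def measureEm : Em := seqs [.emit .gH, numAt 0 .nil, .emit .gFan,
  forItems 1 (numAt 0 (itemCols 2 1)), .emit .endList, numAt 0 .nil,
  forItems 1 (.seq (.emit .gH) (numAt 0 (itemCols 2 1)))]

/-- The fan-out gate for a correction. -/
def signalEm : Em := seqs [.emit .gFan, forRest 1 (numAt 1 (itemCols 2 0)), .emit .endList,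
  numAt 0 .nil]

/-- Run `P` if the scan of depth `0` is at a command or gate whose name has the code `k`. -/
def ifKind (k : ℕ) (P : Em) : Em := eq (.fld 0 .kd) (.const k) P

/-- The gates for a command. -/
def blockEm : Em := seqs [
  ifKind 1 (seqs [.emit .gCZ, numAt 0 .nil, forRest 1 (numAt 1 .nil)]),
  ifKind 2 measureEm,
  ifKind 3 (.seq zGatesEm measureEm),
  ifKind 4 (seqs [.emit .gH, numAt 0 .nil, zGatesEm, .emit .gH, numAt 0 .nil, .emit .gRz,
    numAt 0 .nil, measureEm]),
  ifKind 5 (seqs [.emit .gH, numAt 0 .nil, signalEm, .emit .gH, numAt 0 .nil]),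
  ifKind 6 signalEm]

/-- The description of the simulating circuit. -/
def circuitEm : Em := seqs [
  unitN 0, forItems 0 (unitN 1), .emit .endNum,
  forIns 0 (numAt 0 .nil), .emit .endList, forOuts 0 (numAt 0 .nil), .emit .endList,
  forN 0 (.seq (.emit .gH) (numAt 0 .nil)), forIns 0 (.seq (.emit .gH) (numAt 0 .nil)),
  forItems 0 blockEm]

theorem den_numAt {k : ℕ} {cols : Em} {N K j : ℕ} {v : Fin N} (hj : j ≤ K) (hv : (env k).v = v)
    (hc : cols.den w ℓ env = List.replicate (N * j) .tick) :
    (numAt k cols).den w ℓ env = encodeNum (lab K v j : ℕ) := by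
  rw [encodeNum_lab hj, ← hc, ← hv]
  simp [numAt, den, Opd.eval, Ent.get]

end Em

namespace Pattern

open Em

variable {N : ℕ} {A : List (Command (Fin N))} {w : List Token} {D : Desc} {c : ℕ}

/-- The program `blockEm` describes the gates for the command at the scan of depth `0`. -/
theorem den_blockEm (hw : ReadsAs w D) (hN : D.N = N) (hA : D.items = A.map Command.item)
    {q : Command (Fin N)} (hq : (q, c + 1) ∈ A.zipIdx 1) {env : ℕ → Ent}
    (he : env 0 = q.item.main (c + 1)) :
    blockEm.den w 1 env = (block A.length c q).flatMap encodeGate := by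
  have hc : c + 1 ≤ A.length := by
    have := List.snd_lt_of_mem_zipIdx hq
    simp only at this; omega
  have hlen : D.items.length = A.length := by rw [hA, List.length_map]
  have hit : (q.item, c + 1) ∈ D.items.zipIdx 1 := by
    rw [hA, List.zipIdx_map]
    exact List.mem_map.2 ⟨_, hq, rfl⟩
  have hg : (env 0).g = c + 1 := by rw [he, main_g]
  have h0 : ∀ {ℓ : ℕ} {env' : ℕ → Ent} (k : ℕ) (v : Fin N), (env' k).v = v →
      (numAt k .nil).den w ℓ env' = encodeNum (lab A.length v 0 : ℕ) :=
    fun k v hv => den_numAt (Nat.zero_le _) hv (by simp [den])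
  have h1 : ∀ {ℓ : ℕ} {env' : ℕ → Ent} (k : ℕ) (v : Fin N), (env' k).v = v →
      (numAt k (unitN ℓ)).den w ℓ env' = encodeNum (lab A.length v 1 : ℕ) :=
    fun k v hv => den_numAt (by omega) hv (by rw [den_unitN hw, hN, Nat.mul_one])
  have h2 : ∀ {ℓ k k' : ℕ} {env' : ℕ → Ent} (v : Fin N) (c' : ℕ), k' < ℓ → (env' k).v = v →
      (env' k').g = c' → c' ≤ A.length →
      (numAt k (itemCols ℓ k')).den w ℓ env' = encodeNum (lab A.length v c' : ℕ) :=
    fun v c' hk hv hg hc' => den_numAt hc' hv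
      (by rw [den_itemCols hw hk (by rw [hg, hlen]; exact hc'), hg, hN])
  have hcop : ∀ (i : Fin N), (env 0).v = i → (forItems 1 (numAt 0 (itemCols 2 1))).den w 1 env =
      (copies A.length i).flatMap fun x : Fin _ => encodeNum (x : ℕ) := by
    intro i hi
    rw [den_forItems hw, copies, List.flatMap_map]
    have e := flatMap_zipIdx_snd (fun g => encodeNum (lab A.length i g : ℕ)) D.items 1
    rw [hlen] at e
    rw [← e]
    refine flatMap_congr fun x hx => ?_
    have hx2 := List.snd_lt_of_mem_zipIdx hx
    rw [h2 i x.2 (by omega) (by simpa using hi) (by simp [main_g]) (by omega)]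
  have hcopH : ∀ (i : Fin N), (env 0).v = i →
      (forItems 1 (.seq (.emit .gH) (numAt 0 (itemCols 2 1)))).den w 1 env =
        (copies A.length i).flatMap fun x : Fin _ => .gH :: encodeNum (x : ℕ) := by
    intro i hi
    rw [den_forItems hw, copies, List.flatMap_map]
    have e := flatMap_zipIdx_snd (fun g => Token.gH :: encodeNum (lab A.length i g : ℕ)) D.items 1
    rw [hlen] at e
    rw [← e]
    refine flatMap_congr fun x hx => ?_
    have hx2 := List.snd_lt_of_mem_zipIdx hx
    rw [den, h2 i x.2 (by omega) (by simpa using hi) (by simp [main_g]) (by omega)]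
    rfl
  have hmeas : ∀ i : Fin N, (env 0).v = i → measureEm.den w 1 env =
      ([Gate.H (lab A.length i 0), .fan (copies A.length i) (lab A.length i 0)] ++
        (copies A.length i).map Gate.H).flatMap encodeGate := by
    intro i hi
    simp [measureEm, h0 0 i hi, hcop i hi, hcopH i hi, den, encodeGate, encodeList_eq,
      List.flatMap_map]
  have hz : ∀ i : Fin N, (env 0).v = i →
      zGatesEm.den w 1 env = (zGates A.length i).flatMap encodeGate := by
    intro i hi
    simp [zGatesEm, h0 0 i hi, h1 0 i hi, den, encodeGate, zGates]
  have hsig : ∀ (i : Fin N) (σ : List (Fin N)) (kd : ℕ) (hkd : kd < 10),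
      q.item = .one kd hkd i (σ.map Fin.val) → signalEm.den w 1 env =
        encodeGate (.fan (σ.map fun v => lab A.length v (c + 1)) (lab A.length i 0)) := by
    intro i σ kd hkd e
    have hi : (env 0).v = i := by rw [he, e]; rfl
    rw [e] at hit
    have e1 : (forRest 1 (numAt 1 (itemCols 2 0))).den w 1 env =
        σ.flatMap fun v => encodeNum (lab A.length v (c + 1) : ℕ) := by
      rw [den_forRest hw hg (by omega) hit, List.zipIdx_map, List.flatMap_map,
        ← flatMap_zipIdx_fst _ σ 1]
      refine flatMap_congr fun x _ => ?_
      exact h2 x.1 (c + 1) (by omega) (by simp) (by simpa using hg) hc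
    simp [signalEm, h0 0 i hi, e1, den, encodeGate, encodeList_eq, List.flatMap_map]
  cases q with
  | E i j =>
    have hi : (env 0).v = i := by rw [he]; rfl
    have hk : (env 0).kd = 1 := by rw [he]; rfl
    have e1 : (forRest 1 (numAt 1 .nil)).den w 1 env = encodeNum (lab A.length j 0 : ℕ) := by
      rw [den_forRest hw hg (by omega) hit]
      simp [h0 1 j]
    simp [blockEm, ifKind, Opd.eval, Ent.get, hk, h0 0 i hi, e1, den, encodeGate, block]
  | M i a =>
    have hi : (env 0).v = i := by rw [he]; cases a <;> rfl
    cases a with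
    | zero =>
      have hk : (env 0).kd = 2 := by rw [he]; rfl
      simp [blockEm, ifKind, Opd.eval, Ent.get, hk, hmeas i hi, block, rotGates]
    | pi =>
      have hk : (env 0).kd = 3 := by rw [he]; rfl
      simp [blockEm, ifKind, Opd.eval, Ent.get, hk, hmeas i hi, hz i hi, den, block, rotGates]
    | irr =>
      have hk : (env 0).kd = 4 := by rw [he]; rfl
      simp [blockEm, ifKind, Opd.eval, Ent.get, hk, hmeas i hi, hz i hi, h0 0 i hi, den, block,
        rotGates, encodeGate]
  | X i σ =>
    have hi : (env 0).v = i := by rw [he]; rfl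
    have hk : (env 0).kd = 5 := by rw [he]; rfl
    simp [blockEm, ifKind, Opd.eval, Ent.get, hk, hsig i σ _ _ rfl, h0 0 i hi, den, block]
    simp [encodeGate]
  | Z i σ =>
    have hk : (env 0).kd = 6 := by rw [he]; rfl
    simp [blockEm, ifKind, Opd.eval, Ent.get, hk, hsig i σ _ _ rfl, block]

theorem blocks_flatMap (L : ℕ) : ∀ (c : ℕ) (A : List (Command (Fin N))),
    (blocks L c A).flatMap Prod.snd = (A.zipIdx c).flatMap fun x => block L x.2 x.1
  | _, [] => rfl
  | c, q :: A => by
    rw [blocks, List.flatMap_cons, blocks_flatMap L, List.zipIdx_cons, List.flatMap_cons]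

theorem den_circuitEm (t : Pattern) (env : ℕ → Ent) :
    circuitEm.den t.encode 0 env = t.toCircuit.encode := by
  have hw := t.readsAs
  set D : Desc := ⟨t.numQubits, t.inputs.map Fin.val, t.outputs.map Fin.val,
    t.commands.map Command.item⟩ with hD
  set L := t.commands.length with hL
  have hlen : D.items.length = L := List.length_map ..
  have h0 : ∀ {ℓ : ℕ} {env' : ℕ → Ent} (k : ℕ) (v : Fin t.numQubits), (env' k).v = v →
      (numAt k .nil).den t.encode ℓ env' = encodeNum (lab L v 0 : ℕ) :=
    fun k v hv => den_numAt (Nat.zero_le _) hv (by simp [den])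
  have hins : ∀ P : Em, (forIns 0 P).den t.encode 0 env = (t.inputs.zipIdx 1).flatMap fun x =>
      P.den t.encode 1 (Function.update env 0 ⟨0, 0, 0, x.2, x.1⟩) := by
    intro P
    rw [den_forIns hw, hD, List.zipIdx_map, List.flatMap_map]
    rfl
  have e1 : (unitN 0).den t.encode 0 env ++ ((forItems 0 (unitN 1)).den t.encode 0 env ++
      [.endNum]) = encodeNum ((L + 1) * t.numQubits) := by
    rw [den_unitN hw, den_forItems hw]
    simp only [den_unitN hw]
    rw [flatMap_replicate, List.length_zipIdx, hlen, ← List.append_assoc,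
      List.replicate_append_replicate, encodeNum]
    congr 2
    change t.numQubits + t.numQubits * L = _
    ring
  have e2 : (forIns 0 (numAt 0 .nil)).den t.encode 0 env =
      t.inputs.flatMap fun v => encodeNum (lab L v 0 : ℕ) := by
    rw [hins, ← flatMap_zipIdx_fst _ t.inputs 1]
    exact flatMap_congr fun x _ => h0 0 x.1 (by simp)
  have e3 : (forOuts 0 (numAt 0 .nil)).den t.encode 0 env =
      t.outputs.flatMap fun v => encodeNum (lab L v 0 : ℕ) := by
    rw [den_forOuts hw, hD, List.zipIdx_map, List.flatMap_map, ← flatMap_zipIdx_fst _ t.outputs 0]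
    exact flatMap_congr fun x _ => h0 0 x.1 (by simp)
  have e4 : (forN 0 (.seq (.emit .gH) (numAt 0 .nil))).den t.encode 0 env =
      (List.finRange t.numQubits).flatMap fun v => .gH :: encodeNum (lab L v 0 : ℕ) := by
    rw [den_forN hw, hD]
    have : List.range t.numQubits = (List.finRange t.numQubits).map Fin.val := by simp
    rw [this, List.flatMap_map]
    refine flatMap_congr fun v _ => ?_
    rw [den, h0 0 v (by simp)]
    rfl
  have e5 : (forIns 0 (.seq (.emit .gH) (numAt 0 .nil))).den t.encode 0 env =
      t.inputs.flatMap fun v => .gH :: encodeNum (lab L v 0 : ℕ) := by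
    rw [hins, ← flatMap_zipIdx_fst _ t.inputs 1]
    refine flatMap_congr fun x _ => ?_
    rw [den, h0 0 x.1 (by simp)]
    rfl
  have e6 : (forItems 0 blockEm).den t.encode 0 env =
      ((blocks L 0 t.commands).flatMap Prod.snd).flatMap encodeGate := by
    rw [den_forItems hw, blocks_flatMap, List.flatMap_assoc, hD, List.zipIdx_map, List.flatMap_map]
    have e : t.commands.zipIdx 1 = (t.commands.zipIdx 0).map fun x => (x.1, x.2 + 1) := by
      rw [List.zipIdx_succ]
    rw [e, List.flatMap_map]
    refine flatMap_congr fun x hx => ?_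
    refine den_blockEm hw rfl rfl ?_ (by simp)
    rw [e]
    exact List.mem_map.2 ⟨x, hx, rfl⟩
  simp only [circuitEm, den_seqs_cons, den_seqs_nil, e2, e3, e4, e5, e6]
  rw [← List.append_assoc (den _ _ _ (forItems 0 (unitN 1))), ← List.append_assoc (den _ _ _ (unitN 0))]
  simp only [den]
  rw [e1]
  simp [Circuit.encode, toCircuit, simGates, encodeList_eq, encodeGate, List.flatMap_map]
  rfl

end Pattern

/-! ### Generating the description of the simulating pattern -/

section Indices

open Em

variable {β γ : Type}

theorem flatMap_zipIdx_lt (f : β → List γ) : ∀ (l : List β) (k c : ℕ),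
    (l.zipIdx k).flatMap (fun x => if x.2 < c + k then f x.1 else []) = (l.take c).flatMap f
  | [], _, _ => by simp
  | a :: l, k, 0 => by
    rw [List.take_zero, List.flatMap_nil]
    exact flatMap_nil fun x hx => if_neg (by
      have := List.le_snd_of_mem_zipIdx hx
      omega)
  | a :: l, k, c + 1 => by
    rw [List.zipIdx_cons, List.flatMap_cons, List.take_succ_cons, List.flatMap_cons,
      ← flatMap_zipIdx_lt f l (k + 1) c]
    congr 1
    · exact if_pos (by dsimp only; omega)
    · exact flatMap_congr fun x _ => by rw [show c + 1 + k = c + (k + 1) by ring]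

theorem flatMap_zipIdx_eq (f : β → List γ) : ∀ (l : List β) (k m : ℕ),
    (l.zipIdx k).flatMap (fun x => if x.2 = m + k then f x.1 else []) = (l[m]?.map f).getD []
  | [], _, _ => by simp
  | a :: l, k, 0 => by
    rw [List.zipIdx_cons, List.flatMap_cons, flatMap_nil (l := l.zipIdx _), List.append_nil]
    · simp
    · exact fun x hx => if_neg (by
        have := List.le_snd_of_mem_zipIdx hx
        omega)
  | a :: l, k, m + 1 => by
    rw [List.zipIdx_cons, List.flatMap_cons, List.getElem?_cons_succ,
      ← flatMap_zipIdx_eq f l (k + 1) m, if_neg (by dsimp only; omega), List.nil_append]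
    exact flatMap_congr fun x _ => by rw [show m + 1 + k = m + (k + 1) by ring]

theorem flatMap_ite_eq [DecidableEq β] (u : List γ) (v : β) : ∀ {l : List β}, l.Nodup →
    l.flatMap (fun a => if a = v then u else []) = if v ∈ l then u else []
  | [], _ => by simp
  | a :: l, h => by
    rw [List.nodup_cons] at h
    rw [List.flatMap_cons, flatMap_ite_eq u v h.2]
    by_cases ha : a = v
    · subst ha
      simp [h.1]
    · simp [ha, Ne.symm ha]

theorem getElem?_of_drop {l ts : List β} {k : ℕ} {t : β} (h : l.drop k = t :: ts) :
    l[k]? = some t ∧ l.drop (k + 1) = ts ∧ l.take (k + 1) = l.take k ++ [t] := by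
  have h1 : l[k]? = some t := by
    have := congrArg (fun l => l[0]?) h
    simpa using this
  refine ⟨h1, ?_, ?_⟩
  · have := congrArg List.tail h
    simpa using this
  · rw [List.take_add_one, h1]; rfl

variable {V W : Type} {q : V → ℕ → W}

variable (q) in
/-- The qubit from which the value of the control is passed on to the `j`-th target. -/
def prev (p : W) (l : List V) (j : ℕ) : W :=
  if j = 0 then p else (l[j - 1]?.map fun t => q t 3).getD p

theorem chain_eq_map (p : W) (l : List V) : ∀ (ts : List V) (k : ℕ), l.drop k = ts →
    chain q (prev q p l k) ts = (ts.zipIdx k).map fun x => (prev q p l x.2, x.1)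
  | [], _, _ => rfl
  | t :: ts, k, h => by
    obtain ⟨h1, h2, -⟩ := getElem?_of_drop h
    have e : q t 3 = prev q p l (k + 1) := by simp [prev, h1]
    rw [chain, e, chain_eq_map p l ts (k + 1) h2]
    rfl

theorem fixes_eq_map (l : List V) : ∀ (ts : List V) (k : ℕ), l.drop k = ts →
    fixes q ((l.take k).map fun t => q t 2) ts = (ts.zipIdx k).map fun x =>
      .Z (q x.1 1) ((l.take (x.2 + 1)).map fun t => q t 2)
  | [], _, _ => rfl
  | t :: ts, k, h => by
    obtain ⟨-, h2, h3⟩ := getElem?_of_drop h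
    have e : (l.take k).map (fun t => q t 2) ++ [q t 2] = (l.take (k + 1)).map fun t => q t 2 := by
      rw [h3]; simp
    rw [fixes, e, fixes_eq_map l ts (k + 1) h2]
    rfl

end Indices

namespace Circuit

open Em

section Tallies

variable {N : ℕ}

/-- The qubits attached to a qubit when a gate is applied are determined by the number of previous gates
on this qubit. -/
theorem gateBlocks_flatMap (K : ℕ) (k₀ : Fin N → ℕ) (l : List (Gate (Fin N))) :
    ∀ (gs : List (Gate (Fin N))) (c : ℕ), l.drop c = gs →
      (gateBlocks K ((l.take c).foldl tally k₀) gs).flatMap Prod.snd =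
        (gs.zipIdx c).flatMap fun x => gateBlock (wire K ((l.take x.2).foldl tally k₀)) x.1
  | [], _, _ => rfl
  | g :: gs, c, h => by
    obtain ⟨-, h2, h3⟩ := getElem?_of_drop h
    have e : tally ((l.take c).foldl tally k₀) g = (l.take (c + 1)).foldl tally k₀ := by
      rw [h3, List.foldl_append]; rfl
    rw [gateBlocks, List.flatMap_cons, e, gateBlocks_flatMap K k₀ l gs (c + 1) h2]
    rfl

/-- The number of gates on `v`, in unary, is obtained from a scan of the gates. -/
theorem flatMap_tally {γ : Type} (t : γ) (m : ℕ) (v : Fin N) : ∀ (gs : List (Gate (Fin N)))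
    (k : Fin N → ℕ), List.replicate (m * k v) t ++
      gs.flatMap (fun g => if v ∈ g.acts then List.replicate m t else []) =
        List.replicate (m * gs.foldl tally k v) t
  | [], _ => by simp
  | g :: gs, k => by
    rw [List.foldl_cons, ← flatMap_tally t m v gs, List.flatMap_cons, ← List.append_assoc, tally]
    congr 1
    split_ifs
    · rw [List.replicate_append_replicate]
      congr 1
    · rw [List.append_nil]

theorem flatMap_item_ents {γ : Type} (f : ℕ → List γ) (n : ℕ) (g : Gate (Fin N)) :
    (g.item.ents n).flatMap (fun e => f e.v) = g.acts.flatMap fun a : Fin N => f (a : ℕ) := by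
  have key : ∀ (kd g l : ℕ) (ns : List ℕ),
      (groupEnts kd g l 0 ns).flatMap (fun e => f e.v) = ns.flatMap f := by
    intro kd g l ns
    rw [groupEnts, List.flatMap_map]
    exact flatMap_zipIdx_fst f ns 0
  cases g with
  | H i => simp [Gate.item, Item.ents, key, Gate.acts]
  | Rz i => simp [Gate.item, Item.ents, key, Gate.acts]
  | CZ i j => simp [Gate.item, Item.ents, key, Gate.acts]
  | fan ts c => simp [Gate.item, Item.ents, key, Gate.acts, List.flatMap_map]

end Tallies

end Circuit

namespace Em

/-- Four copies of the letters for `N` for each previous gate on the qubit of the scan `k`. -/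
def touchCols (ℓ k : ℕ) : Em := forNums ℓ <| lt (.fld ℓ .g) (.fld 0 .g) <|
  eq (.fld ℓ .v) (.fld k .v) (units (ℓ + 1) 4)

/-- Four copies of the letters for `N` for each gate on the qubit of the scan `k`. -/
def finalCols (ℓ k : ℕ) : Em := forNums ℓ <| eq (.fld ℓ .v) (.fld k .v) (units (ℓ + 1) 4)

/-- The number of the `d`-th qubit attached to the qubit of the scan `k`. -/
def wireNum (ℓ k d : ℕ) : Em := numAt k (.seq (units ℓ (2 + d)) (touchCols ℓ k))

/-- The commands of `hop`, if `x` and `y` yield the numbers of the qubits. -/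
def hopEm (x y : Em) (a : Angle) : Em :=
  seqs [.emit .cE, x, y, .emit (.cM a), x, .emit .cX, y, x, .emit .endList]

/-- The commands of `hops` for the first list of the gate of the scan of depth `0`. -/
def hopsEm (d d' : ℕ) : Em := forFirst 1 (hopEm (wireNum 2 1 d) (wireNum 2 1 d') .zero)

/-- The commands of `couplings` for the targets. -/
def couplingsEm : Em := forFirst 1 <| seqs [.emit .cE, wireNum 2 1 2, wireNum 2 1 3,
  .emit .cE, wireNum 2 1 3, wireNum 2 1 1]

/-- The commands of `links`: the line starts at the control, and a link starts at the qubit of the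
previous target, which is found by another scan. -/
def linksEm : Em := forFirst 1 <| seqs [.emit .cE, .iflt (.fld 1 .j) (.const 1) (wireNum 2 0 0)
    (forFirst 2 (eq (.fld 2 .j) (.pred 1 .j) (wireNum 3 2 3))),
  wireNum 2 1 2, .emit (.cM .zero), wireNum 2 1 2]

/-- The commands of `fixes`: the correction on a target reads the outcomes for all targets up to it. -/
def fixesEm : Em := forFirst 1 <| seqs [.emit .cZ, wireNum 2 1 1,
  forFirst 2 (le (.fld 2 .j) (.fld 1 .j) (wireNum 3 2 2)), .emit .endList]

/-- The commands for a gate. -/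
def gateEm : Em := seqs [
  ifKind 7 (hopEm (wireNum 1 0 0) (wireNum 1 0 4) .zero),
  ifKind 8 (seqs [hopEm (wireNum 1 0 0) (wireNum 1 0 1) .zero,
    hopEm (wireNum 1 0 1) (wireNum 1 0 2) .pi, hopEm (wireNum 1 0 2) (wireNum 1 0 3) .irr,
    hopEm (wireNum 1 0 3) (wireNum 1 0 4) .pi]),
  ifKind 9 (seqs [.emit .cE, forFirst 1 (wireNum 2 1 0), hopsEm 0 1, hopsEm 1 4]),
  ifKind 10 (seqs [hopsEm 0 1, couplingsEm, linksEm,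
    forFirst 1 (.seq (.emit (.cM .zero)) (wireNum 2 1 3)), fixesEm,
    .emit .cZ, wireNum 1 0 0, forFirst 1 (wireNum 2 1 3), .emit .endList,
    hopEm (wireNum 1 0 0) (wireNum 1 0 1) .zero, hopEm (wireNum 1 0 1) (wireNum 1 0 4) .zero,
    hopsEm 1 4])]

/-- The description of the simulating pattern. -/
def patternEm : Em := seqs [
  units 0 7, forItems 0 (units 1 4), .emit .endNum,
  forIns 0 (numAt 0 .nil), .emit .endList,
  forOuts 0 (numAt 0 (.seq (units 1 2) (finalCols 1 0))), .emit .endList,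
  forIns 0 (hopEm (numAt 0 .nil) (numAt 0 (units 1 1)) .zero),
  forN 0 (hopEm (numAt 0 (units 1 1)) (numAt 0 (units 1 2)) .zero),
  forItems 0 gateEm]

theorem den_hopEm {w : List Token} {env : ℕ → Ent} {ℓ m : ℕ} {x y : Em} {i j : Fin m}
    (hx : x.den w ℓ env = encodeNum (i : ℕ)) (hy : y.den w ℓ env = encodeNum (j : ℕ)) (a : Angle) :
    (hopEm x y a).den w ℓ env = (hop i j a).flatMap encodeCommand := by
  simp [hopEm, hx, hy, den, hop, encodeCommand, encodeList_eq]

end Em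

namespace Circuit

open Em

variable {N : ℕ} {gs : List (Gate (Fin N))} {w : List Token} {D : Desc} {c : ℕ}

theorem den_finalCols (hw : ReadsAs w D) (hN : D.N = N) (hgs : D.items = gs.map Gate.item)
    (hnd : ∀ g ∈ gs, g.acts.Nodup) {env : ℕ → Ent} {ℓ k : ℕ} (hk : k < ℓ) {v : Fin N}
    (hv : (env k).v = v) : (finalCols ℓ k).den w ℓ env =
      List.replicate (N * (4 * gs.foldl tally (fun _ => 0) v)) .tick := by
  have hku : ∀ e, Function.update env ℓ e k = env k := fun e => Function.update_of_ne hk.ne _ _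
  rw [finalCols, den_forNums hw, hgs, List.zipIdx_map, List.flatMap_map]
  simp only [den_eq, Opd.eval, Ent.get, Function.update_self, hku, hv, den_units hw, hN]
  have e := flatMap_tally Token.tick (N * 4) v gs fun _ => 0
  rw [mul_zero, List.replicate_zero, List.nil_append, mul_assoc] at e
  rw [← e, ← flatMap_zipIdx_fst _ gs 1]
  refine flatMap_congr fun x hx => ?_
  have h1 := flatMap_item_ents (fun u => if u = v then List.replicate (N * 4) Token.tick else [])
    x.2 x.1
  refine h1.trans ?_
  simp only [Fin.val_inj]
  exact flatMap_ite_eq _ v (hnd _ (List.fst_mem_of_mem_zipIdx hx))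

theorem den_touchCols (hw : ReadsAs w D) (hN : D.N = N) (hgs : D.items = gs.map Gate.item)
    (hnd : ∀ g ∈ gs, g.acts.Nodup) {env : ℕ → Ent} {ℓ k : ℕ} (hk : k < ℓ) {v : Fin N}
    (hv : (env k).v = v) (hc : (env 0).g = c + 1) : (touchCols ℓ k).den w ℓ env =
      List.replicate (N * (4 * (gs.take c).foldl tally (fun _ => 0) v)) .tick := by
  have hku : ∀ e, Function.update env ℓ e k = env k := fun e => Function.update_of_ne hk.ne _ _
  have h0u : ∀ e, Function.update env ℓ e 0 = env 0 :=
    fun e => Function.update_of_ne (by omega) _ _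
  rw [touchCols, den_forNums hw, hgs, List.zipIdx_map, List.flatMap_map]
  simp only [den_lt, den_eq, Opd.eval, Ent.get, Function.update_self, hku, h0u, hv, hc, den_units hw,
    hN]
  have e := flatMap_tally Token.tick (N * 4) v (gs.take c) fun _ => 0
  rw [mul_zero, List.replicate_zero, List.nil_append, mul_assoc] at e
  rw [← e, ← flatMap_zipIdx_lt _ gs 1 c]
  refine flatMap_congr fun x hx => ?_
  have h1 := flatMap_item_ents (fun u => if u = v then List.replicate (N * 4) Token.tick else [])
    x.2 x.1
  have h2 : ∀ e ∈ x.1.item.ents x.2, e.g = x.2 := fun e he => g_of_mem_ents he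
  refine (flatMap_congr (f' := fun e => if x.2 < c + 1 then
    (if e.v = (v : ℕ) then List.replicate (N * 4) Token.tick else []) else [])
    fun e he => by rw [h2 e he]).trans ?_
  by_cases hx2 : x.2 < c + 1
  · simp only [hx2, if_true]
    refine h1.trans ?_
    simp only [Fin.val_inj]
    exact flatMap_ite_eq _ v (hnd _ (List.fst_mem_of_mem_zipIdx hx))
  · simp only [hx2, if_false]
    exact flatMap_nil fun _ _ => rfl

theorem den_wireNum (hw : ReadsAs w D) (hN : D.N = N) (hgs : D.items = gs.map Gate.item)
    (hnd : ∀ g ∈ gs, g.acts.Nodup) {env : ℕ → Ent} {ℓ k d : ℕ} (hk : k < ℓ) {v : Fin N}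
    (hv : (env k).v = v) (hc : (env 0).g = c + 1) (hd : d ≤ 4) :
    (wireNum ℓ k d).den w ℓ env = encodeNum
      (wire (4 * gs.length + 6) ((gs.take c).foldl tally fun _ => 0) v d : ℕ) := by
  have h1 := foldl_tally_le (gs.take c) (fun _ => 0) v
  have h2 := List.length_take_le' c gs
  refine den_numAt (by omega) hv ?_
  rw [den, den_units hw, den_touchCols hw hN hgs hnd hk hv hc, hN,
    List.replicate_append_replicate]
  congr 1
  ring

/-- The program `gateEm` describes the commands for the gate at the scan of depth `0`. -/
theorem den_gateEm (hw : ReadsAs w D) (hN : D.N = N) (hgs : D.items = gs.map Gate.item)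
    (hnd : ∀ g ∈ gs, g.acts.Nodup) {g : Gate (Fin N)} (hg : (g, c + 1) ∈ gs.zipIdx 1)
    {env : ℕ → Ent} (he : env 0 = g.item.main (c + 1)) :
    gateEm.den w 1 env = (gateBlock (wire (4 * gs.length + 6)
      ((gs.take c).foldl tally fun _ => 0)) g).flatMap encodeCommand := by
  have hit : (g.item, c + 1) ∈ D.items.zipIdx 1 := by
    rw [hgs, List.zipIdx_map]
    exact List.mem_map.2 ⟨_, hg, rfl⟩
  have hc : (env 0).g = c + 1 := by rw [he, main_g]
  have hq : ∀ {ℓ : ℕ} {env' : ℕ → Ent} (k d : ℕ) (v : Fin N), k < ℓ → (env' 0).g = c + 1 →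
      (env' k).v = v → d ≤ 4 → (wireNum ℓ k d).den w ℓ env' = encodeNum
        (wire (4 * gs.length + 6) ((gs.take c).foldl tally fun _ => 0) v d : ℕ) :=
    fun k d v hk hc hv hd => den_wireNum hw hN hgs hnd hk hv hc hd
  generalize wire (4 * gs.length + 6) ((gs.take c).foldl tally fun _ => 0) = q at hq ⊢
  have hfirst : ∀ {l : List (Fin N)} {ℓ : ℕ} {env' : ℕ → Ent} (P : Em), ℓ ≠ 0 →
      (env' 0).g = c + 1 → g.item.first = l.map Fin.val → (forFirst ℓ P).den w ℓ env' =
        l.zipIdx.flatMap fun x => P.den w (ℓ + 1)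
          (Function.update env' ℓ ⟨g.item.kind, c + 1, 0, x.2, x.1⟩) := by
    intro l ℓ env' P hℓ hc' hl
    rw [den_forFirst hw hc' hℓ hit, hl, List.zipIdx_map, List.flatMap_map]
    rfl
  have hhops : ∀ (l : List (Fin N)) (d d' : ℕ), g.item.first = l.map Fin.val → d ≤ 4 → d' ≤ 4 →
      (hopsEm d d').den w 1 env = (hops q l d d').flatMap encodeCommand := by
    intro l d d' hl hd hd'
    rw [hopsEm, hfirst _ one_ne_zero hc hl, hops, List.flatMap_assoc, ← flatMap_zipIdx_fst _ l 0]
    exact flatMap_congr fun x _ => den_hopEm (hq 1 d x.1 (by omega) (by simpa using hc) (by simp) hd)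
      (hq 1 d' x.1 (by omega) (by simpa using hc) (by simp) hd') .zero
  have hhop : ∀ (v : Fin N) (d d' : ℕ) (a : Angle), (env 0).v = v → d ≤ 4 → d' ≤ 4 →
      (hopEm (wireNum 1 0 d) (wireNum 1 0 d') a).den w 1 env =
        (hop (q v d) (q v d') a).flatMap encodeCommand := fun v d d' a hv hd hd' =>
    den_hopEm (hq 0 d v (by omega) hc hv hd) (hq 0 d' v (by omega) hc hv hd') a
  cases g with
  | H i =>
    have hi : (env 0).v = i := by rw [he]; rfl
    have hk : (env 0).kd = 7 := by rw [he]; rfl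
    simp [gateEm, ifKind, Opd.eval, Ent.get, hk, hhop i _ _ _ hi, gateBlock]
  | Rz i =>
    have hi : (env 0).v = i := by rw [he]; rfl
    have hk : (env 0).kd = 8 := by rw [he]; rfl
    simp [gateEm, ifKind, Opd.eval, Ent.get, hk, hhop i _ _ _ hi, gateBlock]
  | CZ i j =>
    have hk : (env 0).kd = 9 := by rw [he]; rfl
    have e1 : (forFirst 1 (wireNum 2 1 0)).den w 1 env = encodeNum (q i 0 : ℕ) ++
        encodeNum (q j 0 : ℕ) := by
      rw [hfirst (l := [i, j]) _ one_ne_zero hc rfl]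
      have h : ∀ (v : Fin N) (m : ℕ), (wireNum 2 1 0).den w 2
          (Function.update env 1 ⟨9, c + 1, 0, m, v⟩) = encodeNum (q v 0 : ℕ) :=
        fun v m => hq 1 0 v (by omega) (by simpa using hc) (by simp) (by omega)
      simp [h, Item.kind, Gate.item]
    simp [gateEm, ifKind, Opd.eval, Ent.get, hk, e1, hhops [i, j] _ _ rfl, gateBlock, den,
      encodeCommand]
  | fan ts t₀ =>
    have hi : (env 0).v = t₀ := by rw [he]; rfl
    have hk : (env 0).kd = 10 := by rw [he]; rfl
    have hq0 : ∀ (m : ℕ) (v : Fin N), (wireNum 2 0 0).den w 2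
        (Function.update env 1 ⟨10, c + 1, 0, m, v⟩) = encodeNum (q t₀ 0 : ℕ) :=
      fun m v => hq 0 0 t₀ (by omega) (by simpa using hc) (by simpa using hi) (by omega)
    have hq1 : ∀ (d m : ℕ) (v : Fin N), d ≤ 4 → (wireNum 2 1 d).den w 2
        (Function.update env 1 ⟨10, c + 1, 0, m, v⟩) = encodeNum (q v d : ℕ) :=
      fun d m v hd => hq 1 d v (by omega) (by simpa using hc) (by simp) hd
    have hq2 : ∀ (d m m' : ℕ) (v v' : Fin N), d ≤ 4 → (wireNum 3 2 d).den w 3 (Function.update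
        (Function.update env 1 ⟨10, c + 1, 0, m, v⟩) 2 ⟨10, c + 1, 0, m', v'⟩) =
          encodeNum (q v' d : ℕ) :=
      fun d m m' v v' hd => hq 2 d v' (by omega) (by simpa using hc) (by simp) hd
    have e1 : couplingsEm.den w 1 env = (couplings q ts).flatMap encodeCommand := by
      rw [couplingsEm, hfirst _ one_ne_zero hc rfl, couplings, List.flatMap_assoc,
        ← flatMap_zipIdx_fst _ ts 0]
      refine flatMap_congr fun x _ => ?_
      simp [den, hq1, Item.kind, Gate.item, encodeCommand]
    have e2 : linksEm.den w 1 env =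
        (links q (chain q (q t₀ 0) ts)).flatMap encodeCommand := by
      have h := chain_eq_map (q := q) (q t₀ 0) ts ts 0 rfl
      rw [prev, if_pos rfl] at h
      rw [h, linksEm, hfirst _ one_ne_zero hc rfl, links, List.flatMap_assoc, List.flatMap_map]
      refine flatMap_congr fun x hx => ?_
      have hp : (Em.iflt (.fld 1 .j) (.const 1) (wireNum 2 0 0)
          (forFirst 2 (eq (.fld 2 .j) (.pred 1 .j) (wireNum 3 2 3)))).den w 2
          (Function.update env 1 ⟨10, c + 1, 0, x.2, x.1⟩) =
            encodeNum ((prev q (q t₀ 0) ts x.2 : Fin _) : ℕ) := by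
        obtain ⟨t, j⟩ := x
        rcases j with _ | j
        · simp [den, Opd.eval, Ent.get, prev, hq0]
        · have hj : j < ts.length := by
            have := List.snd_lt_of_mem_zipIdx hx
            simp only at this; omega
          have h3 := flatMap_zipIdx_eq (fun t => encodeNum (q t 3 : ℕ)) ts 0 j
          rw [List.getElem?_eq_getElem hj] at h3
          rw [den, hfirst _ two_ne_zero (by simpa using hc) rfl]
          simp [Opd.eval, Ent.get, prev, hj, hq2, Item.kind, Gate.item] at h3 ⊢
          exact h3
      simp only [den_seqs_cons, den_seqs_nil, Item.kind, Gate.item, hp]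
      simp [hq1, encodeCommand, den]
    have e3 : fixesEm.den w 1 env = (fixes q [] ts).flatMap encodeCommand := by
      have h := fixes_eq_map (q := q) ts ts 0 rfl
      rw [List.take_zero, List.map_nil] at h
      rw [h, fixesEm, hfirst _ one_ne_zero hc rfl, List.flatMap_map]
      refine flatMap_congr fun x _ => ?_
      have hp : (forFirst 2 (le (.fld 2 .j) (.fld 1 .j) (wireNum 3 2 2))).den w 2
          (Function.update env 1 ⟨10, c + 1, 0, x.2, x.1⟩) =
            (ts.take (x.2 + 1)).flatMap fun t => encodeNum (q t 2 : ℕ) := by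
        rw [hfirst _ two_ne_zero (by simpa using hc) rfl,
          ← flatMap_zipIdx_lt (fun t => encodeNum (q t 2 : ℕ)) ts 0 (x.2 + 1)]
        refine flatMap_congr fun y _ => ?_
        simp [Opd.eval, Ent.get, hq2, Item.kind, Gate.item]
      simp [hp, hq1, Item.kind, Gate.item, encodeCommand, encodeList_eq, den]
      rw [← List.map_take, List.flatMap_map]
    have e4 : (forFirst 1 (.seq (.emit (.cM .zero)) (wireNum 2 1 3))).den w 1 env =
        (ts.map fun t => Command.M (q t 3) .zero).flatMap encodeCommand := by
      rw [hfirst _ one_ne_zero hc rfl, List.flatMap_map, ← flatMap_zipIdx_fst _ ts 0]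
      refine flatMap_congr fun x _ => ?_
      simp [den, hq1, Item.kind, Gate.item, encodeCommand]
    have e5 : (forFirst 1 (wireNum 2 1 3)).den w 1 env =
        ts.flatMap fun t => encodeNum (q t 3 : ℕ) := by
      rw [hfirst _ one_ne_zero hc rfl, ← flatMap_zipIdx_fst _ ts 0]
      exact flatMap_congr fun x _ => hq1 3 x.2 x.1 (by omega)
    have e6 := hq (env' := env) 0 0 t₀ one_pos hc hi (by omega)
    simp [gateEm, ifKind, Opd.eval, Ent.get, hk, e1, e2, e3, e4, e5, e6, hhops ts _ _ rfl,
      hhop t₀ _ _ _ hi, gateBlock, den]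
    simp [encodeCommand, encodeList_eq, hops, List.flatMap_map]

theorem den_patternEm (C : Circuit) (hC : C.WellFormed) (env : ℕ → Ent) :
    patternEm.den C.encode 0 env = C.toPattern.encode := by
  have hw := C.readsAs
  set D : Desc := ⟨C.numQubits, C.inputs.map Fin.val, C.outputs.map Fin.val,
    C.gates.map Gate.item⟩ with hD
  set K := 4 * C.gates.length + 6 with hK
  have hlen : D.items.length = C.gates.length := List.length_map ..
  have h0 : ∀ {ℓ : ℕ} {env' : ℕ → Ent} (v : Fin C.numQubits), (env' 0).v = v →
      (numAt 0 .nil).den C.encode ℓ env' = encodeNum (lab K v 0 : ℕ) :=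
    fun v hv => den_numAt (Nat.zero_le _) hv (by simp [den])
  have h1 : ∀ {ℓ : ℕ} {env' : ℕ → Ent} (v : Fin C.numQubits) (j : ℕ), (env' 0).v = v → j ≤ 2 →
      (numAt 0 (units ℓ j)).den C.encode ℓ env' = encodeNum (lab K v j : ℕ) :=
    fun v j hv hj => den_numAt (by omega) hv (den_units hw j)
  have hins : ∀ P : Em, (forIns 0 P).den C.encode 0 env = (C.inputs.zipIdx 1).flatMap fun x =>
      P.den C.encode 1 (Function.update env 0 ⟨0, 0, 0, x.2, x.1⟩) := by
    intro P
    rw [den_forIns hw, hD, List.zipIdx_map, List.flatMap_map]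
    rfl
  have e1 : (units 0 7).den C.encode 0 env ++ ((forItems 0 (units 1 4)).den C.encode 0 env ++
      [.endNum]) = encodeNum ((K + 1) * C.numQubits) := by
    rw [den_units hw, den_forItems hw]
    simp only [den_units hw]
    rw [flatMap_replicate, List.length_zipIdx, hlen, ← List.append_assoc,
      List.replicate_append_replicate, encodeNum]
    congr 2
    change C.numQubits * 7 + C.numQubits * 4 * C.gates.length = _
    ring
  have e2 : (forIns 0 (numAt 0 .nil)).den C.encode 0 env =
      C.inputs.flatMap fun v => encodeNum (lab K v 0 : ℕ) := by
    rw [hins, ← flatMap_zipIdx_fst _ C.inputs 1]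
    exact flatMap_congr fun x _ => h0 x.1 (by simp)
  have e3 : (forOuts 0 (numAt 0 (.seq (units 1 2) (finalCols 1 0)))).den C.encode 0 env =
      C.outputs.flatMap fun v =>
        encodeNum (wire K (C.gates.foldl tally fun _ => 0) v 0 : ℕ) := by
    rw [den_forOuts hw, hD, List.zipIdx_map, List.flatMap_map, ← flatMap_zipIdx_fst _ C.outputs 0]
    refine flatMap_congr fun x _ => ?_
    have h2 := foldl_tally_le C.gates (fun _ => 0) x.1
    refine den_numAt (by omega) (by simp) ?_
    have h3 := den_finalCols hw rfl rfl hC.gates_wf (ℓ := 1) (k := 0) one_pos (v := x.1)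
      (env := Function.update env 0 ⟨0, 0, 1, x.2, x.1⟩) (by simp)
    rw [den, den_units hw]
    refine (congrArg _ h3).trans ?_
    rw [List.replicate_append_replicate]
    congr 1
    change C.numQubits * 2 + _ = _
    ring
  have e4 : (forIns 0 (hopEm (numAt 0 .nil) (numAt 0 (units 1 1)) .zero)).den C.encode 0 env =
      (hops (lab K) C.inputs 0 1).flatMap encodeCommand := by
    rw [hins, hops, List.flatMap_assoc, ← flatMap_zipIdx_fst _ C.inputs 1]
    exact flatMap_congr fun x _ =>
      den_hopEm (h0 x.1 (by simp)) (h1 x.1 1 (by simp) (by omega)) .zero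
  have e5 : (forN 0 (hopEm (numAt 0 (units 1 1)) (numAt 0 (units 1 2)) .zero)).den C.encode 0 env =
      (hops (lab K) (List.finRange C.numQubits) 1 2).flatMap encodeCommand := by
    rw [den_forN hw, hD, hops, List.flatMap_assoc]
    have : List.range C.numQubits = (List.finRange C.numQubits).map Fin.val := by simp
    rw [this, List.flatMap_map]
    exact flatMap_congr fun v _ =>
      den_hopEm (h1 v 1 (by simp) (by omega)) (h1 v 2 (by simp) (by omega)) .zero
  have e6 : (forItems 0 gateEm).den C.encode 0 env =
      ((gateBlocks K (fun _ => 0) C.gates).flatMap Prod.snd).flatMap encodeCommand := by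
    have h := gateBlocks_flatMap K (fun _ => 0) C.gates C.gates 0 rfl
    rw [List.take_zero, List.foldl_nil] at h
    rw [den_forItems hw, h, List.flatMap_assoc, hD, List.zipIdx_map, List.flatMap_map]
    have e : C.gates.zipIdx 1 = (C.gates.zipIdx 0).map fun x => (x.1, x.2 + 1) := by
      rw [List.zipIdx_succ]
    rw [e, List.flatMap_map]
    refine flatMap_congr fun x hx => ?_
    refine den_gateEm hw rfl rfl hC.gates_wf ?_ (by simp)
    rw [e]
    exact List.mem_map.2 ⟨x, hx, rfl⟩
  simp only [patternEm, den_seqs_cons, den_seqs_nil, e2, e3, e4, e5, e6]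
  rw [← List.append_assoc (den _ _ _ (forItems 0 (units 1 4))),
    ← List.append_assoc (den _ _ _ (units 0 7))]
  simp only [den]
  rw [e1]
  simp [Pattern.encode, toPattern, simCommands, encodeList_eq, List.flatMap_map]
  rfl

end Circuit

/-! ### The simulations of families -/

theorem sum_map_le_length_flatMap {β γ : Type} {f : β → ℕ} {F : β → List γ} :
    ∀ l : List β, (∀ x ∈ l, f x ≤ (F x).length) → (l.map f).sum ≤ (l.flatMap F).length
  | [], _ => by simp
  | a :: l, h => by
    rw [List.map_cons, List.sum_cons, List.flatMap_cons, List.length_append]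
    exact add_le_add (h a List.mem_cons_self)
      (sum_map_le_length_flatMap l fun x hx => h x (List.mem_cons_of_mem _ hx))

theorem length_le_encodeList {m : ℕ} (l : List (Fin m)) : l.length ≤ (encodeList l).length := by
  have h := sum_map_le_length_flatMap (f := fun _ => 1) (F := fun v : Fin m => encodeNum v) l
    fun v _ => by simp [encodeNum]
  rw [List.map_const', List.sum_replicate, smul_eq_mul, mul_one] at h
  rw [Em.encodeList_eq, List.length_append]
  exact h.trans (Nat.le_add_right _ _)

/-- The size is polynomial because the length of the description is. -/
theorem Pattern.size_le_length_encode (t : Pattern) : t.size ≤ t.encode.length := by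
  refine (sum_map_le_length_flatMap _ fun c _ => ?_).trans
    (by rw [Pattern.encode, List.length_append]; exact Nat.le_add_left _ _)
  cases c with
  | E i j => simp [encodeCommand, encodeNum, Command.size, Command.acts]; omega
  | _ => simp [encodeCommand, encodeNum, Command.size, Command.acts]

theorem Circuit.size_le_length_encode (C : Circuit) : C.size ≤ C.encode.length := by
  refine (sum_map_le_length_flatMap _ fun g _ => ?_).trans
    (by rw [Circuit.encode, List.length_append]; exact Nat.le_add_left _ _)
  cases g with
  | fan ts c =>
    have := length_le_encodeList ts
    simp [encodeGate, encodeNum, Gate.size, Gate.acts]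
    omega
  | _ => simp [encodeGate, encodeNum, Gate.size, Gate.acts] <;> omega

theorem PolyBounded.mono {f g : ℕ → ℕ} (hg : PolyBounded g) (h : ∀ n, f n ≤ g n) :
    PolyBounded f :=
  hg.imp fun _ hp n => (h n).trans (hp n)

theorem PatternFamily.toCircuit {k : ℕ} {P : ℕ → Pattern} (h : PatternFamily k P) :
    CircuitFamily k fun n => (P n).toCircuit := by
  have hu : LogSpaceGenerated fun n => (P n).toCircuit.encode := by
    have := h.uniform.em Em.circuitEm
    simpa only [Pattern.den_circuitEm] using this
  exact
    { wellFormed := fun n => Pattern.toCircuit_wellFormed (h.wellFormed n)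
      inputs := fun n => (List.length_map _).trans (h.inputs n)
      outputs := fun n => (List.length_map _).trans (h.outputs n)
      uniform := hu
      size := hu.polyBounded_length.mono fun n => Circuit.size_le_length_encode _
      depth := h.depth.of_le 14 2 fun n => Pattern.toCircuit_depth_le (h.wellFormed n) }

theorem CircuitFamily.toPattern {k : ℕ} {C : ℕ → Circuit} (h : CircuitFamily k C) :
    PatternFamily k fun n => (C n).toPattern := by
  have hu : LogSpaceGenerated fun n => (C n).toPattern.encode := by
    have := h.uniform.em Em.patternEm
    simpa only [Circuit.den_patternEm _ (h.wellFormed _)] using this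
  exact
    { wellFormed := fun n => Circuit.toPattern_wellFormed (h.wellFormed n)
      inputs := fun n => (List.length_map _).trans (h.inputs n)
      outputs := fun n => (List.length_map _).trans (h.outputs n)
      uniform := hu
      size := hu.polyBounded_length.mono fun n => Pattern.size_le_length_encode _
      depth := h.depth.of_le 16 6 fun n => Circuit.toPattern_depth_le (h.wellFormed n) }

theorem PatternFamily.acceptProb_toCircuit {k : ℕ} {P : ℕ → Pattern} (h : PatternFamily k P)
    (α₀ : ℝ) : (fun w => (P w.length).toCircuit.acceptProb α₀ w) =
      fun w => (P w.length).acceptProb α₀ w :=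
  funext fun w => Pattern.toCircuit_acceptProb α₀ (h.wellFormed _) w

theorem CircuitFamily.acceptProb_toPattern {k : ℕ} {C : ℕ → Circuit} (h : CircuitFamily k C)
    (α₀ : ℝ) : (fun w => (C w.length).toPattern.acceptProb α₀ w) =
      fun w => (C w.length).acceptProb α₀ w :=
  funext fun w => Circuit.toPattern_acceptProb α₀ (h.wellFormed _) w

end MBQC

theorem mainTheorem1 (α₀ : ℝ) (hα₀ : Irrational (α₀ / Real.pi)) (k : ℕ) :
    MBQC.QMNC α₀ k = MBQC.QNCf α₀ k ∧ MBQC.BQMNC α₀ k = MBQC.BQNCf α₀ k := by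
  refine ⟨Set.Subset.antisymm ?_ ?_, Set.Subset.antisymm ?_ ?_⟩
  · rintro L ⟨P, hP, hL⟩
    exact ⟨_, hP.toCircuit, by rwa [hP.acceptProb_toCircuit]⟩
  · rintro L ⟨C, hC, hL⟩
    exact ⟨_, hC.toPattern, by rwa [hC.acceptProb_toPattern]⟩
  · rintro L ⟨P, hP, ε, hε, hL⟩
    exact ⟨_, hP.toCircuit, ε, hε, by rwa [hP.acceptProb_toCircuit]⟩
  · rintro L ⟨C, hC, ε, hε, hL⟩
    exact ⟨_, hC.toPattern, ε, hε, by rwa [hC.acceptProb_toPattern]⟩
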